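/- **Approximation for C-surfaces.** Let $N\ge 2$ and $B(r)=[0,r]^2$. *Smooth notions.* A C-surface $x:B(r)\to\mathbb R^N$ is a smooth map with $\partial_1x,\partial_2x\ne0$, $\partial_1x\cdot\partial_2x=0$ and $\partial_1\partial_2x\in\mathrm{span}(\partial_1x,\partial_2x)$. With $v_i=\partial_ix/|\partial_ix|$, its rotation coefficients are defined by $\partial_iv_j=\beta_{ji}v_i$ $(i\ne j)$. *Frames.* Let $\mathbb R^{N+1,1}$ be Minkowski space with basis $e_1,\dots,e_{N+2}$ and $\langle u,v\rangle=\sum_{k\le N+1}u_kv_k-u_{N+2}v_{N+2}$; put $e_0=\frac12(e_{N+2}+e_{N+1})$, $e_\infty=\frac12(e_{N+2}-e_{N+1})$, and $\lambda(x)=x+e_0+|x|^2e_\infty$ for $x\in\mathbb R^N$. In the Clifford algebra with $uv+vu=-2\langle u,v\rangle$ let $\mathcal H_\infty$ be the set of products of vectors $u$ with $u^2=-1$, $\langle u,e_\infty\rangle=0$, and let $A_\psi(v)=\psi^{-1}v\psi$. *Data.* Let $X_1,X_2:\mathbb R\to\mathbb R^N$ be smooth curves with $X_1(0)=X_2(0)$,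 $X_i'(0)\neq0$ and $X_1'(0)\cdot X_2'(0)=0$, and let $\Gamma:\mathbb R^2\to\mathbb R$ be smooth. Put $\hat X_i=\lambda\circ X_i$, $H_i=|X_i'|$, and $\hat v_i=H_i^{-1}\hat X_i'$ where $H_i\ne0$. An element $\Psi\in\mathcal H_\infty$ is *suited* if $A_\Psi(e_0)=\hat X_1(0)=\hat X_2(0)$ and $A_\Psi(e_i)=\hat v_i(0)$, $i=1,2$. For suited $\Psi$ the functions $B_{ki}$ ($i=1,2$, $1\le k\le N$, $k\ne i$) *read off* $X_i$ on an interval $[0,r]$ on which $X_i'\neq0$ are $B_{ki}=-\langle\hat v_k,\hat v_i'\rangle$, where $\hat v_k$ solves $\hat v_k'=B_{ki}\hat v_i$, $\hat v_k(0)=A_\Psi(e_k)$. *Discrete problem.* For $\epsilon>0$ let $B^\epsilon(r)=B(r)\cap(\epsilon\mathbb Z)^2$, let $\mathbf u_1,\mathbf u_2$ be the standard basis vectors of $\mathbb R^2$, and put $(\tau_iu)(\xi)=u(\xi+\epsilon\mathbf u_i)$, $\delta_i=(\tau_i-1)/\epsilon$. The discrete Goursat problem asks for $\psi$ (with values in the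 Clifford algebra) and real functions $h_i$, $\beta_{ki}$ ($k\neq i$), $\gamma$ on $B^\epsilon(r)$ such that, for $\{i,j\}=\{1,2\}$ and $k\ne i,j$, $$\delta_i\psi=\Big(\tfrac{N_i-1}{\epsilon}-\tfrac12\sum_{k\ne i}\beta_{ki}e_ke_i+h_ie_\infty e_i\Big)\psi,\qquad \delta_ih_j=\tfrac{\rho_{ij}}{\epsilon n}h_i+\tfrac{1-n}{\epsilon n}h_j,$$ $$\delta_i\beta_{ij}=\tfrac{2N_i\rho_{ij}}{\epsilon^2n}-\tfrac{1+n}{\epsilon n}\beta_{ij},\qquad \delta_i\beta_{kj}=\tfrac{1-n}{\epsilon n}\beta_{kj}+\tfrac{\rho_{ij}}{\epsilon n}\beta_{ki},$$ each equation being required where both of its lattice points lie in $B^\epsilon(r)$. Here $N_i=\big(1-\frac{\epsilon^2}4\sum_{k\ne i}\beta_{ki}^2\big)^{1/2}$, $n=(1-\rho_{12}\rho_{21})^{1/2}$ (with positive radicands on $B^\epsilon(r)$), $\Theta=\frac12\sum_{k>2}\beta_{k1}\beta_{k2}$, $\rho_{12}=\epsilon N_1\beta_{12}-\frac{\epsilon^2}2(\Theta-\gamma)$,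 $\rho_{21}=\epsilon N_2\beta_{21}-\frac{\epsilon^2}2(\Theta+\gamma)$. The data are $\psi(0)=\Psi$, $h_i=H_i$ and $\beta_{ki}=B_{ki}$ at the lattice points of the $i$-th axis, and $\gamma=\Gamma$ at all lattice points of $B^\epsilon(r)$. **Claim.** There is $r>0$ (with $X_1',X_2'\ne0$ on $[0,r]$) such that: 1. There is a unique C-surface $x:B(r)\to\mathbb R^N$ that coincides with $X_i$ on the $i$-th coordinate axis ($i=1,2$) and satisfies $\partial_1\beta_{12}-\partial_2\beta_{21}=2\Gamma$ on $B(r)$. 2. For every suited $\Psi$, the functions $B_{ki}$ read off $X_1,X_2$ with respect to $\Psi$ exist on $[0,r]$, and there is $\epsilon_1>0$ such that for all $0<\epsilon<\epsilon_1$ the discrete Goursat problem has a unique solution on $B^\epsilon(r)$. It satisfies $\psi\in\mathcal H_\infty$ and $A_\psi(e_0)=\lambda(x^\epsilon)$ for a map $x^\epsilon:B^\epsilon(r)\to\mathbb R^N$ that is a discrete C-surface (the points $x^\epsilon,\tau_1x^\epsilon,\tau_2x^\epsilon,\tau_1\tau_2x^\epsilon$ of each elementary quadrilateral are concircular). The restriction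 of $x^\epsilon$ to the $i$-th axis is the canonical $\epsilon$-discretization of $X_i$, i.e. $\lambda(x^\epsilon)=A_\varphi(e_0)$ there, where $\varphi\in\mathcal H_\infty$, $\varphi(0)=\Psi$, $\tau_i\varphi=-\Sigma_ie_i\varphi$, $\Sigma_i=\big(1-\frac{\epsilon^2}4\sum_{k\ne i}B_{ki}^2\big)^{1/2}e_i+\frac\epsilon2\sum_{k\ne i}B_{ki}e_k-\epsilon H_ie_\infty$. The family $x^\epsilon$ is $O(\epsilon)$-convergent to $x$ in $C^\infty$: for every integer $\ell\ge0$ there is $K_\ell$ such that for all $0<\epsilon<\epsilon_1$ with $\epsilon\ell<r$, all multi-indices $\alpha\in\mathbb N^2$ with $|\alpha|\le\ell$ and all $\xi\in B^\epsilon(r-\epsilon|\alpha|)$, $$\big|\delta^\alpha\big(x^\epsilon-x|_{B^\epsilon(r)}\big)(\xi)\big|\le K_\ell\,\epsilon .$$ -/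

import Mathlib

open scoped ContDiff

noncomputable section

namespace CSurf

/-! ### Smooth C-surfaces -/

/-- The Euclidean space `ℝ^N`. -/
abbrev E (N : ℕ) : Type := EuclideanSpace ℝ (Fin N)

/-- The closed square `B(r) = {ξ ∈ ℝ² | 0 ≤ ξ_i ≤ r}`. -/
def box (r : ℝ) : Set (Fin 2 → ℝ) := {ξ | ∀ i, 0 ≤ ξ i ∧ ξ i ≤ r}

/-- The partial derivative `∂_i f` on the closed square `B(r)`
(one-sided at the boundary of the square). -/
def pderiv {F : Type*} [NormedAddCommGroup F] [NormedSpace ℝ F]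
    (r : ℝ) (i : Fin 2) (f : (Fin 2 → ℝ) → F) (ξ : Fin 2 → ℝ) : F :=
  fderivWithin ℝ f (box r) ξ (Pi.single i 1)

/-- `x : B(r) → ℝ^N` is a C-surface: a smooth two-dimensional conjugate net with orthogonal
coordinate lines. It is regular, `∂_i x ≠ 0`, so that the unit vectors `v_i` and the rotation
coefficients make sense. -/
structure IsCSurface {N : ℕ} (r : ℝ) (x : (Fin 2 → ℝ) → E N) : Prop where
  smooth : ContDiffOn ℝ ∞ x (box r)
  regular : ∀ i, ∀ ξ ∈ box r, pderiv r i x ξ ≠ 0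
  conjugate : ∀ i j, i ≠ j → ∀ ξ ∈ box r,
    pderiv r i (pderiv r j x) ξ ∈ Submodule.span ℝ {pderiv r i x ξ, pderiv r j x ξ}
  orthogonal : ∀ i j, i ≠ j → ∀ ξ ∈ box r, inner ℝ (pderiv r i x ξ) (pderiv r j x ξ) = 0

/-- The unit vectors `v_i = ∂_i x / |∂_i x|` of a C-surface. -/
def unitVec {N : ℕ} (r : ℝ) (x : (Fin 2 → ℝ) → E N) (i : Fin 2) (ξ : Fin 2 → ℝ) : E N :=
  ‖pderiv r i x ξ‖⁻¹ • pderiv r i x ξ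

/-- `β j i` are the rotation coefficients of the C-surface `x` on `B(r)`:
`∂_i v_j = β_{ji} v_i` for `i ≠ j`. -/
def HasRotationCoeff {N : ℕ} (r : ℝ) (x : (Fin 2 → ℝ) → E N)
    (β : Fin 2 → Fin 2 → (Fin 2 → ℝ) → ℝ) : Prop :=
  ∀ i j, i ≠ j → ∀ ξ ∈ box r, pderiv r i (unitVec r x j) ξ = β j i ξ • unitVec r x i ξ

/-- `x` is a C-surface on `B(r)` which coincides with the curve `X i` on the `i`-th coordinate
axis and satisfies `∂₁β₁₂ - ∂₂β₂₁ = 2Γ` on `B(r)`. -/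
def IsCSurfaceWithData {N : ℕ} (r : ℝ) (X : Fin 2 → ℝ → E N) (Γ : (Fin 2 → ℝ) → ℝ)
    (x : (Fin 2 → ℝ) → E N) : Prop :=
  IsCSurface r x ∧
  (∀ i, ∀ t ∈ Set.Icc 0 r, x (Pi.single i t) = X i t) ∧
  ∃ β : Fin 2 → Fin 2 → (Fin 2 → ℝ) → ℝ, HasRotationCoeff r x β ∧
    ∀ ξ ∈ box r, pderiv r 0 (β 0 1) ξ - pderiv r 1 (β 1 0) ξ = 2 * Γ ξ

/-! ### Möbius geometry: Minkowski space, Clifford algebra, frames -/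

/-- The Minkowski space `ℝ^{N+1,1}`: a triple `(y, s, t)` is
`∑_{k ≤ N} y_k e_k + s e_{N+1} + t e_{N+2}`. -/
abbrev Mink (N : ℕ) : Type := E N × ℝ × ℝ

/-- The Lorentz scalar product `⟨u, v⟩ = ∑_{k ≤ N+1} u_k v_k - u_{N+2} v_{N+2}`. -/
def lorentz (N : ℕ) : LinearMap.BilinForm ℝ (Mink N) :=
  LinearMap.mk₂ ℝ (fun u v => inner ℝ u.1 v.1 + u.2.1 * v.2.1 - u.2.2 * v.2.2)
    (by intro a b c; simp only [Prod.fst_add, Prod.snd_add, inner_add_left]; ring)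
    (by
      intro a b c
      simp only [Prod.smul_fst, Prod.smul_snd, real_inner_smul_left, smul_eq_mul]; ring)
    (by intro a b c; simp only [Prod.fst_add, Prod.snd_add, inner_add_right]; ring)
    (by
      intro a b c
      simp only [Prod.smul_fst, Prod.smul_snd, real_inner_smul_right, smul_eq_mul]; ring)

/-- The quadratic form `u ↦ -⟨u, u⟩`. -/
def cliffordForm (N : ℕ) : QuadraticForm ℝ (Mink N) :=
  -(LinearMap.BilinMap.toQuadraticMap (lorentz N))

/-- The Clifford algebra with the relations `u v + v u = -2 ⟨u, v⟩`, i.e. `u² = -⟨u, u⟩`. -/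
abbrev Cl (N : ℕ) : Type := CliffordAlgebra (cliffordForm N)

/-- The inclusion of the Minkowski space into the Clifford algebra. -/
abbrev emb {N : ℕ} (u : Mink N) : Cl N := CliffordAlgebra.ι (cliffordForm N) u

/-- The basis vector `e_k`, `1 ≤ k ≤ N`. -/
def e {N : ℕ} (k : Fin N) : Mink N := (EuclideanSpace.single k 1, 0, 0)

/-- `e_0 = (e_{N+2} + e_{N+1}) / 2`. -/
def eZero (N : ℕ) : Mink N := (0, 1 / 2, 1 / 2)

/-- `e_∞ = (e_{N+2} - e_{N+1}) / 2`. -/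
def eInf (N : ℕ) : Mink N := (0, -(1 / 2), 1 / 2)

/-- The canonical lift `λ(x) = x + e_0 + |x|² e_∞`. -/
def lift {N : ℕ} (x : E N) : Mink N := (x, 0, 0) + eZero N + ‖x‖ ^ 2 • eInf N

/-- `H_∞ = {u_1 ⋯ u_n | u_i² = -1, ⟨u_i, e_∞⟩ = 0}`. -/
def HInf (N : ℕ) : Submonoid (Cl N) :=
  Submonoid.closure {a | ∃ u : Mink N, lorentz N u u = 1 ∧ lorentz N u (eInf N) = 0 ∧ a = emb u}

/-- The action `A_ψ(v) = ψ⁻¹ v ψ` of an invertible element `ψ`, as an element of the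
Clifford algebra. -/
def act {N : ℕ} (ψ : Cl N) (v : Mink N) : Cl N := Ring.inverse ψ * emb v * ψ

/-- Elements of `H_∞` are invertible, so that `act` is the conjugation on them. -/
theorem isUnit_of_mem_HInf {N : ℕ} {ψ : Cl N} (h : ψ ∈ HInf N) : IsUnit ψ := by
  refine Submonoid.closure_le (S := IsUnit.submonoid (Cl N)) |>.2 ?_ h
  rintro a ⟨u, hu, -, rfl⟩
  have hsq : emb u * emb u = -1 := by
    rw [CliffordAlgebra.ι_sq_scalar]
    have hq : cliffordForm N u = -1 := by
      simp [cliffordForm, LinearMap.BilinMap.toQuadraticMap_apply, hu]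
    rw [hq, map_neg, map_one]
  exact ⟨⟨emb u, -emb u, by rw [mul_neg, hsq, neg_neg], by rw [neg_mul, hsq, neg_neg]⟩, rfl⟩

/-- The index `i ∈ {1, 2}` regarded as an element of `{1, …, N}`. -/
abbrev ax {N : ℕ} (hN : 2 ≤ N) (i : Fin 2) : Fin N := Fin.castLE hN i

/-- The unit tangent field `|∂X|⁻¹ ∂(λ ∘ X)` of the lift of a curve `X`. -/
def unitTangent {N : ℕ} (X : ℝ → E N) (t : ℝ) : Mink N :=
  ‖deriv X t‖⁻¹ • deriv (fun s => lift (X s)) t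

/-- `Ψ ∈ H_∞` is suited to the common initial point and the initial unit tangent vectors of the
lifted curves: `A_Ψ(e_0) = λ(X_i(0))`, `A_Ψ(e_i) = v̂_i(0)`. -/
def IsSuited {N : ℕ} (hN : 2 ≤ N) (X : Fin 2 → ℝ → E N) (Ψ : Cl N) : Prop :=
  Ψ ∈ HInf N ∧ ∀ i, act Ψ (eZero N) = emb (lift (X i 0)) ∧
    act Ψ (e (ax hN i)) = emb (unitTangent (X i) 0)

/-- The functions `H = h_i` and `B k = β_{ki}` (`k ≠ i`) are read off the curve `X = X_i` on
`[0, r]`, with the initial frame `Ψ`: `h_i = |∂_i X_i| > 0`, `v̂_i = h_i⁻¹ ∂_i X̂_i`, and the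
fields `v̂_k` solve `∂_i v̂_k = β_{ki} v̂_i`, `β_{ki} = -⟨v̂_k, ∂_i v̂_i⟩`,
`v̂_k(0) = A_Ψ(e_k)`. -/
def IsReadOff {N : ℕ} (hN : 2 ≤ N) (r : ℝ) (Ψ : Cl N) (i : Fin 2) (X : ℝ → E N)
    (H : ℝ → ℝ) (B : Fin N → ℝ → ℝ) : Prop :=
  ∃ v : Fin N → ℝ → Mink N,
    (∀ t ∈ Set.Icc 0 r, 0 < ‖deriv X t‖ ∧ H t = ‖deriv X t‖ ∧ v (ax hN i) t = unitTangent X t) ∧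
    (∀ k, act Ψ (e k) = emb (v k 0)) ∧
    ∀ k, k ≠ ax hN i → ∀ t ∈ Set.Icc 0 r,
      B k t = -lorentz N (v k t) (deriv (unitTangent X) t) ∧
      HasDerivWithinAt (v k) (B k t • v (ax hN i) t) (Set.Icc 0 r) t

/-! ### Lattice functions -/

/-- Points of the quadrant `{ξ ∈ (εℤ)² | ξ_i ≥ 0}` are written `ξ = ε n` and labelled by
`n ∈ ℕ²`. -/
abbrev Lat : Type := Fin 2 → ℕ

/-- The lattice point with label `n`. -/
def pt (ε : ℝ) (n : Lat) : Fin 2 → ℝ := fun i => ε * n i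

/-- The (labels of the) lattice points in `B^ε(r)`. -/
def latBox (ε r : ℝ) : Set Lat := {n | pt ε n ∈ box r}

/-- The shift `τ_i`, on labels. -/
abbrev sh (i : Fin 2) (n : Lat) : Lat := n + Pi.single i 1

/-- The difference operator `δ_i = (τ_i - 1) / ε`. -/
def diff {F : Type*} [AddCommGroup F] [Module ℝ F]
    (ε : ℝ) (i : Fin 2) (u : Lat → F) (n : Lat) : F :=
  ε⁻¹ • (u (sh i n) - u n)

/-- `δ^α = δ_1^{α_1} δ_2^{α_2}`. -/
def diffPow {F : Type*} [AddCommGroup F] [Module ℝ F]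
    (ε : ℝ) (α : Fin 2 → ℕ) (u : Lat → F) : Lat → F :=
  (diff ε 0)^[α 0] ((diff ε 1)^[α 1] u)

/-- The family `u ε : B^ε(r) → ℝ^N`, `0 < ε < ε₁`, is `O(ε)`-convergent in `C^∞(B(r))` to `x`:
for every `ℓ` there is `K_ℓ` with `‖u ε - x‖_ℓ ≤ K_ℓ ε` for all admissible `ε < r / ℓ`, where
`‖w‖_ℓ = sup {|δ^α w(ξ)| : |α| ≤ ℓ, ξ ∈ B^ε(r - ε|α|)}`. -/
def SmoothOConverges {N : ℕ} (r ε₁ : ℝ) (u : ℝ → Lat → E N) (x : (Fin 2 → ℝ) → E N) : Prop :=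
  ∀ l : ℕ, ∃ K : ℝ, ∀ ε : ℝ, 0 < ε → ε < ε₁ → ε * l < r →
    ∀ α : Fin 2 → ℕ, α 0 + α 1 ≤ l →
      ∀ n ∈ latBox ε (r - ε * (α 0 + α 1 : ℕ)),
        ‖diffPow ε α (fun m => u ε m - x (pt ε m)) n‖ ≤ K * ε

/-! ### Discrete C-surfaces -/

/-- `x : B^ε(r) → ℝ^N` is a discrete C-surface: the four points `x, τ₁x, τ₂x, τ₁τ₂x` of each
elementary quadrilateral in `B^ε(r)` lie on a circle. -/
def IsDiscreteCSurface {N : ℕ} (ε r : ℝ) (x : Lat → E N) : Prop :=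
  ∀ n, sh 0 (sh 1 n) ∈ latBox ε r →
    EuclideanGeometry.Concyclic ({x n, x (sh 0 n), x (sh 1 n), x (sh 0 (sh 1 n))} : Set (E N))

/-- The dependent variables `ψ`, `h_i`, `β_{ki}`, `γ` of the discrete Goursat problem. The value
`β k i` is only meaningful for `k ≠ i`. -/
structure Fields (N : ℕ) where
  ψ : Lat → Cl N
  h : Fin 2 → Lat → ℝ
  β : Fin N → Fin 2 → Lat → ℝ
  γ : Lat → ℝ

namespace Fields

variable {N : ℕ} (hN : 2 ≤ N) (ε : ℝ) (S : Fields N)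

/-- `N_i² = 1 - (ε²/4) ∑_{k ≠ i} β_{ki}²`. -/
def normSq (i : Fin 2) (n : Lat) : ℝ :=
  1 - ε ^ 2 / 4 * ∑ k ∈ Finset.univ.erase (ax hN i), S.β k i n ^ 2

/-- `N_i`. -/
def nrm (i : Fin 2) (n : Lat) : ℝ := Real.sqrt (S.normSq hN ε i n)

/-- `Θ = (1/2) ∑_{k > 2} β_{k1} β_{k2}`. -/
def theta (n : Lat) : ℝ :=
  1 / 2 * ∑ k ∈ Finset.univ.filter (fun k : Fin N => k ≠ ax hN 0 ∧ k ≠ ax hN 1),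
    S.β k 0 n * S.β k 1 n

/-- `ρ₁₂ = ε N₁ β₁₂ - (ε²/2)(Θ - γ)`. -/
def rho12 (n : Lat) : ℝ :=
  ε * S.nrm hN ε 0 n * S.β (ax hN 0) 1 n - ε ^ 2 / 2 * (S.theta hN n - S.γ n)

/-- `ρ₂₁ = ε N₂ β₂₁ - (ε²/2)(Θ + γ)`. -/
def rho21 (n : Lat) : ℝ :=
  ε * S.nrm hN ε 1 n * S.β (ax hN 1) 0 n - ε ^ 2 / 2 * (S.theta hN n + S.γ n)

/-- `ρ_{ij}` for `j ≠ i`. -/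
def rho (i : Fin 2) (n : Lat) : ℝ := if i = 0 then S.rho12 hN ε n else S.rho21 hN ε n

/-- `n² = 1 - ρ₁₂ ρ₂₁`. -/
def nuSq (n : Lat) : ℝ := 1 - S.rho12 hN ε n * S.rho21 hN ε n

/-- `n = √(1 - ρ₁₂ ρ₂₁)`. -/
def nu (n : Lat) : ℝ := Real.sqrt (S.nuSq hN ε n)

end Fields

/-- `S` solves on `B^ε(r)` the Goursat problem for discrete C-surfaces with the data
`ψ(0) = Ψ`, `h_i = H_i` and `β_{ki} = B_{ki}` on the `i`-th axis, `γ = Γ` (data given as functions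
of a continuous argument and restricted to the lattice). The fields `real_N`, `real_n` say that the
solution stays in the domain where the right-hand sides are defined and smooth; an equation in the
direction `i` is imposed wherever both of its lattice points belong to `B^ε(r)`. -/
structure IsGoursatSolution {N : ℕ} (hN : 2 ≤ N) (ε r : ℝ) (Ψ : Cl N)
    (H : Fin 2 → ℝ → ℝ) (B : Fin N → Fin 2 → ℝ → ℝ) (Γ : (Fin 2 → ℝ) → ℝ)
    (S : Fields N) : Prop where
  real_N : ∀ i, ∀ n ∈ latBox ε r, 0 < S.normSq hN ε i n
  real_n : ∀ n ∈ latBox ε r, 0 < S.nuSq hN ε n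
  eq_ψ : ∀ i n, sh i n ∈ latBox ε r →
    diff ε i S.ψ n =
      (algebraMap ℝ (Cl N) ((S.nrm hN ε i n - 1) / ε)
        - (1 / 2 : ℝ) • ∑ k ∈ Finset.univ.erase (ax hN i),
            S.β k i n • (emb (e k) * emb (e (ax hN i)))
        + S.h i n • (emb (eInf N) * emb (e (ax hN i)))) * S.ψ n
  eq_h : ∀ i j, i ≠ j → ∀ n, sh i n ∈ latBox ε r →
    diff ε i (S.h j) n =
      S.rho hN ε i n / (ε * S.nu hN ε n) * S.h i n
        + (1 - S.nu hN ε n) / (ε * S.nu hN ε n) * S.h j n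
  eq_β : ∀ i j, i ≠ j → ∀ n, sh i n ∈ latBox ε r →
    diff ε i (S.β (ax hN i) j) n =
      2 * S.nrm hN ε i n * S.rho hN ε i n / (ε * ε * S.nu hN ε n)
        - (1 + S.nu hN ε n) / (ε * S.nu hN ε n) * S.β (ax hN i) j n
  eq_β' : ∀ i j, i ≠ j → ∀ k, k ≠ ax hN i → k ≠ ax hN j → ∀ n, sh i n ∈ latBox ε r →
    diff ε i (S.β k j) n =
      (1 - S.nu hN ε n) / (ε * S.nu hN ε n) * S.β k j n
        + S.rho hN ε i n / (ε * S.nu hN ε n) * S.β k i n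
  data_ψ : S.ψ 0 = Ψ
  data_h : ∀ i, ∀ a : ℕ, Pi.single i a ∈ latBox ε r → S.h i (Pi.single i a) = H i (ε * a)
  data_β : ∀ i k, k ≠ ax hN i → ∀ a : ℕ, Pi.single i a ∈ latBox ε r →
    S.β k i (Pi.single i a) = B k i (ε * a)
  data_γ : ∀ n ∈ latBox ε r, S.γ n = Γ (pt ε n)

/-- Two collections of fields coincide on `B^ε(r)`. -/
def Fields.EqOnBox {N : ℕ} (hN : 2 ≤ N) (ε r : ℝ) (S T : Fields N) : Prop :=
  ∀ n ∈ latBox ε r, S.ψ n = T.ψ n ∧ (∀ i, S.h i n = T.h i n) ∧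
    (∀ i k, k ≠ ax hN i → S.β k i n = T.β k i n) ∧ S.γ n = T.γ n

/-- The lattice curve `Y` on `[0, r] ∩ εℤ` is the canonical discretization, with respect to the
initial frame `Ψ`, of a curve with index `i` from which `H` and `B` are read off:
`λ(Y) = A_φ(e_0)`, where `φ` has values in `H_∞`, `φ(0) = Ψ`, `τ_i φ = -Σ_i e_i φ` and
`Σ_i = (1 - (ε²/4) ∑_{k≠i} β_{ki}²)^{1/2} e_i + (ε/2) ∑_{k≠i} β_{ki} e_k - ε h_i e_∞`. -/
def IsCanonicalDiscretization {N : ℕ} (hN : 2 ≤ N) (ε r : ℝ) (Ψ : Cl N) (i : Fin 2)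
    (H : ℝ → ℝ) (B : Fin N → ℝ → ℝ) (Y : ℕ → E N) : Prop :=
  ∃ φ : ℕ → Cl N, φ 0 = Ψ ∧
    (∀ a : ℕ, ε * (a + 1 : ℕ) ≤ r →
      0 ≤ 1 - ε ^ 2 / 4 * ∑ k ∈ Finset.univ.erase (ax hN i), B k (ε * a) ^ 2 ∧
      φ (a + 1) =
        -(emb (Real.sqrt (1 - ε ^ 2 / 4 *
                ∑ k ∈ Finset.univ.erase (ax hN i), B k (ε * a) ^ 2) • e (ax hN i)
            + (ε / 2) • ∑ k ∈ Finset.univ.erase (ax hN i), B k (ε * a) • e k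
            - (ε * H (ε * a)) • eInf N)) * emb (e (ax hN i)) * φ a) ∧
    ∀ a : ℕ, ε * a ≤ r → φ a ∈ HInf N ∧ emb (lift (Y a)) = act (φ a) (eZero N)

end CSurf

end

set_option linter.unusedSectionVars false

noncomputable section

namespace CSurf

open Topology Set


/-! A C-surface is described by a moving frame. With `u i` the unit tangents at the origin, `∂_i x =
h_i P u_i` and `∂_i P = P Ω_i`, where `P` is orthogonal with `P(0) = id` and `Ω_i z = ⟨b_i, z⟩ u_i -
⟨u_i, z⟩ b_i`, `b_i ⊥ u_i`. The components of `b_i` are the `β_{ki}`. The compatibility conditions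
determine only the sum of `∂_iβ_{ij}` and `∂_jβ_{ji}`; once their difference is prescribed through
`Γ`, the pairs `W j = (h_j, b_j)` satisfy a Goursat problem: `W j` evolves in the direction `i ≠ j`
and is given on the `j`-th axis, where it comes from a rotation minimizing frame along `X j`
(`exists_curveFrame`).

Existence: `exists_goursat` solves the smooth Goursat problem by the implicit function theorem, and
`zero_curvature` propagates the frame equation that was not imposed (`PreSol.evol_P_zero`).
Uniqueness: unit tangents, lengths and curvature vectors of any C-surface solve a Goursat problem
with a smooth right-hand side, and two solutions are compared in a weighted supremum norm
(`eq_zero_of_goursat`).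

Discrete side: a lattice step multiplies `ψ` by `-Σ_i e_i`, a product of two reflections. The
evolution `drhs` is made so that the unit vectors `Σ_i` evolve as `sig_step` says, which is what
makes steps in the two directions commute (`frame_compat`); circularity follows from the same
identities (`concyclic_of_edges`). In the Euclidean picture a step is a rotation `O(ε)`-close to the
identity (`IsFrame.step`, `erefl_comp_erefl_sig`).

Convergence: with the square roots cut off away from zero, the discrete right-hand sides are smooth
in all variables and in `ε`, and at `ε = 0` they are the smooth equations (`drhs_zero`). Difference
quotients of a smooth map are again smooth functions, down to step zero (`contDiff_hadamard`). So
the consistency error is `ε` times a smooth function, and the error divided by `ε` solves a discrete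
Goursat problem with smooth right-hand side and zero data. It is bounded by `lat_gronwall`, and its
differences solve problems of the same type, hence are bounded to every order
(`bddDiff_of_goursat`). Frame and points follow by `discrete_total_converges`.

The size `r` does not depend on `Ψ`, because the smooth equations are written without coordinates;
`Ψ` enters only through the isometry `O` of `IsSuited.exists_isFrame`, which turns `b_i` into the
numbers `β_{ki}`. -/

/-! ### Smoothness of superposition operators and parametric integrals -/

section Nemytskii

variable {K V W : Type} [TopologicalSpace K] [CompactSpace K]
  [NormedAddCommGroup V] [NormedSpace ℝ V] [NormedAddCommGroup W] [NormedSpace ℝ W]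

/-- The superposition operator `u ↦ F ∘ u` on spaces of continuous functions. -/
def superpos (F : V → W) (hF : Continuous F) (u : C(K, V)) : C(K, W) := ⟨fun k => F (u k), by fun_prop⟩

@[simp] theorem superpos_apply (F : V → W) (hF : Continuous F) (u : C(K, V)) (k : K) :
    superpos F hF u k = F (u k) := rfl

/-- Pointwise application of operator-valued continuous functions. -/
def pointwiseApply (K V W : Type) [TopologicalSpace K] [CompactSpace K]
    [NormedAddCommGroup V] [NormedSpace ℝ V] [NormedAddCommGroup W] [NormedSpace ℝ W] :
    C(K, V →L[ℝ] W) →L[ℝ] C(K, V) →L[ℝ] C(K, W) :=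
  LinearMap.mkContinuous₂
    (LinearMap.mk₂ ℝ (fun (g : C(K, V →L[ℝ] W)) (h : C(K, V)) =>
        (⟨fun k => g k (h k), by fun_prop⟩ : C(K, W)))
      (by intros; ext; simp) (by intros; ext; simp) (by intros; ext; simp) (by intros; ext; simp))
    1 (by
      intro g h
      rw [ContinuousMap.norm_le _ (by positivity)]
      intro k
      simp only [LinearMap.mk₂_apply, ContinuousMap.coe_mk, one_mul]
      exact (ContinuousLinearMap.le_opNorm _ _).trans
        (mul_le_mul (g.norm_coe_le_norm k) (h.norm_coe_le_norm k) (norm_nonneg _) (norm_nonneg g)))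

@[simp] theorem pointwiseApply_apply (g : C(K, V →L[ℝ] W)) (h : C(K, V)) (k : K) :
    pointwiseApply K V W g h k = g k (h k) := rfl

theorem contDiff_pointwiseApply {n : ℕ∞ω} : ContDiff ℝ n (pointwiseApply K V W) :=
  ContinuousLinearMap.contDiff _

/-- Differentiability is uniform along the compact set `range u`: `F'` is uniformly continuous
there, and the mean value inequality on a ball bounds the remainder at every `k` with the same
constant. -/
theorem hasFDerivAt_superpos (F : V → W) (hF : Continuous F) (F' : V → V →L[ℝ] W)
    (hF' : Continuous F') (h : ∀ x, HasFDerivAt F (F' x) x) (u : C(K, V)) :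
    HasFDerivAt (superpos F hF) (pointwiseApply K V W (superpos F' hF' u)) u := by
  rw [hasFDerivAt_iff_isLittleO_nhds_zero, Asymptotics.isLittleO_iff]
  intro c hc
  have hK : IsCompact (range u) := isCompact_range u.continuous
  have h1 := hK.uniformContinuousAt_of_continuousAt F' (fun a _ => hF'.continuousAt)
    (Metric.dist_mem_uniformity hc)
  obtain ⟨δ, hδ, h2⟩ := Metric.mem_uniformity_dist.1 h1
  filter_upwards [Metric.ball_mem_nhds (0 : C(K, V)) hδ] with w hw
  rw [mem_ball_zero_iff] at hw
  rw [ContinuousMap.norm_le _ (by positivity)]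
  intro k
  have hwk : ‖w k‖ < δ := (w.norm_coe_le_norm k).trans_lt hw
  have h3 := (convex_ball (u k) δ).norm_image_sub_le_of_norm_hasFDerivWithin_le'
    (f := F) (f' := F') (φ := F' (u k)) (C := c) (x := u k) (y := u k + w k)
    (fun x _ => (h x).hasFDerivWithinAt)
    (fun x hx => by
      have := h2 (a := u k) (b := x) (by rw [dist_comm]; exact hx) (mem_range_self k)
      simp only [mem_ofPred_eq] at this
      rw [← dist_eq_norm, dist_comm]; exact this.le)
    (Metric.mem_ball_self hδ) (by simpa [dist_eq_norm] using hwk)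
  rw [add_sub_cancel_left] at h3
  refine le_trans ?_ (h3.trans (mul_le_mul_of_nonneg_left (w.norm_coe_le_norm k) hc.le))
  simp

/-- The derivative of a superposition operator is the superposition operator of `fderiv ℝ F`
followed by a bounded bilinear map, so one induction gives all orders. The target `W` is quantified
inside because the inductive step replaces it by `V →L[ℝ] W`. -/
theorem contDiff_superpos_nat (n : ℕ) : ∀ {W : Type} [NormedAddCommGroup W] [NormedSpace ℝ W]
    (F : V → W) (hF : ContDiff ℝ ∞ F),
    ContDiff ℝ n (superpos (K := K) F hF.continuous) := by
  induction n with
  | zero =>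
    intro W _ _ F hF
    refine contDiff_zero.2 (continuous_iff_continuousAt.2 fun u => ?_)
    exact (hasFDerivAt_superpos F hF.continuous (fderiv ℝ F) (hF.continuous_fderiv (by simp))
      (fun x => (hF.differentiable (by simp) x).hasFDerivAt) u).continuousAt
  | succ n ih =>
    intro W _ _ F hF
    have hF' : ContDiff ℝ ∞ (fderiv ℝ F) := (contDiff_infty_iff_fderiv.1 hF).2
    push_cast
    refine contDiff_succ_iff_hasFDerivAt.2
      ⟨fun u => pointwiseApply K V W (superpos (fderiv ℝ F) hF'.continuous u),
        contDiff_pointwiseApply.comp (ih _ hF'), fun u => ?_⟩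
    exact hasFDerivAt_superpos F hF.continuous (fderiv ℝ F) hF'.continuous
      (fun x => (hF.differentiable (by simp) x).hasFDerivAt) u

theorem contDiff_superpos (F : V → W) (hF : ContDiff ℝ ∞ F) :
    ContDiff ℝ ∞ (superpos (K := K) F hF.continuous) :=
  contDiff_infty.2 fun n => contDiff_superpos_nat n F hF

end Nemytskii

/-! ### Hadamard quotients: difference quotients as smooth functions of the step. -/

section Hadamard

variable {V W : Type} [NormedAddCommGroup V] [NormedSpace ℝ V]
  [NormedAddCommGroup W] [NormedSpace ℝ W] [CompleteSpace W]

/-- The integral over the unit interval as a continuous linear map. -/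
def integralCLM (W : Type) [NormedAddCommGroup W] [NormedSpace ℝ W] :
    C(unitInterval, W) →L[ℝ] W :=
  LinearMap.mkContinuous
    { toFun := fun f => ∫ t, f t
      map_add' := fun f g => by
        simpa using MeasureTheory.integral_add
          (f.continuous.integrable_of_hasCompactSupport (HasCompactSupport.of_compactSpace _))
          (g.continuous.integrable_of_hasCompactSupport (HasCompactSupport.of_compactSpace _))
      map_smul' := fun c f => by
        simpa using MeasureTheory.integral_smul c (fun t => f t) }
    1 (by
      intro f
      have := MeasureTheory.norm_integral_le_of_norm_le_const
        (μ := (MeasureTheory.volume : MeasureTheory.Measure unitInterval))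
        (Filter.Eventually.of_forall fun t => f.norm_coe_le_norm t)
      simpa using this)

theorem integralCLM_apply (f : C(unitInterval, W)) : integralCLM W f = ∫ t, f t := rfl

theorem integralCLM_eq_intervalIntegral (g : ℝ → W) (hg : Continuous g) :
    integralCLM W ⟨fun t => g t, by fun_prop⟩ = ∫ t in (0:ℝ)..1, g t := by
  rw [integralCLM_apply, intervalIntegral.integral_of_le zero_le_one,
    ← MeasureTheory.integral_Icc_eq_integral_Ioc]
  exact MeasureTheory.integral_subtype_comap (μ := MeasureTheory.volume)
    (measurableSet_Icc (a := (0:ℝ)) (b := 1)) g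

/-- The segment `t ↦ x + t y` as a continuous linear function of `(x, y)`. -/
def segmentCLM (V : Type) [NormedAddCommGroup V] [NormedSpace ℝ V] :
    V × V →L[ℝ] C(unitInterval, V) :=
  LinearMap.mkContinuous
    { toFun := fun p => ⟨fun t => p.1 + (t : ℝ) • p.2, by fun_prop⟩
      map_add' := fun p q => by ext t; simp [smul_add]; abel
      map_smul' := fun c p => by ext t; simp [smul_comm c] }
    2 (by
      intro p
      rw [ContinuousMap.norm_le _ (by positivity)]
      intro t
      have h1 : ‖(t : ℝ) • p.2‖ ≤ ‖p.2‖ := by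
        rw [norm_smul, Real.norm_of_nonneg t.2.1]
        exact mul_le_of_le_one_left (norm_nonneg _) t.2.2
      have := norm_add_le p.1 ((t : ℝ) • p.2)
      have h2 := norm_fst_le p
      have h3 := norm_snd_le p
      simp only [LinearMap.coe_mk, AddHom.coe_mk, ContinuousMap.coe_mk]
      linarith)

/-- The Hadamard quotient `∫₀¹ DF(x + t ε y) y dt` of a smooth map. -/
def hadamard (F : V → W) (p : ℝ × V × V) : W :=
  ∫ t in (0:ℝ)..1, fderiv ℝ F (p.2.1 + t • p.1 • p.2.2) p.2.2

/-- No differentiation under the integral sign is needed: the quotient is assembled from continuous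
linear maps and the superposition operator of `fderiv ℝ F` on `C([0,1])`. It is therefore smooth
jointly in step, point and direction, also at step zero. -/
theorem contDiff_hadamard {F : V → W} (hF : ContDiff ℝ ∞ F) : ContDiff ℝ ∞ (hadamard F) := by
  have hF' : ContDiff ℝ ∞ (fderiv ℝ F) := (contDiff_infty_iff_fderiv.1 hF).2
  have hG : ContDiff ℝ ∞ (fun q : V × V => fderiv ℝ F q.1 q.2) :=
    (hF'.comp contDiff_fst).clm_apply contDiff_snd
  have h1 : hadamard F = fun p : ℝ × V × V => integralCLM W
      (pointwiseApply unitInterval V W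
        (superpos (fderiv ℝ F) hF'.continuous (segmentCLM V (p.2.1, p.1 • p.2.2)))
        (segmentCLM V (p.2.2, 0))) := by
    funext p
    have hc := hF'.continuous
    rw [hadamard, ← integralCLM_eq_intervalIntegral _ (by fun_prop)]
    congr 1
    ext t
    simp [segmentCLM]
  rw [h1]
  have h2 : ContDiff ℝ ∞ (fun p : ℝ × V × V =>
      superpos (fderiv ℝ F) hF'.continuous (segmentCLM V (p.2.1, p.1 • p.2.2))) :=
    (contDiff_superpos _ hF').comp ((segmentCLM V).contDiff.comp (by fun_prop))
  refine (integralCLM W).contDiff.comp (ContDiff.clm_apply ?_ ?_)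
  · exact contDiff_pointwiseApply.comp h2
  · exact (segmentCLM V).contDiff.comp (by fun_prop)

/-- Fundamental theorem of calculus along the segment from `x` to `x + ε • y`. -/
theorem smul_hadamard {F : V → W} (hF : ContDiff ℝ ∞ F) (ε : ℝ) (x y : V) :
    ε • hadamard F (ε, x, y) = F (x + ε • y) - F x := by
  have hF' : Continuous (fderiv ℝ F) := hF.continuous_fderiv (by simp)
  have h1 : ∀ t : ℝ, HasDerivAt (fun t : ℝ => F (x + t • ε • y))
      (ε • fderiv ℝ F (x + t • ε • y) y) t := by
    intro t
    have h2 : HasDerivAt (fun t : ℝ => x + t • ε • y) (ε • y) t := by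
      simpa using ((hasDerivAt_id t).smul_const (ε • y)).const_add x
    have := ((hF.differentiable (by simp) (x + t • ε • y)).hasFDerivAt).comp_hasDerivAt t h2
    simpa [Function.comp_def] using this
  have h3 := intervalIntegral.integral_eq_sub_of_hasDerivAt (a := 0) (b := 1) (fun t _ => h1 t)
    (Continuous.intervalIntegrable (by fun_prop) _ _)
  rw [intervalIntegral.integral_smul] at h3
  simpa [hadamard] using h3

theorem hadamard_eq {F : V → W} (hF : ContDiff ℝ ∞ F) {ε : ℝ} (hε : ε ≠ 0) (x y : V) :
    hadamard F (ε, x, y) = ε⁻¹ • (F (x + ε • y) - F x) := by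
  rw [← smul_hadamard hF, inv_smul_smul₀ hε]

theorem hadamard_zero (F : V → W) (x y : V) : hadamard F (0, x, y) = fderiv ℝ F x y := by
  simp [hadamard]

end Hadamard

/-! ### Globally smooth representatives of smooth germs. -/

section Extension

variable {V W : Type} [NormedAddCommGroup V] [NormedSpace ℝ V] [FiniteDimensional ℝ V]
  [NormedAddCommGroup W] [NormedSpace ℝ W]

/-- A map which is smooth near a point agrees near that point with a globally smooth map. -/
theorem exists_contDiff_eventuallyEq {f : V → W} {x : V}
    (hf : ∀ᶠ y in 𝓝 x, ContDiffAt ℝ ∞ f y) : ∃ g : V → W, ContDiff ℝ ∞ g ∧ g =ᶠ[𝓝 x] f := by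
  obtain ⟨δ, hδ, h⟩ := Metric.eventually_nhds_iff_ball.1 hf
  -- The outer radius is smaller than `δ`, so the bump dies out before `f` stops being smooth.
  let χ : ContDiffBump x := ⟨δ / 4, δ / 2, by positivity, by linarith⟩
  refine ⟨fun y => χ y • f y, contDiff_iff_contDiffAt.2 fun y => ?_, ?_⟩
  · by_cases hy : y ∈ Metric.ball x δ
    · exact χ.contDiff.contDiffAt.smul (h y hy)
    · have h0 : (fun y => χ y • f y) =ᶠ[𝓝 y] fun _ => 0 := by
        have h1 : y ∉ tsupport χ := by
          rw [χ.tsupport_eq]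
          intro h2
          apply hy
          have : dist y x ≤ δ / 2 := h2
          rw [Metric.mem_ball]; linarith
        filter_upwards [(isClosed_tsupport χ).isOpen_compl.mem_nhds h1] with z hz
        rw [image_eq_zero_of_notMem_tsupport hz, zero_smul]
      exact contDiffAt_const.congr_of_eventuallyEq h0
  · filter_upwards [Metric.closedBall_mem_nhds x χ.rIn_pos] with y hy
    rw [χ.one_of_mem_closedBall hy, one_smul]

end Extension


/-! ### Implicit functions that are smooth on a whole neighbourhood. -/

section Implicit

variable {E₁ E₂ F : Type} [NormedAddCommGroup E₁] [NormedSpace ℝ E₁] [CompleteSpace E₁]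
  [NormedAddCommGroup E₂] [NormedSpace ℝ E₂] [CompleteSpace E₂]
  [NormedAddCommGroup F] [NormedSpace ℝ F] [CompleteSpace F]

/-- The implicit function of a smooth equation is smooth in a full neighbourhood. -/
theorem exists_smooth_implicitFunction {f : E₁ × E₂ → F} (hf : ContDiff ℝ ∞ f) (u : E₁ × E₂)
    (hinv : (fderiv ℝ f u ∘L .inr ℝ E₁ E₂).IsInvertible) :
    ∃ ψ : E₁ → E₂, ψ u.1 = u.2 ∧ (∀ᶠ x in 𝓝 u.1, f (x, ψ x) = f u) ∧
      (∀ᶠ v in 𝓝 u, f v = f u → ψ v.1 = v.2) ∧ ∀ᶠ x in 𝓝 u.1, ContDiffAt ℝ ∞ ψ x := by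
  have hn : (∞ : ℕ∞ω) ≠ 0 := by simp
  have hfu : ContDiffAt ℝ ∞ f u := hf.contDiffAt
  set ψ := hfu.implicitFunction hn hinv with hψ
  have h0 : ψ u.1 = u.2 := hfu.implicitFunction_apply_self hn hinv
  have h1 : ∀ᶠ x in 𝓝 u.1, f (x, ψ x) = f u := hfu.eventually_apply_implicitFunction hn hinv
  have h2 : ContDiffAt ℝ ∞ ψ u.1 := hfu.contDiffAt_implicitFunction hn hinv
  refine ⟨ψ, h0, h1,
    (hfu.eventually_apply_eq_iff_implicitFunction hn hinv).mono fun v hv h => hv.1 h, ?_⟩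
  -- `ContDiffAt ℝ ∞` at one point passes to nearby points only for finite orders. Full smoothness
  -- at a nearby `x` comes from applying the theorem again at `(x, ψ x)`, where the partial
  -- derivative is still invertible, and from local uniqueness of the implicit function.
  have h3 : ∀ᶠ x in 𝓝 u.1, ContDiffAt ℝ 1 ψ x := (h2.of_le (by simp)).eventually (by simp)
  have hgraph : ContinuousAt (fun x => (x, ψ x)) u.1 := continuousAt_id.prodMk h2.continuousAt
  have h4 : ∀ᶠ x in 𝓝 u.1, (fderiv ℝ f (x, ψ x) ∘L .inr ℝ E₁ E₂).IsInvertible := by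
    have hc : Continuous (fun v => fderiv ℝ f v ∘L .inr ℝ E₁ E₂) :=
      (hf.continuous_fderiv (by simp)).clm_comp continuous_const
    have ho : IsOpen {T : E₂ →L[ℝ] F | T.IsInvertible} := by
      convert ContinuousLinearEquiv.isOpen (𝕜 := ℝ) (E := E₂) (F := F) using 1
      ext T; simp [ContinuousLinearMap.IsInvertible]
    have : ContinuousAt (fun x => fderiv ℝ f (x, ψ x) ∘L .inr ℝ E₁ E₂) u.1 :=
      hc.continuousAt.comp hgraph
    exact this.eventually (ho.mem_nhds (by
      change (fderiv ℝ f (u.1, ψ u.1) ∘L _).IsInvertible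
      rw [h0]; exact hinv))
  filter_upwards [h1.eventually_nhds, h3, h4, h1] with x hx1 hx3 hx4 hx5
  have hfx : ContDiffAt ℝ ∞ f (x, ψ x) := hf.contDiffAt
  have h5 := hfx.eventually_apply_eq_iff_implicitFunction hn hx4
  have h6 : ContDiffAt ℝ ∞ (hfx.implicitFunction hn hx4) x :=
    hfx.contDiffAt_implicitFunction hn hx4
  have hgx : ContinuousAt (fun y => (y, ψ y)) x := continuousAt_id.prodMk hx3.continuousAt
  refine h6.congr_of_eventuallyEq ?_
  filter_upwards [hgx.eventually h5, hx1] with y hy1 hy2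
  exact (hy1.1 (hy2.trans hx5.symm)).symm

end Implicit

/-! ### The smooth Goursat problem as a fixed point equation on the unit square. -/

section Goursat

variable {P Q V W K : Type} [NormedAddCommGroup P] [NormedSpace ℝ P]
  [NormedAddCommGroup Q] [NormedSpace ℝ Q]
  [NormedAddCommGroup V] [NormedSpace ℝ V] [NormedAddCommGroup W] [NormedSpace ℝ W]
  [TopologicalSpace K] [CompactSpace K]

/-- Pairing of continuous functions as a continuous linear map. -/
def pairCLM (K V W : Type) [TopologicalSpace K] [CompactSpace K] [NormedAddCommGroup V]
    [NormedSpace ℝ V] [NormedAddCommGroup W] [NormedSpace ℝ W] :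
    C(K, V) × C(K, W) →L[ℝ] C(K, V × W) :=
  LinearMap.mkContinuous
    { toFun := fun p => p.1.prodMk p.2
      map_add' := fun p q => by ext <;> simp
      map_smul' := fun c p => by ext <;> simp }
    1 (by
      intro p
      rw [ContinuousMap.norm_le _ (by positivity)]
      intro k
      rw [one_mul]
      exact max_le_max (p.1.norm_coe_le_norm k) (p.2.norm_coe_le_norm k))

@[simp] theorem pairCLM_apply (p : C(K, V) × C(K, W)) (k : K) :
    pairCLM K V W p k = (p.1 k, p.2 k) := rfl

theorem contDiff_pairCLM {n : ℕ∞ω} : ContDiff ℝ n (pairCLM K V W) :=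
  ContinuousLinearMap.contDiff _

/-- The weighted mean `f ↦ (k ↦ w k ∫₀¹ f (φ (k, θ)) dθ)`. -/
def meanCLM (V : Type) [NormedAddCommGroup V] [NormedSpace ℝ V] (w : C(K, ℝ))
    (φ : C(K × unitInterval, K)) : C(K, V) →L[ℝ] C(K, V) :=
  LinearMap.mkContinuous
    { toFun := fun f => ⟨fun k => w k • integralCLM V ((f.comp φ).curry k), by fun_prop⟩
      map_add' := fun f g => by
        ext k
        simp
      map_smul' := fun c f => by
        ext k
        simp [smul_comm c] }
    (‖w‖ * ‖integralCLM V‖) (by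
      intro f
      rw [ContinuousMap.norm_le _ (by positivity)]
      intro k
      simp only [LinearMap.coe_mk, AddHom.coe_mk, ContinuousMap.coe_mk, norm_smul, mul_assoc]
      refine mul_le_mul (w.norm_coe_le_norm k) ?_ (norm_nonneg _) (norm_nonneg w)
      refine ((integralCLM V).le_opNorm _).trans (mul_le_mul_of_nonneg_left ?_ (norm_nonneg _))
      rw [ContinuousMap.norm_le _ (by positivity)]
      intro θ
      exact f.norm_coe_le_norm _)

/-- The unit square as parameter space of rescaled solutions. -/
abbrev USq : Type := unitInterval × unitInterval

/-- The chart `(s, t) ↦ (ξ₀ s, ξ₁ t)` as a linear function of `ξ`. -/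
def chartCLM : (Fin 2 → ℝ) →L[ℝ] C(USq, Fin 2 → ℝ) :=
  LinearMap.mkContinuous
    { toFun := fun ξ => ⟨fun k => ![ξ 0 * k.1, ξ 1 * k.2], by
        refine continuous_pi fun i => ?_
        fin_cases i <;> simp <;> fun_prop⟩
      map_add' := fun p q => by ext k i; fin_cases i <;> simp [add_mul]
      map_smul' := fun c p => by ext k i; fin_cases i <;> simp [mul_assoc] }
    1 (by
      intro ξ
      rw [ContinuousMap.norm_le _ (by positivity)]
      intro k
      rw [one_mul, pi_norm_le_iff_of_nonneg (norm_nonneg _)]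
      have h : ∀ (i : Fin 2) (s : unitInterval), ‖ξ i * s‖ ≤ ‖ξ‖ := fun i s => by
        rw [norm_mul, Real.norm_of_nonneg s.2.1]
        exact (mul_le_of_le_one_right (norm_nonneg _) s.2.2).trans (norm_le_pi_norm ξ i)
      intro i
      fin_cases i
      · exact h 0 k.1
      · exact h 1 k.2)

@[simp] theorem chartCLM_apply (ξ : Fin 2 → ℝ) (k : USq) :
    chartCLM ξ k = ![ξ 0 * k.1, ξ 1 * k.2] := rfl

theorem contDiff_chartCLM {n : ℕ∞ω} : ContDiff ℝ n chartCLM := ContinuousLinearMap.contDiff _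

/-- The integration operators along the two coordinate directions. -/
def intCLM (V : Type) [NormedAddCommGroup V] [NormedSpace ℝ V] (i : Fin 2) :
    C(USq, V) →L[ℝ] C(USq, V) :=
  if i = 0 then
    meanCLM V ⟨fun k => (k.1 : ℝ), by fun_prop⟩ ⟨fun p => (p.1.1 * p.2, p.1.2), by fun_prop⟩
  else
    meanCLM V ⟨fun k => (k.2 : ℝ), by fun_prop⟩ ⟨fun p => (p.1.1, p.1.2 * p.2), by fun_prop⟩

theorem intCLM_zero_apply (f : C(USq, V)) (k : USq) :
    intCLM V 0 f k = (k.1 : ℝ) • ∫ θ : unitInterval, f (k.1 * θ, k.2) := rfl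

theorem intCLM_one_apply (f : C(USq, V)) (k : USq) :
    intCLM V 1 f k = (k.2 : ℝ) • ∫ θ : unitInterval, f (k.1, k.2 * θ) := rfl

theorem contDiff_eval {n : ℕ∞ω} (k : K) : ContDiff ℝ n (fun f : C(K, V) => f k) := by
  have h : ContDiff ℝ n (ContinuousMap.evalCLM ℝ k : C(K, V) →L[ℝ] V) :=
    ContinuousLinearMap.contDiff _
  exact h

theorem contDiff_intCLM {n : ℕ∞ω} (i : Fin 2) : ContDiff ℝ n (intCLM V i) :=
  ContinuousLinearMap.contDiff _

/-- The rescaled integral equation of one component of the Goursat problem. -/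
def goursatPart (i j : Fin 2) (F : (Fin 2 → ℝ) × P × Q → V) (hF : Continuous F)
    (A : ℝ → V) (hA : Continuous A) (p : (Fin 2 → ℝ) × C(USq, P) × C(USq, Q)) : C(USq, V) :=
  superpos (fun ξ : Fin 2 → ℝ => A (ξ j)) (by fun_prop) (chartCLM p.1) +
    p.1 i • intCLM V i (superpos F hF (pairCLM USq _ _ (chartCLM p.1, pairCLM USq _ _ p.2)))

theorem contDiff_goursatPart (i j : Fin 2) (F : (Fin 2 → ℝ) × P × Q → V) (hF : ContDiff ℝ ∞ F)
    (A : ℝ → V) (hA : ContDiff ℝ ∞ A) :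
    ContDiff ℝ ∞ (goursatPart i j F hF.continuous A hA.continuous) := by
  unfold goursatPart
  have h1 : ContDiff ℝ ∞ (fun p : (Fin 2 → ℝ) × C(USq, P) × C(USq, Q) => chartCLM p.1) :=
    contDiff_chartCLM.comp contDiff_fst
  have h2 : ContDiff ℝ ∞ (fun p : (Fin 2 → ℝ) × C(USq, P) × C(USq, Q) => pairCLM USq P Q p.2) :=
    contDiff_pairCLM.comp contDiff_snd
  refine ContDiff.add ?_ (ContDiff.smul ((contDiff_apply ℝ ℝ i).comp contDiff_fst) ?_)
  · have h3 : ContDiff ℝ ∞ (fun ξ : Fin 2 → ℝ => A (ξ j)) := hA.comp (contDiff_apply ℝ ℝ j)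
    exact (contDiff_superpos _ h3).comp h1
  · exact (contDiff_intCLM i).comp ((contDiff_superpos F hF).comp
      (contDiff_pairCLM.comp (h1.prodMk h2)))

/-- Rescaling of a function on the unit square. -/
def rescale (k : USq) (f : C(USq, V)) : C(USq, V) :=
  ⟨fun l => f (k.1 * l.1, k.2 * l.2), by fun_prop⟩

@[simp] theorem rescale_apply (k l : USq) (f : C(USq, V)) :
    rescale k f l = f (k.1 * l.1, k.2 * l.2) := rfl

/-- The integral operator commutes with restriction to a smaller rectangle. Hence the solution for
the corner `ξ`, restricted and rescaled, solves the problem for the smaller corner `chartCLM ξ k`.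
-/
theorem goursatPart_rescale (i j : Fin 2) (hij : i ≠ j) (F : (Fin 2 → ℝ) × P × Q → V)
    (hF : Continuous F) (A : ℝ → V) (hA : Continuous A) (ξ : Fin 2 → ℝ)
    (u : C(USq, P)) (v : C(USq, Q)) (k : USq) :
    goursatPart i j F hF A hA (chartCLM ξ k, rescale k u, rescale k v) =
      rescale k (goursatPart i j F hF A hA (ξ, u, v)) := by
  ext l
  have : (i = 0 ∧ j = 1) ∨ (i = 1 ∧ j = 0) := by revert i j; decide
  rcases this with ⟨rfl, rfl⟩ | ⟨rfl, rfl⟩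
  · simp [goursatPart, intCLM_zero_apply, mul_assoc, mul_smul]
  · simp [goursatPart, intCLM_one_apply, mul_assoc, mul_smul]

variable [CompleteSpace P] [CompleteSpace Q]

/-- Local solvability of the smooth Goursat problem, in integral form. -/
theorem exists_goursat_integral (F : (Fin 2 → ℝ) × P × Q → P) (hF : ContDiff ℝ ∞ F)
    (G : (Fin 2 → ℝ) × P × Q → Q) (hG : ContDiff ℝ ∞ G)
    (A : ℝ → P) (hA : ContDiff ℝ ∞ A) (B : ℝ → Q) (hB : ContDiff ℝ ∞ B) :
    ∃ (a : (Fin 2 → ℝ) → P) (b : (Fin 2 → ℝ) → Q),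
      ContDiff ℝ ∞ a ∧ ContDiff ℝ ∞ b ∧ ∃ δ > 0, ∀ ξ ∈ Metric.ball (0 : Fin 2 → ℝ) δ,
        a ξ = A (ξ 1) + ξ 0 • ∫ θ : unitInterval,
          F (![ξ 0 * θ, ξ 1], a ![ξ 0 * θ, ξ 1], b ![ξ 0 * θ, ξ 1]) ∧
        b ξ = B (ξ 0) + ξ 1 • ∫ θ : unitInterval,
          G (![ξ 0, ξ 1 * θ], a ![ξ 0, ξ 1 * θ], b ![ξ 0, ξ 1 * θ]) := by
  set Fa := goursatPart 0 1 F hF.continuous A hA.continuous with hFa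
  set Fb := goursatPart 1 0 G hG.continuous B hB.continuous with hFb
  have hFas : ContDiff ℝ ∞ Fa := contDiff_goursatPart 0 1 F hF A hA
  have hFbs : ContDiff ℝ ∞ Fb := contDiff_goursatPart 1 0 G hG B hB
  let f : (Fin 2 → ℝ) × C(USq, P) × C(USq, Q) → C(USq, P) × C(USq, Q) :=
    fun p => p.2 - (Fa p, Fb p)
  have hf : ContDiff ℝ ∞ f := contDiff_snd.sub (hFas.prodMk hFbs)
  let U : C(USq, P) × C(USq, Q) := (ContinuousMap.const _ (A 0), ContinuousMap.const _ (B 0))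
  -- For the degenerate rectangle `ξ = 0` the integral terms drop out, so the derivative of the
  -- equation in `w` is the identity and the implicit function theorem applies.
  have hf0 : ∀ w, f (0, w) = w - U := by
    intro w
    refine Prod.ext ?_ ?_
    · ext l; simp [f, Fa, goursatPart, U]
    · ext l; simp [f, Fb, goursatPart, U]
  have hfU : f (0, U) = 0 := by rw [hf0, sub_self]
  have hinv : (fderiv ℝ f (0, U) ∘L .inr ℝ (Fin 2 → ℝ) (C(USq, P) × C(USq, Q))).IsInvertible := by
    have h1 : HasFDerivAt (fun w => f (0, w))
        (fderiv ℝ f (0, U) ∘L .inr ℝ (Fin 2 → ℝ) (C(USq, P) × C(USq, Q))) U := by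
      have h2 : HasFDerivAt (fun w : C(USq, P) × C(USq, Q) => ((0 : Fin 2 → ℝ), w))
          (.inr ℝ (Fin 2 → ℝ) (C(USq, P) × C(USq, Q))) U := hasFDerivAt_prodMk_right 0 U
      exact HasFDerivAt.comp (g := f) U
        (hf.differentiable (by simp) (0, U)).hasFDerivAt h2
    have h3 : HasFDerivAt (fun w => f (0, w)) (ContinuousLinearMap.id ℝ _) U := by
      simp only [hf0]; exact (hasFDerivAt_id U).sub_const U
    rw [h1.unique h3]
    exact ⟨ContinuousLinearEquiv.refl ℝ _, rfl⟩
  obtain ⟨ψ, hψ0, hψ1, hψ2, hψ3⟩ := exists_smooth_implicitFunction hf (0, U) hinv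
  rw [hfU] at hψ1 hψ2
  simp only at hψ0 hψ1 hψ3
  -- evaluation at the corner
  have hev1 : ∀ (k : USq), ContDiff ℝ ∞ (fun w : C(USq, P) × C(USq, Q) => w.1 k) := fun k =>
    (contDiff_eval k).comp contDiff_fst
  have hev2 : ∀ (k : USq), ContDiff ℝ ∞ (fun w : C(USq, P) × C(USq, Q) => w.2 k) := fun k =>
    (contDiff_eval k).comp contDiff_snd
  -- The value at the corner `(1, 1)` of the unit square is the value of the solution at `ξ` itself.
  obtain ⟨a, ha, hae⟩ := exists_contDiff_eventuallyEq (f := fun ξ => (ψ ξ).1 (1, 1)) (x := 0)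
    (hψ3.mono fun ξ hξ => (hev1 (1, 1)).contDiffAt.comp ξ hξ)
  obtain ⟨b, hb, hbe⟩ := exists_contDiff_eventuallyEq (f := fun ξ => (ψ ξ).2 (1, 1)) (x := 0)
    (hψ3.mono fun ξ hξ => (hev2 (1, 1)).contDiffAt.comp ξ hξ)
  -- self-similarity of the rescaled solutions
  have hsc : ∀ᶠ ξ in 𝓝 (0 : Fin 2 → ℝ), ∀ k : USq,
      ψ (chartCLM ξ k) = (rescale k (ψ ξ).1, rescale k (ψ ξ).2) := by
    obtain ⟨δ, hδ, hball⟩ := Metric.eventually_nhds_iff_ball.1 hψ2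
    have hcont : ContinuousAt ψ 0 := hψ3.self_of_nhds.continuousAt
    have h4 : ∀ᶠ ξ in 𝓝 (0 : Fin 2 → ℝ), ψ ξ ∈ Metric.ball U δ := by
      have := hcont.eventually (Metric.ball_mem_nhds (ψ 0) hδ)
      rwa [hψ0] at this
    filter_upwards [h4, hψ1, Metric.ball_mem_nhds (0 : Fin 2 → ℝ) hδ] with ξ h5 h6 h7 k
    -- The rescaled solution stays in the uniqueness neighbourhood: the chart does not increase the
    -- norm of `ξ`, and since `U` is constant, rescaling does not increase the supremum distance to
    -- `U`.
    refine hball (chartCLM ξ k, rescale k (ψ ξ).1, rescale k (ψ ξ).2) ?_ ?_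
    · have hnorm : ‖chartCLM ξ k‖ ≤ ‖ξ‖ := by
        refine ((chartCLM ξ).norm_coe_le_norm k).trans ?_
        have := chartCLM.le_of_opNorm_le (LinearMap.mkContinuous_norm_le _ zero_le_one _) ξ
        simpa using this
      rw [Metric.mem_ball, dist_eq_norm] at h5 h7 ⊢
      rw [Prod.norm_def] at h5 ⊢
      simp only [Prod.fst_sub, Prod.snd_sub] at h5 ⊢
      rw [sub_zero] at h7 ⊢
      refine max_lt (hnorm.trans_lt h7) ?_
      rw [Prod.norm_def]
      refine lt_of_le_of_lt (max_le_max ?_ ?_) h5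
      · rw [ContinuousMap.norm_le _ (by positivity)]
        intro l
        exact ((ψ ξ).1 - U.1).norm_coe_le_norm (k.1 * l.1, k.2 * l.2)
      · rw [ContinuousMap.norm_le _ (by positivity)]
        intro l
        exact ((ψ ξ).2 - U.2).norm_coe_le_norm (k.1 * l.1, k.2 * l.2)
    · have h8 : ((ψ ξ).1, (ψ ξ).2) = (Fa (ξ, ψ ξ), Fb (ξ, ψ ξ)) := sub_eq_zero.1 h6
      simp only [Prod.mk.injEq] at h8
      simp only [f, hFa, hFb]
      rw [goursatPart_rescale 0 1 (by decide), goursatPart_rescale 1 0 (by decide), sub_eq_zero]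
      exact Prod.ext (congrArg (rescale k) h8.1) (congrArg (rescale k) h8.2)
  obtain ⟨δ, hδ, hall⟩ := Metric.eventually_nhds_iff_ball.1 ((hae.and hbe).and (hsc.and hψ1))
  have hmul : ∀ (c : ℝ) (s : unitInterval), |c| < δ → |c * s| < δ := fun c s hc => by
    rw [abs_mul, abs_of_nonneg s.2.1]
    exact (mul_le_of_le_one_right (abs_nonneg c) s.2.2).trans_lt hc
  refine ⟨a, b, ha, hb, δ, hδ, fun ξ hξ => ?_⟩
  have hmem : ∀ k : USq, chartCLM ξ k ∈ Metric.ball (0 : Fin 2 → ℝ) δ := by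
    intro k
    rw [mem_ball_zero_iff, pi_norm_lt_iff hδ] at hξ ⊢
    intro i
    fin_cases i
    · exact hmul _ _ (hξ 0)
    · exact hmul _ _ (hξ 1)
  -- Self-similarity identifies the whole function `ψ ξ` with the values of the corner functions
  -- `a`, `b` on the rectangle below `ξ`.
  have key : ∀ k : USq, a (chartCLM ξ k) = (ψ ξ).1 k ∧ b (chartCLM ξ k) = (ψ ξ).2 k := by
    intro k
    have h9 := hall _ (hmem k)
    have h10 := (hall _ hξ).2.1 k
    refine ⟨h9.1.1.trans ?_, h9.1.2.trans ?_⟩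
    · simp only [h10]; simp
    · simp only [h10]; simp
  have hξ1 : chartCLM ξ (1, 1) = ξ := by ext i; fin_cases i <;> simp
  have h11 := (hall _ hξ).2.2
  have h12 : ((ψ ξ).1, (ψ ξ).2) = (Fa (ξ, ψ ξ), Fb (ξ, ψ ξ)) := sub_eq_zero.1 h11
  simp only [Prod.mk.injEq] at h12
  constructor
  · have h13 := (key (1, 1)).1
    rw [hξ1] at h13
    rw [h13, h12.1]
    simp only [hFa, goursatPart, ContinuousMap.add_apply, ContinuousMap.smul_apply,
      superpos_apply, intCLM_zero_apply, pairCLM_apply]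
    congr 1
    · rw [hξ1]
    · simp only [one_mul, Icc.coe_one, one_smul]
      congr 2; funext θ
      rw [← (key (θ, 1)).1, ← (key (θ, 1)).2]
      simp
  · have h13 := (key (1, 1)).2
    rw [hξ1] at h13
    rw [h13, h12.2]
    simp only [hFb, goursatPart, ContinuousMap.add_apply, ContinuousMap.smul_apply,
      superpos_apply, intCLM_one_apply, pairCLM_apply]
    congr 1
    · rw [hξ1]
    · simp only [one_mul, Icc.coe_one, one_smul]
      congr 2; funext θ
      rw [← (key (1, θ)).1, ← (key (1, θ)).2]
      simp

theorem smul_integral_unitInterval_comp_mul [CompleteSpace V] (g : ℝ → V) (hg : Continuous g) (c : ℝ) :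
    c • ∫ θ : unitInterval, g (c * θ) = ∫ s in (0:ℝ)..c, g s := by
  have h := integralCLM_eq_intervalIntegral (fun θ : ℝ => g (c * θ)) (by fun_prop)
  rw [integralCLM_apply] at h
  simp only [ContinuousMap.coe_mk] at h
  rw [h, intervalIntegral.smul_integral_comp_mul_left]
  simp

/-- Local solvability of the smooth Goursat problem: `∂₀ a = F(ξ, a, b)`, `∂₁ b = G(ξ, a, b)` with
`a` prescribed on the axis `1` and `b` prescribed on the axis `0`. -/
theorem exists_goursat (F : (Fin 2 → ℝ) × P × Q → P) (hF : ContDiff ℝ ∞ F)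
    (G : (Fin 2 → ℝ) × P × Q → Q) (hG : ContDiff ℝ ∞ G)
    (A : ℝ → P) (hA : ContDiff ℝ ∞ A) (B : ℝ → Q) (hB : ContDiff ℝ ∞ B) :
    ∃ (a : (Fin 2 → ℝ) → P) (b : (Fin 2 → ℝ) → Q),
      ContDiff ℝ ∞ a ∧ ContDiff ℝ ∞ b ∧
      (∀ᶠ ξ in 𝓝 (0 : Fin 2 → ℝ), fderiv ℝ a ξ (Pi.single 0 1) = F (ξ, a ξ, b ξ) ∧
        fderiv ℝ b ξ (Pi.single 1 1) = G (ξ, a ξ, b ξ)) ∧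
      ∀ᶠ t in 𝓝 (0 : ℝ), a (Pi.single 1 t) = A t ∧ b (Pi.single 0 t) = B t := by
  obtain ⟨a, b, ha, hb, δ, hδ, h⟩ := exists_goursat_integral F hF G hG A hA B hB
  have hac := ha.continuous
  have hbc := hb.continuous
  have hFc := hF.continuous
  have hGc := hG.continuous
  refine ⟨a, b, ha, hb, ?_, ?_⟩
  · filter_upwards [Metric.ball_mem_nhds (0 : Fin 2 → ℝ) hδ] with ξ hξ
    constructor
    · let g : ℝ → P := fun s => F (![s, ξ 1], a ![s, ξ 1], b ![s, ξ 1])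
      have hg : Continuous g := by
        have : Continuous (fun s : ℝ => ![s, ξ 1]) := by
          refine continuous_pi fun i => ?_
          fin_cases i <;> simp <;> fun_prop
        fun_prop
      have hline : HasDerivAt (fun s : ℝ => (![s, ξ 1] : Fin 2 → ℝ)) (Pi.single 0 1) (ξ 0) := by
        rw [hasDerivAt_pi]
        intro i
        fin_cases i
        · simpa using hasDerivAt_id' (ξ 0)
        · simpa using hasDerivAt_const (ξ 0) (ξ 1)
      have hξe : ![ξ 0, ξ 1] = ξ := by ext i; fin_cases i <;> rfl
      have h1 : HasDerivAt (fun s : ℝ => a ![s, ξ 1]) (fderiv ℝ a ξ (Pi.single 0 1)) (ξ 0) := by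
        have h2 : HasFDerivAt a (fderiv ℝ a ξ) ![ξ 0, ξ 1] := by
          rw [hξe]; exact (ha.differentiable (by simp) ξ).hasFDerivAt
        exact h2.comp_hasDerivAt _ hline
      have h3 : HasDerivAt (fun s : ℝ => A (ξ 1) + ∫ x in (0:ℝ)..s, g x) (g (ξ 0)) (ξ 0) :=
        (intervalIntegral.integral_hasDerivAt_right (hg.intervalIntegrable _ _)
          (hg.stronglyMeasurableAtFilter _ _) hg.continuousAt).const_add _
      have h4 : (fun s : ℝ => a ![s, ξ 1]) =ᶠ[𝓝 (ξ 0)]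
          fun s : ℝ => A (ξ 1) + ∫ x in (0:ℝ)..s, g x := by
        have h5 : ∀ᶠ s in 𝓝 (ξ 0), ![s, ξ 1] ∈ Metric.ball (0 : Fin 2 → ℝ) δ := by
          apply hline.continuousAt.eventually
          simp only [hξe]
          exact Metric.isOpen_ball.mem_nhds hξ
        filter_upwards [h5] with s hs
        have := (h _ hs).1
        simp only [Matrix.cons_val_zero, Matrix.cons_val_one] at this
        rw [this, ← smul_integral_unitInterval_comp_mul g hg]
      rw [h1.unique (h3.congr_of_eventuallyEq h4)]
      simp only [g, hξe]
    · let g : ℝ → Q := fun s => G (![ξ 0, s], a ![ξ 0, s], b ![ξ 0, s])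
      have hg : Continuous g := by
        have : Continuous (fun s : ℝ => ![ξ 0, s]) := by
          refine continuous_pi fun i => ?_
          fin_cases i <;> simp <;> fun_prop
        fun_prop
      have hline : HasDerivAt (fun s : ℝ => (![ξ 0, s] : Fin 2 → ℝ)) (Pi.single 1 1) (ξ 1) := by
        rw [hasDerivAt_pi]
        intro i
        fin_cases i
        · simpa using hasDerivAt_const (ξ 1) (ξ 0)
        · simpa using hasDerivAt_id' (ξ 1)
      have hξe : ![ξ 0, ξ 1] = ξ := by ext i; fin_cases i <;> rfl
      have h1 : HasDerivAt (fun s : ℝ => b ![ξ 0, s]) (fderiv ℝ b ξ (Pi.single 1 1)) (ξ 1) := by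
        have h2 : HasFDerivAt b (fderiv ℝ b ξ) ![ξ 0, ξ 1] := by
          rw [hξe]; exact (hb.differentiable (by simp) ξ).hasFDerivAt
        exact h2.comp_hasDerivAt _ hline
      have h3 : HasDerivAt (fun s : ℝ => B (ξ 0) + ∫ x in (0:ℝ)..s, g x) (g (ξ 1)) (ξ 1) :=
        (intervalIntegral.integral_hasDerivAt_right (hg.intervalIntegrable _ _)
          (hg.stronglyMeasurableAtFilter _ _) hg.continuousAt).const_add _
      have h4 : (fun s : ℝ => b ![ξ 0, s]) =ᶠ[𝓝 (ξ 1)]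
          fun s : ℝ => B (ξ 0) + ∫ x in (0:ℝ)..s, g x := by
        have h5 : ∀ᶠ s in 𝓝 (ξ 1), ![ξ 0, s] ∈ Metric.ball (0 : Fin 2 → ℝ) δ := by
          apply hline.continuousAt.eventually
          simp only [hξe]
          exact Metric.isOpen_ball.mem_nhds hξ
        filter_upwards [h5] with s hs
        have := (h _ hs).2
        simp only [Matrix.cons_val_zero, Matrix.cons_val_one] at this
        rw [this, ← smul_integral_unitInterval_comp_mul g hg]
      rw [h1.unique (h3.congr_of_eventuallyEq h4)]
      simp only [g, hξe]
  · filter_upwards [Metric.ball_mem_nhds (0 : ℝ) hδ] with t ht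
    have hmem : ∀ i : Fin 2, (Pi.single i t : Fin 2 → ℝ) ∈ Metric.ball (0 : Fin 2 → ℝ) δ := by
      intro i
      rw [mem_ball_zero_iff] at ht ⊢
      rwa [Pi.norm_single]
    constructor
    · have := (h _ (hmem 1)).1
      simpa using this
    · have := (h _ (hmem 0)).2
      simpa using this

end Goursat


/-! ### Lattice boxes -/

theorem mem_latBox_iff {ε ρ : ℝ} (hε : 0 < ε) {n : Lat} : n ∈ latBox ε ρ ↔ ∀ i, ε * n i ≤ ρ :=
  ⟨fun h i => (h i).2, fun h i => ⟨by unfold pt; positivity, h i⟩⟩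

theorem sh_apply_self (i : Fin 2) (n : Lat) : sh i n i = n i + 1 := by simp [sh]

theorem sh_apply_of_ne {i j : Fin 2} (h : j ≠ i) (n : Lat) : sh i n j = n j := by simp [sh, h]

theorem sh_comm (i j : Fin 2) (n : Lat) : sh i (sh j n) = sh j (sh i n) := by
  simp only [sh]; abel

theorem pt_sh (ε : ℝ) (i : Fin 2) (n : Lat) : pt ε (sh i n) = pt ε n + ε • Pi.single i 1 := by
  ext j
  by_cases h : j = i
  · subst h; simp [pt]; ring
  · simp [pt, h]

theorem le_sh (i : Fin 2) (n : Lat) : n ≤ sh i n := le_self_add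

theorem latBox_of_le {ε ρ : ℝ} (hε : 0 < ε) {m n : Lat} (h : m ≤ n) (hn : n ∈ latBox ε ρ) :
    m ∈ latBox ε ρ := by
  rw [mem_latBox_iff hε] at hn ⊢
  intro i
  exact (mul_le_mul_of_nonneg_left (by exact_mod_cast h i) hε.le).trans (hn i)

theorem mem_of_sh_mem {ε ρ : ℝ} (hε : 0 < ε) {i : Fin 2} {n : Lat} (h : sh i n ∈ latBox ε ρ) :
    n ∈ latBox ε ρ := latBox_of_le hε (le_sh i n) h

theorem sh_mem_of_mem_sub {ε ρ : ℝ} (hε : 0 < ε) {n : Lat} (h : n ∈ latBox ε (ρ - ε))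
    (i : Fin 2) : sh i n ∈ latBox ε ρ := by
  rw [mem_latBox_iff hε] at h ⊢
  intro j
  have := h j
  by_cases hj : j = i
  · subst hj; rw [sh_apply_self]; push_cast; linarith
  · rw [sh_apply_of_ne hj]; linarith

theorem latBox_mono {ε ρ ρ' : ℝ} (h : ρ ≤ ρ') : latBox ε ρ ⊆ latBox ε ρ' :=
  fun _ hn i => ⟨(hn i).1, (hn i).2.trans h⟩

theorem exists_sh_of_ne_zero {n : Lat} {i : Fin 2} (h : n i ≠ 0) : ∃ m, n = sh i m := by
  refine ⟨n - Pi.single i 1, ?_⟩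
  ext j
  by_cases hj : j = i
  · subst hj; simp; omega
  · simp [hj]

theorem lat_eq_zero_or_sh (n : Lat) : n = 0 ∨ ∃ i m, n = sh i m := by
  by_cases h : n = 0
  · exact Or.inl h
  · obtain ⟨i, hi⟩ := Function.ne_iff.1 h
    exact Or.inr ⟨i, exists_sh_of_ne_zero hi⟩

/-- Induction over the lattice quadrant along arbitrary monotone paths. -/
theorem lat_induction {p : Lat → Prop} (h0 : p 0) (hs : ∀ i n, p n → p (sh i n)) (n : Lat) : p n := by
  have key : ∀ k : ℕ, ∀ n : Lat, n 0 + n 1 = k → p n := by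
    intro k
    induction k with
    | zero =>
      intro n hn
      have : n = 0 := by ext i; fin_cases i <;> simp <;> omega
      rwa [this]
    | succ k ih =>
      intro n hn
      rcases lat_eq_zero_or_sh n with rfl | ⟨i, m, rfl⟩
      · exact h0
      · refine hs i m (ih m ?_)
        fin_cases i <;> simp at hn <;> omega
  exact key _ n rfl

/-! ### Lattice Gronwall lemma -/

/-- A discrete Gronwall inequality on the lattice box. The a priori bound may be used in the
one-step estimate. -/
theorem lat_gronwall {ε ρ r M κ : ℝ} (hε : 0 < ε) (hρ : ρ ≤ r) (hM : 0 ≤ M) (hκ : 0 ≤ κ)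
    (T : Lat → ℝ)
    (h : ∀ n ∈ latBox ε ρ, T n ≤ M ∨ ∃ i m, n = sh i m ∧
      (T m ≤ M * Real.exp (4 * κ * r) → T n ≤ T m + ε * (κ * (T m + M)))) :
    ∀ n ∈ latBox ε ρ, T n ≤ M * Real.exp (4 * κ * r) := by
  -- A point of the box is reached in `n 0 + n 1` steps of length `ε`, of total length at most `2
  -- r`.
  have hb : ∀ n ∈ latBox ε ρ, M * Real.exp (2 * κ * (ε * (n 0 + n 1 : ℕ))) ≤
      M * Real.exp (4 * κ * r) := by
    intro n hn
    rw [mem_latBox_iff hε] at hn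
    refine mul_le_mul_of_nonneg_left (Real.exp_le_exp.2 ?_) hM
    have h0 := hn 0
    have h1 := hn 1
    push_cast
    nlinarith
  have key : ∀ k : ℕ, ∀ n ∈ latBox ε ρ, n 0 + n 1 = k →
      T n ≤ M * Real.exp (2 * κ * (ε * (n 0 + n 1 : ℕ))) := by
    intro k
    induction k with
    | zero =>
      intro n hn hk
      rcases h n hn with h1 | ⟨i, m, rfl, -⟩
      · simpa [hk] using h1
      · fin_cases i <;> simp at hk
    | succ k ih =>
      intro n hn hk
      rcases h n hn with h1 | ⟨i, m, rfl, h2⟩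
      · refine h1.trans (le_mul_of_one_le_right hM (Real.one_le_exp (by positivity)))
      · have hm := mem_of_sh_mem hε hn
        have hmk : m 0 + m 1 = k := by fin_cases i <;> simp at hk <;> omega
        have h3 := ih m hm hmk
        -- The a priori bound holds at the previous point by induction, so the conditional one-step
        -- estimate may be used.
        have h4 := h2 (h3.trans (hb m hm))
        rw [hmk] at h3
        rw [hk]
        set B := M * Real.exp (2 * κ * (ε * (k : ℕ))) with hB
        have hMB : M ≤ B := le_mul_of_one_le_right hM (Real.one_le_exp (by positivity))
        have h5 : M * Real.exp (2 * κ * (ε * (k + 1 : ℕ))) = B * Real.exp (2 * κ * ε) := by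
          rw [hB, mul_assoc M, ← Real.exp_add]; push_cast; ring_nf
        rw [h5]
        have h6 : 2 * κ * ε + 1 ≤ Real.exp (2 * κ * ε) := Real.add_one_le_exp _
        have hB0 : 0 ≤ B := hM.trans hMB
        calc T (sh i m) ≤ T m + ε * (κ * (T m + M)) := h4
          _ ≤ B + ε * (κ * (B + B)) := by gcongr
          _ = B * (2 * κ * ε + 1) := by ring
          _ ≤ _ := mul_le_mul_of_nonneg_left h6 hB0
  intro n hn
  exact (key _ n hn rfl).trans (hb n hn)

/-! ### Families of lattice functions with bounded differences -/

section Bounded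

variable {V W : Type} [NormedAddCommGroup V] [NormedSpace ℝ V]
  [NormedAddCommGroup W] [NormedSpace ℝ W]

/-- The family `u ε`, `0 < ε < ε₁`, of lattice functions on the boxes of size `ρ ε` has uniformly
bounded differences up to the order `l`. -/
@[reducible] def BddDiff (ε₁ : ℝ) : ℕ → (ℝ → ℝ) → (ℝ → Lat → V) → Prop
  | 0, ρ, u => ∃ C : ℝ, ∀ ε, 0 < ε → ε < ε₁ → ∀ n ∈ latBox ε (ρ ε), ‖u ε n‖ ≤ C
  | l + 1, ρ, u => (∃ C : ℝ, ∀ ε, 0 < ε → ε < ε₁ → ∀ n ∈ latBox ε (ρ ε), ‖u ε n‖ ≤ C) ∧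
      ∀ i, BddDiff ε₁ l (fun ε => ρ ε - ε) (fun ε => diff ε i (u ε))

variable {ε₁ : ℝ} {ρ ρ' : ℝ → ℝ} {u v : ℝ → Lat → V}

theorem BddDiff.congr {l : ℕ} : ∀ {ρ : ℝ → ℝ} {u v : ℝ → Lat → V}, BddDiff ε₁ l ρ u →
    (∀ ε, 0 < ε → ε < ε₁ → ∀ n ∈ latBox ε (ρ ε), v ε n = u ε n) → BddDiff ε₁ l ρ v := by
  induction l with
  | zero =>
    rintro ρ u v ⟨C, hC⟩ h
    exact ⟨C, fun ε h0 h1 n hn => by rw [h ε h0 h1 n hn]; exact hC ε h0 h1 n hn⟩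
  | succ l ih =>
    intro ρ u v hu h
    have h0 : BddDiff ε₁ 0 ρ v := by
      obtain ⟨C, hC⟩ := hu.1
      exact ⟨C, fun ε h0 h1 n hn => by rw [h ε h0 h1 n hn]; exact hC ε h0 h1 n hn⟩
    refine ⟨h0, fun i => ih (hu.2 i) fun ε h0 h1 n hn => ?_⟩
    have hs := sh_mem_of_mem_sub h0 hn i
    simp only [diff]
    rw [h ε h0 h1 _ hs, h ε h0 h1 _ (mem_of_sh_mem h0 hs)]

theorem BddDiff.mono_box {l : ℕ} : ∀ {ρ ρ' : ℝ → ℝ} {u : ℝ → Lat → V}, BddDiff ε₁ l ρ u →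
    (∀ ε, 0 < ε → ε < ε₁ → ρ' ε ≤ ρ ε) → BddDiff ε₁ l ρ' u := by
  induction l with
  | zero =>
    rintro ρ ρ' u ⟨C, hC⟩ h
    exact ⟨C, fun ε h0 h1 n hn => hC ε h0 h1 n (latBox_mono (h ε h0 h1) hn)⟩
  | succ l ih =>
    intro ρ ρ' u hu h
    obtain ⟨C, hC⟩ := hu.1
    exact ⟨⟨C, fun ε h0 h1 n hn => hC ε h0 h1 n (latBox_mono (h ε h0 h1) hn)⟩,
      fun i => ih (hu.2 i) fun ε h0 h1 => sub_le_sub_right (h ε h0 h1) ε⟩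

theorem BddDiff.shrink {l : ℕ} (h : BddDiff ε₁ l ρ u) : BddDiff ε₁ l (fun ε => ρ ε - ε) u :=
  h.mono_box fun ε h0 _ => by linarith

theorem BddDiff.of_succ {l : ℕ} : ∀ {ρ : ℝ → ℝ} {u : ℝ → Lat → V},
    BddDiff ε₁ (l + 1) ρ u → BddDiff ε₁ l ρ u := by
  induction l with
  | zero => intro ρ u h; exact h.1
  | succ l ih => intro ρ u h; exact ⟨h.1, fun i => ih (h.2 i)⟩

theorem diff_comm (ε : ℝ) (i j : Fin 2) (u : Lat → V) :
    diff ε i (diff ε j u) = diff ε j (diff ε i u) := by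
  funext n
  simp only [diff, sh_comm i j, ← smul_sub]
  congr 2; abel

theorem diff_prodMk (ε : ℝ) (i : Fin 2) (u : Lat → V) (v : Lat → W) (n : Lat) :
    diff ε i (fun n => (u n, v n)) n = (diff ε i u n, diff ε i v n) := rfl

theorem BddDiff.prodMk {l : ℕ} : ∀ {ρ : ℝ → ℝ} {u : ℝ → Lat → V} {v : ℝ → Lat → W},
    BddDiff ε₁ l ρ u → BddDiff ε₁ l ρ v → BddDiff ε₁ l ρ (fun ε n => (u ε n, v ε n)) := by
  induction l with
  | zero =>
    rintro ρ u v ⟨C, hC⟩ ⟨D, hD⟩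
    exact ⟨max C D, fun ε h0 h1 n hn => max_le_max (hC ε h0 h1 n hn) (hD ε h0 h1 n hn)⟩
  | succ l ih =>
    intro ρ u v hu hv
    obtain ⟨C, hC⟩ := hu.1
    obtain ⟨D, hD⟩ := hv.1
    exact ⟨⟨max C D, fun ε h0 h1 n hn => max_le_max (hC ε h0 h1 n hn) (hD ε h0 h1 n hn)⟩,
      fun i => ih (hu.2 i) (hv.2 i)⟩

theorem BddDiff.const {l : ℕ} (c : V) : ∀ {ρ : ℝ → ℝ}, BddDiff ε₁ l ρ (fun _ _ => c) := by
  induction l generalizing c with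
  | zero => exact ⟨‖c‖, fun _ _ _ _ _ => le_rfl⟩
  | succ l ih =>
    intro ρ
    refine ⟨⟨‖c‖, fun _ _ _ _ _ => le_rfl⟩, fun i => ?_⟩
    have : (fun ε => diff ε i (fun _ : Lat => c)) = fun _ _ => (0 : V) := by
      funext ε n; simp [diff]
    rw [this]
    exact ih 0

theorem BddDiff.pt {l : ℕ} {r : ℝ} (hρ : ∀ ε, 0 < ε → ε < ε₁ → ρ ε ≤ r) :
    BddDiff ε₁ l ρ pt := by
  have h0 : BddDiff ε₁ 0 ρ CSurf.pt := by
    refine ⟨|r|, fun ε h0 h1 n hn => (pi_norm_le_iff_of_nonneg (abs_nonneg r)).2 fun i => ?_⟩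
    rw [Real.norm_of_nonneg (hn i).1]
    exact ((hn i).2.trans (hρ ε h0 h1)).trans (le_abs_self r)
  cases l with
  | zero => exact h0
  | succ l =>
    refine ⟨h0, fun i => ?_⟩
    refine (BddDiff.const (Pi.single i 1)).congr fun ε h0 h1 n _ => ?_
    simp only [diff, pt_sh, add_sub_cancel_left, inv_smul_smul₀ h0.ne']

/-- Smooth functions of families with bounded differences have bounded differences. -/
theorem BddDiff.comp {l : ℕ} (hε₁ : ε₁ ≤ 1) : ∀ {V W : Type} [NormedAddCommGroup V]
    [NormedSpace ℝ V] [FiniteDimensional ℝ V] [NormedAddCommGroup W] [NormedSpace ℝ W]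
    [CompleteSpace W] {ρ : ℝ → ℝ} {u : ℝ → Lat → V} {F : ℝ × V → W}, ContDiff ℝ ∞ F →
    BddDiff ε₁ l ρ u → BddDiff ε₁ l ρ (fun ε n => F (ε, u ε n)) := by
  have base : ∀ {V W : Type} [NormedAddCommGroup V]
      [NormedSpace ℝ V] [FiniteDimensional ℝ V] [NormedAddCommGroup W] [NormedSpace ℝ W]
      {ρ : ℝ → ℝ} {u : ℝ → Lat → V} {F : ℝ × V → W}, ContDiff ℝ ∞ F →
      BddDiff ε₁ 0 ρ u → BddDiff ε₁ 0 ρ (fun ε n => F (ε, u ε n)) := by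
    intro V W _ _ _ _ _ ρ u F hF ⟨C, hC⟩
    have := FiniteDimensional.proper_real (ℝ × V)
    obtain ⟨D, hD⟩ := (isCompact_closedBall (0 : ℝ × V) (max 1 C)).exists_bound_of_continuousOn
      hF.continuous.continuousOn
    refine ⟨D, fun ε h0 h1 n hn => hD _ ?_⟩
    rw [mem_closedBall_zero_iff]
    refine max_le_max ?_ (hC ε h0 h1 n hn)
    simp only [Real.norm_of_nonneg h0.le]; linarith
  induction l with
  | zero => intro V W _ _ _ _ _ _ ρ u F hF hu; exact base hF hu
  | succ l ih =>
    intro V W _ _ _ _ _ _ ρ u F hF hu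
    refine ⟨base hF hu.1, fun i => ?_⟩
    have h1 : BddDiff ε₁ l (fun ε => ρ ε - ε) (fun ε n => (u ε n, diff ε i (u ε) n)) :=
      hu.of_succ.shrink.prodMk (hu.2 i)
    -- The difference of `F (ε, u)` is the Hadamard quotient of `F` at `u` in the direction of the
    -- difference of `u`: again a smooth function of a family, with one order less to control. The
    -- first component of the direction is zero because `ε` is not shifted.
    have h2 : ContDiff ℝ ∞ (fun p : ℝ × V × V =>
        hadamard F (p.1, (p.1, p.2.1), ((0 : ℝ), p.2.2))) :=
      (contDiff_hadamard hF).comp (by fun_prop)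
    refine (ih h2 h1).congr fun ε h0 h1 n hn => ?_
    simp only [diff]
    rw [hadamard_eq hF h0.ne']
    simp [smul_inv_smul₀ h0.ne']

theorem BddDiff.diffPow {l : ℕ} : ∀ {ρ : ℝ → ℝ} {u : ℝ → Lat → V} (α : Fin 2 → ℕ),
    α 0 + α 1 ≤ l → BddDiff ε₁ l ρ u →
    BddDiff ε₁ 0 (fun ε => ρ ε - ε * (α 0 + α 1 : ℕ)) (fun ε => diffPow ε α (u ε)) := by
  have key : ∀ (i : Fin 2) (k l : ℕ) {ρ : ℝ → ℝ} {u : ℝ → Lat → V}, BddDiff ε₁ (l + k) ρ u →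
      BddDiff ε₁ l (fun ε => ρ ε - ε * k) (fun ε => (diff ε i)^[k] (u ε)) := by
    intro i k
    induction k with
    | zero => intro l ρ u h; simpa using h
    | succ k ih =>
      intro l ρ u h
      have h1 := ih l ((show BddDiff ε₁ ((l + k) + 1) ρ u from h).2 i)
      simp only [Function.iterate_succ, Function.comp]
      refine h1.mono_box fun ε _ _ => le_of_eq ?_
      push_cast; ring
  have down : ∀ (k l : ℕ) {ρ : ℝ → ℝ} {u : ℝ → Lat → V}, BddDiff ε₁ (l + k) ρ u →
      BddDiff ε₁ l ρ u := by
    intro k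
    induction k with
    | zero => intro l ρ u h; exact h
    | succ k ih => intro l ρ u h; exact ih l (BddDiff.of_succ h)
  intro ρ u α hα h
  have h1 : BddDiff ε₁ ((0 + α 0) + α 1) ρ u := by
    obtain ⟨k, rfl⟩ := Nat.exists_eq_add_of_le hα
    rw [zero_add]
    exact down k _ h
  have h2 := key 0 (α 0) 0 (key 1 (α 1) (0 + α 0) h1)
  refine h2.mono_box fun ε _ _ => le_of_eq ?_
  push_cast; ring

end Bounded


/-! ### Regularity of bounded solutions of discrete Goursat problems -/

theorem exists_lipschitz_closedBall {V W : Type} [NormedAddCommGroup V] [NormedSpace ℝ V]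
    [FiniteDimensional ℝ V] [NormedAddCommGroup W] [NormedSpace ℝ W] {F : V → W}
    (hF : ContDiff ℝ ∞ F) (C : ℝ) :
    ∃ L, 0 ≤ L ∧ ∀ x y, ‖x‖ ≤ C → ‖y‖ ≤ C → ‖F x - F y‖ ≤ L * ‖x - y‖ := by
  have := FiniteDimensional.proper_real V
  obtain ⟨D, hD⟩ := (isCompact_closedBall (0 : V) C).exists_bound_of_continuousOn
    (hF.continuous_fderiv (by simp)).continuousOn
  refine ⟨max D 0, le_max_right _ _, fun x y hx hy => ?_⟩
  exact (convex_closedBall (0 : V) C).norm_image_sub_le_of_norm_fderiv_le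
    (fun z _ => hF.differentiable (by simp) z)
    (fun z hz => (hD z hz).trans (le_max_left _ _)) (by simpa using hy) (by simpa using hx)

section Regularity

variable {Z P Q : Type} [NormedAddCommGroup Z] [NormedSpace ℝ Z] [FiniteDimensional ℝ Z]
  [NormedAddCommGroup P] [NormedSpace ℝ P] [FiniteDimensional ℝ P]
  [NormedAddCommGroup Q] [NormedSpace ℝ Q] [FiniteDimensional ℝ Q]
  {ε₁ r : ℝ} {ρ : ℝ → ℝ}

/-- Differencing the scheme in the direction `j` gives a one-step scheme for `diff ε j a`, whose
right-hand side is smooth down to `ε = 0`. -/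
theorem diff_diff_eq_hadamard {F : ℝ × Z × P → P} (hF : ContDiff ℝ ∞ F) {ε ρ : ℝ} (hε : 0 < ε)
    {i j : Fin 2} {z : Lat → Z} {a : Lat → P}
    (ea : ∀ n, sh i n ∈ latBox ε ρ → diff ε i a n = F (ε, z n, a n))
    {n : Lat} (hn : sh i n ∈ latBox ε (ρ - ε)) :
    diff ε i (diff ε j a) n =
      hadamard F (ε, (ε, z n, a n), (0, diff ε j z n, diff ε j a n)) := by
  have h1 : sh i (sh j n) ∈ latBox ε ρ := by
    rw [sh_comm]; exact sh_mem_of_mem_sub hε hn j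
  have h2 : sh i n ∈ latBox ε ρ := latBox_mono (by linarith) hn
  rw [hadamard_eq hF hε.ne', diff_comm]
  conv_lhs => rw [diff]
  rw [ea _ h1, ea _ h2]
  simp [diff, smul_inv_smul₀ hε.ne']

/-- The equation bounds only the difference in its own direction `i`. The difference in the
direction `j` vanishes on the line `n i = 0` along with the data, and is transported from there in
the direction `i` by the differenced equation, so the Gronwall lemma applies. -/
theorem bddDiff_cross (hε₁ : ε₁ ≤ 1) {F : ℝ × Z × P → P} (hF : ContDiff ℝ ∞ F)
    (hρ : ∀ ε, 0 < ε → ε < ε₁ → ρ ε ≤ r) {i j : Fin 2} (hij : i ≠ j)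
    {z : ℝ → Lat → Z} {a : ℝ → Lat → P}
    (hz : BddDiff ε₁ 0 ρ z) (ha : BddDiff ε₁ 0 ρ a)
    (hdz : BddDiff ε₁ 0 (fun ε => ρ ε - ε) (fun ε => diff ε j (z ε)))
    (ea : ∀ ε, 0 < ε → ε < ε₁ → ∀ n, sh i n ∈ latBox ε (ρ ε) →
      diff ε i (a ε) n = F (ε, z ε n, a ε n))
    (da : ∀ ε, 0 < ε → ε < ε₁ → ∀ n ∈ latBox ε (ρ ε), n i = 0 → a ε n = 0) :
    BddDiff ε₁ 0 (fun ε => ρ ε - ε) (fun ε => diff ε j (a ε)) := by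
  obtain ⟨Cz, hCz⟩ := hz
  obtain ⟨Ca, hCa⟩ := ha
  obtain ⟨D, hD⟩ := hdz
  obtain ⟨L, hL, hLip⟩ := exists_lipschitz_closedBall hF (max 1 (max Cz Ca))
  refine ⟨max D 0 * Real.exp (4 * L * r), fun ε h0 h1 => ?_⟩
  have hball : ∀ n ∈ latBox ε (ρ ε), ‖(ε, z ε n, a ε n)‖ ≤ max 1 (max Cz Ca) := fun n hn =>
    max_le_max (by rw [Real.norm_of_nonneg h0.le]; linarith)
      (max_le_max (hCz ε h0 h1 n hn) (hCa ε h0 h1 n hn))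
  refine lat_gronwall h0 (r := r) (by linarith [hρ ε h0 h1]) (le_max_right _ _) hL _ ?_
  intro n hn
  have hsn := sh_mem_of_mem_sub h0 hn j
  by_cases hni : n i = 0
  · left
    have h2 : a ε (sh j n) = 0 := da ε h0 h1 _ hsn (by rw [sh_apply_of_ne hij, hni])
    have h3 : a ε n = 0 := da ε h0 h1 _ (mem_of_sh_mem h0 hsn) hni
    simp [diff, h2, h3]
  · right
    obtain ⟨m, rfl⟩ := exists_sh_of_ne_zero hni
    refine ⟨i, m, rfl, fun _ => ?_⟩
    have hm := mem_of_sh_mem h0 hn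
    have hmj := sh_mem_of_mem_sub h0 hm j
    have h4 := diff_diff_eq_hadamard (j := j) hF h0 (ea ε h0 h1) hn
    have h5 : ‖diff ε i (diff ε j (a ε)) m‖ ≤ L * (‖diff ε j (a ε) m‖ + max D 0) := by
      have h6 : ((ε, z ε m, a ε m) : ℝ × Z × P) + ε • (0, diff ε j (z ε) m, diff ε j (a ε) m) =
          (ε, z ε (sh j m), a ε (sh j m)) := by
        simp [diff, smul_inv_smul₀ h0.ne']
      have h7 := hLip _ _ (hball _ hmj) (hball _ (mem_of_sh_mem h0 hmj))
      rw [← h6, add_sub_cancel_left, ← smul_hadamard hF, norm_smul, norm_smul,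
        Real.norm_of_nonneg h0.le, mul_left_comm] at h7
      have h8 := le_of_mul_le_mul_left h7 h0
      rw [h4]
      refine h8.trans (mul_le_mul_of_nonneg_left ?_ hL)
      have h9 := hD ε h0 h1 m hm
      rw [Prod.norm_def, Prod.norm_def]
      simp only [norm_zero]
      have := norm_nonneg (diff ε j (a ε) m)
      refine max_le (by positivity) (max_le ?_ ?_)
      · exact h9.trans ((le_max_left _ _).trans (by linarith))
      · linarith [le_max_right D 0]
    have h10 : diff ε j (a ε) (sh i m) = diff ε j (a ε) m + ε • diff ε i (diff ε j (a ε)) m := by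
      simp [diff, smul_inv_smul₀ h0.ne']
    beta_reduce
    rw [h10]
    refine (norm_add_le _ _).trans ?_
    rw [norm_smul, Real.norm_of_nonneg h0.le]
    gcongr

/-- Bounded solutions of discrete Goursat problems with smooth right-hand sides, coefficients with
bounded differences and zero data have bounded differences of all orders. -/
theorem bddDiff_of_goursat (hε₁ : ε₁ ≤ 1) (l : ℕ) : ∀ {Z P Q : Type}
    [NormedAddCommGroup Z] [NormedSpace ℝ Z] [FiniteDimensional ℝ Z]
    [NormedAddCommGroup P] [NormedSpace ℝ P] [FiniteDimensional ℝ P]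
    [NormedAddCommGroup Q] [NormedSpace ℝ Q] [FiniteDimensional ℝ Q]
    {F : ℝ × Z × P × Q → P} {G : ℝ × Z × P × Q → Q}, ContDiff ℝ ∞ F → ContDiff ℝ ∞ G →
    ∀ {ρ : ℝ → ℝ}, (∀ ε, 0 < ε → ε < ε₁ → ρ ε ≤ r) →
    ∀ {z : ℝ → Lat → Z} {a : ℝ → Lat → P} {b : ℝ → Lat → Q},
    (∀ k, BddDiff ε₁ k ρ z) → BddDiff ε₁ 0 ρ a → BddDiff ε₁ 0 ρ b →
    (∀ ε, 0 < ε → ε < ε₁ → ∀ n, sh 0 n ∈ latBox ε (ρ ε) →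
      diff ε 0 (a ε) n = F (ε, z ε n, a ε n, b ε n)) →
    (∀ ε, 0 < ε → ε < ε₁ → ∀ n, sh 1 n ∈ latBox ε (ρ ε) →
      diff ε 1 (b ε) n = G (ε, z ε n, a ε n, b ε n)) →
    (∀ ε, 0 < ε → ε < ε₁ → ∀ n ∈ latBox ε (ρ ε), n 0 = 0 → a ε n = 0) →
    (∀ ε, 0 < ε → ε < ε₁ → ∀ n ∈ latBox ε (ρ ε), n 1 = 0 → b ε n = 0) →
    BddDiff ε₁ l ρ a ∧ BddDiff ε₁ l ρ b := by
  induction l with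
  | zero => intros; exact ⟨‹_›, ‹_›⟩
  | succ l ih =>
    intro Z P Q _ _ _ _ _ _ _ _ _ F G hF hG ρ hρ z a b hz ha hb ea eb da db
    let F' : ℝ × (Z × Q) × P → P := fun p => F (p.1, p.2.1.1, p.2.2, p.2.1.2)
    let G' : ℝ × (Z × P) × Q → Q := fun p => G (p.1, p.2.1.1, p.2.1.2, p.2.2)
    have hF' : ContDiff ℝ ∞ F' := hF.comp (by fun_prop)
    have hG' : ContDiff ℝ ∞ G' := hG.comp (by fun_prop)
    have hFc : ∀ {k : ℕ} {ρ' : ℝ → ℝ}, BddDiff ε₁ k ρ' z → BddDiff ε₁ k ρ' a →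
        BddDiff ε₁ k ρ' b → BddDiff ε₁ k ρ' (fun ε n => F (ε, z ε n, a ε n, b ε n)) :=
      fun h1 h2 h3 => BddDiff.comp hε₁ hF (h1.prodMk (h2.prodMk h3))
    have hGc : ∀ {k : ℕ} {ρ' : ℝ → ℝ}, BddDiff ε₁ k ρ' z → BddDiff ε₁ k ρ' a →
        BddDiff ε₁ k ρ' b → BddDiff ε₁ k ρ' (fun ε n => G (ε, z ε n, a ε n, b ε n)) :=
      fun h1 h2 h3 => BddDiff.comp hε₁ hG (h1.prodMk (h2.prodMk h3))
    have ea' : ∀ ε, 0 < ε → ε < ε₁ → ∀ n ∈ latBox ε (ρ ε - ε),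
        diff ε 0 (a ε) n = F (ε, z ε n, a ε n, b ε n) := fun ε h0 h1 n hn =>
      ea ε h0 h1 n (sh_mem_of_mem_sub h0 hn 0)
    have eb' : ∀ ε, 0 < ε → ε < ε₁ → ∀ n ∈ latBox ε (ρ ε - ε),
        diff ε 1 (b ε) n = G (ε, z ε n, a ε n, b ε n) := fun ε h0 h1 n hn =>
      eb ε h0 h1 n (sh_mem_of_mem_sub h0 hn 1)
    have hda : BddDiff ε₁ 0 (fun ε => ρ ε - ε) (fun ε => diff ε 0 (a ε)) :=
      (hFc (hz 0).shrink ha.shrink hb.shrink).congr ea'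
    have hdb : BddDiff ε₁ 0 (fun ε => ρ ε - ε) (fun ε => diff ε 1 (b ε)) :=
      (hGc (hz 0).shrink ha.shrink hb.shrink).congr eb'
    have hp : BddDiff ε₁ 0 (fun ε => ρ ε - ε) (fun ε => diff ε 1 (a ε)) :=
      bddDiff_cross hε₁ hF' hρ (by decide) (z := fun ε n => (z ε n, b ε n))
        ((hz 0).prodMk hb) ha (((hz 1).2 1).prodMk hdb) ea da
    have hq : BddDiff ε₁ 0 (fun ε => ρ ε - ε) (fun ε => diff ε 0 (b ε)) :=
      bddDiff_cross hε₁ hG' hρ (by decide) (z := fun ε n => (z ε n, a ε n))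
        ((hz 0).prodMk ha) hb (((hz 1).2 0).prodMk hda) eb db
    -- The pairs `(a, δ₁ a)` and `(b, δ₀ b)` solve a Goursat problem of the same type, with
    -- coefficients `z` and its first differences. The other differences `δ₁ b` and `δ₀ a` that
    -- appear are replaced by `G` and `F`, so the system closes and the induction hypothesis applies
    -- to it.
    let F₂ : ℝ × (Z × Z × Z) × (P × P) × (Q × Q) → P × P := fun p =>
      (F (p.1, p.2.1.1, p.2.2.1.1, p.2.2.2.1),
        hadamard F' (p.1, (p.1, (p.2.1.1, p.2.2.2.1), p.2.2.1.1),
          ((0 : ℝ), (p.2.1.2.2, G (p.1, p.2.1.1, p.2.2.1.1, p.2.2.2.1)), p.2.2.1.2)))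
    let G₂ : ℝ × (Z × Z × Z) × (P × P) × (Q × Q) → Q × Q := fun p =>
      (G (p.1, p.2.1.1, p.2.2.1.1, p.2.2.2.1),
        hadamard G' (p.1, (p.1, (p.2.1.1, p.2.2.1.1), p.2.2.2.1),
          ((0 : ℝ), (p.2.1.2.1, F (p.1, p.2.1.1, p.2.2.1.1, p.2.2.2.1)), p.2.2.2.2)))
    have hF₂ : ContDiff ℝ ∞ F₂ :=
      (hF.comp (by fun_prop)).prodMk ((contDiff_hadamard hF').comp (by fun_prop))
    have hG₂ : ContDiff ℝ ∞ G₂ :=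
      (hG.comp (by fun_prop)).prodMk ((contDiff_hadamard hG').comp (by fun_prop))
    have main := ih hF₂ hG₂ (ρ := fun ε => ρ ε - ε)
      (fun ε h0 h1 => by linarith [hρ ε h0 h1])
      (z := fun ε n => (z ε n, diff ε 0 (z ε) n, diff ε 1 (z ε) n))
      (a := fun ε n => (a ε n, diff ε 1 (a ε) n))
      (b := fun ε n => (b ε n, diff ε 0 (b ε) n))
      (fun k => (hz k).shrink.prodMk (((hz (k + 1)).2 0).prodMk ((hz (k + 1)).2 1)))
      (ha.shrink.prodMk hp) (hb.shrink.prodMk hq)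
      (fun ε h0 h1 n hn => by
        have hn' : sh 0 n ∈ latBox ε (ρ ε) := latBox_mono (by linarith) hn
        have h2 := diff_diff_eq_hadamard (j := 1) hF' h0 (z := fun n => (z ε n, b ε n))
          (ea ε h0 h1) hn
        refine Prod.ext (ea ε h0 h1 n hn') ?_
        change diff ε 0 (diff ε 1 (a ε)) n = _
        rw [h2]
        simp only [F₂, diff_prodMk]
        rw [eb' ε h0 h1 n (mem_of_sh_mem h0 hn)])
      (fun ε h0 h1 n hn => by
        have hn' : sh 1 n ∈ latBox ε (ρ ε) := latBox_mono (by linarith) hn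
        have h2 := diff_diff_eq_hadamard (j := 0) hG' h0 (z := fun n => (z ε n, a ε n))
          (eb ε h0 h1) hn
        refine Prod.ext (eb ε h0 h1 n hn') ?_
        change diff ε 1 (diff ε 0 (b ε)) n = _
        rw [h2]
        simp only [G₂, diff_prodMk]
        rw [ea' ε h0 h1 n (mem_of_sh_mem h0 hn)])
      (fun ε h0 h1 n hn hn0 => by
        have hs := sh_mem_of_mem_sub h0 hn 1
        have h2 := da ε h0 h1 n (mem_of_sh_mem h0 hs) hn0
        have h3 := da ε h0 h1 _ hs (by rw [sh_apply_of_ne (by decide), hn0])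
        simp [diff, h2, h3])
      (fun ε h0 h1 n hn hn0 => by
        have hs := sh_mem_of_mem_sub h0 hn 0
        have h2 := db ε h0 h1 n (mem_of_sh_mem h0 hs) hn0
        have h3 := db ε h0 h1 _ hs (by rw [sh_apply_of_ne (by decide), hn0])
        simp [diff, h2, h3])
    have hfst : ∀ {X Y : Type} [NormedAddCommGroup X] [NormedSpace ℝ X] [FiniteDimensional ℝ X]
        [NormedAddCommGroup Y] [NormedSpace ℝ Y] [FiniteDimensional ℝ Y] {ρ : ℝ → ℝ}
        {u : ℝ → Lat → X × Y}, BddDiff ε₁ l ρ u →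
        BddDiff ε₁ l ρ (fun ε n => (u ε n).1) ∧ BddDiff ε₁ l ρ (fun ε n => (u ε n).2) := by
      intro X Y _ _ _ _ _ _ ρ u h
      have := FiniteDimensional.complete ℝ X
      have := FiniteDimensional.complete ℝ Y
      exact ⟨BddDiff.comp hε₁ (F := fun p : ℝ × X × Y => p.2.1) (by fun_prop) h,
        BddDiff.comp hε₁ (F := fun p : ℝ × X × Y => p.2.2) (by fun_prop) h⟩
    obtain ⟨h1, h2⟩ := hfst main.1
    obtain ⟨h3, h4⟩ := hfst main.2
    refine ⟨⟨ha, fun i => ?_⟩, ⟨hb, fun i => ?_⟩⟩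
    · fin_cases i
      · exact (hFc (hz l).shrink h1 h3).congr ea'
      · exact h2
    · fin_cases i
      · exact h4
      · exact (hGc (hz l).shrink h1 h3).congr eb'

end Regularity


/-! ### Convergence of discrete Goursat problems -/

theorem BddDiff.mono_eps {V : Type} [NormedAddCommGroup V] [NormedSpace ℝ V] {ε₁ ε₂ : ℝ}
    (h : ε₂ ≤ ε₁) {l : ℕ} : ∀ {ρ : ℝ → ℝ} {u : ℝ → Lat → V}, BddDiff ε₁ l ρ u →
    BddDiff ε₂ l ρ u := by
  induction l with
  | zero =>
    rintro ρ u ⟨C, hC⟩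
    exact ⟨C, fun ε h0 h1 => hC ε h0 (h1.trans_le h)⟩
  | succ l ih =>
    rintro ρ u ⟨⟨C, hC⟩, hu⟩
    exact ⟨⟨C, fun ε h0 h1 => hC ε h0 (h1.trans_le h)⟩, fun i => ih (hu i)⟩

section Convergence

variable {V P Q Y : Type} [NormedAddCommGroup V] [NormedSpace ℝ V] [FiniteDimensional ℝ V]
  [NormedAddCommGroup P] [NormedSpace ℝ P] [FiniteDimensional ℝ P]
  [NormedAddCommGroup Q] [NormedSpace ℝ Q] [FiniteDimensional ℝ Q]
  [NormedAddCommGroup Y] [NormedSpace ℝ Y] [FiniteDimensional ℝ Y]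

/-- The consistency error of a one-step scheme is `ε` times a smooth function. -/
theorem exists_smooth_residual {f : (Fin 2 → ℝ) → V} (hf : ContDiff ℝ ∞ f)
    {E : ℝ × (Fin 2 → ℝ) → V} (hE : ContDiff ℝ ∞ E) (r : ℝ) (i : Fin 2)
    (h : ∀ ξ ∈ box r, fderiv ℝ f ξ (Pi.single i 1) = E (0, ξ)) :
    ∃ R : ℝ × (Fin 2 → ℝ) → V, ContDiff ℝ ∞ R ∧ ∀ ε, 0 < ε → ∀ n ∈ latBox ε r,
      E (ε, pt ε n) - diff ε i (fun n => f (pt ε n)) n = ε • R (ε, pt ε n) := by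
  have := FiniteDimensional.complete ℝ V
  -- `D` is the consistency error as a function of `(ε, ξ)`. It vanishes at `ε = 0` on the box, so a
  -- second Hadamard quotient, now in the variable `ε`, divides it by `ε`.
  let D : ℝ × (Fin 2 → ℝ) → V := fun p => E p - hadamard f (p.1, p.2, Pi.single i 1)
  have hD : ContDiff ℝ ∞ D := hE.sub ((contDiff_hadamard hf).comp (by fun_prop))
  refine ⟨fun p => hadamard D (p.1, ((0 : ℝ), p.2), ((1 : ℝ), (0 : Fin 2 → ℝ))),
    (contDiff_hadamard hD).comp (by fun_prop), fun ε hε n hn => ?_⟩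
  rw [smul_hadamard hD]
  have h0 : D (0, pt ε n) = 0 := by
    simp only [D, hadamard_zero, h _ hn, sub_self]
  have h1 : ((0 : ℝ), pt ε n) + ε • ((1 : ℝ), (0 : Fin 2 → ℝ)) = (ε, pt ε n) := by simp
  rw [h1, h0, sub_zero]
  simp only [D, diff, pt_sh]
  rw [hadamard_eq hf hε.ne']

/-- The scaled error of a one-step scheme satisfies a one-step scheme. -/
theorem diff_scaled_error {X : Type} [NormedAddCommGroup X] [NormedSpace ℝ X]
    {F : X → V} (hF : ContDiff ℝ ∞ F) {f : (Fin 2 → ℝ) → V} {ε : ℝ} (hε : 0 < ε) {i : Fin 2}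
    {u : Lat → V} {n : Lat} {x w : X} {R : V}
    (hR : F x - diff ε i (fun n => f (pt ε n)) n = ε • R)
    (hu : diff ε i u n = F (x + ε • w)) :
    diff ε i (fun n => ε⁻¹ • (u n - f (pt ε n))) n = hadamard F (ε, x, w) + R := by
  have := FiniteDimensional.complete ℝ V
  have h1 : diff ε i (fun n => ε⁻¹ • (u n - f (pt ε n))) n =
      ε⁻¹ • (diff ε i u n - diff ε i (fun n => f (pt ε n)) n) := by
    simp only [diff, ← smul_sub]
    congr 2; abel
  rw [h1, hadamard_eq hF hε.ne', hu]
  have h2 : R = ε⁻¹ • (F x - diff ε i (fun n => f (pt ε n)) n) := by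
    rw [hR, inv_smul_smul₀ hε.ne']
  rw [h2, ← smul_add]
  congr 1; abel

theorem norm_hadamard_le {X : Type} [NormedAddCommGroup X] [NormedSpace ℝ X]
    {F : X → V} (hF : ContDiff ℝ ∞ F) {L C : ℝ}
    (hL : ∀ x y, ‖x‖ ≤ C → ‖y‖ ≤ C → ‖F x - F y‖ ≤ L * ‖x - y‖) {ε : ℝ} (hε : 0 < ε) {x w : X}
    (hx : ‖x‖ ≤ C) (hw : ‖x + ε • w‖ ≤ C) : ‖hadamard F (ε, x, w)‖ ≤ L * ‖w‖ := by
  have := FiniteDimensional.complete ℝ V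
  have h7 := hL _ _ hw hx
  rw [add_sub_cancel_left, ← smul_hadamard hF, norm_smul, norm_smul,
    Real.norm_of_nonneg hε.le, mul_left_comm] at h7
  exact le_of_mul_le_mul_left h7 hε

theorem exists_bound_box {W : Type} [NormedAddCommGroup W] (r : ℝ) {g : (Fin 2 → ℝ) → W}
    (hg : Continuous g) : ∃ C, 0 ≤ C ∧ ∀ ξ ∈ box r, ‖g ξ‖ ≤ C := by
  obtain ⟨C, hC⟩ := (isCompact_closedBall (0 : Fin 2 → ℝ) |r|).exists_bound_of_continuousOn
    hg.continuousOn
  refine ⟨max C 0, le_max_right _ _, fun ξ hξ => (hC ξ ?_).trans (le_max_left _ _)⟩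
  rw [mem_closedBall_zero_iff, pi_norm_le_iff_of_nonneg (abs_nonneg r)]
  intro i
  rw [Real.norm_of_nonneg (hξ i).1]
  exact (hξ i).2.trans (le_abs_self r)

theorem exists_bound_box_eps {W : Type} [NormedAddCommGroup W] (r : ℝ)
    {g : ℝ × (Fin 2 → ℝ) → W} (hg : Continuous g) :
    ∃ C, 0 ≤ C ∧ ∀ ε, 0 ≤ ε → ε ≤ 1 → ∀ ξ ∈ box r, ‖g (ε, ξ)‖ ≤ C := by
  obtain ⟨C, hC⟩ := ((isCompact_Icc (a := (0:ℝ)) (b := 1)).prod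
    (isCompact_closedBall (0 : Fin 2 → ℝ) |r|)).exists_bound_of_continuousOn hg.continuousOn
  refine ⟨max C 0, le_max_right _ _, fun ε h0 h1 ξ hξ => (hC _ ⟨⟨h0, h1⟩, ?_⟩).trans
    (le_max_left _ _)⟩
  rw [mem_closedBall_zero_iff, pi_norm_le_iff_of_nonneg (abs_nonneg r)]
  intro i
  rw [Real.norm_of_nonneg (hξ i).1]
  exact (hξ i).2.trans (le_abs_self r)

/-- Solutions of a discrete Goursat problem which is consistent with a smooth one converge to the
smooth solution, with scaled errors whose differences of all orders are bounded. -/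
theorem discrete_goursat_converges {F : ℝ × (Fin 2 → ℝ) × P × Q → P}
    {G : ℝ × (Fin 2 → ℝ) × P × Q → Q} (hF : ContDiff ℝ ∞ F) (hG : ContDiff ℝ ∞ G)
    {fa : (Fin 2 → ℝ) → P} {fb : (Fin 2 → ℝ) → Q} (hfa : ContDiff ℝ ∞ fa) (hfb : ContDiff ℝ ∞ fb)
    {r : ℝ}
    (efa : ∀ ξ ∈ box r, fderiv ℝ fa ξ (Pi.single 0 1) = F (0, ξ, fa ξ, fb ξ))
    (efb : ∀ ξ ∈ box r, fderiv ℝ fb ξ (Pi.single 1 1) = G (0, ξ, fa ξ, fb ξ)) :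
    ∃ ε₀ C : ℝ, 0 < ε₀ ∧ ε₀ ≤ 1 ∧ ∀ ε₁ ≤ ε₀, ∀ (a : ℝ → Lat → P) (b : ℝ → Lat → Q),
      (∀ ε, 0 < ε → ε < ε₁ → ∀ n, sh 0 n ∈ latBox ε r →
        diff ε 0 (a ε) n = F (ε, pt ε n, a ε n, b ε n)) →
      (∀ ε, 0 < ε → ε < ε₁ → ∀ n, sh 1 n ∈ latBox ε r →
        diff ε 1 (b ε) n = G (ε, pt ε n, a ε n, b ε n)) →
      (∀ ε, 0 < ε → ε < ε₁ → ∀ n ∈ latBox ε r, n 0 = 0 → a ε n = fa (pt ε n)) →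
      (∀ ε, 0 < ε → ε < ε₁ → ∀ n ∈ latBox ε r, n 1 = 0 → b ε n = fb (pt ε n)) →
      (∀ ε, 0 < ε → ε < ε₁ → ∀ n ∈ latBox ε r, ‖a ε n‖ ≤ C ∧ ‖b ε n‖ ≤ C) ∧
      ∀ l, BddDiff ε₁ l (fun _ => r) (fun ε n => ε⁻¹ • (a ε n - fa (pt ε n))) ∧
        BddDiff ε₁ l (fun _ => r) (fun ε n => ε⁻¹ • (b ε n - fb (pt ε n))) := by
  have := FiniteDimensional.complete ℝ P
  have := FiniteDimensional.complete ℝ Q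
  obtain ⟨Ra, hRa, hRa'⟩ := exists_smooth_residual hfa
    (E := fun p : ℝ × (Fin 2 → ℝ) => F (p.1, p.2, fa p.2, fb p.2))
    (hF.comp (by fun_prop)) r 0 efa
  obtain ⟨Rb, hRb, hRb'⟩ := exists_smooth_residual hfb
    (E := fun p : ℝ × (Fin 2 → ℝ) => G (p.1, p.2, fa p.2, fb p.2))
    (hG.comp (by fun_prop)) r 1 efb
  obtain ⟨Cf, hCf0, hCf⟩ := exists_bound_box_eps r
    (g := fun p : ℝ × (Fin 2 → ℝ) => (p.1, p.2, fa p.2, fb p.2))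
    (by have := hfa.continuous; have := hfb.continuous; fun_prop)
  obtain ⟨M, hM0, hM⟩ := exists_bound_box_eps r (g := fun p => (Ra p, Rb p))
    (by have := hRa.continuous; have := hRb.continuous; fun_prop)
  obtain ⟨L, hL0, hL⟩ := exists_lipschitz_closedBall (hF.prodMk hG) (Cf + 1)
  -- Taking `κ ≥ 1` lets `κ * (T + M)` absorb both the Lipschitz term and the residual.
  set κ := max L 1 with hκ
  have hκ0 : 0 ≤ κ := hL0.trans (le_max_left _ _)
  set K := M * Real.exp (4 * κ * r) with hK
  have hK0 : 0 ≤ K := by positivity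
  -- This mesh bound gives `ε * K ≤ 1`: while the scaled error stays below the Gronwall bound `K`,
  -- the discrete solution is within distance `1` of the smooth one, hence in the ball where `L` is
  -- a Lipschitz constant.
  have hε₀ : 0 < min 1 (1 / (K + 1)) := lt_min one_pos (by positivity)
  refine ⟨min 1 (1 / (K + 1)), Cf + 1, hε₀, min_le_left _ _, ?_⟩
  intro ε₁ hε₁ a b ea eb da db
  have hε₁1 : ε₁ ≤ 1 := hε₁.trans (min_le_left _ _)
  have hεK : ∀ ε, 0 < ε → ε < ε₁ → ε * K ≤ 1 := fun ε h0 h1 => by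
    have h2 : ε ≤ 1 / (K + 1) := h1.le.trans (hε₁.trans (min_le_right _ _))
    rw [le_div_iff₀ (by positivity)] at h2
    nlinarith
  let Wa : ℝ → Lat → P := fun ε n => ε⁻¹ • (a ε n - fa (pt ε n))
  let Wb : ℝ → Lat → Q := fun ε n => ε⁻¹ • (b ε n - fb (pt ε n))
  let x : ℝ → Lat → ℝ × (Fin 2 → ℝ) × P × Q := fun ε n => (ε, pt ε n, fa (pt ε n), fb (pt ε n))
  have hx : ∀ ε, 0 < ε → ∀ n, x ε n + ε • (0, 0, Wa ε n, Wb ε n) =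
      (ε, pt ε n, a ε n, b ε n) := fun ε h0 n => by
    simp [x, Wa, Wb, smul_inv_smul₀ h0.ne']
  have eWa : ∀ ε, 0 < ε → ε < ε₁ → ∀ n, sh 0 n ∈ latBox ε r → diff ε 0 (Wa ε) n =
      hadamard F (ε, x ε n, (0, 0, Wa ε n, Wb ε n)) + Ra (ε, pt ε n) := fun ε h0 h1 n hn =>
    diff_scaled_error hF h0 (hRa' ε h0 n (mem_of_sh_mem h0 hn))
      (by rw [hx ε h0]; exact ea ε h0 h1 n hn)
  have eWb : ∀ ε, 0 < ε → ε < ε₁ → ∀ n, sh 1 n ∈ latBox ε r → diff ε 1 (Wb ε) n =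
      hadamard G (ε, x ε n, (0, 0, Wa ε n, Wb ε n)) + Rb (ε, pt ε n) := fun ε h0 h1 n hn =>
    diff_scaled_error hG h0 (hRb' ε h0 n (mem_of_sh_mem h0 hn))
      (by rw [hx ε h0]; exact eb ε h0 h1 n hn)
  have dWa : ∀ ε, 0 < ε → ε < ε₁ → ∀ n ∈ latBox ε r, n 0 = 0 → Wa ε n = 0 :=
    fun ε h0 h1 n hn hn0 => by simp [Wa, da ε h0 h1 n hn hn0]
  have dWb : ∀ ε, 0 < ε → ε < ε₁ → ∀ n ∈ latBox ε r, n 1 = 0 → Wb ε n = 0 :=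
    fun ε h0 h1 n hn hn0 => by simp [Wb, db ε h0 h1 n hn hn0]
  have hxC : ∀ ε, 0 < ε → ε < ε₁ → ∀ n ∈ latBox ε r, ‖x ε n‖ ≤ Cf := fun ε h0 h1 n hn =>
    hCf ε h0.le (h1.le.trans hε₁1) _ hn
  have hnear : ∀ ε, 0 < ε → ε < ε₁ → ∀ n ∈ latBox ε r, ‖(Wa ε n, Wb ε n)‖ ≤ K →
      ‖(ε, pt ε n, a ε n, b ε n)‖ ≤ Cf + 1 := by
    intro ε h0 h1 n hn hW
    rw [← hx ε h0]
    refine (norm_add_le _ _).trans (add_le_add (hxC ε h0 h1 n hn) ?_)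
    have h2 : ‖((0 : ℝ), (0 : Fin 2 → ℝ), Wa ε n, Wb ε n)‖ = ‖(Wa ε n, Wb ε n)‖ := by
      rw [Prod.norm_mk, Prod.norm_mk, norm_zero, norm_zero, max_eq_right, max_eq_right] <;>
        positivity
    rw [norm_smul, h2, Real.norm_of_nonneg h0.le]
    exact (mul_le_mul_of_nonneg_left hW h0.le).trans (hεK ε h0 h1)
  have hbound : ∀ ε, 0 < ε → ε < ε₁ → ∀ n ∈ latBox ε r, ‖(Wa ε n, Wb ε n)‖ ≤ K := by
    intro ε h0 h1
    refine lat_gronwall h0 le_rfl hM0 hκ0 (fun n => ‖(Wa ε n, Wb ε n)‖) ?_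
    have step : ∀ m, m ∈ latBox ε r → ‖(Wa ε m, Wb ε m)‖ ≤ K →
        ‖(hadamard F (ε, x ε m, (0, 0, Wa ε m, Wb ε m)) + Ra (ε, pt ε m))‖ ≤
          κ * (‖(Wa ε m, Wb ε m)‖ + M) ∧
        ‖(hadamard G (ε, x ε m, (0, 0, Wa ε m, Wb ε m)) + Rb (ε, pt ε m))‖ ≤
          κ * (‖(Wa ε m, Wb ε m)‖ + M) := by
      intro m hm hW
      have h2 : ‖((0 : ℝ), (0 : Fin 2 → ℝ), Wa ε m, Wb ε m)‖ = ‖(Wa ε m, Wb ε m)‖ := by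
        rw [Prod.norm_mk, Prod.norm_mk, norm_zero, norm_zero, max_eq_right, max_eq_right] <;>
          positivity
      have h3 : ‖x ε m‖ ≤ Cf + 1 := (hxC ε h0 h1 m hm).trans (by linarith)
      have h4 : ‖x ε m + ε • (0, 0, Wa ε m, Wb ε m)‖ ≤ Cf + 1 := by
        rw [hx ε h0]; exact hnear ε h0 h1 m hm hW
      have hLF := norm_hadamard_le hF (fun y z hy hz => (le_max_left _ _).trans (hL y z hy hz))
        h0 h3 h4
      have hLG := norm_hadamard_le hG (fun y z hy hz => (le_max_right _ _).trans (hL y z hy hz))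
        h0 h3 h4
      rw [h2] at hLF hLG
      have hR := hM ε h0.le (h1.le.trans hε₁1) (pt ε m) hm
      have hR1 := (norm_fst_le _).trans hR
      have hR2 := (norm_snd_le _).trans hR
      simp only at hR1 hR2
      have hκL : L ≤ κ := le_max_left _ _
      have hκ1 : 1 ≤ κ := le_max_right _ _
      have hW0 := norm_nonneg (Wa ε m, Wb ε m)
      have h5 : L * ‖(Wa ε m, Wb ε m)‖ + M ≤ κ * (‖(Wa ε m, Wb ε m)‖ + M) := by nlinarith
      exact ⟨((norm_add_le _ _).trans (add_le_add hLF hR1)).trans h5,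
        ((norm_add_le _ _).trans (add_le_add hLG hR2)).trans h5⟩
    intro n hn
    -- The norm of the pair is a maximum. The larger component decides the direction in which the
    -- last step is taken back.
    rcases le_total ‖Wb ε n‖ ‖Wa ε n‖ with hmax | hmax
    · have hT : ‖(Wa ε n, Wb ε n)‖ = ‖Wa ε n‖ := max_eq_left hmax
      rw [hT]
      by_cases hn0 : n 0 = 0
      · left; rw [dWa ε h0 h1 n hn hn0, norm_zero]; exact hM0
      · right
        obtain ⟨m, rfl⟩ := exists_sh_of_ne_zero hn0
        have hm := mem_of_sh_mem h0 hn
        refine ⟨0, m, rfl, fun hTm => ?_⟩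
        have h6 : Wa ε (sh 0 m) = Wa ε m + ε • diff ε 0 (Wa ε) m := by
          simp [diff, smul_inv_smul₀ h0.ne']
        rw [h6, eWa ε h0 h1 m hn]
        refine (norm_add_le _ _).trans (add_le_add (norm_fst_le (Wa ε m, Wb ε m)) ?_)
        rw [norm_smul, Real.norm_of_nonneg h0.le]
        exact mul_le_mul_of_nonneg_left (step m hm hTm).1 h0.le
    · have hT : ‖(Wa ε n, Wb ε n)‖ = ‖Wb ε n‖ := max_eq_right hmax
      rw [hT]
      by_cases hn0 : n 1 = 0
      · left; rw [dWb ε h0 h1 n hn hn0, norm_zero]; exact hM0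
      · right
        obtain ⟨m, rfl⟩ := exists_sh_of_ne_zero hn0
        have hm := mem_of_sh_mem h0 hn
        refine ⟨1, m, rfl, fun hTm => ?_⟩
        have h6 : Wb ε (sh 1 m) = Wb ε m + ε • diff ε 1 (Wb ε) m := by
          simp [diff, smul_inv_smul₀ h0.ne']
        rw [h6, eWb ε h0 h1 m hn]
        refine (norm_add_le _ _).trans (add_le_add (norm_snd_le (Wa ε m, Wb ε m)) ?_)
        rw [norm_smul, Real.norm_of_nonneg h0.le]
        exact mul_le_mul_of_nonneg_left (step m hm hTm).2 h0.le
  refine ⟨fun ε h0 h1 n hn => ?_, fun l => ?_⟩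
  · have h2 := hnear ε h0 h1 n hn (hbound ε h0 h1 n hn)
    have h3 := (norm_snd_le _).trans ((norm_snd_le _).trans h2)
    exact ⟨(norm_fst_le _).trans h3, (norm_snd_le _).trans h3⟩
  -- The scaled errors solve a discrete Goursat problem with zero data whose only coefficient is the
  -- lattice point itself.
  · refine bddDiff_of_goursat (r := r) hε₁1 l (Z := Fin 2 → ℝ)
      (F := fun p => hadamard F (p.1, (p.1, p.2.1, fa p.2.1, fb p.2.1),
        ((0 : ℝ), (0 : Fin 2 → ℝ), p.2.2.1, p.2.2.2)) + Ra (p.1, p.2.1))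
      (G := fun p => hadamard G (p.1, (p.1, p.2.1, fa p.2.1, fb p.2.1),
        ((0 : ℝ), (0 : Fin 2 → ℝ), p.2.2.1, p.2.2.2)) + Rb (p.1, p.2.1))
      (((contDiff_hadamard hF).comp (by fun_prop)).add (hRa.comp (by fun_prop)))
      (((contDiff_hadamard hG).comp (by fun_prop)).add (hRb.comp (by fun_prop)))
      (fun _ _ _ => le_rfl) (z := pt) (fun k => BddDiff.pt fun _ _ _ => le_rfl)
      ⟨K, fun ε h0 h1 n hn => (norm_fst_le (Wa ε n, Wb ε n)).trans (hbound ε h0 h1 n hn)⟩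
      ⟨K, fun ε h0 h1 n hn => (norm_snd_le (Wa ε n, Wb ε n)).trans (hbound ε h0 h1 n hn)⟩
      eWa eWb dWa dWb

/-- Convergence for discrete systems which prescribe the evolution in both directions, with
coefficients that converge. -/
theorem discrete_total_converges {c : Fin 2 → ℝ × Y × P → P} (hc : ∀ i, ContDiff ℝ ∞ (c i))
    {fy : (Fin 2 → ℝ) → Y} {fc : (Fin 2 → ℝ) → P} (hfy : ContDiff ℝ ∞ fy) (hfc : ContDiff ℝ ∞ fc)
    {r : ℝ} (hr : 0 ≤ r)
    (efc : ∀ i, ∀ ξ ∈ box r, fderiv ℝ fc ξ (Pi.single i 1) = c i (0, fy ξ, fc ξ))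
    {ε₁ : ℝ} (hε₁0 : 0 < ε₁) (hε₁ : ε₁ ≤ 1) {y : ℝ → Lat → Y}
    (hy : ∀ l, BddDiff ε₁ l (fun _ => r) (fun ε n => ε⁻¹ • (y ε n - fy (pt ε n)))) :
    ∃ ε₂, 0 < ε₂ ∧ ε₂ ≤ ε₁ ∧ ∀ u : ℝ → Lat → P,
      (∀ ε, 0 < ε → ε < ε₂ → u ε 0 = fc 0) →
      (∀ ε, 0 < ε → ε < ε₂ → ∀ i n, sh i n ∈ latBox ε r →
        diff ε i (u ε) n = c i (ε, y ε n, u ε n)) →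
      ∀ l, BddDiff ε₂ l (fun _ => r) (fun ε n => ε⁻¹ • (u ε n - fc (pt ε n))) := by
  have := FiniteDimensional.complete ℝ P
  have hres := fun i => exists_smooth_residual hfc
    (E := fun p : ℝ × (Fin 2 → ℝ) => c i (p.1, fy p.2, fc p.2))
    ((hc i).comp (by fun_prop)) r i (efc i)
  choose R hR hR' using hres
  obtain ⟨Cf, hCf0, hCf⟩ := exists_bound_box_eps r
    (g := fun p : ℝ × (Fin 2 → ℝ) => (p.1, fy p.2, fc p.2))
    (by have := hfy.continuous; have := hfc.continuous; fun_prop)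
  obtain ⟨M₁, hM₁0, hM₁⟩ := exists_bound_box_eps r (g := fun p i => R i p)
    (by have := fun i => (hR i).continuous; fun_prop)
  obtain ⟨L, hL0, hL⟩ := exists_lipschitz_closedBall (contDiff_pi.2 hc) (Cf + 1)
  obtain ⟨D, hD⟩ := hy 0
  set κ := max L 1 with hκ
  have hκ0 : 0 ≤ κ := hL0.trans (le_max_left _ _)
  set M := M₁ + max D 0 with hMdef
  have hM0 : 0 ≤ M := add_nonneg hM₁0 (le_max_right _ _)
  have hDM : D ≤ M := (le_max_left _ _).trans (le_add_of_nonneg_left hM₁0)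
  set K := M * Real.exp (4 * κ * r) with hK
  have hK0 : 0 ≤ K := by positivity
  have hMK : M ≤ K := le_mul_of_one_le_right hM0 (Real.one_le_exp (by positivity))
  refine ⟨min ε₁ (1 / (K + 1)), lt_min hε₁0 (by positivity), min_le_left _ _, ?_⟩
  intro u hu0 hu
  set ε₂ := min ε₁ (1 / (K + 1)) with hε₂
  have hε₂1 : ε₂ ≤ 1 := (min_le_left _ _).trans hε₁
  have hεK : ∀ ε, 0 < ε → ε < ε₂ → ε * K ≤ 1 := fun ε h0 h1 => by
    have h2 : ε ≤ 1 / (K + 1) := h1.le.trans (min_le_right _ _)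
    rw [le_div_iff₀ (by positivity)] at h2
    nlinarith
  let Wc : ℝ → Lat → P := fun ε n => ε⁻¹ • (u ε n - fc (pt ε n))
  let Wy : ℝ → Lat → Y := fun ε n => ε⁻¹ • (y ε n - fy (pt ε n))
  let x : ℝ → Lat → ℝ × Y × P := fun ε n => (ε, fy (pt ε n), fc (pt ε n))
  have hx : ∀ ε, 0 < ε → ∀ n, x ε n + ε • (0, Wy ε n, Wc ε n) =
      (ε, y ε n, u ε n) := fun ε h0 n => by
    simp [x, Wc, Wy, smul_inv_smul₀ h0.ne']
  have eWc : ∀ ε, 0 < ε → ε < ε₂ → ∀ i n, sh i n ∈ latBox ε r → diff ε i (Wc ε) n =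
      hadamard (c i) (ε, x ε n, (0, Wy ε n, Wc ε n)) + R i (ε, pt ε n) := fun ε h0 h1 i n hn =>
    diff_scaled_error (hc i) h0 (hR' i ε h0 n (mem_of_sh_mem h0 hn))
      (by rw [hx ε h0]; exact hu ε h0 h1 i n hn)
  have hWy : ∀ ε, 0 < ε → ε < ε₂ → ∀ n ∈ latBox ε r, ‖Wy ε n‖ ≤ D := fun ε h0 h1 n hn =>
    hD ε h0 (h1.trans_le (min_le_left _ _)) n hn
  have hbound : ∀ ε, 0 < ε → ε < ε₂ → ∀ n ∈ latBox ε r, ‖Wc ε n‖ ≤ K := by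
    intro ε h0 h1
    refine lat_gronwall h0 le_rfl hM0 hκ0 (fun n => ‖Wc ε n‖) fun n hn => ?_
    rcases lat_eq_zero_or_sh n with rfl | ⟨i, m, rfl⟩
    · left
      have h2 : pt ε 0 = 0 := by ext i; simp [pt]
      simp only [Wc, h2, hu0 ε h0 h1, sub_self, smul_zero, norm_zero]
      exact hM0
    · right
      have hm := mem_of_sh_mem h0 hn
      refine ⟨i, m, rfl, fun hTm => ?_⟩
      have hxC : ‖x ε m‖ ≤ Cf := hCf ε h0.le (h1.le.trans hε₂1) _ hm
      have h2 : ‖((0 : ℝ), Wy ε m, Wc ε m)‖ ≤ ‖Wc ε m‖ + max D 0 := by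
        refine max_le (by rw [norm_zero]; positivity) (max_le ?_ ?_)
        · exact ((hWy ε h0 h1 m hm).trans (le_max_left D 0)).trans
            (le_add_of_nonneg_left (norm_nonneg _))
        · exact le_add_of_nonneg_right (le_max_right _ _)
      have h3 : ‖((0 : ℝ), Wy ε m, Wc ε m)‖ ≤ K := by
        refine max_le (by rw [norm_zero]; exact hK0) (max_le ?_ hTm)
        exact (hWy ε h0 h1 m hm).trans (hDM.trans hMK)
      have h4 : ‖x ε m + ε • (0, Wy ε m, Wc ε m)‖ ≤ Cf + 1 := by
        refine (norm_add_le _ _).trans (add_le_add hxC ?_)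
        rw [norm_smul, Real.norm_of_nonneg h0.le]
        exact (mul_le_mul_of_nonneg_left h3 h0.le).trans (hεK ε h0 h1)
      have hLc := norm_hadamard_le (hc i)
        (fun y z hy hz => (norm_le_pi_norm (fun i => c i y - c i z) i).trans (hL y z hy hz))
        h0 (hxC.trans (by linarith)) h4
      have hRi := (norm_le_pi_norm (fun i => R i (ε, pt ε m)) i).trans
        (hM₁ ε h0.le (h1.le.trans hε₂1) (pt ε m) hm)
      have h6 : Wc ε (sh i m) = Wc ε m + ε • diff ε i (Wc ε) m := by
        simp [diff, smul_inv_smul₀ h0.ne']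
      rw [h6, eWc ε h0 h1 i m hn]
      refine (norm_add_le _ _).trans (add_le_add le_rfl ?_)
      rw [norm_smul, Real.norm_of_nonneg h0.le]
      refine mul_le_mul_of_nonneg_left ?_ h0.le
      have hκL : L ≤ κ := le_max_left _ _
      have hκ1 : 1 ≤ κ := le_max_right _ _
      have hW0 := norm_nonneg (Wc ε m)
      have hD0 : 0 ≤ max D 0 := le_max_right _ _
      calc _ ≤ L * ‖((0 : ℝ), Wy ε m, Wc ε m)‖ + M₁ := (norm_add_le _ _).trans (add_le_add hLc hRi)
        _ ≤ κ * (‖Wc ε m‖ + max D 0) + κ * M₁ :=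
          add_le_add (mul_le_mul hκL h2 (norm_nonneg _) hκ0) (le_mul_of_one_le_left hM₁0 hκ1)
        _ = κ * (‖Wc ε m‖ + M) := by rw [hMdef]; ring
  intro l
  -- All first differences are given by the equations, so each order follows from the previous one
  -- without a cross estimate.
  induction l with
  | zero => exact ⟨K, hbound⟩
  | succ l ih =>
    refine ⟨⟨K, hbound⟩, fun i => ?_⟩
    have hsample : BddDiff ε₂ l (fun ε => r - ε) pt :=
      BddDiff.pt (r := r) fun ε h0 _ => by linarith
    refine BddDiff.congr (BddDiff.comp hε₂1
      (F := fun p : ℝ × (Fin 2 → ℝ) × Y × P => hadamard (c i) (p.1, (p.1, fy p.2.1, fc p.2.1),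
        ((0 : ℝ), p.2.2.1, p.2.2.2)) + R i (p.1, p.2.1))
      (((contDiff_hadamard (hc i)).comp (by fun_prop)).add ((hR i).comp (by fun_prop)))
      (hsample.prodMk ((((hy l).mono_eps (min_le_left _ _)).shrink).prodMk ih.shrink)))
      fun ε h0 h1 n hn => eWc ε h0 h1 i n (sh_mem_of_mem_sub h0 hn i)

end Convergence


/-! ### Clifford algebra -/

section Clifford

variable {N : ℕ}

theorem lorentz_apply (u v : Mink N) :
    lorentz N u v = inner ℝ u.1 v.1 + u.2.1 * v.2.1 - u.2.2 * v.2.2 := rfl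

theorem lorentz_comm (u v : Mink N) : lorentz N u v = lorentz N v u := by
  simp only [lorentz_apply, real_inner_comm]; ring

/-- The linear isomorphism with the exterior algebra carries vectors to vectors, and there the
inclusion of vectors is injective. -/
theorem emb_injective : Function.Injective (emb : Mink N → Cl N) := by
  intro u v h
  have := congrArg (CliffordAlgebra.equivExterior (cliffordForm N)) h
  simpa using this

theorem emb_add (u v : Mink N) : emb (u + v) = emb u + emb v := map_add _ _ _

theorem emb_sub (u v : Mink N) : emb (u - v) = emb u - emb v := map_sub _ _ _

theorem emb_neg (u : Mink N) : emb (-u) = -emb u := map_neg _ _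

theorem emb_smul (c : ℝ) (u : Mink N) : emb (c • u) = c • emb u := map_smul _ _ _

theorem cliffordForm_apply (u : Mink N) : cliffordForm N u = -lorentz N u u := by
  simp [cliffordForm, LinearMap.BilinMap.toQuadraticMap_apply]

theorem emb_mul_self (u : Mink N) : emb u * emb u = algebraMap ℝ (Cl N) (-lorentz N u u) := by
  rw [CliffordAlgebra.ι_sq_scalar, cliffordForm_apply]

theorem emb_mul_self_of_unit {u : Mink N} (hu : lorentz N u u = 1) : emb u * emb u = -1 := by
  rw [emb_mul_self, hu, map_neg, map_one]

theorem emb_mul_add_swap (u v : Mink N) :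
    emb u * emb v + emb v * emb u = algebraMap ℝ (Cl N) (-(2 * lorentz N u v)) := by
  rw [CliffordAlgebra.ι_mul_ι_add_swap]
  congr 1
  simp only [QuadraticMap.polar, cliffordForm_apply, map_add, LinearMap.add_apply]
  rw [lorentz_comm v u]; ring

/-- The reflection of `v` in the hyperplane orthogonal to a unit vector `u`. -/
def mrefl (u v : Mink N) : Mink N := v - (2 * lorentz N u v) • u

theorem emb_conj {u : Mink N} (hu : lorentz N u u = 1) (v : Mink N) :
    emb u * emb v * emb u = emb (mrefl u v) := by
  have h1 : emb u * emb v = algebraMap ℝ (Cl N) (-(2 * lorentz N u v)) - emb v * emb u := by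
    rw [← emb_mul_add_swap]; abel
  rw [h1, sub_mul, mul_assoc, emb_mul_self_of_unit hu, mrefl, emb_sub, emb_smul,
    Algebra.algebraMap_eq_smul_one, smul_mul_assoc, one_mul, neg_smul]
  simp only [mul_neg, mul_one]
  abel

theorem inverse_eq_of_mul_eq_one {A : Type*} [Ring A] {a b : A} (h1 : a * b = 1)
    (h2 : b * a = 1) : Ring.inverse a = b :=
  Ring.inverse_unit (⟨a, b, h1, h2⟩ : Aˣ)

theorem inverse_mul_of_isUnit {A : Type*} [Ring A] {a b : A} (ha : IsUnit a) (hb : IsUnit b) :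
    Ring.inverse (a * b) = Ring.inverse b * Ring.inverse a := by
  obtain ⟨a, rfl⟩ := ha
  obtain ⟨b, rfl⟩ := hb
  rw [← Units.val_mul, Ring.inverse_unit, Ring.inverse_unit, Ring.inverse_unit, mul_inv_rev,
    Units.val_mul]

theorem isUnit_emb {u : Mink N} (hu : lorentz N u u = 1) : IsUnit (emb u) :=
  ⟨⟨emb u, -emb u, by rw [mul_neg, emb_mul_self_of_unit hu, neg_neg],
    by rw [neg_mul, emb_mul_self_of_unit hu, neg_neg]⟩, rfl⟩

theorem inverse_emb {u : Mink N} (hu : lorentz N u u = 1) : Ring.inverse (emb u) = -emb u :=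
  inverse_eq_of_mul_eq_one (by rw [mul_neg, emb_mul_self_of_unit hu, neg_neg])
    (by rw [neg_mul, emb_mul_self_of_unit hu, neg_neg])

theorem act_add (ψ : Cl N) (u v : Mink N) : act ψ (u + v) = act ψ u + act ψ v := by
  simp [act, mul_add, add_mul]

theorem act_smul (ψ : Cl N) (c : ℝ) (v : Mink N) : act ψ (c • v) = c • act ψ v := by
  simp [act]

theorem act_mul {φ ψ : Cl N} (hφ : IsUnit φ) (hψ : IsUnit ψ) {u v : Mink N}
    (h : act φ u = emb v) : act (φ * ψ) u = act ψ v := by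
  simp only [act] at h ⊢
  rw [inverse_mul_of_isUnit hφ hψ, ← h]
  simp only [mul_assoc]

theorem act_emb {u : Mink N} (hu : lorentz N u u = 1) (v : Mink N) :
    act (emb u) v = emb (-mrefl u v) := by
  rw [act, inverse_emb hu, neg_mul, neg_mul, emb_conj hu, emb_neg]

/-- Conjugation by a unit vector is minus a reflection; the two signs cancel in the product, and the
sign in front of the product does not affect conjugation. -/
theorem act_step {S U : Mink N} (hS : lorentz N S S = 1) (hU : lorentz N U U = 1) {ψ : Cl N}
    (hψ : IsUnit ψ) (v : Mink N) :
    act (-(emb S * emb U) * ψ) v = act ψ (mrefl U (mrefl S v)) := by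
  have hS' : lorentz N (-S) (-S) = 1 := by simpa using hS
  rw [← neg_mul, ← emb_neg]
  refine act_mul ((isUnit_emb hS').mul (isUnit_emb hU)) hψ ?_
  rw [act_mul (isUnit_emb hS') (isUnit_emb hU) (act_emb hS' v), act_emb hU]
  have h1 : -mrefl (-S) v = -mrefl S v := by simp [mrefl]
  rw [h1]
  congr 1
  generalize mrefl S v = w
  simp only [mrefl, map_neg]
  module

theorem mem_HInf_step {S U : Mink N} (hS : lorentz N S S = 1) (hU : lorentz N U U = 1)
    (hS' : lorentz N S (eInf N) = 0) (hU' : lorentz N U (eInf N) = 0) {ψ : Cl N}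
    (hψ : ψ ∈ HInf N) : -(emb S * emb U) * ψ ∈ HInf N := by
  refine (HInf N).mul_mem ?_ hψ
  rw [← neg_mul, ← emb_neg]
  refine (HInf N).mul_mem (Submonoid.subset_closure ⟨-S, ?_, ?_, rfl⟩)
    (Submonoid.subset_closure ⟨U, hU, hU', rfl⟩)
  · simpa using hS
  · simpa using hS'

theorem lorentz_mrefl {u : Mink N} (hu : lorentz N u u = 1) (v w : Mink N) :
    lorentz N (mrefl u v) (mrefl u w) = lorentz N v w := by
  simp only [mrefl, map_sub, map_smul, LinearMap.sub_apply, LinearMap.smul_apply, smul_eq_mul, hu]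
  rw [lorentz_comm v u]; ring

/-- Elements of `H_∞` act by Lorentz transformations which fix the line of `e_∞`. -/
theorem exists_act_of_mem_HInf {ψ : Cl N} (hψ : ψ ∈ HInf N) :
    ∃ T : Mink N → Mink N, (∀ v, act ψ v = emb (T v)) ∧
      (∀ u v, lorentz N (T u) (T v) = lorentz N u v) ∧ (T (eInf N) = eInf N ∨ T (eInf N) = -eInf N) ∧
      T (-eInf N) = -T (eInf N) := by
  induction hψ using Submonoid.closure_induction with
  | mem x hx =>
    obtain ⟨u, hu, hu', rfl⟩ := hx
    refine ⟨fun v => -mrefl u v, fun v => act_emb hu v, fun v w => ?_, Or.inr ?_, ?_⟩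
    · simpa using lorentz_mrefl hu v w
    · simp [mrefl, hu']
    · simp [mrefl, hu']
  | one => exact ⟨id, fun v => by simp [act], fun _ _ => rfl, Or.inl rfl, rfl⟩
  | mul x y hx hy ihx ihy =>
    obtain ⟨T, hT, hTl, hTi, hTn⟩ := ihx
    obtain ⟨T', hT', hTl', hTi', hTn'⟩ := ihy
    refine ⟨T' ∘ T, fun v => ?_, fun u v => by simp [hTl, hTl'], ?_, ?_⟩
    · rw [act_mul (isUnit_of_mem_HInf hx) (isUnit_of_mem_HInf hy) (hT v), hT']; rfl
    · rcases hTi with h | h <;> rcases hTi' with h' | h' <;> simp [h, h', hTn']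
    · rcases hTi with h | h <;> simp [hTn, h, hTn']

/-- Compatibility of the two frame equations. -/
theorem frame_compat {a₁ a₂ S₁ S₂ : Mink N} (h₁ : lorentz N a₁ a₁ = 1) (h₂ : lorentz N a₂ a₂ = 1)
    (h₁₂ : lorentz N a₁ a₂ = 0) {n ρ₁₂ ρ₂₁ : ℝ}
    (hq : ρ₁₂ + ρ₂₁ = -(2 * lorentz N (mrefl a₂ S₁) (mrefl a₁ S₂)))
    (hS₁ : lorentz N S₁ S₁ = 1) (hS₂ : lorentz N S₂ S₂ = 1) :
    emb (n • (mrefl a₁ S₂ + ρ₁₂ • mrefl a₂ S₁)) * emb a₂ * (emb S₁ * emb a₁) =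
      emb (n • (mrefl a₂ S₁ + ρ₂₁ • mrefl a₁ S₂)) * emb a₁ * (emb S₂ * emb a₂) := by
  set q := mrefl a₂ S₁ with hqd
  set t := mrefl a₁ S₂ with htd
  have hqq : emb q * emb q = -1 := emb_mul_self_of_unit (by rw [hqd, lorentz_mrefl h₂, hS₁])
  have htt : emb t * emb t = -1 := emb_mul_self_of_unit (by rw [htd, lorentz_mrefl h₁, hS₂])
  have e1 : emb a₂ * emb S₁ = -(emb q * emb a₂) := by
    rw [hqd, ← emb_conj h₂, mul_assoc _ (emb a₂) (emb a₂), emb_mul_self_of_unit h₂]; simp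
  have e2 : emb a₁ * emb S₂ = -(emb t * emb a₁) := by
    rw [htd, ← emb_conj h₁, mul_assoc _ (emb a₁) (emb a₁), emb_mul_self_of_unit h₁]; simp
  have e3 : emb a₁ * emb a₂ = -(emb a₂ * emb a₁) := by
    have := emb_mul_add_swap a₁ a₂
    rw [h₁₂, mul_zero, neg_zero, map_zero] at this
    exact eq_neg_of_add_eq_zero_left this
  -- This is the core of the compatibility. Since `q` and `t` square to `-1`, the sum is `n` times
  -- `tq + qt - (ρ₁₂ + ρ₂₁)`, and `tq + qt` is the scalar `-2⟨q, t⟩`; it vanishes by `hq`. The rest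
  -- of the proof moves the factors `a₁`, `a₂` to the right.
  have e4 : emb (n • (t + ρ₁₂ • q)) * emb q + emb (n • (q + ρ₂₁ • t)) * emb t = 0 := by
    have h5 := emb_mul_add_swap q t
    simp only [emb, map_add, map_smul, smul_mul_assoc, add_mul] at h5 ⊢
    rw [hqq, htt, ← smul_add]
    have : (CliffordAlgebra.ι (cliffordForm N)) t * (CliffordAlgebra.ι (cliffordForm N)) q +
        ρ₁₂ • (-1 : Cl N) + ((CliffordAlgebra.ι (cliffordForm N)) q *
          (CliffordAlgebra.ι (cliffordForm N)) t + ρ₂₁ • (-1 : Cl N)) =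
        algebraMap ℝ (Cl N) (-(2 * lorentz N q t)) - (ρ₁₂ + ρ₂₁) • (1 : Cl N) := by
      rw [← h5]; module
    rw [this, hq, Algebra.algebraMap_eq_smul_one, sub_self, smul_zero]
  calc emb (n • (t + ρ₁₂ • q)) * emb a₂ * (emb S₁ * emb a₁)
      = emb (n • (t + ρ₁₂ • q)) * (emb a₂ * emb S₁) * emb a₁ := by simp only [mul_assoc]
    _ = -(emb (n • (t + ρ₁₂ • q)) * emb q) * (emb a₂ * emb a₁) := by
        rw [e1]; simp only [mul_assoc, mul_neg, neg_mul]
    _ = emb (n • (q + ρ₂₁ • t)) * emb t * (emb a₂ * emb a₁) := by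
        rw [eq_neg_of_add_eq_zero_left e4, neg_neg]
    _ = emb (n • (q + ρ₂₁ • t)) * -(emb t * emb a₁) * emb a₂ := by
        rw [← neg_neg (emb a₂ * emb a₁), ← e3]; simp only [mul_assoc, mul_neg, neg_mul]
    _ = _ := by rw [← e2]; simp only [mul_assoc]

end Clifford

/-! ### Euclidean frames of elements of the Clifford algebra -/

section Frame

variable {N : ℕ}

/-- The inclusion `ℝ^N ⊂ ℝ^{N+1,1}`. -/
def inj (z : E N) : Mink N := (z, 0, 0)

/-- The lift of a tangent vector `z` at the point `x`. -/
def tlift (x z : E N) : Mink N := inj z + (2 * inner ℝ x z) • eInf N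

theorem tlift_injective {x : E N} : Function.Injective (tlift x) := by
  intro z z' h
  simpa [tlift, inj, eInf] using congrArg Prod.fst h

theorem lift_injective : Function.Injective (lift : E N → Mink N) := by
  intro z z' h
  simpa [lift, eInf, eZero] using congrArg Prod.fst h

theorem e_eq_inj (k : Fin N) : (e k : Mink N) = inj (EuclideanSpace.single k 1) := rfl

/-- The Euclidean reflection in the hyperplane orthogonal to a unit vector `a`. -/
def erefl (a : E N) : E N →L[ℝ] E N :=
  ContinuousLinearMap.id ℝ _ - (2 : ℝ) • (innerSL ℝ a).smulRight a

theorem erefl_apply (a z : E N) : erefl a z = z - (2 * inner ℝ a z) • a := by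
  simp [erefl, smul_smul]

theorem inner_erefl {a : E N} (ha : inner ℝ a a = (1 : ℝ)) (y z : E N) :
    inner ℝ (erefl a y) (erefl a z) = (inner ℝ y z : ℝ) := by
  simp only [erefl_apply, inner_sub_left, inner_sub_right, real_inner_smul_left,
    real_inner_smul_right, ha]
  rw [real_inner_comm a y]; ring

theorem erefl_self {a : E N} (ha : inner ℝ a a = (1 : ℝ)) : erefl a a = -a := by
  rw [erefl_apply, ha]; module

theorem inner_erefl_self {a : E N} (ha : inner ℝ a a = (1 : ℝ)) (z : E N) :
    inner ℝ a (erefl a z) = -(inner ℝ a z : ℝ) := by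
  rw [erefl_apply, inner_sub_right, real_inner_smul_right, ha]; ring

/-- `x` and `R` are the point and the tangent frame (relative to the initial frame `O`) which
belong to the element `ψ` of the Clifford algebra. -/
structure IsFrame (O : E N ≃ₗᵢ[ℝ] E N) (ψ : Cl N) (x : E N) (R : E N →L[ℝ] E N) : Prop where
  unit : IsUnit ψ
  vec : ∀ z, act ψ (inj z) = emb (tlift x (R (O z)))
  org : act ψ (eZero N) = emb (lift x)
  inf : act ψ (eInf N) = emb (eInf N)
  iso : ∀ y z, inner ℝ (R y) (R z) = (inner ℝ y z : ℝ)

theorem IsFrame.unique {O : E N ≃ₗᵢ[ℝ] E N} {ψ : Cl N} {x x' : E N} {R R' : E N →L[ℝ] E N}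
    (h : IsFrame O ψ x R) (h' : IsFrame O ψ x' R') : x = x' ∧ R = R' := by
  obtain rfl : x = x' := lift_injective (emb_injective (h.org.symm.trans h'.org))
  refine ⟨rfl, ContinuousLinearMap.ext fun z => ?_⟩
  have := tlift_injective (emb_injective ((h.vec (O.symm z)).symm.trans (h'.vec (O.symm z))))
  simpa using this

theorem mrefl_inj (s z : E N) (c : ℝ) :
    mrefl (inj s - c • eInf N) (inj z) = inj (erefl s z) + (2 * c * inner ℝ s z) • eInf N := by
  have h : lorentz N (inj s - c • eInf N) (inj z) = inner ℝ s z := by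
    simp [lorentz_apply, inj, eInf]
  rw [mrefl, h]
  ext <;> simp [inj, eInf, erefl_apply] <;> ring

theorem mrefl_inj_eInf (a : E N) : mrefl (inj a) (eInf N) = eInf N := by
  have h : lorentz N (inj a) (eInf N) = 0 := by simp [lorentz_apply, inj, eInf]
  simp [mrefl, h]

theorem mrefl_inj_inj (a z : E N) : mrefl (inj a) (inj z) = inj (erefl a z) := by
  simpa using mrefl_inj a z 0

theorem mrefl_inj_eZero (a : E N) : mrefl (inj a) (eZero N) = eZero N := by
  have h : lorentz N (inj a) (eZero N) = 0 := by simp [lorentz_apply, inj, eZero]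
  simp [mrefl, h]

theorem mrefl_add (u v w : Mink N) : mrefl u (v + w) = mrefl u v + mrefl u w := by
  simp only [mrefl, map_add]; module

theorem mrefl_smul (u v : Mink N) (c : ℝ) : mrefl u (c • v) = c • mrefl u v := by
  simp only [mrefl, map_smul, smul_eq_mul]; module

theorem lorentz_inj_sub (s s' : E N) (c c' : ℝ) :
    lorentz N (inj s - c • eInf N) (inj s' - c' • eInf N) = inner ℝ s s' := by
  simp [lorentz_apply, inj, eInf]

theorem mrefl_eZero (s : E N) (c : ℝ) :
    mrefl (inj s - c • eInf N) (eZero N) = eZero N + (-c) • inj s + c ^ 2 • eInf N := by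
  have h : lorentz N (inj s - c • eInf N) (eZero N) = c / 2 := by
    simp [lorentz_apply, inj, eInf, eZero]; ring
  rw [mrefl, h, mul_div_cancel₀ c two_ne_zero]
  ext <;> simp [inj, eInf, eZero] <;> ring

theorem mrefl_eInf (s : E N) (c : ℝ) :
    mrefl (inj s - c • eInf N) (eInf N) = eInf N := by
  have h : lorentz N (inj s - c • eInf N) (eInf N) = 0 := by
    simp [lorentz_apply, inj, eInf]
  rw [mrefl, h]; simp

/-- The frame equation, in terms of the Euclidean frame. -/
theorem IsFrame.step {O : E N ≃ₗᵢ[ℝ] E N} {ψ : Cl N} {x : E N} {R : E N →L[ℝ] E N}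
    (h : IsFrame O ψ x R) {a s : E N} (ha : inner ℝ a a = (1 : ℝ)) (hs : inner ℝ s s = (1 : ℝ))
    (c : ℝ) :
    IsFrame O (-(emb (inj s - c • eInf N) * emb (inj a)) * ψ)
      (x - c • R (erefl (O a) (O s))) (R ∘L erefl (O a) ∘L erefl (O s)) := by
  have hU : lorentz N (inj a) (inj a) = 1 := by simpa using (lorentz_inj_sub a a 0 0).trans ha
  have hS : lorentz N (inj s - c • eInf N) (inj s - c • eInf N) = 1 :=
    (lorentz_inj_sub s s c c).trans hs
  have hOa : inner ℝ (O a) (O a) = (1 : ℝ) := by rw [O.inner_map_map, ha]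
  have hOs : inner ℝ (O s) (O s) = (1 : ℝ) := by rw [O.inner_map_map, hs]
  have hO : ∀ y z, O (erefl y z) = erefl (O y) (O z) := fun y z => by
    simp [erefl_apply, O.inner_map_map]
  refine ⟨(((isUnit_emb hS).mul (isUnit_emb hU)).neg).mul h.unit, fun z => ?_, ?_, ?_,
    fun y z => ?_⟩
  · rw [act_step hS hU h.unit, mrefl_inj, mrefl_add, mrefl_smul, mrefl_inj_eInf, mrefl_inj_inj,
      act_add, act_smul, h.vec, h.inf, ← map_smul, ← map_add]
    congr 1
    have h1 : (inner ℝ (R (erefl (O a) (O s))) (R (erefl (O a) (erefl (O s) (O z)))) : ℝ) =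
        -inner ℝ s z := by
      rw [h.iso, inner_erefl hOa, inner_erefl_self hOs, O.inner_map_map]
    simp only [tlift, ContinuousLinearMap.comp_apply, hO, inner_sub_left, real_inner_smul_left, h1]
    module
  · rw [act_step hS hU h.unit, mrefl_eZero, mrefl_add, mrefl_add, mrefl_smul, mrefl_smul,
      mrefl_inj_eInf, mrefl_inj_inj, mrefl_inj_eZero, act_add, act_add, act_smul, act_smul, h.vec,
      h.inf, h.org, ← map_smul, ← map_smul, ← map_add, ← map_add]
    congr 1
    have h1 : (inner ℝ (R (erefl (O a) (O s))) (R (erefl (O a) (O s))) : ℝ) = 1 := by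
      rw [h.iso, inner_erefl hOa, hOs]
    have h2 : ‖x - c • R (erefl (O a) (O s))‖ ^ 2 =
        ‖x‖ ^ 2 - 2 * c * inner ℝ x (R (erefl (O a) (O s))) + c ^ 2 := by
      rw [norm_sub_sq_real, norm_smul, mul_pow, ← real_inner_self_eq_norm_sq (R _), h1,
        real_inner_smul_right]
      simp; ring
    simp only [lift, tlift, hO, h2]
    ext <;> simp [inj, eInf, eZero] <;> ring
  · rw [act_step hS hU h.unit, mrefl_eInf, mrefl_inj_eInf, h.inf]
  · simp only [ContinuousLinearMap.comp_apply, h.iso, inner_erefl hOa, inner_erefl hOs]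

end Frame


/-! ### The discrete evolution equations in invariant form -/

section Cutoff

/-- A smooth positive function which is the identity on `[1/2, ∞)`. -/
def posCut (y : ℝ) : ℝ :=
  Real.smoothTransition (4 * y - 1) * y + (1 - Real.smoothTransition (4 * y - 1))

theorem posCut_pos (y : ℝ) : 0 < posCut y := by
  unfold posCut
  have h0 := Real.smoothTransition.nonneg (4 * y - 1)
  have h1 := Real.smoothTransition.le_one (4 * y - 1)
  by_cases hy : 4 * y - 1 ≤ 0
  · rw [Real.smoothTransition.zero_of_nonpos hy]; norm_num
  · have hy' : 1 / 4 < y := by linarith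
    nlinarith [mul_nonneg h0 (by linarith : (0:ℝ) ≤ y - 1 / 4)]

/-- The cutoff makes the discrete right-hand sides smooth on the whole space. Where the radicands
are at least `1/2` it is invisible. -/
theorem posCut_eq {y : ℝ} (hy : 1 / 2 ≤ y) : posCut y = y := by
  rw [posCut, Real.smoothTransition.one_of_one_le (by linarith)]; ring

/-- A smooth positive function which agrees with the square root on `[1/2, ∞)`. -/
def sqrtCut (y : ℝ) : ℝ := Real.sqrt (posCut y)

theorem sqrtCut_pos (y : ℝ) : 0 < sqrtCut y := Real.sqrt_pos.2 (posCut_pos y)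

theorem sqrtCut_eq {y : ℝ} (hy : 1 / 2 ≤ y) : sqrtCut y = Real.sqrt y := by
  rw [sqrtCut, posCut_eq hy]

theorem sqrtCut_sq {y : ℝ} (hy : 1 / 2 ≤ y) : sqrtCut y ^ 2 = y := by
  rw [sqrtCut_eq hy, Real.sq_sqrt (by linarith)]

theorem sqrtCut_one : sqrtCut 1 = 1 := by rw [sqrtCut_eq (by norm_num), Real.sqrt_one]

theorem contDiff_sqrtCut {n : ℕ∞} : ContDiff ℝ n sqrtCut := by
  refine ContDiff.sqrt ?_ fun y => (posCut_pos y).ne'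
  have h : ContDiff ℝ n fun y : ℝ => Real.smoothTransition (4 * y - 1) :=
    Real.smoothTransition.contDiff.comp (by fun_prop)
  exact (h.mul contDiff_id).add (contDiff_const.sub h)

end Cutoff

/-! ### The discrete right-hand side and the one-step formula. -/

section Rhs

variable {N : ℕ}

/-- `N_i` as a function of the rotation vector `b_i`. -/
def dN (ε : ℝ) (b : E N) : ℝ := sqrtCut (1 - ε ^ 2 / 4 * ‖b‖ ^ 2)

/-- `ρ_{ij} / ε`; `own = b_j`, `other = b_i`, `u = u_i`. -/
def dr (ε γ : ℝ) (u own other : E N) : ℝ :=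
  dN ε other * inner ℝ own u - ε / 2 * (inner ℝ own other / 2 - γ)

/-- The radicand of `n`. -/
def dnSq (ε γ : ℝ) (ui uj own other : E N) : ℝ :=
  1 - ε ^ 2 * (dr ε γ ui own other * dr ε (-γ) uj other own)

/-- The quantity `n`. -/
def dn (ε γ : ℝ) (ui uj own other : E N) : ℝ := sqrtCut (dnSq ε γ ui uj own other)

/-- `(1 - n) / (ε n)`. -/
def dk (ε γ : ℝ) (ui uj own other : E N) : ℝ :=
  ε * (dr ε γ ui own other * dr ε (-γ) uj other own) /
    (dn ε γ ui uj own other * (1 + dn ε γ ui uj own other))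

/-- The right-hand side of the evolution of `own = (h_j, b_j)` in the direction `i`, with
`other = (h_i, b_i)`. -/
def drhs (ε γ : ℝ) (ui uj : E N) (own other : ℝ × E N) : ℝ × E N :=
  (dr ε γ ui own.2 other.2 / dn ε γ ui uj own.2 other.2 * other.1 +
      dk ε γ ui uj own.2 other.2 * own.1,
    dk ε γ ui uj own.2 other.2 • own.2 +
      (dr ε γ ui own.2 other.2 / dn ε γ ui uj own.2 other.2) •
        (other.2 - inner ℝ other.2 uj • uj) +
      ((-(ε / 2 * ‖other.2‖ ^ 2 * inner ℝ own.2 ui) -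
        dN ε other.2 * (inner ℝ own.2 other.2 / 2 - γ)) / dn ε γ ui uj own.2 other.2) • ui)

/-- Exchanging the two directions reverses the sign of `γ` and swaps the two factors `ρ`, so the
radicand of `n` is common to both directions. -/
theorem dnSq_swap (ε γ : ℝ) (ui uj own other : E N) :
    dnSq ε (-γ) uj ui other own = dnSq ε γ ui uj own other := by
  simp only [dnSq, neg_neg]; ring

theorem dn_swap (ε γ : ℝ) (ui uj own other : E N) :
    dn ε (-γ) uj ui other own = dn ε γ ui uj own other := by
  simp only [dn, dnSq_swap]

section Smooth

variable {X : Type} [NormedAddCommGroup X] [NormedSpace ℝ X] {ε γ : X → ℝ} {b own other : X → E N}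

theorem contDiff_dN (hε : ContDiff ℝ ∞ ε) (hb : ContDiff ℝ ∞ b) :
    ContDiff ℝ ∞ fun x => dN (ε x) (b x) := by
  have h : ContDiff ℝ ∞ fun x => 1 - ε x ^ 2 / 4 * ‖b x‖ ^ 2 :=
    contDiff_const.sub (((hε.pow 2).div_const 4).mul (hb.norm_sq ℝ))
  exact (contDiff_sqrtCut (n := ⊤)).comp h

theorem contDiff_dr (hε : ContDiff ℝ ∞ ε) (hγ : ContDiff ℝ ∞ γ) (u : E N) (ho : ContDiff ℝ ∞ own)
    (ho' : ContDiff ℝ ∞ other) : ContDiff ℝ ∞ fun x => dr (ε x) (γ x) u (own x) (other x) :=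
  ((contDiff_dN hε ho').mul (ho.inner ℝ contDiff_const)).sub
    ((hε.div_const 2).mul (((ho.inner ℝ ho').div_const 2).sub hγ))

theorem contDiff_dn (hε : ContDiff ℝ ∞ ε) (hγ : ContDiff ℝ ∞ γ) (ui uj : E N)
    (ho : ContDiff ℝ ∞ own) (ho' : ContDiff ℝ ∞ other) :
    ContDiff ℝ ∞ fun x => dn (ε x) (γ x) ui uj (own x) (other x) := by
  have h : ContDiff ℝ ∞ fun x => dnSq (ε x) (γ x) ui uj (own x) (other x) :=
    contDiff_const.sub ((hε.pow 2).mul ((contDiff_dr hε hγ ui ho ho').mul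
      (contDiff_dr hε hγ.neg uj ho' ho)))
  exact (contDiff_sqrtCut (n := ⊤)).comp h

theorem dn_pos (ε γ : ℝ) (ui uj own other : E N) : 0 < dn ε γ ui uj own other := sqrtCut_pos _

theorem contDiff_dk (hε : ContDiff ℝ ∞ ε) (hγ : ContDiff ℝ ∞ γ) (ui uj : E N)
    (ho : ContDiff ℝ ∞ own) (ho' : ContDiff ℝ ∞ other) :
    ContDiff ℝ ∞ fun x => dk (ε x) (γ x) ui uj (own x) (other x) := by
  have hn := contDiff_dn hε hγ ui uj ho ho'
  refine ContDiff.div (hε.mul ((contDiff_dr hε hγ ui ho ho').mul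
      (contDiff_dr hε hγ.neg uj ho' ho))) (hn.mul (contDiff_const.add hn)) fun x => ?_
  have := dn_pos (ε x) (γ x) ui uj (own x) (other x)
  positivity

theorem contDiff_drhs {own other : X → ℝ × E N} (hε : ContDiff ℝ ∞ ε) (hγ : ContDiff ℝ ∞ γ)
    (ui uj : E N) (ho : ContDiff ℝ ∞ own) (ho' : ContDiff ℝ ∞ other) :
    ContDiff ℝ ∞ fun x => drhs (ε x) (γ x) ui uj (own x) (other x) := by
  have ho1 := ho.fst
  have ho2 := ho.snd
  have ho1' := ho'.fst
  have ho2' := ho'.snd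
  have hn := contDiff_dn hε hγ ui uj ho2 ho2'
  have hn0 : ∀ x, dn (ε x) (γ x) ui uj (own x).2 (other x).2 ≠ 0 := fun x => (dn_pos _ _ _ _ _ _).ne'
  have hr := contDiff_dr hε hγ ui ho2 ho2'
  have hk := contDiff_dk hε hγ ui uj ho2 ho2'
  have hN := contDiff_dN hε ho2'
  refine ContDiff.prodMk (((hr.div hn hn0).mul ho1').add (hk.mul ho1)) ?_
  refine ((hk.smul ho2).add ((hr.div hn hn0).smul (ho2'.sub ((ho2'.inner ℝ contDiff_const).smul
    contDiff_const)))).add (ContDiff.smul (ContDiff.div ?_ hn hn0) contDiff_const)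
  exact ((((hε.div_const 2).mul (ho2'.norm_sq ℝ)).mul (ho2.inner ℝ contDiff_const)).neg).sub
    (hN.mul (((ho2.inner ℝ ho2').div_const 2).sub hγ))

end Smooth

/-- At `ε = 0` the square roots are `1` and `dk` vanishes; what remains is the smooth system of
C-surfaces. -/
theorem drhs_zero (γ : ℝ) (ui uj : E N) (own other : ℝ × E N) :
    drhs 0 γ ui uj own other =
      (inner ℝ own.2 ui * other.1, inner ℝ own.2 ui • (other.2 - inner ℝ other.2 uj • uj) -
        (inner ℝ own.2 other.2 / 2 - γ) • ui) := by
  have h1 : ∀ b : E N, dN 0 b = 1 := fun b => by simp [dN, sqrtCut_one]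
  simp [drhs, dr, dn, dnSq, dk, h1, sqrtCut_one, sub_eq_add_neg, add_smul]

/-- The unit vector `N_i u_i + (ε/2) b_i`. -/
def sig (ε : ℝ) (u b : E N) : E N := dN ε b • u + (ε / 2) • b

/-- The unit vector `N_i u_i - (ε/2) b_i`. -/
def edge (ε : ℝ) (u b : E N) : E N := dN ε b • u - (ε / 2) • b

theorem erefl_sig {ε : ℝ} {u b : E N} (hu : inner ℝ u u = (1 : ℝ)) (hb : inner ℝ b u = (0 : ℝ)) :
    erefl u (sig ε u b) = -edge ε u b := by
  rw [erefl_apply, sig, edge, inner_add_right, real_inner_smul_right, real_inner_smul_right, hu,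
    real_inner_comm, hb]
  module

theorem inner_sig_self {ε : ℝ} {u b : E N} (hu : inner ℝ u u = (1 : ℝ))
    (hb : inner ℝ b u = (0 : ℝ)) (hN : dN ε b ^ 2 = 1 - ε ^ 2 / 4 * ‖b‖ ^ 2) :
    inner ℝ (sig ε u b) (sig ε u b) = (1 : ℝ) := by
  have hb' : inner ℝ u b = (0 : ℝ) := by rw [real_inner_comm, hb]
  simp only [sig, inner_add_left, inner_add_right, real_inner_smul_left, real_inner_smul_right,
    hu, hb, hb']
  rw [real_inner_self_eq_norm_sq]
  linarith

/-- The generator of the rotation of the discrete frame. -/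
def rotGen (ε : ℝ) (u b : E N) : E N →L[ℝ] E N :=
  (innerSL ℝ b).smulRight (edge ε u b) -
    (innerSL ℝ u).smulRight ((ε / 2 * ‖b‖ ^ 2) • u + dN ε b • b)

theorem rotGen_apply (ε : ℝ) (u b z : E N) :
    rotGen ε u b z = (inner ℝ b z : ℝ) • edge ε u b -
      (inner ℝ u z : ℝ) • ((ε / 2 * ‖b‖ ^ 2) • u + dN ε b • b) := by
  simp [rotGen]

theorem rotGen_zero (u b z : E N) :
    rotGen 0 u b z = (inner ℝ b z : ℝ) • u - (inner ℝ u z : ℝ) • b := by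
  simp [rotGen_apply, edge, dN, sqrtCut_one]

/-- The two reflections have almost the same axis, so their product is a rotation close to the
identity. The relation for `dN ε b ^ 2` removes the term of order zero and makes the deviation `ε`
times a generator that is smooth in `ε`. -/
theorem erefl_comp_erefl_sig {ε : ℝ} {u b : E N} (hu : inner ℝ u u = (1 : ℝ))
    (hb : inner ℝ b u = (0 : ℝ)) (hN : dN ε b ^ 2 = 1 - ε ^ 2 / 4 * ‖b‖ ^ 2) :
    erefl u ∘L erefl (sig ε u b) = ContinuousLinearMap.id ℝ _ + ε • rotGen ε u b := by
  ext1 z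
  have h1 : erefl u (erefl (sig ε u b) z) =
      erefl u z + (2 * inner ℝ (sig ε u b) z) • edge ε u b := by
    rw [erefl_apply (sig ε u b), map_sub, map_smul, erefl_sig hu hb]; module
  have h2 : inner ℝ (sig ε u b) z = dN ε b * inner ℝ u z + ε / 2 * inner ℝ b z := by
    simp [sig, inner_add_left, real_inner_smul_left]
  simp only [ContinuousLinearMap.comp_apply, add_apply,
    smul_apply, ContinuousLinearMap.id_apply]
  rw [h1, h2, erefl_apply, rotGen_apply, edge]
  have h3 : (2 * (dN ε b * inner ℝ u z + ε / 2 * inner ℝ b z)) • (dN ε b • u - (ε / 2) • b) =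
      (2 * inner ℝ u z * dN ε b ^ 2 + ε * inner ℝ b z * dN ε b) • u -
        ((dN ε b * inner ℝ u z + ε / 2 * inner ℝ b z) * ε) • b := by module
  rw [h3, hN]
  module

section Step

variable {ε γ : ℝ} {ui uj : E N} {own other : ℝ × E N}

/-- The scalar product of the reflected vectors of the two directions. -/
theorem inner_erefl_sig (hi : inner ℝ ui ui = (1 : ℝ)) (hj : inner ℝ uj uj = (1 : ℝ))
    (hij : inner ℝ ui uj = (0 : ℝ)) (ho : inner ℝ own.2 uj = (0 : ℝ))
    (ho' : inner ℝ other.2 ui = (0 : ℝ)) :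
    ε * dr ε γ ui own.2 other.2 + ε * dr ε (-γ) uj other.2 own.2 =
      -(2 * inner ℝ (erefl uj (sig ε ui other.2)) (erefl ui (sig ε uj own.2))) := by
  have hji : inner ℝ uj ui = (0 : ℝ) := by rw [real_inner_comm, hij]
  have h1 : erefl uj (sig ε ui other.2) =
      dN ε other.2 • ui + (ε / 2) • other.2 - (ε * inner ℝ other.2 uj) • uj := by
    rw [erefl_apply, sig, inner_add_right, real_inner_smul_right, real_inner_smul_right, hji,
      real_inner_comm uj]
    module
  have h2 : erefl ui (sig ε uj own.2) =
      dN ε own.2 • uj + (ε / 2) • own.2 - (ε * inner ℝ own.2 ui) • ui := by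
    rw [erefl_apply, sig, inner_add_right, real_inner_smul_right, real_inner_smul_right, hij,
      real_inner_comm ui]
    module
  rw [h1, h2]
  simp only [inner_add_left, inner_add_right, inner_sub_left, inner_sub_right,
    real_inner_smul_left, real_inner_smul_right, hi, hj, hij, hji, ho, ho',
    real_inner_comm own.2 ui, real_inner_comm own.2 uj, real_inner_comm own.2 other.2]
  simp only [real_inner_comm ui own.2, real_inner_comm uj other.2, dr]
  rw [real_inner_comm own.2 other.2]
  ring

/-- Rationalizing, `(1 - n) / (ε n) = (1 - n²) / (ε n (1 + n))`, and `1 - n²` carries a factor `ε²`;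
so the definition of `dk` needs no division by `ε`. -/
theorem one_add_dk (hn : 1 / 2 ≤ dnSq ε γ ui uj own.2 other.2) :
    1 + ε * dk ε γ ui uj own.2 other.2 = (dn ε γ ui uj own.2 other.2)⁻¹ := by
  have h1 := dn_pos ε γ ui uj own.2 other.2
  have h2 : dn ε γ ui uj own.2 other.2 ^ 2 = dnSq ε γ ui uj own.2 other.2 := sqrtCut_sq hn
  rw [dk]
  rw [dnSq] at h2
  field_simp
  nlinarith

/-- One step of the evolution of the vector `σ_j` in the direction `i`. -/
theorem sig_step (hi : inner ℝ ui ui = (1 : ℝ)) (hj : inner ℝ uj uj = (1 : ℝ))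
    (hij : inner ℝ ui uj = (0 : ℝ)) (ho : inner ℝ own.2 uj = (0 : ℝ))
    (ho' : inner ℝ other.2 ui = (0 : ℝ))
    (hNi : dN ε other.2 ^ 2 = 1 - ε ^ 2 / 4 * ‖other.2‖ ^ 2)
    (hNj : dN ε own.2 ^ 2 = 1 - ε ^ 2 / 4 * ‖own.2‖ ^ 2)
    (hn : 1 / 2 ≤ dnSq ε γ ui uj own.2 other.2)
    (hpos : ε ^ 2 / 2 * dr ε γ ui own.2 other.2 * inner ℝ other.2 uj < dN ε own.2)
    (hN' : 1 / 2 ≤ 1 - ε ^ 2 / 4 * ‖(own + ε • drhs ε γ ui uj own other).2‖ ^ 2) :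
    (own + ε • drhs ε γ ui uj own other).1 = (dn ε γ ui uj own.2 other.2)⁻¹ *
        (own.1 + ε * dr ε γ ui own.2 other.2 * other.1) ∧
      inner ℝ (own + ε • drhs ε γ ui uj own other).2 uj = (0 : ℝ) ∧
      sig ε uj (own + ε • drhs ε γ ui uj own other).2 = (dn ε γ ui uj own.2 other.2)⁻¹ •
        (erefl ui (sig ε uj own.2) +
          (ε * dr ε γ ui own.2 other.2) • erefl uj (sig ε ui other.2)) := by
  have hk := one_add_dk hn
  have hn0 := dn_pos ε γ ui uj own.2 other.2
  have hn2 : dn ε γ ui uj own.2 other.2 ^ 2 = dnSq ε γ ui uj own.2 other.2 := sqrtCut_sq hn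
  have hg := inner_erefl_sig (ε := ε) (γ := γ) hi hj hij ho ho'
  have hji : inner ℝ uj ui = (0 : ℝ) := by rw [real_inner_comm, hij]
  set n := dn ε γ ui uj own.2 other.2 with hnd
  set r := dr ε γ ui own.2 other.2 with hr
  set k := dk ε γ ui uj own.2 other.2 with hkd
  set t := erefl ui (sig ε uj own.2) with ht
  set q := erefl uj (sig ε ui other.2) with hq
  set b' := (own + ε • drhs ε γ ui uj own other).2 with hb'
  have hb'e : b' = n⁻¹ • own.2 + (ε * r / n) • (other.2 - inner ℝ other.2 uj • uj) +
      (ε * ((-(ε / 2 * ‖other.2‖ ^ 2 * inner ℝ own.2 ui) -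
        dN ε other.2 * (inner ℝ own.2 other.2 / 2 - γ)) / n)) • ui := by
    rw [hb', ← hk]
    simp only [drhs, Prod.snd_add, Prod.smul_snd, ← hnd, ← hr, ← hkd]
    module
  have hperp : inner ℝ b' uj = (0 : ℝ) := by
    rw [hb'e]
    simp only [inner_add_left, inner_sub_left, real_inner_smul_left, ho, hij, hj]
    ring
  have hte : t = dN ε own.2 • uj + (ε / 2) • own.2 - (ε * inner ℝ own.2 ui) • ui := by
    rw [ht, erefl_apply, sig, inner_add_right, real_inner_smul_right, real_inner_smul_right, hij,
      real_inner_comm ui]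
    module
  have hqe : q = dN ε other.2 • ui + (ε / 2) • other.2 - (ε * inner ℝ other.2 uj) • uj := by
    rw [hq, erefl_apply, sig, inner_add_right, real_inner_smul_right, real_inner_smul_right, hji,
      real_inner_comm uj]
    module
  -- the evolved vector
  set v := n⁻¹ • (t + (ε * r) • q) with hv
  set c := n⁻¹ * (dN ε own.2 - ε ^ 2 / 2 * r * inner ℝ other.2 uj) with hc
  have hve : v = c • uj + (ε / 2) • b' := by
    -- The coefficients of `u_i` on both sides agree because `N_i² = 1 - ε²‖b_i‖²/4`. Thus the last
    -- term of `drhs` is the factor that produces `v`, written without dividing by `ε`.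
    have hu : ε / 2 * (ε * ((-(ε / 2 * ‖other.2‖ ^ 2 * inner ℝ own.2 ui) -
        dN ε other.2 * (inner ℝ own.2 other.2 / 2 - γ)) / n)) =
        n⁻¹ * (-(ε * inner ℝ own.2 ui) + ε * r * dN ε other.2) := by
      rw [hr, dr]
      have : ε * (dN ε other.2 * inner ℝ own.2 ui - ε / 2 * (inner ℝ own.2 other.2 / 2 - γ)) *
          dN ε other.2 = ε * inner ℝ own.2 ui * dN ε other.2 ^ 2 -
            ε ^ 2 / 2 * dN ε other.2 * (inner ℝ own.2 other.2 / 2 - γ) := by ring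
      rw [this, hNi]
      field_simp
      ring
    rw [hv, hb'e, smul_add (ε / 2), smul_smul (ε / 2) (ε * _), hu, hte, hqe, hc]
    have : ε * r / n = n⁻¹ * (ε * r) := by field_simp
    rw [this]
    module
  -- With `ρ = ε r` and `ρ'` the other one, `inner_erefl_sig` gives `1 + 2ρ⟨q, t⟩ + ρ² = 1 - ρρ' =
  -- n²`; hence dividing by `n` makes `v` a unit vector.
  have hvv : inner ℝ v v = (1 : ℝ) := by
    have htt : inner ℝ t t = (1 : ℝ) := by rw [ht, inner_erefl hi, inner_sig_self hj ho hNj]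
    have hqq : inner ℝ q q = (1 : ℝ) := by rw [hq, inner_erefl hj, inner_sig_self hi ho' hNi]
    have h1 : inner ℝ v v = n⁻¹ ^ 2 * (1 + 2 * (ε * r) * inner ℝ q t + (ε * r) ^ 2) := by
      rw [hv]
      simp only [inner_add_left, inner_add_right, real_inner_smul_left, real_inner_smul_right,
        htt, hqq, real_inner_comm q t]
      ring
    rw [h1, inv_pow, hn2, dnSq, ← hr]
    rw [dnSq, ← hr] at hn hn2
    have h2 : 2 * inner ℝ q t = -(ε * r + ε * dr ε (-γ) uj other.2 own.2) := by linarith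
    have h3 : 1 + 2 * (ε * r) * inner ℝ q t + (ε * r) ^ 2 =
        1 - ε ^ 2 * (r * dr ε (-γ) uj other.2 own.2) := by
      linear_combination (ε * r) * h2
    rw [h3]
    exact inv_mul_cancel₀ (by linarith)
  -- `v = c u_j + (ε/2) b'` is a unit vector and `b' ⊥ u_j`, so `c² = 1 - ε²‖b'‖²/4`. Positivity of
  -- `c` selects the root `N_j` at the new point.
  have hcpos : 0 < c := mul_pos (inv_pos.2 hn0) (by linarith)
  have hcN : c = dN ε b' := by
    rw [dN, sqrtCut_eq hN']
    symm
    rw [Real.sqrt_eq_iff_mul_self_eq (by linarith) hcpos.le]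
    have hperp' : inner ℝ uj b' = (0 : ℝ) := by rw [real_inner_comm, hperp]
    rw [hve] at hvv
    simp only [inner_add_left, inner_add_right, real_inner_smul_left, real_inner_smul_right, hj,
      hperp, hperp'] at hvv
    rw [real_inner_self_eq_norm_sq] at hvv
    linarith
  refine ⟨?_, hperp, ?_⟩
  · simp only [drhs, Prod.fst_add, Prod.smul_fst, smul_eq_mul, ← hnd, ← hr, ← hkd]
    have : own.1 + ε * (r / n * other.1 + k * own.1) =
        (1 + ε * k) * own.1 + n⁻¹ * (ε * r * other.1) := by field_simp; ring
    rw [this, hk]; ring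
  · rw [sig, ← hcN, ← hve]

end Step

end Rhs


/-! ### Solutions of lattice Goursat problems -/

section LatticeRecursion

variable {P Q : Type*}

/-- The solution of a lattice Goursat problem. -/
def latSol (F : Lat → P × Q → P) (G : Lat → P × Q → Q) (A : Lat → P) (B : Lat → Q) :
    ℕ → ℕ → P × Q
  | 0, 0 => (A 0, B 0)
  | m + 1, 0 => (F ![m, 0] (latSol F G A B m 0), B ![m + 1, 0])
  | 0, k + 1 => (A ![0, k + 1], G ![0, k] (latSol F G A B 0 k))
  | m + 1, k + 1 =>
    (F ![m, k + 1] (latSol F G A B m (k + 1)), G ![m + 1, k] (latSol F G A B (m + 1) k))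
  termination_by m k => m + k

theorem sh_zero_vec (m k : ℕ) : sh 0 ![m, k] = ![m + 1, k] := by
  ext i; fin_cases i <;> simp [sh]

theorem sh_one_vec (m k : ℕ) : sh 1 ![m, k] = ![m, k + 1] := by
  ext i; fin_cases i <;> simp [sh]

theorem lat_eta (n : Lat) : n = ![n 0, n 1] := by
  ext i; fin_cases i <;> rfl

theorem exists_lattice_goursat (F : Lat → P × Q → P) (G : Lat → P × Q → Q) (A : Lat → P)
    (B : Lat → Q) : ∃ (a : Lat → P) (b : Lat → Q), (∀ n, a (sh 0 n) = F n (a n, b n)) ∧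
      (∀ n, b (sh 1 n) = G n (a n, b n)) ∧ (∀ n, n 0 = 0 → a n = A n) ∧
      ∀ n, n 1 = 0 → b n = B n := by
  refine ⟨fun n => (latSol F G A B (n 0) (n 1)).1, fun n => (latSol F G A B (n 0) (n 1)).2,
    fun n => ?_, fun n => ?_, fun n hn => ?_, fun n hn => ?_⟩
  · rw [lat_eta n, sh_zero_vec]
    rcases n 1 with _ | k <;> simp [latSol]
  · rw [lat_eta n, sh_one_vec]
    rcases n 0 with _ | k <;> simp [latSol]
  · rw [lat_eta n, hn]
    rcases n 1 with _ | k
    · simp [latSol]; congr 1; ext i; fin_cases i <;> rfl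
    · simp [latSol]
  · rw [lat_eta n, hn]
    rcases n 0 with _ | k
    · simp [latSol]; congr 1; ext i; fin_cases i <;> rfl
    · simp [latSol]

/-- Parallel transport on a lattice box. -/
theorem exists_lattice_transport {A : Type*} [Monoid A] {ε r : ℝ} (hε : 0 < ε)
    (M : Fin 2 → Lat → A)
    (hM : ∀ n, sh 0 (sh 1 n) ∈ latBox ε r → M 1 (sh 0 n) * M 0 n = M 0 (sh 1 n) * M 1 n) (Ψ : A) :
    ∃ ψ : Lat → A, ψ 0 = Ψ ∧ ∀ i n, sh i n ∈ latBox ε r → ψ (sh i n) = M i n * ψ n := by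
  -- `a` transports `Ψ` along the first axis, and `ψ` then continues up the columns. The step in the
  -- direction `0` off the axis follows row by row from the compatibility `hM`.
  obtain ⟨a, _, ha, -, ha', -⟩ := exists_lattice_goursat (P := A) (Q := Unit)
    (fun n q => M 0 n * q.1) (fun _ _ => ()) (fun _ => Ψ) (fun _ => ())
  obtain ⟨_, ψ, -, hψ, -, hψ'⟩ := exists_lattice_goursat (P := Unit) (Q := A)
    (fun _ _ => ()) (fun n q => M 1 n * q.2) (fun _ => ()) a
  have h0 : ∀ k m, sh 0 ![m, k] ∈ latBox ε r → ψ (sh 0 ![m, k]) = M 0 ![m, k] * ψ ![m, k] := by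
    intro k
    induction k with
    | zero =>
      intro m _
      rw [hψ' _ (by simp [sh]), hψ' ![m, 0] (by simp), ha]
    | succ k ih =>
      intro m hm
      rw [← sh_one_vec, sh_comm 0 1, hψ, hψ, ih m, ← mul_assoc, ← mul_assoc, hM]
      · rwa [sh_one_vec]
      · refine latBox_of_le hε ?_ hm
        rw [← sh_one_vec, sh_comm]; exact le_sh _ _
  refine ⟨ψ, by rw [hψ' 0 rfl, ha' 0 rfl], fun i n hn => ?_⟩
  fin_cases i
  · have := h0 (n 1) (n 0)
    rw [← lat_eta n] at this
    exact this hn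
  · exact hψ n

/-- Induction along the two directions of a lattice Goursat problem. -/
theorem goursat_induction {ε r : ℝ} (hε : 0 < ε) {p : Fin 2 → Lat → Prop}
    (axis : ∀ j n, n ∈ latBox ε r → (∀ i, i ≠ j → n i = 0) → p j n)
    (step : ∀ i j, i ≠ j → ∀ n, sh i n ∈ latBox ε r → (∀ k, p k n) → p j (sh i n)) :
    ∀ j n, n ∈ latBox ε r → p j n := by
  have key : ∀ s : ℕ, ∀ n : Lat, n 0 + n 1 = s → n ∈ latBox ε r → ∀ j, p j n := by
    intro s
    induction s with
    | zero =>
      intro n hs hn j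
      refine axis j n hn fun i _ => ?_
      fin_cases i <;> simp <;> omega
    | succ s ih =>
      intro n hs hn j
      obtain ⟨i, hij, hi⟩ : ∃ i, i ≠ j ∧ ∀ i', i' ≠ j → i' = i := by
        fin_cases j
        · exact ⟨1, by decide, by decide⟩
        · exact ⟨0, by decide, by decide⟩
      by_cases h0 : n i = 0
      · exact axis j n hn fun i' hi' => by rw [hi i' hi', h0]
      · obtain ⟨m, rfl⟩ := exists_sh_of_ne_zero h0
        refine step i j hij m hn (ih m ?_ (mem_of_sh_mem hε hn))
        fin_cases i <;> simp [sh] at hs <;> omega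
  exact fun j n hn => key _ n rfl hn j

end LatticeRecursion

/-! ### Circular quadrilaterals -/

section Concyclic

variable {V : Type*} [NormedAddCommGroup V] [InnerProductSpace ℝ V]

/-- In the plane of `v` and `w` the first three points have a circumcentre `x + α v + β w`, found
from a linear system with Gram determinant `1 - g²`. The condition `hpq` says that the fourth point
has the same distance from it. -/
theorem concyclic_of_edges (x v w : V) {h k p q g : ℝ} (hv : inner ℝ v v = (1 : ℝ))
    (hw : inner ℝ w w = (1 : ℝ)) (hvw : inner ℝ v w = g) (hg : g ^ 2 < 1)
    (hpq : p ^ 2 + q ^ 2 + 2 * p * q * g = p * h + q * k) :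
    EuclideanGeometry.Concyclic ({x, x + h • v, x + k • w, x + (p • v + q • w)} : Set V) := by
  have hwv : inner ℝ w v = g := by rw [real_inner_comm, hvw]
  have hg' : 1 - g ^ 2 ≠ 0 := by linarith
  refine ⟨⟨x + (((h - g * k) / (2 * (1 - g ^ 2))) • v + ((k - g * h) / (2 * (1 - g ^ 2))) • w),
    ‖((h - g * k) / (2 * (1 - g ^ 2))) • v + ((k - g * h) / (2 * (1 - g ^ 2))) • w‖, ?_⟩, ?_⟩
  · set α := (h - g * k) / (2 * (1 - g ^ 2)) with hα
    set β := (k - g * h) / (2 * (1 - g ^ 2)) with hβ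
    have h1 : α + β * g = h / 2 := by rw [hα, hβ]; field_simp; ring
    have h2 : α * g + β = k / 2 := by rw [hα, hβ]; field_simp; ring
    have key : ∀ a b : ℝ, a ^ 2 + b ^ 2 + 2 * a * b * g = a * h + b * k →
        dist (x + (a • v + b • w)) (x + (α • v + β • w)) = ‖α • v + β • w‖ := by
      intro a b hab
      rw [dist_eq_norm, ← sq_eq_sq₀ (norm_nonneg _) (norm_nonneg _), ← real_inner_self_eq_norm_sq,
        ← real_inner_self_eq_norm_sq]
      simp only [inner_add_left, inner_add_right, inner_sub_left, inner_sub_right,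
        real_inner_smul_left, real_inner_smul_right, hv, hw, hvw, hwv]
      linear_combination hab - 2 * a * h1 - 2 * b * h2
    rintro y (rfl | rfl | rfl | rfl)
    · simp
    · simpa using key h 0 (by ring)
    · simpa using key 0 k (by ring)
    · exact key p q hpq
  · have hle : vectorSpan ℝ ({x, x + h • v, x + k • w, x + (p • v + q • w)} : Set V) ≤
        Submodule.span ℝ {v, w} := by
      rw [vectorSpan_eq_span_vsub_set_right ℝ (mem_insert x _), Submodule.span_le]
      have hv' : v ∈ Submodule.span ℝ {v, w} := Submodule.subset_span (by simp)
      have hw' : w ∈ Submodule.span ℝ {v, w} := Submodule.subset_span (by simp)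
      rintro _ ⟨y, (rfl | rfl | rfl | rfl), rfl⟩
      · simp
      · simpa using Submodule.smul_mem _ h hv'
      · simpa using Submodule.smul_mem _ k hw'
      · simpa using Submodule.add_mem _ (Submodule.smul_mem _ p hv') (Submodule.smul_mem _ q hw')
    refine (Submodule.rank_mono hle).trans ?_
    refine (rank_span_le _).trans ?_
    refine (Cardinal.mk_insert_le).trans ?_
    simp; norm_num

end Concyclic


/-! ### The discrete surface -/

section DiscreteSurface

variable {N : ℕ}

/-- The sign with which `γ` enters the evolution in the direction `i`. -/
def sgn (i : Fin 2) : ℝ := if i = 0 then 1 else -1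

theorem sgn_of_ne {i j : Fin 2} (h : i ≠ j) : sgn j = -sgn i := by
  fin_cases i <;> fin_cases j <;> simp [sgn] at h ⊢

/-- `W j = (h_j, b_j)` solves the discrete evolution equations on the lattice box, and stays in
the domain where the square roots are regular. -/
structure DiscreteSol (ε r : ℝ) (γ : Lat → ℝ) (u : Fin 2 → E N) (W : Fin 2 → Lat → ℝ × E N) :
    Prop where
  pos : 0 < ε
  unit : ∀ i, inner ℝ (u i) (u i) = (1 : ℝ)
  orth : ∀ i j, i ≠ j → inner ℝ (u i) (u j) = (0 : ℝ)
  step : ∀ i j, i ≠ j → ∀ n, sh i n ∈ latBox ε r →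
    W j (sh i n) = W j n + ε • drhs ε (sgn i * γ n) (u i) (u j) (W j n) (W i n)
  axis : ∀ j n, n ∈ latBox ε r → (∀ i, i ≠ j → n i = 0) → inner ℝ (W j n).2 (u j) = (0 : ℝ)
  hN : ∀ j, ∀ n ∈ latBox ε r, 1 / 2 ≤ 1 - ε ^ 2 / 4 * ‖(W j n).2‖ ^ 2
  hn : ∀ i j, i ≠ j → ∀ n ∈ latBox ε r,
    1 / 2 ≤ dnSq ε (sgn i * γ n) (u i) (u j) (W j n).2 (W i n).2
  hpos : ∀ i j, i ≠ j → ∀ n ∈ latBox ε r,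
    ε ^ 2 / 2 * dr ε (sgn i * γ n) (u i) (W j n).2 (W i n).2 * inner ℝ (W i n).2 (u j) <
      dN ε (W j n).2
  hg : ∀ i j, i ≠ j → ∀ n ∈ latBox ε r,
    (ε * dr ε (sgn i * γ n) (u i) (W j n).2 (W i n).2 +
      ε * dr ε (sgn j * γ n) (u j) (W i n).2 (W j n).2) ^ 2 < 4

/-- The vector `Σ_i` of the frame equation. -/
def bigSig (O : E N ≃ₗᵢ[ℝ] E N) (ε : ℝ) (u : E N) (W : ℝ × E N) : Mink N :=
  inj (O.symm (sig ε u W.2)) - (ε * W.1) • eInf N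

namespace DiscreteSol

variable {ε r : ℝ} {γ : Lat → ℝ} {u : Fin 2 → E N} {W : Fin 2 → Lat → ℝ × E N}

theorem dN_sq (D : DiscreteSol ε r γ u W) (j : Fin 2) {n : Lat} (hn : n ∈ latBox ε r) :
    dN ε (W j n).2 ^ 2 = 1 - ε ^ 2 / 4 * ‖(W j n).2‖ ^ 2 := sqrtCut_sq (D.hN j n hn)

/-- Orthogonality of `b_j` and `u_j` holds on the `j`-th axis and is reproduced by every step in the
other direction. -/
theorem perp (D : DiscreteSol ε r γ u W) :
    ∀ j n, n ∈ latBox ε r → inner ℝ (W j n).2 (u j) = (0 : ℝ) := by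
  have key : ∀ j n, n ∈ latBox ε r → (n ∈ latBox ε r → inner ℝ (W j n).2 (u j) = (0 : ℝ)) := by
    refine goursat_induction D.pos (fun j n hn hax _ => D.axis j n hn hax)
      fun i j hij n hn ih _ => ?_
    have hn' := mem_of_sh_mem D.pos hn
    have hN' := D.hN j _ hn
    rw [D.step i j hij n hn] at hN' ⊢
    exact (sig_step (D.unit i) (D.unit j) (D.orth i j hij) (ih j hn') (ih i hn') (D.dN_sq i hn')
      (D.dN_sq j hn') (D.hn i j hij n hn') (D.hpos i j hij n hn') hN').2.1
  exact fun j n hn => key j n hn hn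

theorem sig_sh (D : DiscreteSol ε r γ u W) {i j : Fin 2} (hij : i ≠ j) {n : Lat}
    (hn : sh i n ∈ latBox ε r) :
    (W j (sh i n)).1 = (dn ε (sgn i * γ n) (u i) (u j) (W j n).2 (W i n).2)⁻¹ *
        ((W j n).1 + ε * dr ε (sgn i * γ n) (u i) (W j n).2 (W i n).2 * (W i n).1) ∧
      sig ε (u j) (W j (sh i n)).2 = (dn ε (sgn i * γ n) (u i) (u j) (W j n).2 (W i n).2)⁻¹ •
        (erefl (u i) (sig ε (u j) (W j n).2) +
          (ε * dr ε (sgn i * γ n) (u i) (W j n).2 (W i n).2) •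
            erefl (u j) (sig ε (u i) (W i n).2)) := by
  have hn' := mem_of_sh_mem D.pos hn
  have hN' := D.hN j _ hn
  rw [D.step i j hij n hn] at hN' ⊢
  have := sig_step (D.unit i) (D.unit j) (D.orth i j hij) (D.perp j n hn') (D.perp i n hn')
    (D.dN_sq i hn') (D.dN_sq j hn') (D.hn i j hij n hn') (D.hpos i j hij n hn') hN'
  exact ⟨this.1, this.2.2⟩

theorem inner_sig (D : DiscreteSol ε r γ u W) (j : Fin 2) {n : Lat} (hn : n ∈ latBox ε r) :
    inner ℝ (sig ε (u j) (W j n).2) (sig ε (u j) (W j n).2) = (1 : ℝ) :=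
  inner_sig_self (D.unit j) (D.perp j n hn) (D.dN_sq j hn)

variable (O : E N ≃ₗᵢ[ℝ] E N)

theorem symm_erefl (a s : E N) : O.symm (erefl a s) = erefl (O.symm a) (O.symm s) := by
  simp [erefl_apply, O.symm.inner_map_map]

theorem mrefl_bigSig (a : E N) (v : E N) (h : ℝ × E N) :
    mrefl (inj (O.symm a)) (bigSig O ε v h) =
      inj (O.symm (erefl a (sig ε v h.2))) - (ε * h.1) • eInf N := by
  rw [bigSig, sub_eq_add_neg, ← neg_smul, mrefl_add, mrefl_smul, mrefl_inj_inj, mrefl_inj_eInf,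
    symm_erefl]
  module

/-- The Minkowski form of `sig_sh`: the evolution of `h_j` is the `e_∞`-component, that of `b_j` the
Euclidean component. The reflections in Euclidean vectors do not touch `e_∞`. -/
theorem bigSig_sh (D : DiscreteSol ε r γ u W) {i j : Fin 2} (hij : i ≠ j) {n : Lat}
    (hn : sh i n ∈ latBox ε r) :
    bigSig O ε (u j) (W j (sh i n)) = (dn ε (sgn i * γ n) (u i) (u j) (W j n).2 (W i n).2)⁻¹ •
      (mrefl (inj (O.symm (u i))) (bigSig O ε (u j) (W j n)) +
        (ε * dr ε (sgn i * γ n) (u i) (W j n).2 (W i n).2) •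
          mrefl (inj (O.symm (u j))) (bigSig O ε (u i) (W i n))) := by
  obtain ⟨h1, h2⟩ := D.sig_sh hij hn
  rw [mrefl_bigSig, mrefl_bigSig, bigSig, h1, h2, map_smul, map_add, map_smul]
  have hs : ∀ (c : ℝ) (z : E N), (inj (c • z) : Mink N) = c • inj z := fun c z => by simp [inj]
  have ha : ∀ y z : E N, (inj (y + z) : Mink N) = inj y + inj z := fun c z => by simp [inj]
  rw [hs, ha, hs]
  module

theorem lorentz_inj (a b : E N) : lorentz N (inj a) (inj b) = inner ℝ a b := by
  simpa using lorentz_inj_sub a b 0 0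

theorem lorentz_bigSig (D : DiscreteSol ε r γ u W) (j : Fin 2) {n : Lat} (hn : n ∈ latBox ε r) :
    lorentz N (bigSig O ε (u j) (W j n)) (bigSig O ε (u j) (W j n)) = 1 := by
  rw [bigSig, lorentz_inj_sub, O.symm.inner_map_map, D.inner_sig j hn]

theorem sum_rho (D : DiscreteSol ε r γ u W) {i j : Fin 2} (hij : i ≠ j) {n : Lat}
    (hn : n ∈ latBox ε r) :
    ε * dr ε (sgn i * γ n) (u i) (W j n).2 (W i n).2 +
      ε * dr ε (sgn j * γ n) (u j) (W i n).2 (W j n).2 =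
      -(2 * inner ℝ (erefl (u j) (sig ε (u i) (W i n).2)) (erefl (u i) (sig ε (u j) (W j n).2))) := by
  rw [← inner_erefl_sig (γ := sgn i * γ n) (D.unit i) (D.unit j) (D.orth i j hij) (D.perp j n hn)
    (D.perp i n hn), sgn_of_ne hij, neg_mul]

/-- The element of the Clifford algebra which describes the step in the direction `i`. -/
def stepElt (ε : ℝ) (u : Fin 2 → E N) (W : Fin 2 → Lat → ℝ × E N) (i : Fin 2) (n : Lat) : Cl N :=
  -(emb (bigSig O ε (u i) (W i n)) * emb (inj (O.symm (u i))))

/-- The discrete connection is flat. By `bigSig_sh` and the symmetry of `n` both sides have the form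
treated in `frame_compat`, and `sum_rho` is its hypothesis. -/
theorem stepElt_compat (D : DiscreteSol ε r γ u W) {n : Lat} (hn : sh 0 (sh 1 n) ∈ latBox ε r) :
    stepElt O ε u W 1 (sh 0 n) * stepElt O ε u W 0 n =
      stepElt O ε u W 0 (sh 1 n) * stepElt O ε u W 1 n := by
  have hn1 : sh 1 n ∈ latBox ε r := mem_of_sh_mem D.pos hn
  have hn0 : sh 0 n ∈ latBox ε r := mem_of_sh_mem D.pos (by rwa [sh_comm] at hn)
  have hnn := mem_of_sh_mem D.pos hn0
  have h01 : (0 : Fin 2) ≠ 1 := by decide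
  have hdn : dn ε (sgn 1 * γ n) (u 1) (u 0) (W 0 n).2 (W 1 n).2 =
      dn ε (sgn 0 * γ n) (u 0) (u 1) (W 1 n).2 (W 0 n).2 := by
    rw [sgn_of_ne h01, neg_mul, dn_swap]
  simp only [stepElt, neg_mul_neg]
  rw [D.bigSig_sh O h01 hn0, D.bigSig_sh O h01.symm hn1, hdn]
  have hu : ∀ i j, lorentz N (inj (O.symm (u i))) (inj (O.symm (u j))) = inner ℝ (u i) (u j) :=
    fun i j => by rw [lorentz_inj, O.symm.inner_map_map]
  refine frame_compat ((hu 0 0).trans (D.unit 0)) ((hu 1 1).trans (D.unit 1))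
    ((hu 0 1).trans (D.orth 0 1 h01)) ?_ (D.lorentz_bigSig O 0 hnn) (D.lorentz_bigSig O 1 hnn)
  rw [mrefl_bigSig, mrefl_bigSig, lorentz_inj_sub, O.symm.inner_map_map]
  exact D.sum_rho h01 hnn

theorem exists_frame (D : DiscreteSol ε r γ u W) (Ψ : Cl N) :
    ∃ ψ : Lat → Cl N, ψ 0 = Ψ ∧
      ∀ i n, sh i n ∈ latBox ε r → ψ (sh i n) = stepElt O ε u W i n * ψ n :=
  exists_lattice_transport D.pos _ (fun _ hn => D.stepElt_compat O hn) Ψ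

variable {O} {Ψ : Cl N} {ψ : Lat → Cl N} {x₀ : E N}

theorem mem_HInf (D : DiscreteSol ε r γ u W) (h0 : ψ 0 ∈ HInf N)
    (hψ : ∀ i n, sh i n ∈ latBox ε r → ψ (sh i n) = stepElt O ε u W i n * ψ n) :
    ∀ n ∈ latBox ε r, ψ n ∈ HInf N := by
  refine lat_induction (fun _ => h0) fun i n ih hn => ?_
  have hn' := mem_of_sh_mem D.pos hn
  rw [hψ i n hn]
  refine mem_HInf_step (D.lorentz_bigSig O i hn') ?_ ?_ ?_ (ih hn')
  · rw [lorentz_inj, O.symm.inner_map_map, D.unit]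
  · simp [bigSig, lorentz_apply, inj, eInf]
  · simp [lorentz_apply, inj, eInf]

theorem frame_sh (D : DiscreteSol ε r γ u W)
    (hψ : ∀ i n, sh i n ∈ latBox ε r → ψ (sh i n) = stepElt O ε u W i n * ψ n) {i : Fin 2} {n : Lat}
    (hn : sh i n ∈ latBox ε r) {x : E N} {R : E N →L[ℝ] E N} (h : IsFrame O (ψ n) x R) :
    IsFrame O (ψ (sh i n)) (x + (ε * (W i n).1) • R (edge ε (u i) (W i n).2))
      (R ∘L erefl (u i) ∘L erefl (sig ε (u i) (W i n).2)) := by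
  have hn' := mem_of_sh_mem D.pos hn
  have := h.step (a := O.symm (u i)) (s := O.symm (sig ε (u i) (W i n).2))
    (by rw [O.symm.inner_map_map, D.unit]) (by rw [O.symm.inner_map_map, D.inner_sig i hn'])
    (ε * (W i n).1)
  rw [O.apply_symm_apply, O.apply_symm_apply, erefl_sig (D.unit i) (D.perp i n hn'), map_neg,
    smul_neg, sub_neg_eq_add] at this
  rw [hψ i n hn]
  exact this

theorem exists_surface (D : DiscreteSol ε r γ u W) (h0 : IsFrame O (ψ 0) x₀ (.id ℝ _))
    (hψ : ∀ i n, sh i n ∈ latBox ε r → ψ (sh i n) = stepElt O ε u W i n * ψ n) :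
    ∃ c : Lat → E N × (E N →L[ℝ] E N), (∀ n ∈ latBox ε r, IsFrame O (ψ n) (c n).1 (c n).2) ∧
      c 0 = (x₀, .id ℝ _) := by
  have h : ∀ n, ∃ c : E N × (E N →L[ℝ] E N), (n ∈ latBox ε r → IsFrame O (ψ n) c.1 c.2) ∧
      (n = 0 → c = (x₀, .id ℝ _)) := by
    refine lat_induction ⟨(x₀, .id ℝ _), fun _ => h0, fun _ => rfl⟩ fun i n ⟨c, hc, _⟩ => ?_
    refine ⟨(c.1 + (ε * (W i n).1) • c.2 (edge ε (u i) (W i n).2),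
      c.2 ∘L erefl (u i) ∘L erefl (sig ε (u i) (W i n).2)),
      fun hn => D.frame_sh hψ hn (hc (mem_of_sh_mem D.pos hn)), fun hn => ?_⟩
    have := congrFun hn i
    simp [sh] at this
  choose c hc using h
  exact ⟨c, fun n => (hc n).1, (hc 0).2 rfl⟩

variable {c : Lat → E N × (E N →L[ℝ] E N)}

/-- `c n` was chosen along some lattice path to `n`. Since the Clifford element determines its
Euclidean frame, the step formula holds in both directions. -/
theorem surface_sh (D : DiscreteSol ε r γ u W)
    (hψ : ∀ i n, sh i n ∈ latBox ε r → ψ (sh i n) = stepElt O ε u W i n * ψ n)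
    (hc : ∀ n ∈ latBox ε r, IsFrame O (ψ n) (c n).1 (c n).2) {i : Fin 2} {n : Lat}
    (hn : sh i n ∈ latBox ε r) :
    c (sh i n) = ((c n).1 + (ε * (W i n).1) • (c n).2 (edge ε (u i) (W i n).2),
      (c n).2 ∘L erefl (u i) ∘L erefl (sig ε (u i) (W i n).2)) := by
  have := (hc _ hn).unique (D.frame_sh hψ hn (hc _ (mem_of_sh_mem D.pos hn)))
  exact Prod.ext this.1 this.2

theorem diff_surface (D : DiscreteSol ε r γ u W)
    (hψ : ∀ i n, sh i n ∈ latBox ε r → ψ (sh i n) = stepElt O ε u W i n * ψ n)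
    (hc : ∀ n ∈ latBox ε r, IsFrame O (ψ n) (c n).1 (c n).2) {i : Fin 2} {n : Lat}
    (hn : sh i n ∈ latBox ε r) :
    diff ε i c n = ((W i n).1 • (c n).2 (edge ε (u i) (W i n).2),
      (c n).2 ∘L rotGen ε (u i) (W i n).2) := by
  have hn' := mem_of_sh_mem D.pos hn
  have hε := D.pos.ne'
  rw [diff, D.surface_sh hψ hc hn,
    erefl_comp_erefl_sig (D.unit i) (D.perp i n hn') (D.dN_sq i hn')]
  ext1
  · simp [smul_smul, hε]
  · simp [smul_smul, hε, ContinuousLinearMap.comp_add]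

/-- The vertices lie in the plane of the two edge directions at `x`: by `hw` the edge opposite to
the second one points in a direction `ν⁻¹(w + ρ' v)`. After substituting the lengths, the circle
condition reduces to `ν² = 1 - ρρ'` and `ρ + ρ' = -2g`. -/
theorem isDiscreteCSurface (D : DiscreteSol ε r γ u W)
    (hψ : ∀ i n, sh i n ∈ latBox ε r → ψ (sh i n) = stepElt O ε u W i n * ψ n)
    (hc : ∀ n ∈ latBox ε r, IsFrame O (ψ n) (c n).1 (c n).2) :
    IsDiscreteCSurface ε r fun n => (c n).1 := by
  intro n hn
  have hn1 : sh 1 n ∈ latBox ε r := mem_of_sh_mem D.pos hn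
  have hn01 : sh 1 (sh 0 n) ∈ latBox ε r := by rwa [sh_comm] at hn
  have hn0 : sh 0 n ∈ latBox ε r := mem_of_sh_mem D.pos hn01
  have hnn := mem_of_sh_mem D.pos hn0
  have h01 : (0 : Fin 2) ≠ 1 := by decide
  have hiso := (hc n hnn).iso
  have e0 := erefl_sig (D.unit 0) (D.perp 0 n hnn) (ε := ε)
  have e1 := erefl_sig (D.unit 1) (D.perp 1 n hnn) (ε := ε)
  have hee : ∀ i, inner ℝ (edge ε (u i) (W i n).2) (edge ε (u i) (W i n).2) = (1 : ℝ) := fun i => by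
    have h := inner_erefl (D.unit i) (sig ε (u i) (W i n).2) (sig ε (u i) (W i n).2)
    rwa [erefl_sig (D.unit i) (D.perp i n hnn), inner_neg_neg, D.inner_sig i hnn] at h
  -- the commuting reflections
  have hcomm : ∀ z, erefl (u 1) (erefl (u 0) z) = erefl (u 0) (erefl (u 1) z) := fun z => by
    have h10 : inner ℝ (u 1) (u 0) = (0 : ℝ) := D.orth 1 0 h01.symm
    have h01' : inner ℝ (u 0) (u 1) = (0 : ℝ) := D.orth 0 1 h01
    simp only [erefl_apply, inner_sub_right, real_inner_smul_right, h10, h01']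
    module
  have hself : ∀ i z, erefl (u i) (erefl (u i) z) = z := fun i z => by
    rw [erefl_apply, inner_erefl_self (D.unit i), erefl_apply]; module
  have hsym : ∀ i y z, inner ℝ (erefl (u i) y) z = (inner ℝ y (erefl (u i) z) : ℝ) := fun i y z => by
    rw [← hself i z, inner_erefl (D.unit i), hself]
  set g : ℝ := inner ℝ (edge ε (u 0) (W 0 n).2) (edge ε (u 1) (W 1 n).2) with hgd
  set ρ := ε * dr ε (sgn 0 * γ n) (u 0) (W 1 n).2 (W 0 n).2 with hρ
  set ρ' := ε * dr ε (sgn 1 * γ n) (u 1) (W 0 n).2 (W 1 n).2 with hρ'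
  have hsum : ρ + ρ' = -(2 * g) := by
    rw [hρ, hρ', D.sum_rho h01 hnn, hgd, ← inner_neg_neg (edge ε (u 0) (W 0 n).2), ← e0, ← e1,
      hsym 1, hcomm, ← hsym 0]
  -- The bound on `ρ + ρ'` keeps the two edge directions linearly independent.
  have hg2 : g ^ 2 < 1 := by
    have := D.hg 0 1 h01 n hnn
    rw [← hρ, ← hρ', hsum] at this
    nlinarith
  have hν2 : dn ε (sgn 0 * γ n) (u 0) (u 1) (W 1 n).2 (W 0 n).2 ^ 2 = 1 - ρ * ρ' := by
    rw [dn, sqrtCut_sq (D.hn 0 1 h01 n hnn), dnSq, hρ, hρ', sgn_of_ne h01, neg_mul]; ring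
  have hν0 := dn_pos ε (sgn 0 * γ n) (u 0) (u 1) (W 1 n).2 (W 0 n).2
  obtain ⟨hh, hs⟩ := D.sig_sh h01 hn0
  set ν := dn ε (sgn 0 * γ n) (u 0) (u 1) (W 1 n).2 (W 0 n).2 with hν
  rw [← hρ] at hh hs
  have hx0 : (c (sh 0 n)).1 = (c n).1 + (ε * (W 0 n).1) • (c n).2 (edge ε (u 0) (W 0 n).2) := by
    rw [D.surface_sh hψ hc hn0]
  have hx1 : (c (sh 1 n)).1 = (c n).1 + (ε * (W 1 n).1) • (c n).2 (edge ε (u 1) (W 1 n).2) := by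
    rw [D.surface_sh hψ hc hn1]
  -- The new edge is expressed through `σ_1` at the shifted point, whose evolution is known. The
  -- reflections of the frame step then undo those in `sig_sh`, up to a multiple of the first edge.
  have hw : (c (sh 0 n)).2 (edge ε (u 1) (W 1 (sh 0 n)).2) =
      ν⁻¹ • ((c n).2 (edge ε (u 1) (W 1 n).2) + ρ' • (c n).2 (edge ε (u 0) (W 0 n).2)) := by
    rw [D.surface_sh hψ hc hn0]
    simp only [ContinuousLinearMap.comp_apply]
    rw [← neg_neg (edge ε (u 1) (W 1 (sh 0 n)).2), ← erefl_sig (D.unit 1) (D.perp 1 _ hn0), hs]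
    rw [← map_smul (c n).2 ρ', ← map_add (c n).2, ← map_smul (c n).2]
    congr 1
    have h1 : erefl (u 0) (erefl (sig ε (u 0) (W 0 n).2) (sig ε (u 0) (W 0 n).2)) =
        edge ε (u 0) (W 0 n).2 := by
      rw [erefl_self (D.inner_sig 0 hnn), map_neg, e0, neg_neg]
    have h2 : erefl (u 0) (erefl (sig ε (u 0) (W 0 n).2)
        (erefl (u 1) (erefl (u 0) (sig ε (u 1) (W 1 n).2)))) =
        -edge ε (u 1) (W 1 n).2 + (2 * g) • edge ε (u 0) (W 0 n).2 := by
      rw [hcomm, e1, map_neg, map_neg, map_neg, erefl_apply (sig _ _ _), ← hsym, e0,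
        map_sub, hself, map_smul, e0, inner_neg_left, ← hgd]
      module
    simp only [map_smul, map_add, map_neg, hself, h1, h2, eq_sub_of_add_eq' hsum]
    module
  have hx : (c (sh 0 (sh 1 n))).1 = (c n).1 +
      ((ε * ((W 0 n).1 + (ν⁻¹ ^ 2 * ((W 1 n).1 + ρ * (W 0 n).1)) * ρ')) •
          (c n).2 (edge ε (u 0) (W 0 n).2) +
        (ε * (ν⁻¹ ^ 2 * ((W 1 n).1 + ρ * (W 0 n).1))) • (c n).2 (edge ε (u 1) (W 1 n).2)) := by
    rw [sh_comm, D.surface_sh hψ hc hn01]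
    simp only
    rw [hw, hx0, hh]
    module
  have hk : (ν⁻¹ ^ 2 * ((W 1 n).1 + ρ * (W 0 n).1)) * (1 - ρ * ρ') = (W 1 n).1 + ρ * (W 0 n).1 := by
    rw [← hν2]; field_simp
  simp only [hx, hx0, hx1]
  set k := ν⁻¹ ^ 2 * ((W 1 n).1 + ρ * (W 0 n).1) with hkd
  refine concyclic_of_edges _ _ _ ((hiso _ _).trans (hee 0)) ((hiso _ _).trans (hee 1))
    ((hiso _ _).trans hgd.symm) hg2 ?_
  have hg' : g = -(ρ + ρ') / 2 := by rw [hsum]; ring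
  rw [hg']
  linear_combination (ε ^ 2 * k) * hk

end DiscreteSol

end DiscreteSurface


/-! ### The discrete Goursat problem in coordinates -/

section Coordinates

variable {N : ℕ} (hN : 2 ≤ N) (O : E N ≃ₗᵢ[ℝ] E N)

/-- The tangent vectors of the coordinate axes at the origin. -/
def axVec (i : Fin 2) : E N := O (EuclideanSpace.single (ax hN i) 1)

/-- The coordinates of a solution of the discrete evolution equations. -/
def fieldsOf (ψ : Lat → Cl N) (W : Fin 2 → Lat → ℝ × E N) (γ : Lat → ℝ) : Fields N where
  ψ := ψ
  h i n := (W i n).1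
  β k i n := O.symm (W i n).2 k
  γ := γ

theorem symm_apply_ax (b : E N) (i : Fin 2) : O.symm b (ax hN i) = inner ℝ b (axVec hN O i) := by
  rw [axVec, ← O.symm.inner_map_map, O.symm_apply_apply, EuclideanSpace.inner_single_right]
  simp

theorem symm_axVec (i : Fin 2) : O.symm (axVec hN O i) = EuclideanSpace.single (ax hN i) 1 := by
  simp [axVec]

theorem sum_symm_mul (b b' : E N) : ∑ k, O.symm b k * O.symm b' k = inner ℝ b b' := by
  rw [← O.symm.inner_map_map, PiLp.inner_apply]
  simp [mul_comm]

theorem ax_injective {i j : Fin 2} (h : i ≠ j) : (ax hN i : Fin N) ≠ ax hN j := by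
  intro h'
  exact h (Fin.castLE_injective hN h')

theorem inner_axVec_self (i : Fin 2) : inner ℝ (axVec hN O i) (axVec hN O i) = (1 : ℝ) := by
  rw [axVec, O.inner_map_map, EuclideanSpace.inner_single_right]; simp

theorem inner_axVec_of_ne {i j : Fin 2} (h : i ≠ j) :
    inner ℝ (axVec hN O i) (axVec hN O j) = (0 : ℝ) := by
  rw [axVec, axVec, O.inner_map_map, EuclideanSpace.inner_single_right]
  simp [h.symm]

variable {ε r : ℝ} {γ : Lat → ℝ} {W : Fin 2 → Lat → ℝ × E N} {ψ : Lat → Cl N}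
  (D : DiscreteSol ε r γ (axVec hN O) W) {n : Lat} (hn : n ∈ latBox ε r)

include D hn

theorem DiscreteSol.symm_ax_self (i : Fin 2) : O.symm (W i n).2 (ax hN i) = 0 := by
  rw [symm_apply_ax, D.perp i n hn]

theorem DiscreteSol.sum_erase (i : Fin 2) :
    ∑ k ∈ Finset.univ.erase (ax hN i), O.symm (W i n).2 k ^ 2 = ‖(W i n).2‖ ^ 2 := by
  rw [Finset.sum_erase, ← real_inner_self_eq_norm_sq, ← sum_symm_mul O]
  · simp only [sq]
  · rw [D.symm_ax_self hN O hn]; simp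

theorem DiscreteSol.normSq_eq (i : Fin 2) :
    (fieldsOf O ψ W γ).normSq hN ε i n = 1 - ε ^ 2 / 4 * ‖(W i n).2‖ ^ 2 := by
  simp only [Fields.normSq, fieldsOf]
  rw [D.sum_erase hN O hn]

theorem DiscreteSol.nrm_eq (i : Fin 2) : (fieldsOf O ψ W γ).nrm hN ε i n = dN ε (W i n).2 := by
  rw [Fields.nrm, D.normSq_eq hN O hn, dN, sqrtCut_eq (D.hN i n hn)]

theorem DiscreteSol.theta_eq :
    (fieldsOf O ψ W γ).theta hN n = inner ℝ (W 0 n).2 (W 1 n).2 / 2 := by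
  simp only [Fields.theta, fieldsOf]
  rw [Finset.sum_filter_of_ne, sum_symm_mul O]
  · ring
  · intro k _ hk
    refine ⟨?_, ?_⟩ <;> rintro rfl <;> simp [D.symm_ax_self hN O hn] at hk

theorem DiscreteSol.rho_eq {i j : Fin 2} (hij : i ≠ j) : (fieldsOf O ψ W γ).rho hN ε i n =
    ε * dr ε (sgn i * γ n) (axVec hN O i) (W j n).2 (W i n).2 := by
  fin_cases i <;> fin_cases j <;> simp at hij
  · simp only [Fields.rho, Fields.rho12, D.nrm_eq hN O hn, D.theta_eq hN O hn, dr, sgn]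
    simp only [fieldsOf, symm_apply_ax, Fin.mk_one, Fin.zero_eta, if_true, real_inner_comm]
    ring
  · simp only [Fields.rho, Fields.rho21, D.nrm_eq hN O hn, D.theta_eq hN O hn, dr, sgn]
    simp only [fieldsOf, symm_apply_ax, Fin.mk_one, Fin.zero_eta, one_ne_zero, if_false]
    ring

theorem DiscreteSol.nuSq_eq {i j : Fin 2} (hij : i ≠ j) : (fieldsOf O ψ W γ).nuSq hN ε n =
    dnSq ε (sgn i * γ n) (axVec hN O i) (axVec hN O j) (W j n).2 (W i n).2 := by
  have h0 := D.rho_eq hN O hn (ψ := ψ) hij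
  have h1 := D.rho_eq hN O hn (ψ := ψ) hij.symm
  have : (fieldsOf O ψ W γ).rho12 hN ε n * (fieldsOf O ψ W γ).rho21 hN ε n =
      (fieldsOf O ψ W γ).rho hN ε i n * (fieldsOf O ψ W γ).rho hN ε j n := by
    fin_cases i <;> fin_cases j <;> simp [Fields.rho] at hij ⊢
    rw [mul_comm]
  rw [Fields.nuSq, this, h0, h1, dnSq, sgn_of_ne hij, neg_mul]
  ring

theorem DiscreteSol.nu_eq {i j : Fin 2} (hij : i ≠ j) : (fieldsOf O ψ W γ).nu hN ε n =
    dn ε (sgn i * γ n) (axVec hN O i) (axVec hN O j) (W j n).2 (W i n).2 := by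
  rw [Fields.nu, D.nuSq_eq hN O hn hij, dn, sqrtCut_eq (D.hn i j hij n hn)]

omit hn in
theorem DiscreteSol.diff_eq {i j : Fin 2} (hij : i ≠ j) (hn : sh i n ∈ latBox ε r) :
    diff ε i (W j) n =
      drhs ε (sgn i * γ n) (axVec hN O i) (axVec hN O j) (W j n) (W i n) := by
  rw [diff, D.step i j hij n hn, add_sub_cancel_left, smul_smul, inv_mul_cancel₀ D.pos.ne', one_smul]

theorem DiscreteSol.dk_eq {i j : Fin 2} (hij : i ≠ j) :
    dk ε (sgn i * γ n) (axVec hN O i) (axVec hN O j) (W j n).2 (W i n).2 =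
      (1 - dn ε (sgn i * γ n) (axVec hN O i) (axVec hN O j) (W j n).2 (W i n).2) /
        (ε * dn ε (sgn i * γ n) (axVec hN O i) (axVec hN O j) (W j n).2 (W i n).2) := by
  have h1 := one_add_dk (D.hn i j hij n hn)
  have h2 := dn_pos ε (sgn i * γ n) (axVec hN O i) (axVec hN O j) (W j n).2 (W i n).2
  have h3 := D.pos
  have h4 : dk ε (sgn i * γ n) (axVec hN O i) (axVec hN O j) (W j n).2 (W i n).2 =
    ((dn ε (sgn i * γ n) (axVec hN O i) (axVec hN O j) (W j n).2 (W i n).2)⁻¹ - 1) / ε := by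
    rw [← h1]; field_simp; ring
  rw [h4]; field_simp

theorem DiscreteSol.inj_sig_eq (i : Fin 2) :
    (inj (O.symm (sig ε (axVec hN O i) (W i n).2)) : Mink N) =
    dN ε (W i n).2 • e (ax hN i) + (ε / 2) • ∑ k ∈ Finset.univ.erase (ax hN i),
      O.symm (W i n).2 k • e k := by
  have h1 : O.symm (W i n).2 = ∑ k ∈ Finset.univ.erase (ax hN i),
      O.symm (W i n).2 k • EuclideanSpace.single k (1 : ℝ) := by
    rw [Finset.sum_erase]
    · ext l
      simp [Pi.single_apply]
    · rw [D.symm_ax_self hN O hn, zero_smul]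
  have h2 : (inj (O.symm (W i n).2) : Mink N) = ∑ k ∈ Finset.univ.erase (ax hN i),
      O.symm (W i n).2 k • e k := by
    conv_lhs => rw [h1]
    rw [show (inj : E N → Mink N) = LinearMap.inl ℝ (E N) (ℝ × ℝ) from rfl, map_sum]
    refine Finset.sum_congr rfl fun k _ => ?_
    rw [map_smul]; rfl
  rw [← h2, sig, map_add, map_smul, map_smul, symm_axVec]
  simp [inj, e]

/-- Expanding `-Σ_i e_i` with `e_i² = -1` turns the multiplicative frame step into the difference
equation for `ψ`. -/
theorem DiscreteSol.stepElt_eq (i : Fin 2) :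
    DiscreteSol.stepElt O ε (axVec hN O) W i n = 1 +
      ε • (algebraMap ℝ (Cl N) (((fieldsOf O ψ W γ).nrm hN ε i n - 1) / ε)
        - (1 / 2 : ℝ) • ∑ k ∈ Finset.univ.erase (ax hN i),
            (fieldsOf O ψ W γ).β k i n • (emb (e k) * emb (e (ax hN i)))
        + (fieldsOf O ψ W γ).h i n • (emb (eInf N) * emb (e (ax hN i)))) := by
  have hε := D.pos.ne'
  have hinj := D.inj_sig_eq hN O hn i
  have he : emb (e (ax hN i)) * emb (e (ax hN i)) = (-1 : Cl N) :=
    emb_mul_self_of_unit (by simp [lorentz_apply, e])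
  rw [DiscreteSol.stepElt, bigSig, hinj, symm_axVec, ← e_eq_inj, D.nrm_eq hN O hn]
  simp only [fieldsOf, emb, map_sub, map_add, map_smul, map_sum, sub_mul, add_mul, smul_mul_assoc,
    Finset.sum_mul] at he ⊢
  rw [he, Algebra.algebraMap_eq_smul_one]
  generalize ∑ k ∈ Finset.univ.erase (ax hN i), O.symm (W i n).2 k •
    ((CliffordAlgebra.ι (cliffordForm N)) (e k) *
      (CliffordAlgebra.ι (cliffordForm N)) (e (ax hN i))) = S
  simp only [smul_sub, smul_add, smul_smul, mul_div_cancel₀ _ hε]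
  module

omit hn
-- The vector equation for `b_j` is read in coordinates: its component along `u_i` is the equation
-- for `β_{ij}`, where the relation for `N_i²` is needed, and the components along the axes other
-- than `i`, `j` are the equations for `β_{kj}`.
theorem DiscreteSol.isGoursatSolution {Ψ : Cl N} {H : Fin 2 → ℝ → ℝ} {B : Fin N → Fin 2 → ℝ → ℝ}
    {Γ : (Fin 2 → ℝ) → ℝ} (hψ0 : ψ 0 = Ψ)
    (hψ : ∀ i n, sh i n ∈ latBox ε r → ψ (sh i n) = stepElt O ε (axVec hN O) W i n * ψ n)
    (hH : ∀ i, ∀ a : ℕ, Pi.single i a ∈ latBox ε r → (W i (Pi.single i a)).1 = H i (ε * a))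
    (hB : ∀ i k, k ≠ ax hN i → ∀ a : ℕ, Pi.single i a ∈ latBox ε r →
      O.symm (W i (Pi.single i a)).2 k = B k i (ε * a))
    (hΓ : ∀ n ∈ latBox ε r, γ n = Γ (pt ε n)) :
    IsGoursatSolution hN ε r Ψ H B Γ (fieldsOf O ψ W γ) where
  real_N i n hn := by rw [D.normSq_eq hN O hn]; linarith [D.hN i n hn]
  real_n n hn := by
    have h01 : (0 : Fin 2) ≠ 1 := by decide
    rw [D.nuSq_eq hN O hn h01]; linarith [D.hn 0 1 h01 n hn]
  eq_ψ i n hn := by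
    have hn' := mem_of_sh_mem D.pos hn
    have h := D.stepElt_eq hN O hn' (ψ := ψ) i
    set Z := algebraMap ℝ (Cl N) (((fieldsOf O ψ W γ).nrm hN ε i n - 1) / ε)
        - (1 / 2 : ℝ) • ∑ k ∈ Finset.univ.erase (ax hN i),
            (fieldsOf O ψ W γ).β k i n • (emb (e k) * emb (e (ax hN i)))
        + (fieldsOf O ψ W γ).h i n • (emb (eInf N) * emb (e (ax hN i)))
    change diff ε i ψ n = Z * ψ n
    rw [diff, hψ i n hn, h, add_mul, one_mul, add_sub_cancel_left, smul_mul_assoc, smul_smul,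
      inv_mul_cancel₀ D.pos.ne', one_smul]
  eq_h i j hij n hn := by
    have hn' := mem_of_sh_mem D.pos hn
    have h := congrArg Prod.fst (D.diff_eq hN O hij hn)
    rw [drhs, D.dk_eq hN O hn' hij] at h
    rw [D.nu_eq hN O hn' hij, D.rho_eq hN O hn' hij]
    have hε := D.pos.ne'
    have hd := (dn_pos ε (sgn i * γ n) (axVec hN O i) (axVec hN O j) (W j n).2 (W i n).2).ne'
    refine Eq.trans ?_ (h.trans ?_)
    · simp [diff, fieldsOf]
    · simp only [fieldsOf]
      rw [mul_div_mul_left _ _ hε]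
  eq_β i j hij n hn := by
    have hn' := mem_of_sh_mem D.pos hn
    have h := congrArg (fun w : ℝ × E N => (inner ℝ w.2 (axVec hN O i) : ℝ)) (D.diff_eq hN O hij hn)
    simp only [drhs, inner_add_left, inner_sub_left, real_inner_smul_left, D.perp i n hn',
      inner_axVec_self, inner_axVec_of_ne hN O hij.symm] at h
    rw [D.dk_eq hN O hn' hij] at h
    rw [D.nu_eq hN O hn' hij, D.rho_eq hN O hn' hij, D.nrm_eq hN O hn']
    have hε := D.pos.ne'
    have hd := (dn_pos ε (sgn i * γ n) (axVec hN O i) (axVec hN O j) (W j n).2 (W i n).2).ne'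
    have hNs := D.dN_sq i hn'
    refine Eq.trans ?_ (h.trans ?_)
    · simp only [diff, fieldsOf, symm_apply_ax, Prod.snd_sub, Prod.smul_snd, inner_sub_left,
        real_inner_smul_left, smul_eq_mul]
    · simp only [fieldsOf, symm_apply_ax]
      set d := dn ε (sgn i * γ n) (axVec hN O i) (axVec hN O j) (W j n).2 (W i n).2
      simp only [dr]
      field_simp
      linear_combination (-(8 * inner ℝ (W j n).2 (axVec hN O i))) * hNs
  eq_β' i j hij k hki hkj n hn := by
    have hn' := mem_of_sh_mem D.pos hn
    have h := congrArg (fun w : ℝ × E N => O.symm w.2 k) (D.diff_eq hN O hij hn)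
    have h0 : ∀ i, k ≠ ax hN i → O.symm (axVec hN O i) k = 0 := fun i hi => by
      rw [symm_axVec]; simp [hi]
    simp only [drhs, map_add, map_sub, map_smul, PiLp.add_apply, PiLp.sub_apply, PiLp.smul_apply,
      smul_eq_mul, h0 i hki, h0 j hkj] at h
    rw [D.dk_eq hN O hn' hij] at h
    rw [D.nu_eq hN O hn' hij, D.rho_eq hN O hn' hij]
    have hε := D.pos.ne'
    refine Eq.trans ?_ (h.trans ?_)
    · simp only [diff, fieldsOf, Prod.snd_sub, Prod.smul_snd, map_sub, map_smul, PiLp.sub_apply,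
        PiLp.smul_apply, smul_eq_mul]
    · simp only [fieldsOf]
      rw [mul_div_mul_left _ _ hε]
      ring
  data_ψ := hψ0
  data_h := hH
  data_β := hB
  data_γ := hΓ

end Coordinates

/-! ### Uniqueness of the solution of the discrete Goursat problem -/

section Uniqueness

variable {N : ℕ} {hN : 2 ≤ N} {ε r : ℝ} {Ψ : Cl N} {H : Fin 2 → ℝ → ℝ} {B : Fin N → Fin 2 → ℝ → ℝ}
  {Γ : (Fin 2 → ℝ) → ℝ} {S T : Fields N}

theorem eq_of_diff_eq {F : Type*} [AddCommGroup F] [Module ℝ F] (hε : ε ≠ 0) {i : Fin 2}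
    {u v : Lat → F} {n : Lat} (h : u n = v n) (hd : diff ε i u n = diff ε i v n) :
    u (sh i n) = v (sh i n) := by
  have := congrArg (fun z => ε • z) hd
  simp only [diff, smul_smul, mul_inv_cancel₀ hε, one_smul, h] at this
  exact sub_left_injective this

theorem exists_ne (i : Fin 2) : ∃ j, i ≠ j := by
  fin_cases i
  · exact ⟨1, by decide⟩
  · exact ⟨0, by decide⟩

/-- The scheme is explicit: each equation yields the value at the shifted point from values before
it, so uniqueness is an induction over the lattice and needs no smallness of the mesh beyond `0 <
ε`. -/
theorem IsGoursatSolution.eqOnBox (hε : 0 < ε) (hS : IsGoursatSolution hN ε r Ψ H B Γ S)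
    (hT : IsGoursatSolution hN ε r Ψ H B Γ T) : T.EqOnBox hN ε r S := by
  have hγ : ∀ n ∈ latBox ε r, T.γ n = S.γ n := fun n hn => by rw [hS.data_γ n hn, hT.data_γ n hn]
  -- coefficients agree where the fields do
  have hcoef : ∀ n ∈ latBox ε r, (∀ i k, k ≠ ax hN i → T.β k i n = S.β k i n) →
      (∀ i, T.nrm hN ε i n = S.nrm hN ε i n) ∧ (∀ i, T.rho hN ε i n = S.rho hN ε i n) ∧
        T.nu hN ε n = S.nu hN ε n := by
    intro n hn hβ
    have h1 : ∀ i, T.nrm hN ε i n = S.nrm hN ε i n := fun i => by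
      rw [Fields.nrm, Fields.nrm, Fields.normSq, Fields.normSq]
      congr 3
      exact Finset.sum_congr rfl fun k hk => by rw [hβ i k (Finset.ne_of_mem_erase hk)]
    have h2 : T.theta hN n = S.theta hN n := by
      rw [Fields.theta, Fields.theta]
      congr 1
      refine Finset.sum_congr rfl fun k hk => ?_
      rw [Finset.mem_filter] at hk
      rw [hβ 0 k hk.2.1, hβ 1 k hk.2.2]
    have h01 : (0 : Fin 2) ≠ 1 := by decide
    have h3 : T.rho12 hN ε n = S.rho12 hN ε n := by
      rw [Fields.rho12, Fields.rho12, h1, h2, hγ n hn, hβ 1 _ (ax_injective hN h01)]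
    have h4 : T.rho21 hN ε n = S.rho21 hN ε n := by
      rw [Fields.rho21, Fields.rho21, h1, h2, hγ n hn, hβ 0 _ (ax_injective hN h01.symm)]
    refine ⟨h1, fun i => ?_, ?_⟩
    · rw [Fields.rho, Fields.rho, h3, h4]
    · rw [Fields.nu, Fields.nu, Fields.nuSq, Fields.nuSq, h3, h4]
  have key : ∀ j n, n ∈ latBox ε r → (n ∈ latBox ε r →
      T.h j n = S.h j n ∧ ∀ k, k ≠ ax hN j → T.β k j n = S.β k j n) := by
    refine goursat_induction hε (fun j n hn hax _ => ?_) fun i j hij n hn ih _ => ?_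
    · obtain ⟨a, rfl⟩ : ∃ a, n = Pi.single j a := by
        refine ⟨n j, funext fun i => ?_⟩
        by_cases h : i = j
        · subst h; simp
        · simp [hax i h, h]
      refine ⟨by rw [hS.data_h _ _ hn, hT.data_h _ _ hn], fun k hk => ?_⟩
      rw [hS.data_β _ _ hk _ hn, hT.data_β _ _ hk _ hn]
    · have hn' := mem_of_sh_mem hε hn
      obtain ⟨h1, h2, h3⟩ := hcoef n hn' fun i k hk => (ih i hn').2 k hk
      refine ⟨eq_of_diff_eq hε.ne' (ih j hn').1 ?_, fun k hk => ?_⟩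
      · rw [hS.eq_h i j hij n hn, hT.eq_h i j hij n hn, h2, h3, (ih i hn').1, (ih j hn').1]
      · refine eq_of_diff_eq hε.ne' ((ih j hn').2 k hk) ?_
        by_cases hki : k = ax hN i
        · subst hki
          rw [hS.eq_β i j hij n hn, hT.eq_β i j hij n hn, h1, h2, h3, (ih j hn').2 _ hk]
        · rw [hS.eq_β' i j hij k hki hk n hn, hT.eq_β' i j hij k hki hk n hn, h2, h3,
            (ih j hn').2 _ hk, (ih i hn').2 _ hki]
  have hψ : ∀ n, n ∈ latBox ε r → T.ψ n = S.ψ n := by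
    refine lat_induction (fun _ => by rw [hS.data_ψ, hT.data_ψ]) fun i n ih hn => ?_
    have hn' := mem_of_sh_mem hε hn
    obtain ⟨h1, -, -⟩ := hcoef n hn' fun i k hk => (key i n hn' hn').2 k hk
    refine eq_of_diff_eq hε.ne' (ih hn') ?_
    rw [hS.eq_ψ i n hn, hT.eq_ψ i n hn, h1, (key i n hn' hn').1, ih hn']
    congr 4
    exact Finset.sum_congr rfl fun k hk => by
      rw [(key i n hn' hn').2 k (Finset.ne_of_mem_erase hk)]
  exact fun n hn => ⟨hψ n hn, fun i => (key i n hn hn).1, fun i k hk => (key i n hn hn).2 k hk,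
    hγ n hn⟩

end Uniqueness


/-! ### Convergence of the discrete surfaces to a smooth solution -/

section Small

variable {N : ℕ} {ε C γ : ℝ} {u u' b b' : E N}

/-- For fields bounded by `C`, the condition `ε * (16 * C ^ 2) ≤ 1` suffices for all the side
conditions in `DiscreteSol`; here and in the next lemmas they are derived from it. -/
theorem dN_bounds (hC : 1 ≤ C) (hε : 0 < ε) (hs : ε * (16 * C ^ 2) ≤ 1) (hb : ‖b‖ ≤ C) :
    1 / 2 ≤ 1 - ε ^ 2 / 4 * ‖b‖ ^ 2 ∧ 1 / 2 < dN ε b ∧ dN ε b ≤ 1 := by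
  have h1 : ε * ‖b‖ ≤ 1 / 16 := by
    have : ε * ‖b‖ ≤ ε * C ^ 2 := by gcongr; nlinarith
    linarith
  have h0 : 0 ≤ ε * ‖b‖ := by positivity
  have h2 : ε ^ 2 / 4 * ‖b‖ ^ 2 ≤ 1 / 16 := by
    have : ε ^ 2 / 4 * ‖b‖ ^ 2 = (ε * ‖b‖) ^ 2 / 4 := by ring
    rw [this]; nlinarith
  have h3 : 1 / 2 ≤ 1 - ε ^ 2 / 4 * ‖b‖ ^ 2 := by linarith
  have h4 : dN ε b ^ 2 = 1 - ε ^ 2 / 4 * ‖b‖ ^ 2 := sqrtCut_sq h3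
  have h5 : 0 < dN ε b := sqrtCut_pos _
  have h6 : 0 ≤ ε ^ 2 / 4 * ‖b‖ ^ 2 := by positivity
  exact ⟨h3, by nlinarith, by nlinarith⟩

theorem abs_dr_le (hC : 1 ≤ C) (hε : 0 < ε) (hs : ε * (16 * C ^ 2) ≤ 1) (hb : ‖b‖ ≤ C)
    (hb' : ‖b'‖ ≤ C) (hγ : |γ| ≤ C) (hu : ‖u‖ = 1) : |ε * dr ε γ u b b'| ≤ 1 / 8 := by
  obtain ⟨-, h1, h2⟩ := dN_bounds hC hε hs hb'
  have h3 : |(inner ℝ b u : ℝ)| ≤ C := by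
    have := abs_real_inner_le_norm b u
    rw [hu, mul_one] at this
    exact this.trans hb
  have h4 : |(inner ℝ b b' : ℝ)| ≤ C ^ 2 := by
    refine (abs_real_inner_le_norm b b').trans ?_
    rw [sq]; gcongr
  have hCC : C ≤ C ^ 2 := by nlinarith
  have hε1 : ε ≤ 1 := by nlinarith
  have h5 : |dN ε b' * inner ℝ b u| ≤ C := by
    rw [abs_mul, abs_of_pos (by linarith)]
    nlinarith [abs_nonneg (inner ℝ b u : ℝ)]
  have h6 : |ε / 2 * (inner ℝ b b' / 2 - γ)| ≤ C ^ 2 := by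
    rw [abs_mul, abs_of_pos (by linarith)]
    have : |(inner ℝ b b' / 2 - γ : ℝ)| ≤ 2 * C ^ 2 := by
      rw [abs_le] at *
      constructor <;> linarith [h4.1, h4.2, hγ.1, hγ.2]
    nlinarith [abs_nonneg (inner ℝ b b' / 2 - γ : ℝ)]
  have h7 : |dr ε γ u b b'| ≤ 2 * C ^ 2 := by
    rw [dr]
    rw [abs_le] at *
    constructor <;> linarith [h5.1, h5.2, h6.1, h6.2]
  rw [abs_mul, abs_of_pos hε]
  have := mul_le_mul_of_nonneg_left h7 hε.le
  linarith

theorem dnSq_bound (hC : 1 ≤ C) (hε : 0 < ε) (hs : ε * (16 * C ^ 2) ≤ 1) (hb : ‖b‖ ≤ C)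
    (hb' : ‖b'‖ ≤ C) (hγ : |γ| ≤ C) (hu : ‖u‖ = 1) (hu' : ‖u'‖ = 1) :
    1 / 2 ≤ dnSq ε γ u u' b b' := by
  have h1 := abs_le.1 (abs_dr_le hC hε hs hb hb' hγ hu)
  have h2 := abs_le.1 (abs_dr_le hC hε hs hb' hb (γ := -γ) (by rwa [abs_neg]) hu')
  have : dnSq ε γ u u' b b' = 1 - (ε * dr ε γ u b b') * (ε * dr ε (-γ) u' b' b) := by
    rw [dnSq]; ring
  rw [this]
  nlinarith [h1.1, h1.2, h2.1, h2.2]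

theorem pos_bound (hC : 1 ≤ C) (hε : 0 < ε) (hs : ε * (16 * C ^ 2) ≤ 1) (hb : ‖b‖ ≤ C)
    (hb' : ‖b'‖ ≤ C) (hγ : |γ| ≤ C) (hu : ‖u‖ = 1) (hu' : ‖u'‖ = 1) :
    ε ^ 2 / 2 * dr ε γ u b b' * inner ℝ b' u' < dN ε b := by
  have h1 := abs_le.1 (abs_dr_le hC hε hs hb hb' hγ hu)
  obtain ⟨-, h2, -⟩ := dN_bounds hC hε hs hb
  have h3 : |ε * (inner ℝ b' u' : ℝ)| ≤ 1 / 16 := by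
    rw [abs_mul, abs_of_pos hε]
    have := abs_real_inner_le_norm b' u'
    rw [hu', mul_one] at this
    have : ε * |(inner ℝ b' u' : ℝ)| ≤ ε * C ^ 2 := by
      gcongr; nlinarith
    linarith
  have h3' := abs_le.1 h3
  have : ε ^ 2 / 2 * dr ε γ u b b' * inner ℝ b' u' =
      (ε * dr ε γ u b b') * (ε * inner ℝ b' u') / 2 := by ring
  rw [this]
  nlinarith [h1.1, h1.2, h3'.1, h3'.2]

end Small

/-! ### From bounded scaled errors to `O(ε)`-convergence. -/

section Convergence

variable {N : ℕ}

/-- A smooth solution of the equations of C-surfaces: `W j = (h_j, b_j)`, and `c = (x, R)` is the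
surface with its frame. -/
structure SmoothSol (r : ℝ) (Γ : (Fin 2 → ℝ) → ℝ) (u : Fin 2 → E N) (x₀ : E N)
    (W : Fin 2 → (Fin 2 → ℝ) → ℝ × E N) (c : (Fin 2 → ℝ) → E N × (E N →L[ℝ] E N)) : Prop where
  smoothW : ∀ i, ContDiff ℝ ∞ (W i)
  smoothc : ContDiff ℝ ∞ c
  unit : ∀ i, inner ℝ (u i) (u i) = (1 : ℝ)
  orth : ∀ i j, i ≠ j → inner ℝ (u i) (u j) = (0 : ℝ)
  evol : ∀ i j, i ≠ j → ∀ ξ ∈ box r, fderiv ℝ (W j) ξ (Pi.single i 1) =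
    drhs 0 (sgn i * Γ ξ) (u i) (u j) (W j ξ) (W i ξ)
  evolc : ∀ i, ∀ ξ ∈ box r, fderiv ℝ c ξ (Pi.single i 1) =
    ((W i ξ).1 • (c ξ).2 (edge 0 (u i) (W i ξ).2), (c ξ).2 ∘L rotGen 0 (u i) (W i ξ).2)
  init : c 0 = (x₀, .id ℝ _)
  perp : ∀ i, ∀ ξ ∈ box r, inner ℝ (W i ξ).2 (u i) = (0 : ℝ)

theorem diffPow_map {V V' : Type*} [AddCommGroup V] [Module ℝ V] [AddCommGroup V'] [Module ℝ V']
    (L : V →ₗ[ℝ] V') (ε : ℝ) (α : Fin 2 → ℕ) (u : Lat → V) (n : Lat) :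
    diffPow ε α (fun m => L (u m)) n = L (diffPow ε α u n) := by
  have h : ∀ i (k : ℕ) (u : Lat → V), (diff ε i)^[k] (fun m => L (u m)) =
      fun m => L ((diff ε i)^[k] u m) := by
    intro i k
    induction k with
    | zero => intro u; rfl
    | succ k ih =>
      intro u
      have : diff ε i (fun m => L (u m)) = fun m => L (diff ε i u m) := by
        funext m; simp [diff]
      rw [Function.iterate_succ_apply, this, ih, Function.iterate_succ_apply]
  rw [diffPow, h, h, diffPow]

theorem smoothOConverges_of_bddDiff {r ε₁ : ℝ} {V : Type} [NormedAddCommGroup V] [NormedSpace ℝ V]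
    {c : (Fin 2 → ℝ) → E N × V} {cd : ℝ → Lat → E N × V}
    (h : ∀ l, BddDiff ε₁ l (fun _ => r) (fun ε n => ε⁻¹ • (cd ε n - c (pt ε n)))) :
    SmoothOConverges r ε₁ (fun ε n => (cd ε n).1) fun ξ => (c ξ).1 := by
  intro l
  have hα : ∀ α : Fin 2 → ℕ, ∃ K, α 0 + α 1 ≤ l → ∀ ε, 0 < ε → ε < ε₁ →
      ∀ n ∈ latBox ε (r - ε * (α 0 + α 1 : ℕ)),
        ‖diffPow ε α (fun n => ε⁻¹ • (cd ε n - c (pt ε n))) n‖ ≤ K := by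
    intro α
    by_cases hl : α 0 + α 1 ≤ l
    · obtain ⟨K, hK⟩ := (h l).diffPow α hl
      exact ⟨K, fun _ => hK⟩
    · exact ⟨0, fun h => absurd h hl⟩
  choose K hK using hα
  -- One constant must serve all multi-indices of order at most `l`; the sum over a square of
  -- indices dominates each of them.
  refine ⟨∑ i ∈ Finset.range (l + 1), ∑ j ∈ Finset.range (l + 1), |K ![i, j]|,
    fun ε hε hε₁ _ α hα n hn => ?_⟩
  have h1 := hK α hα ε hε hε₁ n hn
  have h2 : |K α| ≤ ∑ i ∈ Finset.range (l + 1), ∑ j ∈ Finset.range (l + 1), |K ![i, j]| := by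
    have hα' : α = ![α 0, α 1] := by ext i; fin_cases i <;> rfl
    rw [hα']
    refine le_trans ?_ (Finset.single_le_sum (f := fun i => ∑ j ∈ Finset.range (l + 1), |K ![i, j]|)
      (fun i _ => Finset.sum_nonneg fun j _ => abs_nonneg _)
      (Finset.mem_range.2 (show α 0 < l + 1 by omega)))
    exact Finset.single_le_sum (f := fun j => |K ![α 0, j]|) (fun j _ => abs_nonneg _)
      (Finset.mem_range.2 (show α 1 < l + 1 by omega))
  have h3 : (fun m => (cd ε m).1 - (c (pt ε m)).1) = fun m => (ε • LinearMap.fst ℝ (E N) V)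
      (ε⁻¹ • (cd ε m - c (pt ε m))) := by
    funext m
    simp [smul_smul, hε.ne']
  simp only [h3]
  rw [diffPow_map]
  simp only [LinearMap.smul_apply, LinearMap.fst_apply, norm_smul, Real.norm_of_nonneg hε.le]
  rw [mul_comm]
  gcongr
  exact (norm_fst_le _).trans (h1.trans ((le_abs_self _).trans h2))

theorem contDiff_edge {X : Type} [NormedAddCommGroup X] [NormedSpace ℝ X] {ε : X → ℝ} {b : X → E N}
    (hε : ContDiff ℝ ∞ ε) (hb : ContDiff ℝ ∞ b) (u : E N) :
    ContDiff ℝ ∞ fun x => edge (ε x) u (b x) :=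
  ((contDiff_dN hε hb).smul contDiff_const).sub ((hε.div_const 2).smul hb)

theorem contDiff_smulRight {X : Type} [NormedAddCommGroup X] [NormedSpace ℝ X] {a b : X → E N}
    (ha : ContDiff ℝ ∞ a) (hb : ContDiff ℝ ∞ b) :
    ContDiff ℝ ∞ fun x => (innerSL ℝ (a x)).smulRight (b x) := by
  have h : ContDiff ℝ ∞ fun p : (E N →L[ℝ] ℝ) × E N => p.1.smulRight p.2 :=
    (isBoundedBilinearMap_smulRight (𝕜 := ℝ) (E := E N) (F := E N)).contDiff
  exact h.comp (((innerSL ℝ (E := E N)).contDiff.comp ha).prodMk hb)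

theorem contDiff_rotGen {X : Type} [NormedAddCommGroup X] [NormedSpace ℝ X] {ε : X → ℝ}
    {b : X → E N} (hε : ContDiff ℝ ∞ ε) (hb : ContDiff ℝ ∞ b) (u : E N) :
    ContDiff ℝ ∞ fun x => rotGen (ε x) u (b x) := by
  refine (contDiff_smulRight hb (contDiff_edge hε hb u)).sub (contDiff_smulRight contDiff_const ?_)
  exact (((hε.div_const 2).mul (hb.norm_sq ℝ)).smul contDiff_const).add
    ((contDiff_dN hε hb).smul hb)

/-- The right-hand side of the evolution of the discrete surface and its frame. -/
def frameRhs (ε : ℝ) (u : E N) (W : ℝ × E N) (c : E N × (E N →L[ℝ] E N)) : E N × (E N →L[ℝ] E N) :=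
  (W.1 • c.2 (edge ε u W.2), c.2 ∘L rotGen ε u W.2)

theorem contDiff_frameRhs {X : Type} [NormedAddCommGroup X] [NormedSpace ℝ X] {ε : X → ℝ}
    {W : X → ℝ × E N} {c : X → E N × (E N →L[ℝ] E N)} (hε : ContDiff ℝ ∞ ε) (hW : ContDiff ℝ ∞ W)
    (hc : ContDiff ℝ ∞ c) (u : E N) : ContDiff ℝ ∞ fun x => frameRhs (ε x) u (W x) (c x) :=
  (hW.fst.smul (hc.snd.clm_apply (contDiff_edge hε hW.snd u))).prodMk
    (hc.snd.clm_comp (contDiff_rotGen hε hW.snd u))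

end Convergence


/-! ### The discrete Goursat problem approximates the smooth one -/

section Approximation

variable {N : ℕ}

theorem norm_eq_one_of_inner {u : E N} (h : inner ℝ u u = (1 : ℝ)) : ‖u‖ = 1 := by
  rw [real_inner_self_eq_norm_sq] at h
  nlinarith [norm_nonneg u]

/-- The `i`-th component of a pair. -/
def sel {Y : Type} (i : Fin 2) (p : Y × Y) : Y := if i = 0 then p.1 else p.2

theorem contDiff_sel {X Y : Type} [NormedAddCommGroup X] [NormedSpace ℝ X] [NormedAddCommGroup Y]
    [NormedSpace ℝ Y] (i : Fin 2) {p : X → Y × Y} (hp : ContDiff ℝ ∞ p) :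
    ContDiff ℝ ∞ fun x => sel i (p x) := by
  fin_cases i
  · exact hp.fst
  · exact hp.snd

theorem sel_pair {Y : Type} (W : Fin 2 → Y) (i : Fin 2) : sel i (W 0, W 1) = W i := by
  fin_cases i <;> rfl

theorem pt_of_axis {ε : ℝ} {j : Fin 2} {n : Lat} (h : ∀ i, i ≠ j → n i = 0) :
    n = Pi.single j (n j) ∧ pt ε n = Pi.single j (ε * n j) := by
  constructor <;> ext i <;> by_cases hi : i = j
  · subst hi; simp
  · simp [hi, h i hi]
  · subst hi; simp [pt]
  · simp [pt, hi, h i hi]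

theorem pt_single (ε : ℝ) (j : Fin 2) (a : ℕ) : pt ε (Pi.single j a) = Pi.single j (ε * a) := by
  have := (pt_of_axis (ε := ε) (n := Pi.single j a) (j := j) fun i hi => by simp [hi]).2
  simpa using this

/-- For small mesh sizes the discrete evolution with the data of a smooth solution has a solution
on the lattice box, which converges to the smooth solution. -/
theorem SmoothSol.exists_discreteSol {r : ℝ} {Γ : (Fin 2 → ℝ) → ℝ} (hΓ : ContDiff ℝ ∞ Γ)
    {u : Fin 2 → E N} {x₀ : E N} {W : Fin 2 → (Fin 2 → ℝ) → ℝ × E N}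
    {c : (Fin 2 → ℝ) → E N × (E N →L[ℝ] E N)} (S : SmoothSol r Γ u x₀ W c) :
    ∃ ε₁ : ℝ, 0 < ε₁ ∧ ε₁ ≤ 1 ∧ ∃ Wd : ℝ → Fin 2 → Lat → ℝ × E N,
      (∀ ε, 0 < ε → ε < ε₁ → DiscreteSol ε r (fun n => Γ (pt ε n)) u (Wd ε)) ∧
      (∀ ε j n, (∀ i, i ≠ j → n i = 0) → Wd ε j n = W j (pt ε n)) ∧
      ∀ l, BddDiff ε₁ l (fun _ => r)
        (fun ε n => ε⁻¹ • ((Wd ε 0 n, Wd ε 1 n) - (W 0 (pt ε n), W 1 (pt ε n)))) := by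
  have h01 : (0 : Fin 2) ≠ 1 := by decide
  let F : ℝ × (Fin 2 → ℝ) × (ℝ × E N) × (ℝ × E N) → ℝ × E N :=
    fun p => drhs p.1 (sgn 0 * Γ p.2.1) (u 0) (u 1) p.2.2.1 p.2.2.2
  let G : ℝ × (Fin 2 → ℝ) × (ℝ × E N) × (ℝ × E N) → ℝ × E N :=
    fun p => drhs p.1 (sgn 1 * Γ p.2.1) (u 1) (u 0) p.2.2.2 p.2.2.1
  have hF : ContDiff ℝ ∞ F := contDiff_drhs contDiff_fst
    (contDiff_const.mul (hΓ.comp contDiff_snd.fst)) _ _ contDiff_snd.snd.fst contDiff_snd.snd.snd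
  have hG : ContDiff ℝ ∞ G := contDiff_drhs contDiff_fst
    (contDiff_const.mul (hΓ.comp contDiff_snd.fst)) _ _ contDiff_snd.snd.snd contDiff_snd.snd.fst
  obtain ⟨ε₀, C, hε₀, hε₀1, hconv⟩ := discrete_goursat_converges hF hG (S.smoothW 1) (S.smoothW 0)
    (r := r) (S.evol 0 1 h01) (S.evol 1 0 h01.symm)
  obtain ⟨C', hC'0, hC'⟩ := exists_bound_box r hΓ.continuous
  -- As `drhs` is defined everywhere, the recursion can be run on the whole quadrant. Here `a`
  -- stands for `W 1`, which evolves in the direction `0`, and `b` for `W 0`.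
  have hsol : ∀ ε : ℝ, ∃ (a b : Lat → ℝ × E N),
      (∀ n, a (sh 0 n) = a n + ε • F (ε, pt ε n, a n, b n)) ∧
      (∀ n, b (sh 1 n) = b n + ε • G (ε, pt ε n, a n, b n)) ∧
      (∀ n, n 0 = 0 → a n = W 1 (pt ε n)) ∧ ∀ n, n 1 = 0 → b n = W 0 (pt ε n) := fun ε =>
    exists_lattice_goursat (fun n p => p.1 + ε • F (ε, pt ε n, p.1, p.2))
      (fun n p => p.2 + ε • G (ε, pt ε n, p.1, p.2)) (fun n => W 1 (pt ε n)) fun n => W 0 (pt ε n)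
  choose a b ha hb haA hbB using hsol
  -- `K` bounds both fields and `Γ`, so the mesh bound `1 / (16 K²)` activates the estimates for
  -- small `ε`.
  set K := max (max C C') 1 with hK
  have hK1 : 1 ≤ K := le_max_right _ _
  have hCK : C ≤ K := (le_max_left _ _).trans (le_max_left _ _)
  have hCK' : C' ≤ K := (le_max_right _ _).trans (le_max_left _ _)
  have hdiff : ∀ {ε : ℝ}, 0 < ε → ∀ (v w : ℝ × E N), ε⁻¹ • (v + ε • w - v) = w := fun hε v w => by
    rw [add_sub_cancel_left, smul_smul, inv_mul_cancel₀ hε.ne', one_smul]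
  obtain ⟨hbd, hBd⟩ := hconv (min ε₀ (1 / (16 * K ^ 2))) (min_le_left _ _) a b
    (fun ε hε _ n _ => by rw [diff, ha, hdiff hε]) (fun ε hε _ n _ => by rw [diff, hb, hdiff hε])
    (fun ε _ _ n _ h => haA ε n h) (fun ε _ _ n _ h => hbB ε n h)
  have hax : ∀ ε j n, (∀ i, i ≠ j → n i = 0) →
      (fun j n => sel j (b ε n, a ε n)) j n = W j (pt ε n) := by
    intro ε j n h
    fin_cases j
    · exact hbB ε n (h 1 h01.symm)
    · exact haA ε n (h 0 h01)
  refine ⟨min ε₀ (1 / (16 * K ^ 2)), by positivity, (min_le_left _ _).trans hε₀1,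
    fun ε j n => sel j (b ε n, a ε n), fun ε hε hε₁ => ?_, hax, fun l => ?_⟩
  · have hs : ε * (16 * K ^ 2) ≤ 1 := by
      have h1 := (hε₁.trans_le (min_le_right _ _)).le
      rwa [le_div_iff₀ (by positivity)] at h1
    have hun : ∀ i, ‖u i‖ = 1 := fun i => norm_eq_one_of_inner (S.unit i)
    have hWb : ∀ j n, n ∈ latBox ε r → ‖(sel j (b ε n, a ε n)).2‖ ≤ K := by
      intro j n hn
      have h := hbd ε hε hε₁ n hn
      fin_cases j
      · exact (norm_snd_le _).trans (h.2.trans hCK)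
      · exact (norm_snd_le _).trans (h.1.trans hCK)
    have hγ : ∀ i n, n ∈ latBox ε r → |sgn i * Γ (pt ε n)| ≤ K := by
      intro i n hn
      have h := (hC' _ hn).trans hCK'
      rw [Real.norm_eq_abs] at h
      fin_cases i <;> simpa [sgn] using h
    have hdr : ∀ i j n, n ∈ latBox ε r → |ε * dr ε (sgn i * Γ (pt ε n)) (u i)
        (sel j (b ε n, a ε n)).2 (sel i (b ε n, a ε n)).2| ≤ 1 / 8 := fun i j n hn =>
      abs_dr_le hK1 hε hs (hWb j n hn) (hWb i n hn) (hγ i n hn) (hun i)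
    refine ⟨hε, S.unit, S.orth, fun i j hij n hn => ?_, fun j n hn h => ?_, fun j n hn => ?_,
      fun i j hij n hn => ?_, fun i j hij n hn => ?_, fun i j hij n hn => ?_⟩
    · fin_cases i <;> fin_cases j <;> simp at hij
      · exact ha ε n
      · exact hb ε n
    · have := hax ε j n h
      simp only at this ⊢
      rw [this]
      exact S.perp j _ hn
    · exact (dN_bounds hK1 hε hs (hWb j n hn)).1
    · exact dnSq_bound hK1 hε hs (hWb j n hn) (hWb i n hn) (hγ i n hn) (hun i) (hun j)
    · exact pos_bound hK1 hε hs (hWb j n hn) (hWb i n hn) (hγ i n hn) (hun i) (hun j)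
    · have h1 := abs_le.1 (hdr i j n hn)
      have h2 := abs_le.1 (hdr j i n hn)
      nlinarith [h1.1, h1.2, h2.1, h2.2]
  · have := (hBd l).2.prodMk (hBd l).1
    refine this.congr fun ε _ _ n _ => ?_
    simp [sel]

/-- The canonical discretizations of the axes. -/
theorem DiscreteSol.isCanonicalDiscretization {hN : 2 ≤ N} {O : E N ≃ₗᵢ[ℝ] E N} {ε r : ℝ}
    {γ : Lat → ℝ} {W : Fin 2 → Lat → ℝ × E N} (D : DiscreteSol ε r γ (axVec hN O) W) {ψ : Lat → Cl N}
    {Ψ : Cl N} {c : Lat → E N × (E N →L[ℝ] E N)} {H : Fin 2 → ℝ → ℝ} {B : Fin N → Fin 2 → ℝ → ℝ}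
    (hψ0 : ψ 0 = Ψ)
    (hψ : ∀ i n, sh i n ∈ latBox ε r → ψ (sh i n) = stepElt O ε (axVec hN O) W i n * ψ n)
    (hmem : ∀ n ∈ latBox ε r, ψ n ∈ HInf N)
    (hc : ∀ n ∈ latBox ε r, IsFrame O (ψ n) (c n).1 (c n).2)
    (hH : ∀ i, ∀ a : ℕ, Pi.single i a ∈ latBox ε r → (W i (Pi.single i a)).1 = H i (ε * a))
    (hB : ∀ i k, k ≠ ax hN i → ∀ a : ℕ, Pi.single i a ∈ latBox ε r →
      O.symm (W i (Pi.single i a)).2 k = B k i (ε * a)) (hr : 0 ≤ r) (i : Fin 2) :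
    IsCanonicalDiscretization hN ε r Ψ i (H i) (fun k => B k i)
      (fun a => (c (Pi.single i a)).1) := by
  have hbox : ∀ a : ℕ, ε * a ≤ r → Pi.single i a ∈ latBox ε r := by
    intro a ha
    rw [mem_latBox_iff D.pos]
    intro j
    by_cases hj : j = i
    · subst hj; simpa using ha
    · simpa [hj] using hr
  refine ⟨fun a => ψ (Pi.single i a), by simpa using hψ0, fun a ha => ?_, fun a ha => ?_⟩
  · have hsh : sh i (Pi.single i a) = Pi.single i (a + 1) := by
      rw [sh, ← Pi.single_add]
    have hm1 := hbox _ ha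
    have hm : Pi.single i a ∈ latBox ε r := mem_of_sh_mem D.pos (by rw [hsh]; exact hm1)
    have hsum : ∑ k ∈ Finset.univ.erase (ax hN i), B k i (ε * a) ^ 2 =
        ‖(W i (Pi.single i a)).2‖ ^ 2 := by
      rw [← D.sum_erase hN O hm i]
      exact Finset.sum_congr rfl fun k hk => by rw [hB i k (Finset.ne_of_mem_erase hk) a hm]
    have hsum' : ∑ k ∈ Finset.univ.erase (ax hN i), B k i (ε * a) • (e k : Mink N) =
        ∑ k ∈ Finset.univ.erase (ax hN i), O.symm (W i (Pi.single i a)).2 k • e k :=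
      Finset.sum_congr rfl fun k hk => by rw [hB i k (Finset.ne_of_mem_erase hk) a hm]
    have hN2 := D.hN i _ hm
    simp only
    rw [hsum, hsum']
    refine ⟨by linarith, ?_⟩
    rw [← hsh, hψ i _ (by rw [hsh]; exact hm1), stepElt, bigSig, D.inj_sig_eq hN O hm i, symm_axVec,
      ← e_eq_inj, dN, sqrtCut_eq hN2, hH i a hm, neg_mul (emb _)]
  · exact ⟨hmem _ (hbox a ha), (hc _ (hbox a ha)).org.symm⟩

/-- The approximation statement, in terms of a smooth solution. -/
theorem SmoothSol.approximation {hN : 2 ≤ N} {O : E N ≃ₗᵢ[ℝ] E N} {r : ℝ} (hr : 0 < r)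
    {Γ : (Fin 2 → ℝ) → ℝ} (hΓ : ContDiff ℝ ∞ Γ) {x₀ : E N} {W : Fin 2 → (Fin 2 → ℝ) → ℝ × E N}
    {c : (Fin 2 → ℝ) → E N × (E N →L[ℝ] E N)} (S : SmoothSol r Γ (axVec hN O) x₀ W c) {Ψ : Cl N}
    (hΨ : Ψ ∈ HInf N) (hΨ' : IsFrame O Ψ x₀ (.id ℝ _)) {H : Fin 2 → ℝ → ℝ}
    {B : Fin N → Fin 2 → ℝ → ℝ}
    (hH : ∀ i, ∀ t ∈ Icc 0 r, (W i (Pi.single i t)).1 = H i t)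
    (hB : ∀ i k, k ≠ ax hN i → ∀ t ∈ Icc 0 r, O.symm (W i (Pi.single i t)).2 k = B k i t) :
    ∃ ε₁ : ℝ, 0 < ε₁ ∧ ∃ xd : ℝ → Lat → E N,
      (∀ ε : ℝ, 0 < ε → ε < ε₁ →
        (∃ S : Fields N, IsGoursatSolution hN ε r Ψ H B Γ S ∧
          (∀ T, IsGoursatSolution hN ε r Ψ H B Γ T → T.EqOnBox hN ε r S) ∧
          ∀ n ∈ latBox ε r, S.ψ n ∈ HInf N ∧ emb (lift (xd ε n)) = act (S.ψ n) (eZero N)) ∧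
        IsDiscreteCSurface ε r (xd ε) ∧
        ∀ i, IsCanonicalDiscretization hN ε r Ψ i (H i) (fun k => B k i)
          (fun a => xd ε (Pi.single i a))) ∧
      SmoothOConverges r ε₁ xd fun ξ => (c ξ).1 := by
  obtain ⟨ε₁, hε₁, hε₁1, Wd, hD, hax, hBd⟩ := S.exists_discreteSol hΓ
  obtain ⟨ε₂, hε₂, hε₂₁, hconv⟩ := discrete_total_converges
    (c := fun i (p : ℝ × ((ℝ × E N) × (ℝ × E N)) × (E N × (E N →L[ℝ] E N))) =>
      frameRhs p.1 (axVec hN O i) (sel i p.2.1) p.2.2)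
    (fun i => contDiff_frameRhs contDiff_fst (contDiff_sel i contDiff_snd.fst) contDiff_snd.snd _)
    ((S.smoothW 0).prodMk (S.smoothW 1)) S.smoothc hr.le
    (fun i ξ hξ => by
      rw [S.evolc i ξ hξ, frameRhs, sel_pair fun i => W i ξ]) hε₁ hε₁1 hBd
  have hex : ∀ ε, ∃ (ψ : Lat → Cl N) (cd : Lat → E N × (E N →L[ℝ] E N)), 0 < ε → ε < ε₂ →
      ψ 0 = Ψ ∧ (∀ i n, sh i n ∈ latBox ε r →
        ψ (sh i n) = DiscreteSol.stepElt O ε (axVec hN O) (Wd ε) i n * ψ n) ∧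
      (∀ n ∈ latBox ε r, IsFrame O (ψ n) (cd n).1 (cd n).2) ∧ cd 0 = (x₀, .id ℝ _) := by
    intro ε
    by_cases h : 0 < ε ∧ ε < ε₂
    · have D := hD ε h.1 (h.2.trans_le hε₂₁)
      obtain ⟨ψ, hψ0, hψ⟩ := D.exists_frame O Ψ
      obtain ⟨cd, hcd, hcd0⟩ := D.exists_surface (O := O) (x₀ := x₀) (by rw [hψ0]; exact hΨ') hψ
      exact ⟨ψ, cd, fun _ _ => ⟨hψ0, hψ, hcd, hcd0⟩⟩
    -- Outside the range of admissible `ε` the choice is arbitrary.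
    · exact ⟨fun _ => 0, fun _ => 0, fun h1 h2 => absurd ⟨h1, h2⟩ h⟩
  choose ψ cd hex using hex
  refine ⟨ε₂, hε₂, fun ε n => (cd ε n).1, fun ε hε hεε => ?_, ?_⟩
  · obtain ⟨hψ0, hψ, hcd, hcd0⟩ := hex ε hε hεε
    have D := hD ε hε (hεε.trans_le hε₂₁)
    have hmem := D.mem_HInf (O := O) (by rw [hψ0]; exact hΨ) hψ
    have hIcc : ∀ {i : Fin 2} {a : ℕ}, Pi.single i a ∈ latBox ε r → ε * (a : ℝ) ∈ Icc 0 r := by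
      intro i a h
      have := (mem_latBox_iff hε).1 h i
      rw [Pi.single_eq_same] at this
      exact ⟨by positivity, this⟩
    have hWax : ∀ i (a : ℕ), Wd ε i (Pi.single i a) = W i (Pi.single i (ε * a)) := by
      intro i a
      rw [hax ε i _ fun j hj => by simp [hj], pt_single]
    have hH' : ∀ i, ∀ a : ℕ, Pi.single i a ∈ latBox ε r →
        (Wd ε i (Pi.single i a)).1 = H i (ε * a) := fun i a ha => by
      rw [hWax, hH i _ (hIcc ha)]
    have hB' : ∀ i k, k ≠ ax hN i → ∀ a : ℕ, Pi.single i a ∈ latBox ε r →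
        O.symm (Wd ε i (Pi.single i a)).2 k = B k i (ε * a) := fun i k hk a ha => by
      rw [hWax, hB i k hk _ (hIcc ha)]
    have hsol := D.isGoursatSolution hN O (ψ := ψ ε) hψ0 hψ hH' hB' (Γ := Γ) fun _ _ => rfl
    exact ⟨⟨_, hsol, fun T hT => hsol.eqOnBox hε hT, fun n hn => ⟨hmem n hn, (hcd n hn).org.symm⟩⟩,
      D.isDiscreteCSurface hψ hcd,
      D.isCanonicalDiscretization hψ0 hψ hmem hcd hH' hB' hr.le⟩
  · refine smoothOConverges_of_bddDiff (hconv cd (fun ε hε hεε => ?_) fun ε hε hεε i n hn => ?_)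
    · rw [(hex ε hε hεε).2.2.2, S.init]
    · obtain ⟨hψ0, hψ, hcd, hcd0⟩ := hex ε hε hεε
      rw [(hD ε hε (hεε.trans_le hε₂₁)).diff_surface hψ hcd hn, frameRhs,
        sel_pair fun i => Wd ε i n]

end Approximation


/-! ### Suited elements and coefficients read off a curve -/

section Suited

variable {N : ℕ}

theorem lorentz_tlift (x y z : E N) : lorentz N (tlift x y) (tlift x z) = inner ℝ y z := by
  simp only [lorentz_apply, tlift, inj, eInf, Prod.fst_add, Prod.snd_add, Prod.smul_fst,
    Prod.smul_snd, smul_zero, add_zero, smul_eq_mul]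
  ring

theorem lorentz_tlift_eInf (x y : E N) : lorentz N (tlift x y) (eInf N) = 0 := by
  simp only [lorentz_apply, tlift, inj, eInf, Prod.fst_add, Prod.snd_add, Prod.smul_fst,
    Prod.smul_snd, smul_zero, add_zero, smul_eq_mul, inner_zero_right]
  ring

theorem contDiff_lift : ContDiff ℝ ∞ (lift : E N → Mink N) := by
  have h : ContDiff ℝ ∞ fun x : E N => ‖x‖ ^ 2 := contDiff_id.norm_sq ℝ
  exact ((contDiff_id.prodMk contDiff_const).add contDiff_const).add (h.smul contDiff_const)

theorem hasDerivAt_lift {X : ℝ → E N} {X' : E N} {t : ℝ} (h : HasDerivAt X X' t) :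
    HasDerivAt (fun s => lift (X s)) (tlift (X t) X') t := by
  have h1 : HasDerivAt (fun s => ‖X s‖ ^ 2) (2 * inner ℝ (X t) X') t := h.norm_sq
  have h2 : HasDerivAt (fun s => ((X s, 0, 0) : Mink N)) (inj X') t :=
    h.prodMk (hasDerivAt_const t ((0 : ℝ), (0 : ℝ)))
  exact (h2.add_const (eZero N)).add (h1.smul_const (eInf N))

theorem hasDerivAt_tlift {X z : ℝ → E N} {X' z' : E N} {t : ℝ} (hX : HasDerivAt X X' t)
    (hz : HasDerivAt z z' t) : HasDerivAt (fun s => tlift (X s) (z s))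
      (tlift (X t) z' + (2 * inner ℝ X' (z t)) • eInf N) t := by
  have h2 : HasDerivAt (fun s => inj (z s)) (inj z') t :=
    hz.prodMk (hasDerivAt_const t ((0 : ℝ), (0 : ℝ)))
  have h3 := h2.add (((hX.inner ℝ hz).const_mul 2).smul_const (eInf N))
  refine h3.congr_deriv ?_
  rw [tlift]; module

theorem tlift_smul (x z : E N) (c : ℝ) : tlift x (c • z) = c • tlift x z := by
  simp only [tlift, real_inner_smul_right, smul_add, smul_smul]
  congr 1
  · simp [inj]
  · ring_nf

theorem unitTangent_eq {X : ℝ → E N} {t : ℝ} (h : DifferentiableAt ℝ X t) :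
    unitTangent X t = tlift (X t) (‖deriv X t‖⁻¹ • deriv X t) := by
  rw [unitTangent, (hasDerivAt_lift h.hasDerivAt).deriv, tlift_smul]

theorem differentiableAt_unitTangent {X : ℝ → E N} (hX : ContDiff ℝ ∞ X) {t : ℝ}
    (ht : deriv X t ≠ 0) : DifferentiableAt ℝ (unitTangent X) t := by
  have h1 : ContDiff ℝ ∞ (deriv X) := (contDiff_infty_iff_deriv.1 hX).2
  have h2 : ContDiff ℝ ∞ (deriv fun s => lift (X s)) :=
    (contDiff_infty_iff_deriv.1 (contDiff_lift.comp hX)).2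
  have h3 : DifferentiableAt ℝ (fun s => ‖deriv X s‖) t :=
    (h1.differentiable (by simp)).differentiableAt.norm ℝ ht
  exact (h3.inv (norm_ne_zero_iff.2 ht)).smul (h2.differentiable (by simp)).differentiableAt

/-- A suited `Ψ` acts by a Lorentz transformation which fixes `e_∞` and sends `e_0` to the lift of
the initial point. Such a map is a Euclidean motion: on `ℝ^N` it is an orthogonal map `O` followed
by the tangent lift at that point. -/
theorem IsSuited.exists_isFrame {hN : 2 ≤ N} {X : Fin 2 → ℝ → E N} {Ψ : Cl N}
    (hX : ∀ i, DifferentiableAt ℝ (X i) 0) (h : IsSuited hN X Ψ) :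
    ∃ O : E N ≃ₗᵢ[ℝ] E N, IsFrame O Ψ (X 0 0) (.id ℝ _) ∧
      ∀ i, axVec hN O i = ‖deriv (X i) 0‖⁻¹ • deriv (X i) 0 := by
  obtain ⟨T, hT, hTl, hTi, -⟩ := exists_act_of_mem_HInf h.1
  have hadd : ∀ v w, T (v + w) = T v + T w := fun v w => emb_injective (by
    rw [emb_add, ← hT, ← hT, ← hT, act_add])
  have hsmul : ∀ (c : ℝ) v, T (c • v) = c • T v := fun c v => emb_injective (by
    rw [emb_smul, ← hT, ← hT, act_smul])
  have hz : T (eZero N) = lift (X 0 0) := emb_injective ((hT _).symm.trans (h.2 0).1)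
  have hx : ∀ i, X i 0 = X 0 0 := fun i =>
    lift_injective (emb_injective ((h.2 i).1.symm.trans (h.2 0).1))
  -- The other sign is impossible: `⟨e_0, e_∞⟩` is `-1/2`, and so is the product of `e_∞` with the
  -- lift of any point.
  have hi : T (eInf N) = eInf N := by
    refine hTi.resolve_right fun hi => ?_
    have := hTl (eZero N) (eInf N)
    rw [hz, hi] at this
    simp [lorentz_apply, lift, eZero, eInf] at this
    linarith
  -- Orthogonality to `e_∞` and to the lift of the base point fixes the last two coordinates in
  -- terms of the Euclidean part.
  have hv : ∀ z, T (inj z) = tlift (X 0 0) (T (inj z)).1 := by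
    intro z
    have h1 := hTl (inj z) (eInf N)
    have h2 := hTl (inj z) (eZero N)
    rw [hi] at h1
    rw [hz] at h2
    simp only [lorentz_apply, lift, eZero, eInf, inj, inner_zero_right, Prod.fst_add, Prod.snd_add,
      Prod.smul_fst, Prod.smul_snd, smul_zero, add_zero, smul_eq_mul, zero_add, zero_mul,
      sub_self] at h1 h2
    have h1' : (T (inj z)).2.2 = -(T (inj z)).2.1 := by rw [inj]; linarith
    have h2' : (T (inj z)).2.1 = -inner ℝ (X 0 0) (T (inj z)).1 := by
      rw [real_inner_comm, inj]; rw [inj] at h1'; rw [h1'] at h2; linarith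
    refine Prod.ext (by simp [tlift, inj, eInf]) (Prod.ext ?_ ?_)
    · rw [h2']; simp [tlift, inj, eInf]; ring
    · rw [h1', h2']; simp [tlift, inj, eInf]; ring
  have hinj_add : ∀ y z : E N, (inj (y + z) : Mink N) = inj y + inj z := fun y z => by simp [inj]
  have hinj_smul : ∀ (c : ℝ) (z : E N), (inj (c • z) : Mink N) = c • inj z := fun c z => by
    simp [inj]
  let L : E N →ₗ[ℝ] E N :=
    { toFun := fun z => (T (inj z)).1
      map_add' := fun y z => by rw [hinj_add, hadd]; rfl
      map_smul' := fun c z => by rw [hinj_smul, hsmul]; rfl }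
  have hL : ∀ y z, inner ℝ (L y) (L z) = (inner ℝ y z : ℝ) := fun y z => by
    rw [← DiscreteSol.lorentz_inj y z, ← hTl, hv y, hv z, lorentz_tlift]; rfl
  let O : E N ≃ₗᵢ[ℝ] E N := (L.isometryOfInner hL).toLinearIsometryEquiv rfl
  have hO : ∀ z, O z = (T (inj z)).1 := fun z => rfl
  refine ⟨O, ⟨isUnit_of_mem_HInf h.1, fun z => ?_, (h.2 0).1, by rw [hT, hi], fun _ _ => rfl⟩,
    fun i => ?_⟩
  · rw [hT, hv, hO]; rfl
  · have h1 := (h.2 i).2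
    rw [hT, e_eq_inj, hv, unitTangent_eq (hX i), hx i] at h1
    exact tlift_injective (x := X 0 0) (emb_injective h1)

end Suited

/-! ### Framed curves and the coefficients read off them. -/

section ReadOff

variable {N : ℕ}

/-- A curve with its rotation minimizing frame `R` along `[0, r]`. -/
structure CurveFrame (r : ℝ) (X : ℝ → E N) (u : E N) (h : ℝ → ℝ) (b : ℝ → E N)
    (R : ℝ → E N →L[ℝ] E N) : Prop where
  smooth : ContDiff ℝ ∞ X
  contb : Continuous b
  conth : Continuous h
  contR : Continuous R
  pos : ∀ t ∈ Icc 0 r, 0 < h t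
  tangent : ∀ t ∈ Icc 0 r, deriv X t = h t • R t u
  rot : ∀ t ∈ Icc 0 r, HasDerivAt R (R t ∘L rotGen 0 u (b t)) t
  iso : ∀ t ∈ Icc 0 r, ∀ y z, inner ℝ (R t y) (R t z) = (inner ℝ y z : ℝ)
  init : R 0 = .id ℝ _
  unit : inner ℝ u u = (1 : ℝ)
  perp : ∀ t ∈ Icc 0 r, inner ℝ (b t) u = (0 : ℝ)

variable {r : ℝ} {X : ℝ → E N} {u : E N} {h : ℝ → ℝ} {b : ℝ → E N} {R : ℝ → E N →L[ℝ] E N}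

theorem CurveFrame.norm_deriv (F : CurveFrame r X u h b R) {t : ℝ} (ht : t ∈ Icc 0 r) :
    ‖deriv X t‖ = h t := by
  have : ‖R t u‖ = 1 := norm_eq_one_of_inner (by rw [F.iso t ht, F.unit])
  rw [F.tangent t ht, norm_smul, this, mul_one, Real.norm_of_nonneg (F.pos t ht).le]

theorem CurveFrame.deriv_ne_zero (F : CurveFrame r X u h b R) {t : ℝ} (ht : t ∈ Icc 0 r) :
    deriv X t ≠ 0 := by
  rw [← norm_ne_zero_iff, F.norm_deriv ht]
  exact (F.pos t ht).ne'

theorem CurveFrame.hasDerivAt (F : CurveFrame r X u h b R) {t : ℝ} (ht : t ∈ Icc 0 r) :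
    HasDerivAt X (h t • R t u) t := by
  rw [← F.tangent t ht]
  exact (F.smooth.differentiable (by simp)).differentiableAt.hasDerivAt

theorem CurveFrame.unitTangent_eq (F : CurveFrame r X u h b R) {t : ℝ} (ht : t ∈ Icc 0 r) :
    unitTangent X t = tlift (X t) (R t u) := by
  rw [CSurf.unitTangent_eq (F.hasDerivAt ht).differentiableAt, F.norm_deriv ht, F.tangent t ht,
    smul_smul, inv_mul_cancel₀ (F.pos t ht).ne', one_smul]

theorem CurveFrame.hasDerivAt_apply (F : CurveFrame r X u h b R) {t : ℝ} (ht : t ∈ Icc 0 r)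
    (z : E N) : HasDerivAt (fun s => tlift (X s) (R s z))
      (tlift (X t) ((inner ℝ (b t) z : ℝ) • R t u - (inner ℝ u z : ℝ) • R t (b t)) +
        (2 * (h t * inner ℝ u z)) • eInf N) t := by
  have h1 := (F.rot t ht).clm_apply (hasDerivAt_const t z)
  have h2 := hasDerivAt_tlift (F.hasDerivAt ht) h1
  refine h2.congr_deriv ?_
  rw [real_inner_smul_left, F.iso t ht]
  simp [rotGen_zero]

/-- The formula for the unit tangent is known only on `[0, r]`, while `deriv` is two-sided.
Differentiability of `unitTangent X` and uniqueness of derivatives within the interval identify the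
two, also at the endpoints. -/
theorem CurveFrame.deriv_unitTangent (F : CurveFrame r X u h b R) (hr : 0 < r) {t : ℝ}
    (ht : t ∈ Icc 0 r) :
    deriv (unitTangent X) t = tlift (X t) (-R t (b t)) + (2 * h t) • eInf N := by
  have h1 := F.hasDerivAt_apply ht u
  rw [F.perp t ht, F.unit] at h1
  have h2 := (differentiableAt_unitTangent F.smooth (F.deriv_ne_zero ht)).hasDerivAt
  have h3 : HasDerivWithinAt (unitTangent X) _ (Icc 0 r) t :=
    h1.hasDerivWithinAt.congr (fun s hs => F.unitTangent_eq hs) (F.unitTangent_eq ht)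
  rw [(uniqueDiffOn_Icc hr t ht).eq_deriv _ h2.hasDerivWithinAt h3]
  simp

theorem lorentz_tlift_add_eInf (x y z : E N) (c : ℝ) :
    lorentz N (tlift x y) (tlift x z + c • eInf N) = inner ℝ y z := by
  rw [map_add, map_smul, lorentz_tlift, lorentz_tlift_eInf, smul_zero, add_zero]

theorem abs_lorentz_le (v w : Mink N) : |lorentz N v w| ≤ 3 * (‖v‖ * ‖w‖) := by
  rw [lorentz_apply]
  have h1 : |(inner ℝ v.1 w.1 : ℝ)| ≤ ‖v‖ * ‖w‖ := (abs_real_inner_le_norm _ _).trans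
    (mul_le_mul (norm_fst_le v) (norm_fst_le w) (norm_nonneg _) (norm_nonneg _))
  have h2 : |v.2.1 * w.2.1| ≤ ‖v‖ * ‖w‖ := by
    rw [abs_mul]
    exact mul_le_mul ((norm_fst_le v.2).trans (norm_snd_le v))
      ((norm_fst_le w.2).trans (norm_snd_le w)) (abs_nonneg _) (norm_nonneg _)
  have h3 : |v.2.2 * w.2.2| ≤ ‖v‖ * ‖w‖ := by
    rw [abs_mul]
    exact mul_le_mul ((norm_snd_le v.2).trans (norm_snd_le v))
      ((norm_snd_le w.2).trans (norm_snd_le w)) (abs_nonneg _) (norm_nonneg _)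
  rw [abs_le] at *
  constructor <;> linarith [h1.1, h1.2, h2.1, h2.2, h3.1, h3.2]

variable {hN : 2 ≤ N} {O : E N ≃ₗᵢ[ℝ] E N} {Ψ : Cl N} {i : Fin 2}

theorem inner_axVec_single {k : Fin N}
    (hk : k ≠ ax hN i) : inner ℝ (axVec hN O i) (O (EuclideanSpace.single k 1)) = (0 : ℝ) := by
  rw [axVec, O.inner_map_map, EuclideanSpace.inner_single_right]
  simp [hk]

theorem inner_apply_single (z : E N) (k : Fin N) :
    inner ℝ z (O (EuclideanSpace.single k 1)) = O.symm z k := by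
  rw [← O.symm.inner_map_map, O.symm_apply_apply, EuclideanSpace.inner_single_right]
  simp

/-- The tangent lifts of the columns of `R` serve as the fields `v̂_k`: for `k` other than the
tangential index, a rotation minimizing frame changes the `k`-th column only along the tangent. -/
theorem CurveFrame.isReadOff (F : CurveFrame r X (axVec hN O i) h b R) (hr : 0 < r)
    (hΨ : IsFrame O Ψ (X 0) (.id ℝ _)) :
    IsReadOff hN r Ψ i X h fun k t => O.symm (b t) k := by
  refine ⟨fun k t => tlift (X t) (R t (O (EuclideanSpace.single k 1))), fun t ht => ?_, fun k => ?_,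
    fun k hk t ht => ⟨?_, ?_⟩⟩
  · exact ⟨by rw [F.norm_deriv ht]; exact F.pos t ht, (F.norm_deriv ht).symm,
      (F.unitTangent_eq ht).symm⟩
  · simp only [e_eq_inj, hΨ.vec, F.init]
  · rw [F.deriv_unitTangent hr ht, lorentz_tlift_add_eInf, inner_neg_right, neg_neg, F.iso t ht,
      real_inner_comm, inner_apply_single]
  · have := F.hasDerivAt_apply ht (O (EuclideanSpace.single k 1))
    rw [inner_axVec_single hk, zero_smul, sub_zero, mul_zero, mul_zero, zero_smul, add_zero, tlift_smul,
      inner_apply_single] at this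
    exact this.hasDerivWithinAt

/-- `B k` is itself defined through `v k`, so the condition on `v k` is a linear differential
equation. The difference of two solutions with equal initial value satisfies the homogeneous
equation and vanishes by Gronwall, whence `B k` is determined. -/
theorem CurveFrame.eq_of_isReadOff (F : CurveFrame r X (axVec hN O i) h b R) (hr : 0 < r)
    (hΨ : IsFrame O Ψ (X 0) (.id ℝ _)) {H : ℝ → ℝ} {B : Fin N → ℝ → ℝ}
    (hB : IsReadOff hN r Ψ i X H B) :
    (∀ t ∈ Icc 0 r, h t = H t) ∧ ∀ k, k ≠ ax hN i → ∀ t ∈ Icc 0 r, O.symm (b t) k = B k t := by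
  obtain ⟨v, hv1, hv2, hv3⟩ := hB
  refine ⟨fun t ht => by rw [(hv1 t ht).2.1, F.norm_deriv ht], fun k hk => ?_⟩
  set m := O (EuclideanSpace.single k 1) with hm
  have hcX := F.smooth.continuous
  have hcb := F.contb
  have hch := F.conth
  have hcR := F.contR
  have hctl : ∀ {z : ℝ → E N}, Continuous z → Continuous fun t => tlift (X t) (z t) := by
    intro z hz
    unfold tlift inj
    fun_prop
  have hcont : Continuous fun t => 3 * ‖tlift (X t) (-R t (b t)) + (2 * h t) • eInf N‖ *
      ‖tlift (X t) (R t (axVec hN O i))‖ := by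
    have h1 := hctl (z := fun t => -R t (b t)) (by fun_prop)
    have h2 := hctl (z := fun t => R t (axVec hN O i)) (by fun_prop)
    fun_prop
  obtain ⟨K, hK⟩ := isCompact_Icc.exists_bound_of_continuousOn (s := Icc 0 r) hcont.continuousOn
  have key : ∀ t ∈ Icc 0 r, v k t - tlift (X t) (R t m) = 0 := by
    refine eq_zero_of_abs_deriv_le_mul_abs_self_of_eq_zero_right (K := K)
      (f' := fun t => (-lorentz N (v k t - tlift (X t) (R t m)) (deriv (unitTangent X) t)) •
        unitTangent X t) (fun t ht => ?_) (fun t ht => ?_) ?_ fun t ht => ?_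
    · exact ((hv3 k hk t ht).2.continuousWithinAt).sub
        ((F.hasDerivAt_apply ht m).continuousAt.continuousWithinAt)
    · have ht' := Ico_subset_Icc_self ht
      have h1 := (hv3 k hk t ht').2
      have h2 := F.hasDerivAt_apply ht' m
      have h3 := (h1.sub h2.hasDerivWithinAt).mono_of_mem_nhdsWithin
        (Icc_mem_nhdsGE_of_mem ht)
      refine h3.congr_deriv ?_
      rw [(hv1 t ht').2.2, (hv3 k hk t ht').1, hm, inner_axVec_single hk, zero_smul, sub_zero, mul_zero,
        mul_zero, zero_smul, add_zero, tlift_smul, map_sub, LinearMap.sub_apply,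
        F.deriv_unitTangent hr ht', lorentz_tlift_add_eInf, inner_neg_right, F.iso t ht',
        real_inner_comm, F.unitTangent_eq ht']
      module
    · rw [← emb_injective.eq_iff, emb_sub, ← hv2, e_eq_inj, hΨ.vec, F.init, sub_self]
      exact (map_zero _).symm
    · have ht' := Ico_subset_Icc_self ht
      have h1 := (le_abs_self _).trans (hK t ht')
      have h2 := abs_lorentz_le (v k t - tlift (X t) (R t m)) (deriv (unitTangent X) t)
      rw [norm_smul, norm_neg, Real.norm_eq_abs, F.unitTangent_eq ht']
      rw [F.deriv_unitTangent hr ht'] at h2 ⊢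
      refine (mul_le_mul_of_nonneg_right h2 (norm_nonneg _)).trans ?_
      refine le_trans (le_of_eq ?_) (mul_le_mul_of_nonneg_right h1 (norm_nonneg _))
      ring
  intro t ht
  rw [(hv3 k hk t ht).1, sub_eq_zero.1 (key t ht), F.deriv_unitTangent hr ht,
    lorentz_tlift_add_eInf, inner_neg_right, neg_neg, F.iso t ht, real_inner_comm,
    inner_apply_single]

end ReadOff


/-! ### Calculus on the square -/

section BoxCalculus

variable {V V' : Type*} [NormedAddCommGroup V] [NormedSpace ℝ V] [NormedAddCommGroup V']
  [NormedSpace ℝ V'] {r : ℝ}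

theorem box_eq_pi (r : ℝ) : box r = Set.pi univ fun _ => Icc 0 r := by
  ext ξ; exact ⟨fun h i _ => h i, fun h i => h i (mem_univ i)⟩

theorem uniqueDiffOn_box (hr : 0 < r) : UniqueDiffOn ℝ (box r) := by
  rw [box_eq_pi]
  exact UniqueDiffOn.univ_pi fun _ => uniqueDiffOn_Icc hr

theorem isCompact_box (r : ℝ) : IsCompact (box r) := by
  rw [box_eq_pi]
  exact isCompact_univ_pi fun _ => isCompact_Icc

theorem update_mem_box {ξ : Fin 2 → ℝ} (hξ : ξ ∈ box r) (i : Fin 2) {s : ℝ} (hs : s ∈ Icc 0 r) :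
    Function.update ξ i s ∈ box r := by
  intro j
  by_cases h : j = i
  · subst h; simpa using hs
  · simpa [h] using hξ j

theorem single_mem_box (i : Fin 2) {s : ℝ} (hs : s ∈ Icc 0 r) : Pi.single i s ∈ box r := by
  intro j
  by_cases h : j = i
  · subst h; simpa using hs
  · simpa [h] using hs.1.trans hs.2

theorem update_zero {i j : Fin 2} (h : i ≠ j) (ξ : Fin 2 → ℝ) :
    Function.update ξ i 0 = Pi.single j (ξ j) := by
  ext k
  fin_cases i <;> fin_cases j <;> fin_cases k <;> simp at h ⊢

theorem hasDerivAt_line {f : (Fin 2 → ℝ) → V} {f' : (Fin 2 → ℝ) →L[ℝ] V} {ξ : Fin 2 → ℝ} {i : Fin 2}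
    {s : ℝ} (h : HasFDerivAt f f' (Function.update ξ i s)) :
    HasDerivAt (fun s => f (Function.update ξ i s)) (f' (Pi.single i 1)) s :=
  h.comp_hasDerivAt s (hasDerivAt_update ξ i s)

theorem hasDerivAt_axis {f : (Fin 2 → ℝ) → V} {f' : (Fin 2 → ℝ) →L[ℝ] V} {i : Fin 2}
    {s : ℝ} (h : HasFDerivAt f f' (Pi.single i s)) :
    HasDerivAt (fun s => f (Pi.single i s)) (f' (Pi.single i 1)) s :=
  hasDerivAt_line (ξ := 0) h

theorem hasDerivWithinAt_line {f : (Fin 2 → ℝ) → V} {ξ : Fin 2 → ℝ} (hξ : ξ ∈ box r) {i : Fin 2}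
    {s : ℝ} (h : DifferentiableWithinAt ℝ f (box r) (Function.update ξ i s)) :
    HasDerivWithinAt (fun s => f (Function.update ξ i s)) (pderiv r i f (Function.update ξ i s))
      (Icc 0 r) s :=
  h.hasFDerivWithinAt.comp_hasDerivWithinAt s (hasDerivAt_update ξ i s).hasDerivWithinAt
    fun _ hs => update_mem_box hξ i hs

theorem eq_of_hasDerivWithinAt_zero {f : ℝ → V}
    (h : ∀ t ∈ Icc 0 r, HasDerivWithinAt f 0 (Icc 0 r) t) {t : ℝ} (ht : t ∈ Icc 0 r) :
    f t = f 0 :=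
  constant_of_has_deriv_right_zero (fun t ht => (h t ht).continuousWithinAt)
    (fun t ht => (h t (Ico_subset_Icc_self ht)).mono_of_mem_nhdsWithin
      (Icc_mem_nhdsGE_of_mem ht)) t ht

theorem eq_zero_of_hasDerivWithinAt {f f' : ℝ → V} {K : ℝ}
    (h : ∀ t ∈ Icc 0 r, HasDerivWithinAt f (f' t) (Icc 0 r) t)
    (hK : ∀ t ∈ Icc 0 r, ‖f' t‖ ≤ K * ‖f t‖) (h0 : f 0 = 0) {t : ℝ} (ht : t ∈ Icc 0 r) : f t = 0 :=
  eq_zero_of_abs_deriv_le_mul_abs_self_of_eq_zero_right (fun t ht => (h t ht).continuousWithinAt)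
    (fun t ht => (h t (Ico_subset_Icc_self ht)).mono_of_mem_nhdsWithin
      (Icc_mem_nhdsGE_of_mem ht)) h0 (fun t ht => hK t (Ico_subset_Icc_self ht)) t ht

/-- Uniqueness for the linear equation `D' = D Ω`. -/
theorem clm_eq_zero_of_hasDerivWithinAt {D Ω : ℝ → V →L[ℝ] V} (hΩ : ContinuousOn Ω (Icc 0 r))
    (h : ∀ t ∈ Icc 0 r, HasDerivWithinAt D (D t ∘L Ω t) (Icc 0 r) t) (h0 : D 0 = 0) {t : ℝ}
    (ht : t ∈ Icc 0 r) : D t = 0 := by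
  obtain ⟨K, hK⟩ := isCompact_Icc.exists_bound_of_continuousOn hΩ
  refine eq_zero_of_hasDerivWithinAt h (K := K) (fun t ht => ?_) h0 ht
  refine (ContinuousLinearMap.opNorm_comp_le _ _).trans ?_
  rw [mul_comm]
  gcongr
  exact hK t ht

end BoxCalculus

/-! ### Frames along curves -/

section CurveFrames

variable {N : ℕ}

theorem sum_smul_single (z : E N) : ∑ k, z k • EuclideanSpace.single k (1 : ℝ) = z := by
  ext l
  simp [Pi.single_apply]

/-- The vector `-Rᵀ p`. -/
def negAdj (R : E N →L[ℝ] E N) (p : E N) : E N :=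
  -∑ k, (inner ℝ p (R (EuclideanSpace.single k 1)) : ℝ) • EuclideanSpace.single k (1 : ℝ)

theorem inner_negAdj (R : E N →L[ℝ] E N) (p z : E N) :
    inner ℝ (negAdj R p) z = -(inner ℝ p (R z) : ℝ) := by
  conv_rhs => rw [← sum_smul_single z, map_sum, inner_sum]
  rw [negAdj, inner_neg_left, sum_inner]
  congr 1
  refine Finset.sum_congr rfl fun k _ => ?_
  rw [real_inner_smul_left, map_smul, real_inner_smul_right, EuclideanSpace.inner_single_left]
  simp [mul_comm]

theorem surjective_of_isometry {R : E N →L[ℝ] E N}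
    (hR : ∀ y z, inner ℝ (R y) (R z) = (inner ℝ y z : ℝ)) : Function.Surjective R := by
  have hinj : Function.Injective (R : E N →ₗ[ℝ] E N) :=
    ((R : E N →ₗ[ℝ] E N).isometryOfInner hR).injective
  exact LinearMap.injective_iff_surjective.1 hinj

theorem apply_negAdj {R : E N →L[ℝ] E N} (hR : ∀ y z, inner ℝ (R y) (R z) = (inner ℝ y z : ℝ))
    (p : E N) : R (negAdj R p) = -p := by
  refine ext_inner_right ℝ fun w => ?_
  obtain ⟨z, rfl⟩ := surjective_of_isometry hR w
  rw [hR, inner_negAdj, inner_neg_left]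

theorem contDiff_negAdj {R : ℝ → E N →L[ℝ] E N} {p : ℝ → E N} (hR : ContDiff ℝ ∞ R)
    (hp : ContDiff ℝ ∞ p) : ContDiff ℝ ∞ fun t => negAdj (R t) (p t) :=
  (ContDiff.sum fun _ _ => (hp.inner ℝ (hR.clm_apply contDiff_const)).smul contDiff_const).neg

/-- The generator of the minimal rotation of a unit vector `a` with velocity `p`. -/
def minRot (a p : E N) : E N →L[ℝ] E N :=
  (innerSL ℝ a).smulRight p - (innerSL ℝ p).smulRight a

theorem minRot_apply (a p z : E N) :
    minRot a p z = (inner ℝ a z : ℝ) • p - (inner ℝ p z : ℝ) • a := by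
  simp [minRot]

theorem inner_minRot (a p y z : E N) :
    inner ℝ (minRot a p y) z + inner ℝ y (minRot a p z) = (0 : ℝ) := by
  simp only [minRot_apply, inner_sub_left, inner_sub_right, real_inner_smul_left,
    real_inner_smul_right]
  rw [real_inner_comm y p, real_inner_comm y a]
  ring

/-- An ordinary differential equation is a Goursat problem with constant data and an idle second
unknown; its solution is restricted to the first axis. -/
theorem exists_linear_ode {A : ℝ → E N →L[ℝ] E N} (hA : ContDiff ℝ ∞ A) :
    ∃ R : ℝ → E N →L[ℝ] E N, ContDiff ℝ ∞ R ∧ R 0 = .id ℝ _ ∧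
      ∀ᶠ t in 𝓝 (0 : ℝ), HasDerivAt R (A t ∘L R t) t := by
  obtain ⟨a, b, ha, -, h1, h2⟩ := exists_goursat
    (fun p : (Fin 2 → ℝ) × (E N →L[ℝ] E N) × ℝ => A (p.1 0) ∘L p.2.1)
    ((hA.comp ((contDiff_apply ℝ ℝ 0).comp contDiff_fst)).clm_comp contDiff_snd.fst)
    (fun _ => (0 : ℝ)) contDiff_const (fun _ => .id ℝ _) contDiff_const (fun _ => (0 : ℝ))
    contDiff_const
  have hc : Continuous fun t : ℝ => (Pi.single 0 t : Fin 2 → ℝ) :=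
    (ContinuousLinearMap.single ℝ (fun _ : Fin 2 => ℝ) 0).continuous
  refine ⟨fun t => a (Pi.single 0 t), ha.comp ?_, ?_, ?_⟩
  · exact (ContinuousLinearMap.single ℝ (fun _ : Fin 2 => ℝ) 0).contDiff
  · have := h2.self_of_nhds.1
    simpa using this
  · have h3 : Filter.Tendsto (fun t : ℝ => (Pi.single 0 t : Fin 2 → ℝ)) (𝓝 0) (𝓝 0) := by
      simpa using hc.tendsto 0
    filter_upwards [h3.eventually h1] with t ht
    have := hasDerivAt_axis (i := 0) (s := t) (ha.differentiable (by simp) _).hasFDerivAt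
    rw [ht.1] at this
    simpa using this

/-- Let `τ` be the unit tangent. The skew generator `minRot τ τ'` keeps `R` isometric and satisfies
`minRot τ τ' τ = τ'`, so `R u` follows `τ`. The choice `b = -Rᵀτ'` rewrites left multiplication by
this generator as right multiplication by the generator of `u` and `b`. -/
theorem exists_curveFrame {X : ℝ → E N} (hX : ContDiff ℝ ∞ X) (h0 : deriv X 0 ≠ 0) :
    ∃ (h : ℝ → ℝ) (b : ℝ → E N) (R : ℝ → E N →L[ℝ] E N), ContDiff ℝ ∞ h ∧ ContDiff ℝ ∞ b ∧
      ContDiff ℝ ∞ R ∧ ∃ ρ > 0, CurveFrame ρ X (‖deriv X 0‖⁻¹ • deriv X 0) h b R := by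
  have hX' : ContDiff ℝ ∞ (deriv X) := (contDiff_infty_iff_deriv.1 hX).2
  have hne : ∀ᶠ t in 𝓝 (0 : ℝ), deriv X t ≠ 0 := hX'.continuous.continuousAt.eventually_ne h0
  obtain ⟨h, hh, hhe⟩ := exists_contDiff_eventuallyEq (f := fun t => ‖deriv X t‖) (x := (0 : ℝ))
    (hne.mono fun t ht => hX'.contDiffAt.norm ℝ ht)
  obtain ⟨τ, hτ, hτe⟩ := exists_contDiff_eventuallyEq (f := fun t => ‖deriv X t‖⁻¹ • deriv X t)
    (x := (0 : ℝ)) (hne.mono fun t ht =>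
      ((hX'.contDiffAt.norm ℝ ht).inv (norm_ne_zero_iff.2 ht)).smul hX'.contDiffAt)
  have hτ' : ContDiff ℝ ∞ (deriv τ) := (contDiff_infty_iff_deriv.1 hτ).2
  obtain ⟨R, hR, hR0, hRe⟩ := exists_linear_ode (A := fun t => minRot (τ t) (deriv τ t))
    ((contDiff_smulRight hτ hτ').sub (contDiff_smulRight hτ' hτ))
  refine ⟨h, fun t => negAdj (R t) (deriv τ t), R, hh, contDiff_negAdj hR hτ', hR, ?_⟩
  obtain ⟨δ, hδ, hball⟩ := Metric.eventually_nhds_iff_ball.1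
    (hne.and (hhe.and (hτe.eventually_nhds.and hRe)))
  have hb : ∀ {t}, t ∈ Icc 0 (δ / 2) → t ∈ Metric.ball (0 : ℝ) δ := fun {t} ht => by
    rw [mem_ball_zero_iff, Real.norm_of_nonneg ht.1]; linarith [ht.2]
  have hτt : ∀ t ∈ Icc 0 (δ / 2), τ t = ‖deriv X t‖⁻¹ • deriv X t := fun t ht =>
    (hball t (hb ht)).2.2.1.self_of_nhds
  have hττ : ∀ t ∈ Metric.ball (0 : ℝ) δ, inner ℝ (τ t) (τ t) = (1 : ℝ) := fun t ht => by
    have h1 := (hball t ht).2.2.1.self_of_nhds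
    have h2 := norm_ne_zero_iff.2 (hball t ht).1
    rw [h1, real_inner_self_eq_norm_sq, norm_smul, norm_inv, norm_norm, inv_mul_cancel₀ h2, one_pow]
  have hττ' : ∀ t ∈ Icc 0 (δ / 2), inner ℝ (τ t) (deriv τ t) = (0 : ℝ) := fun t ht => by
    have hd := (hτ.differentiable (by simp) t).hasDerivAt
    have h1 := hd.inner ℝ hd
    have h2 : HasDerivAt (fun s => (inner ℝ (τ s) (τ s) : ℝ)) 0 t := by
      refine (hasDerivAt_const t (1 : ℝ)).congr_of_eventuallyEq ?_
      filter_upwards [Metric.isOpen_ball.mem_nhds (hb ht)] with s hs using hττ s hs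
    have h3 := h1.unique h2
    rw [real_inner_comm (τ t) (deriv τ t)] at h3
    linarith
  have hRd : ∀ t ∈ Icc 0 (δ / 2), HasDerivAt R (minRot (τ t) (deriv τ t) ∘L R t) t := fun t ht =>
    (hball t (hb ht)).2.2.2
  have hRz : ∀ z, ∀ t ∈ Icc 0 (δ / 2),
      HasDerivAt (fun s => R s z) (minRot (τ t) (deriv τ t) (R t z)) t := fun z t ht => by
    simpa using (hRd t ht).clm_apply (hasDerivAt_const t z)
  have hiso : ∀ t ∈ Icc 0 (δ / 2), ∀ y z, inner ℝ (R t y) (R t z) = (inner ℝ y z : ℝ) := by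
    intro t ht y z
    rw [eq_of_hasDerivWithinAt_zero (f := fun t => (inner ℝ (R t y) (R t z) : ℝ)) (fun s hs => ?_) ht,
      hR0]
    · rfl
    · have := (hRz y s hs).inner ℝ (hRz z s hs)
      rw [add_comm, inner_minRot] at this
      exact this.hasDerivWithinAt
  set u := ‖deriv X 0‖⁻¹ • deriv X 0 with hu
  have h00 : (0 : ℝ) ∈ Icc 0 (δ / 2) := ⟨le_rfl, by positivity⟩
  have hu1 : inner ℝ u u = (1 : ℝ) := by rw [hu, ← hτt 0 h00, hττ 0 (hb h00)]
  have hRu : ∀ t ∈ Icc 0 (δ / 2), R t u = τ t := by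
    intro t ht
    -- The scalar product of the two unit vectors is constant because both move with the same skew
    -- generator; being `1` initially, it forces them to agree.
    have h1 : (inner ℝ (R t u) (τ t) : ℝ) = 1 := by
      rw [eq_of_hasDerivWithinAt_zero (f := fun t => (inner ℝ (R t u) (τ t) : ℝ)) (fun s hs => ?_) ht,
        hR0, hτt 0 h00]
      · exact hu1
      · have h2 := (hRz u s hs).inner ℝ (hτ.differentiable (by simp) s).hasDerivAt
        have h3 : deriv τ s = minRot (τ s) (deriv τ s) (τ s) := by
          rw [minRot_apply, hττ s (hb hs), real_inner_comm, hττ' s hs]; simp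
        have h4 := inner_minRot (τ s) (deriv τ s) (R s u) (τ s)
        rw [← h3, add_comm] at h4
        rw [h4] at h2
        exact h2.hasDerivWithinAt
    rw [← sub_eq_zero, ← inner_self_eq_zero (𝕜 := ℝ), inner_sub_left, inner_sub_right,
      inner_sub_right, hiso t ht, hu1, real_inner_comm (R t u) (τ t), h1, hττ t (hb ht)]
    norm_num
  have hcb : ContDiff ℝ ∞ fun t => negAdj (R t) (deriv τ t) := contDiff_negAdj hR hτ'
  refine ⟨δ / 2, by positivity, hX, hcb.continuous, hh.continuous, hR.continuous, fun t ht => ?_,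
    fun t ht => ?_, fun t ht => ?_, hiso, hR0, hu1, fun t ht => ?_⟩
  · rw [(hball t (hb ht)).2.1]
    exact norm_pos_iff.2 (hball t (hb ht)).1
  · rw [(hball t (hb ht)).2.1, hRu t ht, hτt t ht, smul_smul,
      mul_inv_cancel₀ (norm_ne_zero_iff.2 (hball t (hb ht)).1), one_smul]
  · refine (hRd t ht).congr_deriv (ContinuousLinearMap.ext fun z => ?_)
    simp only [ContinuousLinearMap.comp_apply, rotGen_zero, map_sub, map_smul, hRu t ht,
      apply_negAdj (hiso t ht), minRot_apply, inner_negAdj]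
    rw [← hRu t ht, hiso t ht, hRu t ht]
    module
  · rw [inner_negAdj, hRu t ht, real_inner_comm, hττ' t ht, neg_zero]

theorem CurveFrame.mono {r ρ : ℝ} {X : ℝ → E N} {u : E N} {h : ℝ → ℝ} {b : ℝ → E N}
    {R : ℝ → E N →L[ℝ] E N} (F : CurveFrame ρ X u h b R) (hr : r ≤ ρ) : CurveFrame r X u h b R :=
  have hs : Icc 0 r ⊆ Icc 0 ρ := Icc_subset_Icc le_rfl hr
  ⟨F.smooth, F.contb, F.conth, F.contR, fun t ht => F.pos t (hs ht), fun t ht => F.tangent t (hs ht),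
    fun t ht => F.rot t (hs ht), fun t ht => F.iso t (hs ht), F.init, F.unit,
    fun t ht => F.perp t (hs ht)⟩

end CurveFrames


/-! ### Partial derivatives on the square -/

section PartialDerivatives

variable {V V' : Type*} [NormedAddCommGroup V] [NormedSpace ℝ V] [NormedAddCommGroup V']
  [NormedSpace ℝ V'] {r : ℝ} {f g : (Fin 2 → ℝ) → V} {ξ : Fin 2 → ℝ} {i : Fin 2}

theorem pderiv_congr (h : EqOn f g (box r)) (hξ : ξ ∈ box r) : pderiv r i f ξ = pderiv r i g ξ := by
  rw [pderiv, pderiv, fderivWithin_congr h (h hξ)]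

theorem pderiv_eq_fderiv (hr : 0 < r) (hf : DifferentiableAt ℝ f ξ) (hξ : ξ ∈ box r) :
    pderiv r i f ξ = fderiv ℝ f ξ (Pi.single i 1) := by
  rw [pderiv, fderivWithin_eq_fderiv (uniqueDiffOn_box hr ξ hξ) hf]

theorem contDiffOn_pderiv (hr : 0 < r) (hf : ContDiffOn ℝ ∞ f (box r)) :
    ContDiffOn ℝ ∞ (pderiv r i f) (box r) :=
  (hf.fderivWithin (uniqueDiffOn_box hr) (m := ∞) (by simp)).clm_apply contDiffOn_const

/-- Symmetry of second derivatives extends to the boundary of the square, which is in the closure of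
its interior. -/
theorem pderiv_comm (hr : 0 < r) (hf : ContDiffOn ℝ ∞ f (box r)) (hξ : ξ ∈ box r) (i j : Fin 2) :
    pderiv r i (pderiv r j f) ξ = pderiv r j (pderiv r i f) ξ := by
  have hu := uniqueDiffOn_box hr
  have hd : DifferentiableWithinAt ℝ (fderivWithin ℝ f (box r)) (box r) ξ :=
    (hf.fderivWithin hu (m := ∞) (by simp)).differentiableOn (by simp) ξ hξ
  have key : ∀ i j, pderiv r i (pderiv r j f) ξ =
      fderivWithin ℝ (fderivWithin ℝ f (box r)) (box r) ξ (Pi.single i 1) (Pi.single j 1) := by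
    intro i j
    have : pderiv r j f = fun η => fderivWithin ℝ f (box r) η (Pi.single j 1) := rfl
    rw [pderiv, this, fderivWithin_clm_apply (hu ξ hξ) hd (differentiableWithinAt_const _)]
    simp
  rw [key, key]
  have hcl : ξ ∈ closure (interior (box r)) := by
    have hconv : Convex ℝ (box r) := by
      rw [box_eq_pi]; exact convex_pi fun _ _ => convex_Icc _ _
    have hne : (interior (box r)).Nonempty := by
      rw [box_eq_pi, interior_pi_set finite_univ]
      refine ⟨fun _ => r / 2, fun _ _ => ?_⟩
      rw [interior_Icc]
      constructor <;> linarith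
    rw [hconv.closure_interior_eq_closure_of_nonempty_interior hne]
    exact subset_closure hξ
  exact ((hf ξ hξ).isSymmSndFDerivWithinAt
    (by simpa using WithTop.coe_le_coe.2 (le_top : (2 : ℕ∞) ≤ ⊤)) hu hcl hξ).eq _ _

theorem pderiv_clm (hr : 0 < r) (L : V →L[ℝ] V') (hf : DifferentiableWithinAt ℝ f (box r) ξ)
    (hξ : ξ ∈ box r) : pderiv r i (fun η => L (f η)) ξ = L (pderiv r i f ξ) := by
  have := (L.hasFDerivAt.comp_hasFDerivWithinAt ξ hf.hasFDerivWithinAt).fderivWithin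
    (uniqueDiffOn_box hr ξ hξ)
  rw [pderiv, pderiv]
  exact congrArg (fun A => A (Pi.single i 1)) this

theorem pderiv_smul (hr : 0 < r) {c : (Fin 2 → ℝ) → ℝ} (hc : DifferentiableWithinAt ℝ c (box r) ξ)
    (hf : DifferentiableWithinAt ℝ f (box r) ξ) (hξ : ξ ∈ box r) :
    pderiv r i (fun η => c η • f η) ξ = c ξ • pderiv r i f ξ + pderiv r i c ξ • f ξ := by
  rw [pderiv, fderivWithin_fun_smul (uniqueDiffOn_box hr ξ hξ) hc hf]
  simp [pderiv]

theorem pderiv_sub (hr : 0 < r) (hf : DifferentiableWithinAt ℝ f (box r) ξ)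
    (hg : DifferentiableWithinAt ℝ g (box r) ξ) (hξ : ξ ∈ box r) :
    pderiv r i (fun η => f η - g η) ξ = pderiv r i f ξ - pderiv r i g ξ := by
  rw [pderiv, fderivWithin_fun_sub (uniqueDiffOn_box hr ξ hξ) hf hg]
  simp [pderiv]

theorem pderiv_inner {N : ℕ} (hr : 0 < r) {f g : (Fin 2 → ℝ) → E N}
    (hf : DifferentiableWithinAt ℝ f (box r) ξ) (hg : DifferentiableWithinAt ℝ g (box r) ξ)
    (hξ : ξ ∈ box r) : pderiv r i (fun η => (inner ℝ (f η) (g η) : ℝ)) ξ =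
      inner ℝ (f ξ) (pderiv r i g ξ) + inner ℝ (pderiv r i f ξ) (g ξ) := by
  rw [pderiv, (hf.hasFDerivWithinAt.inner ℝ hg.hasFDerivWithinAt).fderivWithin
    (uniqueDiffOn_box hr ξ hξ)]
  simp [pderiv]

theorem pderiv_const (c : V) : pderiv r i (fun _ => c) ξ = 0 := by
  simp [pderiv]

theorem pderiv_clm_comp (hr : 0 < r) {A B : (Fin 2 → ℝ) → V →L[ℝ] V}
    (hA : DifferentiableWithinAt ℝ A (box r) ξ) (hB : DifferentiableWithinAt ℝ B (box r) ξ)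
    (hξ : ξ ∈ box r) : pderiv r i (fun η => A η ∘L B η) ξ =
      A ξ ∘L pderiv r i B ξ + pderiv r i A ξ ∘L B ξ := by
  rw [pderiv, fderivWithin_clm_comp (uniqueDiffOn_box hr ξ hξ) hA hB]
  simp [pderiv]

theorem pderiv_clm_apply_const (hr : 0 < r) {A : (Fin 2 → ℝ) → V →L[ℝ] V'}
    (hA : DifferentiableWithinAt ℝ A (box r) ξ) (z : V) (hξ : ξ ∈ box r) :
    pderiv r i (fun η => A η z) ξ = pderiv r i A ξ z :=
  pderiv_clm hr (ContinuousLinearMap.apply ℝ V' z) hA hξ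

/-- A function with vanishing derivative in the direction `i` is constant in this direction. -/
theorem eq_of_pderiv_eq_zero (hf : ContDiffOn ℝ ∞ f (box r))
    (h : ∀ ξ ∈ box r, pderiv r i f ξ = 0) (hξ : ξ ∈ box r) : f ξ = f (Function.update ξ i 0) := by
  have h1 := eq_of_hasDerivWithinAt_zero (r := r) (f := fun s => f (Function.update ξ i s))
    (fun s hs => by
      have := hasDerivWithinAt_line hξ
        (hf.differentiableOn (by simp) _ (update_mem_box hξ i hs)) (i := i) (s := s)
      rwa [h _ (update_mem_box hξ i hs)] at this) (hξ i)
  simpa using h1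

end PartialDerivatives

/-! ### The equations of C-surfaces -/

section Equations

variable {N : ℕ}

/-- `b ↦ Ω`, where `Ω z = ⟨b, z⟩ u - ⟨u, z⟩ b`. -/
def rotLin (u : E N) : E N →L[ℝ] E N →L[ℝ] E N :=
  LinearMap.toContinuousLinearMap
    { toFun := rotGen 0 u
      map_add' := fun b b' => by
        ext1 z; simp only [rotGen_zero, add_apply, inner_add_left]; module
      map_smul' := fun c b => by
        ext1 z
        simp only [rotGen_zero, smul_apply, real_inner_smul_left, RingHom.id_apply]; module }

theorem rotLin_apply (u b z : E N) :
    rotLin u b z = (inner ℝ b z : ℝ) • u - (inner ℝ u z : ℝ) • b := rotGen_zero u b z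

theorem rotLin_eq (u b : E N) : rotLin u b = rotGen 0 u b := rfl

theorem inner_rotLin (u b y z : E N) :
    inner ℝ (rotLin u b y) z + inner ℝ y (rotLin u b z) = (0 : ℝ) := by
  simp only [rotLin_apply, inner_sub_left, inner_sub_right, real_inner_smul_left,
    real_inner_smul_right]
  rw [real_inner_comm y b, real_inner_comm y u]
  ring

/-- The zero curvature equation. -/
theorem zero_curvature {u v b c : E N} {p q s t γ : ℝ}
    (huv : inner ℝ u v = (0 : ℝ)) (hp : inner ℝ b v = p) (hq : inner ℝ c u = q)
    (hs : inner ℝ b c = s) (ht : t = s / 2) :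
    rotLin u b ∘L rotLin v c - rotLin v c ∘L rotLin u b +
      rotLin v (q • (b - p • v) - (t - γ) • u) - rotLin u (p • (c - q • u) - (t + γ) • v) = 0 := by
  ext1 z
  have hvu : inner ℝ v u = (0 : ℝ) := by rw [real_inner_comm, huv]
  have hvb : inner ℝ v b = p := by rw [real_inner_comm, hp]
  have huc : inner ℝ u c = q := by rw [real_inner_comm, hq]
  have hcb : inner ℝ c b = s := by rw [real_inner_comm, hs]
  simp only [add_apply, sub_apply, ContinuousLinearMap.comp_apply, rotLin_apply, inner_sub_left,
    inner_sub_right, real_inner_smul_left, real_inner_smul_right, huv, hvu, hp, hvb, hq, huc, hs,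
    hcb, zero_apply, ht]
  module

/-- A solution of the Goursat problem for C-surfaces, together with the frame equations in the
second direction and on the first axis. -/
structure PreSol (r : ℝ) (Γ : (Fin 2 → ℝ) → ℝ) (u : Fin 2 → E N) (h : Fin 2 → (Fin 2 → ℝ) → ℝ)
    (b : Fin 2 → (Fin 2 → ℝ) → E N) (x : (Fin 2 → ℝ) → E N) (P : (Fin 2 → ℝ) → E N →L[ℝ] E N) :
    Prop where
  pos : 0 < r
  smooth_h : ∀ i, ContDiffOn ℝ ∞ (h i) (box r)
  smooth_b : ∀ i, ContDiffOn ℝ ∞ (b i) (box r)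
  smooth_x : ContDiffOn ℝ ∞ x (box r)
  smooth_P : ContDiffOn ℝ ∞ P (box r)
  unit : ∀ i, inner ℝ (u i) (u i) = (1 : ℝ)
  orth : ∀ i j, i ≠ j → inner ℝ (u i) (u j) = (0 : ℝ)
  evol_h : ∀ i j, i ≠ j → ∀ ξ ∈ box r, pderiv r i (h j) ξ = inner ℝ (b j ξ) (u i) * h i ξ
  evol_b : ∀ i j, i ≠ j → ∀ ξ ∈ box r, pderiv r i (b j) ξ =
    (inner ℝ (b j ξ) (u i) : ℝ) • (b i ξ - (inner ℝ (b i ξ) (u j) : ℝ) • u j) -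
      (inner ℝ (b j ξ) (b i ξ) / 2 - sgn i * Γ ξ) • u i
  evol_x : ∀ ξ ∈ box r, pderiv r 1 x ξ = h 1 ξ • P ξ (u 1)
  evol_P : ∀ ξ ∈ box r, pderiv r 1 P ξ = P ξ ∘L rotLin (u 1) (b 1 ξ)
  axis_perp : ∀ i, ∀ t ∈ Icc 0 r, inner ℝ (b i (Pi.single i t)) (u i) = (0 : ℝ)
  axis_x : ∀ t ∈ Icc 0 r, pderiv r 0 x (Pi.single 0 t) =
    h 0 (Pi.single 0 t) • P (Pi.single 0 t) (u 0)
  axis_P : ∀ t ∈ Icc 0 r, pderiv r 0 P (Pi.single 0 t) =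
    P (Pi.single 0 t) ∘L rotLin (u 0) (b 0 (Pi.single 0 t))
  axis_iso : ∀ t ∈ Icc 0 r, ∀ y z,
    inner ℝ (P (Pi.single 0 t) y) (P (Pi.single 0 t) z) = (inner ℝ y z : ℝ)

namespace PreSol

variable {r : ℝ} {Γ : (Fin 2 → ℝ) → ℝ} {u : Fin 2 → E N} {h : Fin 2 → (Fin 2 → ℝ) → ℝ}
  {b : Fin 2 → (Fin 2 → ℝ) → E N} {x : (Fin 2 → ℝ) → E N} {P : (Fin 2 → ℝ) → E N →L[ℝ] E N}

theorem diff_h (S : PreSol r Γ u h b x P) (i : Fin 2) {ξ : Fin 2 → ℝ} (hξ : ξ ∈ box r) :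
    DifferentiableWithinAt ℝ (h i) (box r) ξ := (S.smooth_h i).differentiableOn (by simp) ξ hξ

theorem diff_b (S : PreSol r Γ u h b x P) (i : Fin 2) {ξ : Fin 2 → ℝ} (hξ : ξ ∈ box r) :
    DifferentiableWithinAt ℝ (b i) (box r) ξ := (S.smooth_b i).differentiableOn (by simp) ξ hξ

theorem diff_P (S : PreSol r Γ u h b x P) {ξ : Fin 2 → ℝ} (hξ : ξ ∈ box r) :
    DifferentiableWithinAt ℝ P (box r) ξ := S.smooth_P.differentiableOn (by simp) ξ hξ

theorem perp (S : PreSol r Γ u h b x P) :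
    ∀ j, ∀ ξ ∈ box r, inner ℝ (b j ξ) (u j) = (0 : ℝ) := by
  intro j ξ hξ
  obtain ⟨i, hij⟩ := exists_ne j
  rw [eq_of_pderiv_eq_zero (f := fun ξ => (inner ℝ (b j ξ) (u j) : ℝ)) (i := i)
    ((S.smooth_b j).inner ℝ contDiffOn_const) (fun η hη => ?_) hξ, update_zero hij.symm]
  · exact S.axis_perp j _ (hξ j)
  · rw [pderiv_inner S.pos (S.diff_b j hη) (differentiableWithinAt_const _) hη, pderiv_const,
      S.evol_b i j hij.symm η hη]
    simp only [inner_zero_right, inner_sub_left, real_inner_smul_left, S.unit,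
      S.orth i j hij.symm]
    ring

/-- The defect `D` of the missing frame equation satisfies the linear equation `D' = D Ω_1` along
the direction `1`, by the zero curvature equation, and is zero on the first axis by `axis_P`. -/
theorem evol_P_zero (S : PreSol r Γ u h b x P) :
    ∀ ξ ∈ box r, pderiv r 0 P ξ = P ξ ∘L rotLin (u 0) (b 0 ξ) := by
  have h01 : (0 : Fin 2) ≠ 1 := by decide
  have hr := S.pos
  have hrot : ∀ i {ξ}, ξ ∈ box r →
      DifferentiableWithinAt ℝ (fun η => rotLin (u i) (b i η)) (box r) ξ := fun i ξ hξ =>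
    (rotLin (u i)).differentiableAt.comp_differentiableWithinAt ξ (S.diff_b i hξ)
  set D : (Fin 2 → ℝ) → E N →L[ℝ] E N := fun ξ => pderiv r 0 P ξ - P ξ ∘L rotLin (u 0) (b 0 ξ)
    with hDd
  have hDs : ContDiffOn ℝ ∞ D (box r) := (contDiffOn_pderiv hr S.smooth_P).sub
    (S.smooth_P.clm_comp ((rotLin (u 0)).contDiff.comp_contDiffOn (S.smooth_b 0)))
  have hD : ∀ ξ ∈ box r, pderiv r 1 D ξ = D ξ ∘L rotLin (u 1) (b 1 ξ) := by
    intro ξ hξ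
    have hp := (contDiffOn_pderiv hr S.smooth_P (i := 0)).differentiableOn (by simp) ξ hξ
    have hz := zero_curvature (γ := Γ ξ) (b := b 0 ξ) (c := b 1 ξ) (S.orth 0 1 h01) rfl rfl rfl rfl
    have e0 := S.evol_b 0 1 h01 ξ hξ
    have e1 := S.evol_b 1 0 h01.symm ξ hξ
    have s0 : sgn 0 = 1 := rfl
    have s1 : sgn 1 = -1 := by simp [sgn]
    rw [s0, one_mul, real_inner_comm (b 0 ξ) (b 1 ξ)] at e0
    rw [s1, neg_one_mul, sub_neg_eq_add] at e1
    rw [← e0, ← e1] at hz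
    rw [hDd, pderiv_sub hr hp ((S.diff_P hξ).clm_comp (hrot 0 hξ)) hξ,
      pderiv_comm hr S.smooth_P hξ, pderiv_congr S.evol_P hξ,
      pderiv_clm_comp hr (S.diff_P hξ) (hrot 1 hξ) hξ,
      pderiv_clm_comp hr (S.diff_P hξ) (hrot 0 hξ) hξ, S.evol_P ξ hξ,
      pderiv_clm hr _ (S.diff_b 1 hξ) hξ, pderiv_clm hr _ (S.diff_b 0 hξ) hξ]
    have hz' : rotLin (u 1) (pderiv r 0 (b 1) ξ) - rotLin (u 0) (pderiv r 1 (b 0) ξ) =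
        rotLin (u 1) (b 1 ξ) ∘L rotLin (u 0) (b 0 ξ) -
          rotLin (u 0) (b 0 ξ) ∘L rotLin (u 1) (b 1 ξ) := by
      rw [← sub_eq_zero, ← hz]; abel
    have hz'' := congrArg (fun A => P ξ ∘L A) hz'
    simp only [ContinuousLinearMap.comp_sub] at hz''
    simp only [ContinuousLinearMap.sub_comp, ContinuousLinearMap.comp_assoc]
    rw [eq_add_of_sub_eq hz'']
    abel
  intro ξ hξ
  have h0 := clm_eq_zero_of_hasDerivWithinAt (r := r) (D := fun s => D (Function.update ξ 1 s))
    (Ω := fun s => rotLin (u 1) (b 1 (Function.update ξ 1 s))) ?_ (fun s hs => ?_) ?_ (hξ 1)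
  · simp only [Function.update_eq_self] at h0
    exact sub_eq_zero.1 h0
  · intro s hs
    have := (rotLin (u 1)).continuous.continuousAt.comp_continuousWithinAt
      (hasDerivWithinAt_line hξ (S.diff_b 1 (update_mem_box hξ 1 hs))).continuousWithinAt
    exact this
  · have := hasDerivWithinAt_line hξ
      (hDs.differentiableOn (by simp) _ (update_mem_box hξ 1 hs)) (i := 1) (s := s)
    rwa [hD _ (update_mem_box hξ 1 hs)] at this
  · simp only [update_zero h01.symm]
    exact sub_eq_zero.2 (S.axis_P _ (hξ 0))

/-- The defect is constant in the direction `1`: the mixed derivatives of `x` agree with those of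
`h_i P u_i` because of the equations for `h`. -/
theorem evol_x_zero (S : PreSol r Γ u h b x P) :
    ∀ ξ ∈ box r, pderiv r 0 x ξ = h 0 ξ • P ξ (u 0) := by
  have h01 : (0 : Fin 2) ≠ 1 := by decide
  have hr := S.pos
  have hPu : ∀ i {ξ}, ξ ∈ box r → DifferentiableWithinAt ℝ (fun η => P η (u i)) (box r) ξ :=
    fun i ξ hξ => (S.diff_P hξ).clm_apply (differentiableWithinAt_const _)
  intro ξ hξ
  rw [← sub_eq_zero, eq_of_pderiv_eq_zero (i := 1)
    (f := fun ξ => pderiv r 0 x ξ - h 0 ξ • P ξ (u 0)) ?_ (fun η hη => ?_) hξ]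
  · rw [update_zero h01.symm]
    exact sub_eq_zero.2 (S.axis_x _ (hξ 0))
  · exact (contDiffOn_pderiv hr S.smooth_x).sub
      ((S.smooth_h 0).smul (S.smooth_P.clm_apply contDiffOn_const))
  · have hp := (contDiffOn_pderiv hr S.smooth_x (i := 0)).differentiableOn (by simp) η hη
    have hs : DifferentiableWithinAt ℝ (fun η => h 0 η • P η (u 0)) (box r) η :=
      (S.diff_h 0 hη).smul (hPu 0 hη)
    rw [pderiv_sub hr hp hs hη, pderiv_comm hr S.smooth_x hη,
      pderiv_congr S.evol_x hη, pderiv_smul hr (S.diff_h 1 hη) (hPu 1 hη) hη,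
      pderiv_smul hr (S.diff_h 0 hη) (hPu 0 hη) hη,
      pderiv_clm_apply_const hr (S.diff_P hη) _ hη, pderiv_clm_apply_const hr (S.diff_P hη) _ hη,
      S.evol_P_zero η hη, S.evol_P η hη, S.evol_h 0 1 h01 η hη, S.evol_h 1 0 h01.symm η hη]
    simp only [ContinuousLinearMap.comp_apply, rotLin_apply, S.orth 0 1 h01, S.orth 1 0 h01.symm,
      zero_smul, sub_zero, map_smul]
    module

/-- The frame equations in both directions. -/
theorem evol_frame (S : PreSol r Γ u h b x P) (i : Fin 2) {ξ : Fin 2 → ℝ} (hξ : ξ ∈ box r) :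
    pderiv r i x ξ = h i ξ • P ξ (u i) ∧ pderiv r i P ξ = P ξ ∘L rotLin (u i) (b i ξ) := by
  fin_cases i
  · exact ⟨S.evol_x_zero ξ hξ, S.evol_P_zero ξ hξ⟩
  · exact ⟨S.evol_x ξ hξ, S.evol_P ξ hξ⟩

end PreSol

end Equations


/-! ### Existence of C-surfaces -/

section Isometry

variable {N : ℕ} {r : ℝ}

open ContinuousLinearMap in
theorem adjoint_isometry {A : E N →L[ℝ] E N}
    (hA : ∀ y z, inner ℝ (A y) (A z) = (inner ℝ y z : ℝ)) (y z : E N) :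
    inner ℝ (adjoint A y) (adjoint A z) = (inner ℝ y z : ℝ) := by
  have h : ∀ w, adjoint A (A w) = w := fun w => ext_inner_right ℝ fun v => by
    rw [adjoint_inner_left, hA]
  obtain ⟨y, rfl⟩ := surjective_of_isometry hA y
  obtain ⟨z, rfl⟩ := surjective_of_isometry hA z
  rw [h, h, hA]

open ContinuousLinearMap in
/-- The solutions of `P' = P Ω` with skew-symmetric `Ω` remain isometries. -/
theorem isometry_of_hasDerivWithinAt {P Ω : ℝ → E N →L[ℝ] E N}
    (h : ∀ t ∈ Icc 0 r, HasDerivWithinAt P (P t ∘L Ω t) (Icc 0 r) t)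
    (hΩ : ∀ t ∈ Icc 0 r, ∀ y z, inner ℝ (Ω t y) z + inner ℝ y (Ω t z) = (0 : ℝ))
    (h0 : ∀ y z, inner ℝ (P 0 y) (P 0 z) = (inner ℝ y z : ℝ)) {t : ℝ} (ht : t ∈ Icc 0 r)
    (y z : E N) : inner ℝ (P t y) (P t z) = (inner ℝ y z : ℝ) := by
  have hcoord : ∀ t k (y : E N), inner ℝ (P t (EuclideanSpace.single k 1)) y = adjoint (P t) y k := by
    intro t k y
    rw [← adjoint_inner_right, EuclideanSpace.inner_single_left]
    simp
  have hsum : ∀ t (y z : E N), ∑ k, inner ℝ (P t (EuclideanSpace.single k 1)) y *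
      inner ℝ (P t (EuclideanSpace.single k 1)) z = inner ℝ (adjoint (P t) y) (adjoint (P t) z) := by
    intro t y z
    simp only [hcoord, PiLp.inner_apply]
    simp [mul_comm]
  -- For right multiplication the conserved quantity is `P Pᵀ`, since its derivative is `P (Ω + Ωᵀ)
  -- Pᵀ = 0`. So the adjoint is shown to be isometric, and taking the adjoint once more gives the
  -- claim for `P`.
  have hadj : ∀ t ∈ Icc 0 r, ∀ y z,
      inner ℝ (adjoint (P t) y) (adjoint (P t) z) = (inner ℝ y z : ℝ) := by
    intro t ht y z
    rw [← hsum, eq_of_hasDerivWithinAt_zero (f := fun t => ∑ k,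
      inner ℝ (P t (EuclideanSpace.single k 1)) y * inner ℝ (P t (EuclideanSpace.single k 1)) z)
      (fun s hs => ?_) ht, hsum, adjoint_isometry h0]
    have h1 : ∀ k (w : E N), HasDerivWithinAt (fun t => inner ℝ (P t (EuclideanSpace.single k 1)) w)
        (-(Ω s (adjoint (P s) w) k)) (Icc 0 r) s := by
      intro k w
      have h2 : HasDerivWithinAt (fun t => P t (EuclideanSpace.single k 1))
          ((P s ∘L Ω s) (EuclideanSpace.single k 1)) (Icc 0 r) s := by
        simpa using (h s hs).clm_apply (hasDerivWithinAt_const s _ (EuclideanSpace.single k (1 : ℝ)))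
      have h3 := h2.inner ℝ (hasDerivWithinAt_const s _ w)
      refine h3.congr_deriv ?_
      rw [inner_zero_right, zero_add, comp_apply, ← adjoint_inner_right]
      have h4 := hΩ s hs (EuclideanSpace.single k 1) (adjoint (P s) w)
      rw [EuclideanSpace.inner_single_left (v := Ω s _)] at h4
      simp only [map_one, one_mul] at h4
      linarith
    refine (HasDerivWithinAt.fun_sum fun k _ => (h1 k y).mul (h1 k z)).congr_deriv ?_
    have h5 := hΩ s hs (adjoint (P s) y) (adjoint (P s) z)
    simp only [PiLp.inner_apply] at h5
    simp only [hcoord]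
    rw [← neg_eq_zero, ← h5, ← Finset.sum_add_distrib, ← Finset.sum_neg_distrib]
    refine Finset.sum_congr rfl fun k _ => ?_
    simp; ring
  have h6 := adjoint_isometry (A := adjoint (P t)) (hadj t ht) y z
  rwa [adjoint_adjoint] at h6

end Isometry

namespace PreSol

variable {N : ℕ} {r : ℝ} {Γ : (Fin 2 → ℝ) → ℝ} {u : Fin 2 → E N} {h : Fin 2 → (Fin 2 → ℝ) → ℝ}
  {b : Fin 2 → (Fin 2 → ℝ) → E N} {x : (Fin 2 → ℝ) → E N} {P : (Fin 2 → ℝ) → E N →L[ℝ] E N}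

theorem isometry (S : PreSol r Γ u h b x P) {ξ : Fin 2 → ℝ} (hξ : ξ ∈ box r) (y z : E N) :
    inner ℝ (P ξ y) (P ξ z) = (inner ℝ y z : ℝ) := by
  have h1 := isometry_of_hasDerivWithinAt (r := r) (P := fun s => P (Function.update ξ 1 s))
    (Ω := fun s => rotLin (u 1) (b 1 (Function.update ξ 1 s)))
    (fun s hs => by
      have := hasDerivWithinAt_line hξ (S.diff_P (update_mem_box hξ 1 hs)) (i := 1) (s := s)
      rwa [S.evol_P _ (update_mem_box hξ 1 hs)] at this)
    (fun s _ y z => inner_rotLin _ _ _ _)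
    (fun y z => by
      simp only [update_zero (show (1 : Fin 2) ≠ 0 by decide)]
      exact S.axis_iso _ (hξ 0) y z) (hξ 1) y z
  simpa using h1

theorem diff_Pu (S : PreSol r Γ u h b x P) (z : E N) {ξ : Fin 2 → ℝ} (hξ : ξ ∈ box r) :
    DifferentiableWithinAt ℝ (fun η => P η z) (box r) ξ :=
  (S.diff_P hξ).clm_apply (differentiableWithinAt_const _)

theorem pderiv_x (S : PreSol r Γ u h b x P) (i : Fin 2) {ξ : Fin 2 → ℝ} (hξ : ξ ∈ box r) :
    pderiv r i x ξ = h i ξ • P ξ (u i) := (S.evol_frame i hξ).1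

theorem pderiv_Pu (S : PreSol r Γ u h b x P) {i j : Fin 2} (hij : i ≠ j) {ξ : Fin 2 → ℝ}
    (hξ : ξ ∈ box r) : pderiv r i (fun η => P η (u j)) ξ =
      (inner ℝ (b i ξ) (u j) : ℝ) • P ξ (u i) := by
  rw [pderiv_clm_apply_const S.pos (S.diff_P hξ) _ hξ, (S.evol_frame i hξ).2,
    ContinuousLinearMap.comp_apply, rotLin_apply, S.orth i j hij, zero_smul, sub_zero, map_smul]

/-- The surface of a solution with positive metric coefficients is a C-surface. -/
theorem isCSurfaceWithData (S : PreSol r Γ u h b x P) (hpos : ∀ i, ∀ ξ ∈ box r, 0 < h i ξ)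
    {X : Fin 2 → ℝ → E N} (hX : ∀ i, ∀ t ∈ Icc 0 r, x (Pi.single i t) = X i t) :
    IsCSurfaceWithData r X Γ x := by
  have hr := S.pos
  have hn : ∀ i, ∀ ξ ∈ box r, ‖P ξ (u i)‖ = 1 := fun i ξ hξ =>
    norm_eq_one_of_inner (by rw [S.isometry hξ, S.unit])
  have hv : ∀ i, EqOn (unitVec r x i) (fun ξ => P ξ (u i)) (box r) := fun i ξ hξ => by
    rw [unitVec, S.pderiv_x i hξ, norm_smul, hn i ξ hξ, mul_one,
      Real.norm_of_nonneg (hpos i ξ hξ).le, smul_smul, inv_mul_cancel₀ (hpos i ξ hξ).ne', one_smul]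
  refine ⟨⟨S.smooth_x, fun i ξ hξ => ?_, fun i j hij ξ hξ => ?_, fun i j hij ξ hξ => ?_⟩, hX,
    fun j i ξ => inner ℝ (b i ξ) (u j), fun i j hij ξ hξ => ?_, fun ξ hξ => ?_⟩
  · rw [S.pderiv_x i hξ]
    refine smul_ne_zero (hpos i ξ hξ).ne' fun h0 => ?_
    have := hn i ξ hξ
    rw [h0, norm_zero] at this
    exact zero_ne_one this
  · have hi : P ξ (u i) ∈ Submodule.span ℝ {pderiv r i x ξ, pderiv r j x ξ} := by
      rw [← inv_smul_smul₀ (hpos i ξ hξ).ne' (P ξ (u i)), ← S.pderiv_x i hξ]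
      exact Submodule.smul_mem _ _ (Submodule.subset_span (by simp))
    have hj : P ξ (u j) ∈ Submodule.span ℝ {pderiv r i x ξ, pderiv r j x ξ} := by
      rw [← inv_smul_smul₀ (hpos j ξ hξ).ne' (P ξ (u j)), ← S.pderiv_x j hξ]
      exact Submodule.smul_mem _ _ (Submodule.subset_span (by simp))
    rw [pderiv_congr (fun η hη => S.pderiv_x j hη) hξ,
      pderiv_smul hr (S.diff_h j hξ) (S.diff_Pu _ hξ) hξ, S.pderiv_Pu hij hξ]
    exact Submodule.add_mem _ (Submodule.smul_mem _ _ (Submodule.smul_mem _ _ hi))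
      (Submodule.smul_mem _ _ hj)
  · rw [S.pderiv_x i hξ, S.pderiv_x j hξ, real_inner_smul_left, real_inner_smul_right,
      S.isometry hξ, S.orth i j hij, mul_zero, mul_zero]
  · rw [pderiv_congr (hv j) hξ, S.pderiv_Pu hij hξ, hv i hξ]
  · have h01 : (0 : Fin 2) ≠ 1 := by decide
    -- Both derivatives contain the same half of `-⟨b_i, b_j⟩`, which cancels in the difference; the
    -- terms with `Γ` have opposite signs and add up to `2Γ`.
    have key : ∀ i j, i ≠ j → pderiv r i (fun ξ => (inner ℝ (b j ξ) (u i) : ℝ)) ξ =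
        -(inner ℝ (b j ξ) (b i ξ) / 2 - sgn i * Γ ξ) := fun i j hij => by
      rw [pderiv_inner hr (S.diff_b j hξ) (differentiableWithinAt_const _) hξ, pderiv_const,
        S.evol_b i j hij ξ hξ]
      simp only [inner_zero_right, inner_sub_left, real_inner_smul_left, S.unit, S.perp i ξ hξ,
        S.orth j i hij.symm]
      ring
    rw [key 0 1 h01, key 1 0 h01.symm, real_inner_comm (b 1 ξ) (b 0 ξ)]
    simp only [sgn]
    norm_num
    ring

/-- A solution coincides with a framed curve on the second axis. -/
theorem eq_on_second_axis (S : PreSol r Γ u h b x P) {X : ℝ → E N} {k : ℝ → ℝ} {c : ℝ → E N}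
    {R : ℝ → E N →L[ℝ] E N} (F : CurveFrame r X (u 1) k c R)
    (hk : ∀ t ∈ Icc 0 r, h 1 (Pi.single 1 t) = k t) (hc : ∀ t ∈ Icc 0 r, b 1 (Pi.single 1 t) = c t)
    (hx : x 0 = X 0) (hP : P 0 = .id ℝ _) : ∀ t ∈ Icc 0 r, x (Pi.single 1 t) = X t := by
  have h0 : (0 : Fin 2 → ℝ) ∈ box r := fun i => ⟨le_rfl, S.pos.le⟩
  have hline : ∀ {V : Type} [NormedAddCommGroup V] [NormedSpace ℝ V] {f : (Fin 2 → ℝ) → V}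
      (hf : ContDiffOn ℝ ∞ f (box r)), ∀ t ∈ Icc 0 r, HasDerivWithinAt (fun s => f (Pi.single 1 s))
        (pderiv r 1 f (Pi.single 1 t)) (Icc 0 r) t := fun hf t ht =>
    hasDerivWithinAt_line h0 (hf.differentiableOn (by simp) _ (single_mem_box 1 ht))
  have hPR : ∀ t ∈ Icc 0 r, P (Pi.single 1 t) = R t := by
    intro t ht
    rw [← sub_eq_zero]
    refine clm_eq_zero_of_hasDerivWithinAt (D := fun t => P (Pi.single 1 t) - R t)
      (Ω := fun t => rotLin (u 1) (c t))
      ((rotLin (u 1)).continuous.comp F.contb).continuousOn (fun s hs => ?_) ?_ ht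
    · have h1 := hline S.smooth_P s hs
      rw [S.evol_P _ (single_mem_box 1 hs), hc s hs] at h1
      refine (h1.sub (F.rot s hs).hasDerivWithinAt).congr_deriv ?_
      rw [ContinuousLinearMap.sub_comp, rotLin_eq]
    · simp [hP, F.init]
  intro t ht
  rw [← sub_eq_zero]
  have := eq_of_hasDerivWithinAt_zero (f := fun t => x (Pi.single 1 t) - X t) (fun s hs => ?_) ht
  · simpa [hx] using this
  · have h1 := hline S.smooth_x s hs
    rw [S.evol_x _ (single_mem_box 1 hs), hk s hs, hPR s hs] at h1
    exact (h1.sub (F.hasDerivAt hs).hasDerivWithinAt).congr_deriv (sub_self _)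

end PreSol


section Existence

variable {N : ℕ}

theorem box_subset_ball {r δ : ℝ} (h : r < δ) : box r ⊆ Metric.ball (0 : Fin 2 → ℝ) δ := by
  intro ξ hξ
  rw [mem_ball_zero_iff, pi_norm_lt_iff ((hξ 0).1.trans (hξ 0).2 |>.trans_lt h)]
  intro i
  rw [Real.norm_of_nonneg (hξ i).1]
  exact (hξ i).2.trans_lt h

/-- Local existence of smooth solutions of the Goursat problem for C-surfaces. -/
theorem exists_smoothSol {X : Fin 2 → ℝ → E N} (hX : ∀ i, ContDiff ℝ ∞ (X i))
    (hmeet : X 0 0 = X 1 0) (hreg : ∀ i, deriv (X i) 0 ≠ 0)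
    (horth : inner ℝ (deriv (X 0) 0) (deriv (X 1) 0) = (0 : ℝ)) {Γ : (Fin 2 → ℝ) → ℝ}
    (hΓ : ContDiff ℝ ∞ Γ) : ∃ r : ℝ, 0 < r ∧ ∃ (W : Fin 2 → (Fin 2 → ℝ) → ℝ × E N)
      (c : (Fin 2 → ℝ) → E N × (E N →L[ℝ] E N)) (h : Fin 2 → ℝ → ℝ) (b : Fin 2 → ℝ → E N)
      (R : Fin 2 → ℝ → E N →L[ℝ] E N),
      SmoothSol r Γ (fun i => ‖deriv (X i) 0‖⁻¹ • deriv (X i) 0) (X 0 0) W c ∧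
      (∀ i, CurveFrame r (X i) (‖deriv (X i) 0‖⁻¹ • deriv (X i) 0) (h i) (b i) (R i)) ∧
      (∀ i, ∀ t ∈ Icc 0 r, W i (Pi.single i t) = (h i t, b i t)) ∧
      IsCSurfaceWithData r X Γ fun ξ => (c ξ).1 := by
  have h01 : (0 : Fin 2) ≠ 1 := by decide
  choose h b R hh hb hR ρ hρ F using fun i => exists_curveFrame (hX i) (hreg i)
  set u : Fin 2 → E N := fun i => ‖deriv (X i) 0‖⁻¹ • deriv (X i) 0 with hu
  have hunit : ∀ i, inner ℝ (u i) (u i) = (1 : ℝ) := fun i => (F i).unit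
  have hou : ∀ i j, i ≠ j → inner ℝ (u i) (u j) = (0 : ℝ) := by
    have h1 : inner ℝ (u 0) (u 1) = (0 : ℝ) := by
      simp only [hu, real_inner_smul_left, real_inner_smul_right, horth, mul_zero]
    intro i j hij
    fin_cases i <;> fin_cases j <;> simp at hij
    · exact h1
    · exact (real_inner_comm _ _).trans h1
  -- The unknown `a` is `W 1`, evolving in the direction `0`. The unknown `B` combines `W 0` with
  -- the point and the frame, all evolving in the direction `1` from the first axis.
  obtain ⟨a, B, ha, hB, heq, hax⟩ := exists_goursat
    (P := ℝ × E N) (Q := (ℝ × E N) × (E N × (E N →L[ℝ] E N)))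
    (fun p => drhs 0 (sgn 0 * Γ p.1) (u 0) (u 1) p.2.1 p.2.2.1)
    (contDiff_drhs contDiff_const (contDiff_const.mul (hΓ.comp contDiff_fst)) _ _
      contDiff_snd.fst contDiff_snd.snd.fst)
    (fun p => (drhs 0 (sgn 1 * Γ p.1) (u 1) (u 0) p.2.2.1 p.2.1, frameRhs 0 (u 1) p.2.1 p.2.2.2))
    ((contDiff_drhs contDiff_const (contDiff_const.mul (hΓ.comp contDiff_fst)) _ _
      contDiff_snd.snd.fst contDiff_snd.fst).prodMk
      (contDiff_frameRhs contDiff_const contDiff_snd.fst contDiff_snd.snd.snd _))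
    (fun t => (h 1 t, b 1 t)) ((hh 1).prodMk (hb 1))
    (fun t => ((h 0 t, b 0 t), (X 0 t, R 0 t)))
    (((hh 0).prodMk (hb 0)).prodMk ((hX 0).prodMk (hR 0)))
  set W : Fin 2 → (Fin 2 → ℝ) → ℝ × E N := fun i ξ => sel i ((B ξ).1, a ξ) with hW
  have hWs : ∀ i, ContDiff ℝ ∞ (W i) := fun i => contDiff_sel i (hB.fst.prodMk ha)
  have hcs : ContDiff ℝ ∞ fun ξ => (B ξ).2 := hB.snd
  have hW0 : ∀ i, 0 < (W i 0).1 := by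
    have h1 := hax.self_of_nhds
    simp only [Pi.single_zero] at h1
    have hp : ∀ i, 0 < h i 0 := fun i => (F i).pos 0 ⟨le_rfl, (hρ i).le⟩
    intro i
    fin_cases i
    · simpa [hW, sel, h1.2] using hp 0
    · simpa [hW, sel, h1.1] using hp 1
  have hpos : ∀ᶠ ξ in 𝓝 (0 : Fin 2 → ℝ), 0 < (W 0 ξ).1 ∧ 0 < (W 1 ξ).1 :=
    ((hWs 0).continuous.fst.continuousAt.eventually (lt_mem_nhds (hW0 0))).and
      ((hWs 1).continuous.fst.continuousAt.eventually (lt_mem_nhds (hW0 1)))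
  obtain ⟨δ₁, hδ₁, hball₁⟩ := Metric.eventually_nhds_iff_ball.1 (heq.and hpos)
  obtain ⟨δ₂, hδ₂, hball₂⟩ := Metric.eventually_nhds_iff_ball.1 hax
  set r := min (min (δ₁ / 2) (δ₂ / 2)) (min (ρ 0) (ρ 1)) with hr
  have hr0 : 0 < r := lt_min (lt_min (by positivity) (by positivity)) (lt_min (hρ 0) (hρ 1))
  have hrδ₁ : r < δ₁ := by
    have : r ≤ δ₁ / 2 := (min_le_left _ _).trans (min_le_left _ _)
    linarith
  have hrδ₂ : r < δ₂ := by
    have : r ≤ δ₂ / 2 := (min_le_left _ _).trans (min_le_right _ _)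
    linarith
  have hF : ∀ i, CurveFrame r (X i) (u i) (h i) (b i) (R i) := by
    intro i
    fin_cases i
    · exact (F 0).mono ((min_le_right _ _).trans (min_le_left _ _))
    · exact (F 1).mono ((min_le_right _ _).trans (min_le_right _ _))
  have hbox := fun ξ (hξ : ξ ∈ box r) => hball₁ ξ (box_subset_ball hrδ₁ hξ)
  have hax' : ∀ t ∈ Icc 0 r, a (Pi.single 1 t) = (h 1 t, b 1 t) ∧
      B (Pi.single 0 t) = ((h 0 t, b 0 t), (X 0 t, R 0 t)) := fun t ht => by
    refine hball₂ t ?_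
    rw [mem_ball_zero_iff, Real.norm_of_nonneg ht.1]
    exact ht.2.trans_lt hrδ₂
  have hWax : ∀ i, ∀ t ∈ Icc 0 r, W i (Pi.single i t) = (h i t, b i t) := by
    intro i t ht
    fin_cases i
    · simp [hW, sel, (hax' t ht).2]
    · simp [hW, sel, (hax' t ht).1]
  have hd : ∀ {V : Type} [NormedAddCommGroup V] [NormedSpace ℝ V] {f : (Fin 2 → ℝ) → V},
      ContDiff ℝ ∞ f → ∀ ξ, DifferentiableAt ℝ f ξ := fun hf ξ => hf.differentiable (by simp) ξ
  have hBfst : ∀ ξ v, fderiv ℝ (fun ξ => (B ξ).1) ξ v = (fderiv ℝ B ξ v).1 := fun ξ v => by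
    rw [(hd hB ξ).hasFDerivAt.fst.fderiv]; rfl
  have hBsnd : ∀ ξ v, fderiv ℝ (fun ξ => (B ξ).2) ξ v = (fderiv ℝ B ξ v).2 := fun ξ v => by
    rw [(hd hB ξ).hasFDerivAt.snd.fderiv]; rfl
  have hevol : ∀ i j, i ≠ j → ∀ ξ ∈ box r, fderiv ℝ (W j) ξ (Pi.single i 1) =
      drhs 0 (sgn i * Γ ξ) (u i) (u j) (W j ξ) (W i ξ) := by
    intro i j hij ξ hξ
    fin_cases i <;> fin_cases j <;> simp at hij
    · exact (hbox ξ hξ).1.1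
    · refine (hBfst ξ _).trans ?_
      rw [Fin.mk_one, (hbox ξ hξ).1.2]
      rfl
  have hevolc1 : ∀ ξ ∈ box r, fderiv ℝ (fun ξ => (B ξ).2) ξ (Pi.single 1 1) =
      frameRhs 0 (u 1) (W 1 ξ) (B ξ).2 := fun ξ hξ => by
    rw [hBsnd, (hbox ξ hξ).1.2]; rfl
  have hedge : ∀ v w : E N, edge 0 v w = v := fun v w => by simp [edge, dN, sqrtCut_one]
  -- the frame on the first axis
  have haxc : ∀ t ∈ Icc 0 r, (B (Pi.single 0 t)).2 = (X 0 t, R 0 t) := fun t ht => by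
    rw [(hax' t ht).2]
  -- The frame equation in the direction `0` was not imposed; on the first axis it is inherited from
  -- the framed curve.
  have hevolc0 : ∀ t ∈ Icc 0 r, fderiv ℝ (fun ξ => (B ξ).2) (Pi.single 0 t) (Pi.single 0 1) =
      (h 0 t • R 0 t (u 0), R 0 t ∘L rotGen 0 (u 0) (b 0 t)) := by
    intro t ht
    have h1 := (hasDerivAt_axis (hd hcs (Pi.single 0 t)).hasFDerivAt).hasDerivWithinAt (s := Icc 0 r)
    have h2 := (((hF 0).hasDerivAt ht).prodMk ((hF 0).rot t ht)).hasDerivWithinAt (s := Icc 0 r)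
    exact (uniqueDiffOn_Icc hr0 t ht).eq_deriv _ h1 (h2.congr haxc (haxc t ht))
  have hpd : ∀ {V : Type} [NormedAddCommGroup V] [NormedSpace ℝ V] {f : (Fin 2 → ℝ) → V},
      ContDiff ℝ ∞ f → ∀ i, ∀ ξ ∈ box r, pderiv r i f ξ = fderiv ℝ f ξ (Pi.single i 1) :=
    fun hf i ξ hξ => pderiv_eq_fderiv hr0 (hd hf ξ) hξ
  have hfst : ∀ {V V' : Type} [NormedAddCommGroup V] [NormedSpace ℝ V] [NormedAddCommGroup V']
      [NormedSpace ℝ V'] {f : (Fin 2 → ℝ) → V × V'}, ContDiff ℝ ∞ f → ∀ i, ∀ ξ ∈ box r,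
      pderiv r i (fun ξ => (f ξ).1) ξ = (fderiv ℝ f ξ (Pi.single i 1)).1 ∧
        pderiv r i (fun ξ => (f ξ).2) ξ = (fderiv ℝ f ξ (Pi.single i 1)).2 := by
    intro V V' _ _ _ _ f hf i ξ hξ
    rw [hpd hf.fst i ξ hξ, hpd hf.snd i ξ hξ, (hd hf ξ).hasFDerivAt.fst.fderiv,
      (hd hf ξ).hasFDerivAt.snd.fderiv]
    exact ⟨rfl, rfl⟩
  have S : PreSol r Γ u (fun i ξ => (W i ξ).1) (fun i ξ => (W i ξ).2) (fun ξ => (B ξ).2.1)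
      (fun ξ => (B ξ).2.2) :=
    { pos := hr0
      smooth_h := fun i => (hWs i).fst.contDiffOn
      smooth_b := fun i => (hWs i).snd.contDiffOn
      smooth_x := hcs.fst.contDiffOn
      smooth_P := hcs.snd.contDiffOn
      unit := hunit
      orth := hou
      evol_h := fun i j hij ξ hξ => by
        rw [(hfst (hWs j) i ξ hξ).1, hevol i j hij ξ hξ, drhs_zero]
      evol_b := fun i j hij ξ hξ => by
        rw [(hfst (hWs j) i ξ hξ).2, hevol i j hij ξ hξ, drhs_zero]
      evol_x := fun ξ hξ => by
        rw [(hfst hcs 1 ξ hξ).1, hevolc1 ξ hξ, frameRhs, hedge]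
      evol_P := fun ξ hξ => by
        rw [(hfst hcs 1 ξ hξ).2, hevolc1 ξ hξ, frameRhs, rotLin_eq]
      axis_perp := fun i t ht => by rw [hWax i t ht]; exact (hF i).perp t ht
      axis_x := fun t ht => by
        rw [(hfst hcs 0 _ (single_mem_box 0 ht)).1, hevolc0 t ht, hWax 0 t ht, haxc t ht]
      axis_P := fun t ht => by
        rw [(hfst hcs 0 _ (single_mem_box 0 ht)).2, hevolc0 t ht, hWax 0 t ht, haxc t ht, rotLin_eq]
      axis_iso := fun t ht => by rw [haxc t ht]; exact (hF 0).iso t ht }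
  have h00 : (0 : ℝ) ∈ Icc 0 r := ⟨le_rfl, hr0.le⟩
  have hc0 : (B 0).2 = (X 0 0, .id ℝ _) := by
    have := haxc 0 h00
    rwa [Pi.single_zero, (hF 0).init] at this
  refine ⟨r, hr0, W, fun ξ => (B ξ).2, h, b, R, ⟨hWs, hcs, hunit, hou, hevol, fun i ξ hξ => ?_, hc0,
    fun i ξ hξ => S.perp i ξ hξ⟩, hF, hWax, S.isCSurfaceWithData (fun i ξ hξ => ?_) fun i t ht => ?_⟩
  · rw [hedge]
    refine Prod.ext ?_ ?_
    · rw [← (hfst hcs i ξ hξ).1]; exact (S.evol_frame i hξ).1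
    · rw [← (hfst hcs i ξ hξ).2]; exact (S.evol_frame i hξ).2
  · fin_cases i
    · exact (hbox ξ hξ).2.1
    · exact (hbox ξ hξ).2.2
  · fin_cases i
    · exact congrArg Prod.fst (haxc t ht)
    · refine S.eq_on_second_axis (hF 1) (fun t ht => by rw [hWax 1 t ht])
        (fun t ht => by rw [hWax 1 t ht]) ?_ (by rw [hc0]) t ht
      rw [hc0, hmeet]

end Existence


/-! ### Uniqueness of C-surfaces -/

section GoursatUniqueness

variable {V : Type} [NormedAddCommGroup V] [NormedSpace ℝ V] {r : ℝ}

/-- Uniqueness for the linear Goursat problem, where `f j` is prescribed on the `j`-th axis. -/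
theorem eq_zero_of_goursat {f : Fin 2 → (Fin 2 → ℝ) → V} {L : ℝ} (hr : 0 < r) (hL : 0 ≤ L)
    (hf : ∀ j, ContDiffOn ℝ ∞ (f j) (box r))
    (hevol : ∀ i j, i ≠ j → ∀ ξ ∈ box r, ‖pderiv r i (f j) ξ‖ ≤ L * (‖f j ξ‖ + ‖f i ξ‖))
    (haxis : ∀ j, ∀ t ∈ Icc 0 r, f j (Pi.single j t) = 0) :
    ∀ j, ∀ ξ ∈ box r, f j ξ = 0 := by
  -- In the supremum norm with weight `exp (-lam (ξ₀ + ξ₁))`, integrating the equations gains a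
  -- factor `L / lam < 1/4` for each of the two functions, so the maximum `M` satisfies `M ≤ M/2`.
  set lam := 4 * L + 1 with hlam
  have hlam0 : 0 < lam := by positivity
  set S : (Fin 2 → ℝ) → ℝ := fun ξ => ‖f 0 ξ‖ + ‖f 1 ξ‖ with hS
  have hSij : ∀ i j, i ≠ j → ∀ ξ, ‖f j ξ‖ + ‖f i ξ‖ = S ξ := fun i j hij ξ => by
    fin_cases i <;> fin_cases j <;> simp [hS, add_comm] at hij ⊢
  have hexp : Continuous fun ξ : Fin 2 → ℝ => Real.exp (-(lam * (ξ 0 + ξ 1))) := by fun_prop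
  have h0 : (0 : Fin 2 → ℝ) ∈ box r := fun i => ⟨le_rfl, hr.le⟩
  obtain ⟨η, hη, hmax⟩ := (isCompact_box r).exists_isMaxOn ⟨0, h0⟩
    (f := fun ξ => Real.exp (-(lam * (ξ 0 + ξ 1))) * S ξ)
    (hexp.continuousOn.mul ((hf 0).continuousOn.norm.add (hf 1).continuousOn.norm))
  set M := Real.exp (-(lam * (η 0 + η 1))) * S η with hM
  have hSM : ∀ ξ ∈ box r, S ξ ≤ M * Real.exp (lam * (ξ 0 + ξ 1)) := fun ξ hξ => by
    have h1 : Real.exp (-(lam * (ξ 0 + ξ 1))) * S ξ ≤ M := hmax hξ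
    rw [Real.exp_neg, inv_mul_le_iff₀ (Real.exp_pos _)] at h1
    linarith
  have hM0 : 0 ≤ M := by positivity
  have key : ∀ j, ∀ ξ ∈ box r, ‖f j ξ‖ ≤ L * M / lam * Real.exp (lam * (ξ 0 + ξ 1)) := by
    intro j ξ hξ
    obtain ⟨i, hji⟩ := exists_ne j
    have hsum : ∀ s, Function.update ξ i s 0 + Function.update ξ i s 1 = s + ξ j := by
      intro s
      fin_cases i <;> fin_cases j <;> simp [add_comm] at hji ⊢
    have hmem : ∀ s ∈ Icc 0 r, Function.update ξ i s ∈ box r := fun s hs => update_mem_box hξ i hs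
    have hd : ∀ s ∈ Icc 0 r, HasDerivWithinAt (fun s => f j (Function.update ξ i s))
        (pderiv r i (f j) (Function.update ξ i s)) (Icc 0 r) s := fun s hs =>
      hasDerivWithinAt_line hξ ((hf j).differentiableOn (by simp) _ (hmem s hs))
    have hB : ∀ s, HasDerivAt (fun s => L * M / lam * Real.exp (lam * (s + ξ j)))
        (L * (M * Real.exp (lam * (s + ξ j)))) s := by
      intro s
      refine ((((hasDerivAt_id s).add_const (ξ j)).const_mul lam).exp.const_mul
        (L * M / lam)).congr_deriv ?_
      simp only [id]
      field_simp
    have h1 := image_norm_le_of_norm_deriv_right_le_deriv_boundary'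
      (fun s hs => (hd s hs).continuousWithinAt)
      (fun s hs => (hd s (Ico_subset_Icc_self hs)).mono_of_mem_nhdsWithin
        (Icc_mem_nhdsGE_of_mem hs))
      (B := fun s => L * M / lam * Real.exp (lam * (s + ξ j)))
      (by
        rw [update_zero hji.symm, haxis j _ (hξ j), norm_zero]
        positivity)
      (fun s _ => (hB s).continuousAt.continuousWithinAt) (fun s _ => (hB s).hasDerivWithinAt)
      (fun s hs => by
        have hs' := hmem s (Ico_subset_Icc_self hs)
        refine (hevol i j hji.symm _ hs').trans ?_
        rw [hSij i j hji.symm, ← hsum s]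
        gcongr
        exact hSM _ hs') (hξ i)
    have h2 := hsum (ξ i)
    rw [Function.update_eq_self] at h1 h2
    rwa [h2]
  have hM1 : M ≤ 2 * (L * M / lam) := by
    have h1 := key 0 η hη
    have h2 := key 1 η hη
    have h3 : Real.exp (-(lam * (η 0 + η 1))) * S η ≤ 2 * (L * M / lam) := by
      rw [Real.exp_neg, inv_mul_le_iff₀ (Real.exp_pos _)]
      simp only [hS]
      linarith
    exact h3
  have hM2 : M ≤ 0 := by
    have h1 : 2 * (L * M / lam) = 2 * L * M / lam := by ring
    rw [h1, le_div_iff₀ hlam0] at hM1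
    nlinarith
  intro j ξ hξ
  have h1 := key j ξ hξ
  rw [le_antisymm hM2 hM0, mul_zero, zero_div, zero_mul] at h1
  exact norm_le_zero_iff.1 h1

end GoursatUniqueness

/-! ### Two C-surfaces with the same data coincide. -/

section Uniqueness

variable {N : ℕ} {r : ℝ} {X : Fin 2 → ℝ → E N} {Γ : (Fin 2 → ℝ) → ℝ} {x y : (Fin 2 → ℝ) → E N}

/-- The right-hand sides of the evolution in the other direction of the unit tangent vector `v`,
its length `h` and the curvature vector `w`. -/
def surfaceRhs (p : ℝ × (E N × ℝ × E N) × (E N × ℝ × E N)) : E N × ℝ × E N :=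
  (-(inner ℝ p.2.2.2.2 p.2.1.1 : ℝ) • p.2.2.1, -(inner ℝ p.2.1.2.2 p.2.2.1 * p.2.2.2.1),
    (p.1 - inner ℝ p.2.2.2.2 p.2.1.2.2 / 2) • p.2.2.1 +
      (inner ℝ p.2.2.2.2 p.2.1.1 * inner ℝ p.2.1.2.2 p.2.2.1 : ℝ) • p.2.1.1)

theorem contDiff_surfaceRhs : ContDiff ℝ ∞ (surfaceRhs (N := N)) := by
  have a1 : ContDiff ℝ ∞ fun p : ℝ × (E N × ℝ × E N) × (E N × ℝ × E N) => p.2.1.1 := by fun_prop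
  have a2 : ContDiff ℝ ∞ fun p : ℝ × (E N × ℝ × E N) × (E N × ℝ × E N) => p.2.1.2.2 := by fun_prop
  have b1 : ContDiff ℝ ∞ fun p : ℝ × (E N × ℝ × E N) × (E N × ℝ × E N) => p.2.2.1 := by fun_prop
  have b2 : ContDiff ℝ ∞ fun p : ℝ × (E N × ℝ × E N) × (E N × ℝ × E N) => p.2.2.2.2 := by fun_prop
  have c : ContDiff ℝ ∞ fun p : ℝ × (E N × ℝ × E N) × (E N × ℝ × E N) => p.2.2.2.1 := by fun_prop
  have d : ContDiff ℝ ∞ fun p : ℝ × (E N × ℝ × E N) × (E N × ℝ × E N) => p.1 := by fun_prop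
  exact ((b2.inner ℝ a1).neg.smul b1).prodMk (((a2.inner ℝ b1).mul c).neg.prodMk
    (((d.sub ((b2.inner ℝ a2).div_const 2)).smul b1).add
      (((b2.inner ℝ a1).mul (a2.inner ℝ b1)).smul a1)))

/-- The unit tangent vector, its length and the curvature vector of a coordinate line. -/
def surfaceFields (r : ℝ) (x : (Fin 2 → ℝ) → E N) (j : Fin 2) (ξ : Fin 2 → ℝ) : E N × ℝ × E N :=
  (unitVec r x j ξ, ‖pderiv r j x ξ‖, pderiv r j (unitVec r x j) ξ)

theorem pderiv_prodMk {V V' : Type*} [NormedAddCommGroup V] [NormedSpace ℝ V]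
    [NormedAddCommGroup V'] [NormedSpace ℝ V'] {f : (Fin 2 → ℝ) → V} {g : (Fin 2 → ℝ) → V'}
    {ξ : Fin 2 → ℝ} {i : Fin 2} (hr : 0 < r) (hf : DifferentiableWithinAt ℝ f (box r) ξ)
    (hg : DifferentiableWithinAt ℝ g (box r) ξ) (hξ : ξ ∈ box r) :
    pderiv r i (fun η => (f η, g η)) ξ = (pderiv r i f ξ, pderiv r i g ξ) := by
  rw [pderiv, (hf.hasFDerivWithinAt.prodMk hg.hasFDerivWithinAt).fderivWithin
    (uniqueDiffOn_box hr ξ hξ)]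
  rfl

namespace IsCSurface

theorem contDiffOn_norm (S : IsCSurface r x) (hr : 0 < r) (j : Fin 2) :
    ContDiffOn ℝ ∞ (fun ξ => ‖pderiv r j x ξ‖) (box r) :=
  (contDiffOn_pderiv hr S.smooth).norm ℝ fun ξ hξ => S.regular j ξ hξ

theorem contDiffOn_unitVec (S : IsCSurface r x) (hr : 0 < r) (j : Fin 2) :
    ContDiffOn ℝ ∞ (unitVec r x j) (box r) :=
  ((S.contDiffOn_norm hr j).inv fun ξ hξ => norm_ne_zero_iff.2 (S.regular j ξ hξ)).smul
    (contDiffOn_pderiv hr S.smooth)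

theorem contDiffOn_surfaceFields (S : IsCSurface r x) (hr : 0 < r) (j : Fin 2) :
    ContDiffOn ℝ ∞ (surfaceFields r x j) (box r) :=
  (S.contDiffOn_unitVec hr j).prodMk ((S.contDiffOn_norm hr j).prodMk
    (contDiffOn_pderiv hr (S.contDiffOn_unitVec hr j)))

theorem norm_smul_unitVec (S : IsCSurface r x) (j : Fin 2) {ξ : Fin 2 → ℝ} (hξ : ξ ∈ box r) :
    ‖pderiv r j x ξ‖ • unitVec r x j ξ = pderiv r j x ξ :=
  smul_inv_smul₀ (norm_ne_zero_iff.2 (S.regular j ξ hξ)) _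

theorem inner_unitVec_self (S : IsCSurface r x) (j : Fin 2) {ξ : Fin 2 → ℝ} (hξ : ξ ∈ box r) :
    inner ℝ (unitVec r x j ξ) (unitVec r x j ξ) = (1 : ℝ) := by
  rw [unitVec, real_inner_self_eq_norm_sq, norm_smul, norm_inv, norm_norm,
    inv_mul_cancel₀ (norm_ne_zero_iff.2 (S.regular j ξ hξ)), one_pow]

theorem inner_unitVec (S : IsCSurface r x) {i j : Fin 2} (hij : i ≠ j) {ξ : Fin 2 → ℝ}
    (hξ : ξ ∈ box r) : inner ℝ (unitVec r x i ξ) (unitVec r x j ξ) = (0 : ℝ) := by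
  rw [unitVec, unitVec, real_inner_smul_left, real_inner_smul_right, S.orthogonal i j hij ξ hξ,
    mul_zero, mul_zero]

/-- Differentiating `⟨v_i, v_j⟩ = 0` in the direction `i` expresses `β_{ji}` by the curvature vector
`∂_i v_i`; in particular the coefficients are smooth although `HasRotationCoeff` does not require
it. -/
theorem rotationCoeff_eq (S : IsCSurface r x) (hr : 0 < r) {β : Fin 2 → Fin 2 → (Fin 2 → ℝ) → ℝ}
    (hβ : HasRotationCoeff r x β) {i j : Fin 2} (hij : i ≠ j) {ξ : Fin 2 → ℝ} (hξ : ξ ∈ box r) :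
    β j i ξ = -(inner ℝ (pderiv r i (unitVec r x i) ξ) (unitVec r x j ξ) : ℝ) := by
  have hd : ∀ k, DifferentiableWithinAt ℝ (unitVec r x k) (box r) ξ := fun k =>
    (S.contDiffOn_unitVec hr k).differentiableOn (by simp) ξ hξ
  have h1 := pderiv_inner hr (hd i) (hd j) hξ (i := i)
  rw [pderiv_congr (g := fun _ => (0 : ℝ)) (fun η hη => S.inner_unitVec hij hη) hξ, pderiv_const,
    hβ i j hij ξ hξ, real_inner_smul_right, S.inner_unitVec_self i hξ] at h1
  linarith

end IsCSurface

/-- The unit tangent vectors, the metric and the curvature vectors of a C-surface solve a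
Goursat problem. -/
theorem IsCSurfaceWithData.pderiv_surfaceFields (hx : IsCSurfaceWithData r X Γ x) (hr : 0 < r)
    {i j : Fin 2} (hij : i ≠ j) {ξ : Fin 2 → ℝ} (hξ : ξ ∈ box r) :
    pderiv r i (surfaceFields r x j) ξ =
      surfaceRhs (sgn j * Γ ξ, surfaceFields r x j ξ, surfaceFields r x i ξ) := by
  obtain ⟨S, -, β, hβ, hΓ⟩ := hx
  have hv : ∀ k, ContDiffOn ℝ ∞ (unitVec r x k) (box r) := S.contDiffOn_unitVec hr
  have hw : ∀ k, ContDiffOn ℝ ∞ (pderiv r k (unitVec r x k)) (box r) := fun k =>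
    contDiffOn_pderiv hr (hv k)
  have dv : ∀ k, DifferentiableWithinAt ℝ (unitVec r x k) (box r) ξ := fun k =>
    (hv k).differentiableOn (by simp) ξ hξ
  have dw : ∀ k, DifferentiableWithinAt ℝ (pderiv r k (unitVec r x k)) (box r) ξ := fun k =>
    (hw k).differentiableOn (by simp) ξ hξ
  have dh : ∀ k, DifferentiableWithinAt ℝ (fun ξ => ‖pderiv r k x ξ‖) (box r) ξ := fun k =>
    (S.contDiffOn_norm hr k).differentiableOn (by simp) ξ hξ
  have hβe : ∀ k l, k ≠ l → EqOn (β l k)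
      (fun ξ => -(inner ℝ (pderiv r k (unitVec r x k) ξ) (unitVec r x l ξ) : ℝ)) (box r) :=
    fun k l hkl η hη => S.rotationCoeff_eq hr hβ hkl hη
  have dβ : ∀ k l, k ≠ l → DifferentiableWithinAt ℝ (β l k) (box r) ξ := fun k l hkl =>
    ((dw k).inner ℝ (dv l)).neg.congr (hβe k l hkl) (hβe k l hkl hξ)
  have e1 : ∀ k l, k ≠ l → pderiv r k (unitVec r x l) ξ = β l k ξ • unitVec r x k ξ :=
    fun k l hkl => hβ k l hkl ξ hξ
  -- The mixed second derivatives of `x`, computed in both orders and paired with `v_l`, give the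
  -- equation for the metric coefficient.
  have e2 : ∀ k l, k ≠ l → pderiv r k (fun ξ => ‖pderiv r l x ξ‖) ξ =
      ‖pderiv r k x ξ‖ * β k l ξ := by
    intro k l hkl
    have hx' : ∀ m, EqOn (pderiv r m x) (fun ξ => ‖pderiv r m x ξ‖ • unitVec r x m ξ) (box r) :=
      fun m η hη => (S.norm_smul_unitVec m hη).symm
    have h1 := pderiv_comm hr S.smooth hξ k l
    rw [pderiv_congr (hx' l) hξ, pderiv_congr (hx' k) hξ, pderiv_smul hr (dh l) (dv l) hξ,
      pderiv_smul hr (dh k) (dv k) hξ, e1 k l hkl, e1 l k hkl.symm] at h1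
    have h2 := congrArg (fun z => (inner ℝ z (unitVec r x l ξ) : ℝ)) h1
    simp only [inner_add_left, real_inner_smul_left, S.inner_unitVec_self l hξ,
      S.inner_unitVec hkl hξ] at h2
    linarith
  have e3 : ∀ k l, k ≠ l → pderiv r k (pderiv r l (unitVec r x l)) ξ =
      pderiv r l (β l k) ξ • unitVec r x k ξ + (β l k ξ * β k l ξ) • unitVec r x l ξ := by
    intro k l hkl
    rw [pderiv_comm hr (hv l) hξ, pderiv_congr (hβ k l hkl) hξ,
      pderiv_smul hr (dβ k l hkl) (dv k) hξ, e1 l k hkl.symm]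
    module
  -- Differentiating the expression of `β_{kl}` by `∂_l v_l` gives the sum of the two derivatives of
  -- rotation coefficients.
  have e4 : ∀ k l, k ≠ l → pderiv r k (β k l) ξ + pderiv r l (β l k) ξ =
      -(inner ℝ (pderiv r k (unitVec r x k) ξ) (pderiv r l (unitVec r x l) ξ) : ℝ) := by
    intro k l hkl
    have h1 := pderiv_clm hr (-.id ℝ ℝ) ((dw l).inner ℝ (dv k)) hξ (i := k)
    simp only [neg_apply, ContinuousLinearMap.id_apply] at h1
    rw [pderiv_congr (hβe l k hkl.symm) hξ, h1, pderiv_inner hr (dw l) (dv k) hξ, e3 k l hkl,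
      inner_add_left, real_inner_smul_left, real_inner_smul_left, S.inner_unitVec_self k hξ,
      S.inner_unitVec hkl.symm hξ, real_inner_comm (pderiv r k (unitVec r x k) ξ)]
    ring
  -- The sum is known from `e4` and the difference is prescribed as `2Γ`; together they isolate the
  -- single derivative that occurs in `e3`, and the system closes.
  have e5 : pderiv r j (β j i) ξ = sgn j * Γ ξ -
      inner ℝ (pderiv r i (unitVec r x i) ξ) (pderiv r j (unitVec r x j) ξ) / 2 := by
    have h1 := hΓ ξ hξ
    have h2 := e4 i j hij
    fin_cases i <;> fin_cases j <;> simp [sgn] at hij h2 ⊢ <;> linarith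
  have hβi := hβe i j hij hξ
  have hβj := hβe j i hij.symm hξ
  simp only at hβi hβj
  have h1 : pderiv r i (surfaceFields r x j) ξ = (pderiv r i (unitVec r x j) ξ,
      pderiv r i (fun ξ => ‖pderiv r j x ξ‖) ξ, pderiv r i (pderiv r j (unitVec r x j)) ξ) := by
    have h2 := pderiv_prodMk hr (dv j) ((dh j).prodMk (dw j)) hξ (i := i)
    rw [pderiv_prodMk hr (dh j) (dw j) hξ] at h2
    exact h2
  rw [h1, e1 i j hij, e2 i j hij, e3 i j hij, e5, hβi, hβj]
  simp only [surfaceFields, surfaceRhs, neg_mul_neg]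
  refine Prod.ext rfl (Prod.ext ?_ rfl)
  ring

/-- The fields with index `j` involve only derivatives along the `j`-th direction, so on the `j`-th
axis they depend on the curve `X j` alone. -/
theorem IsCSurfaceWithData.surfaceFields_axis_eq (hx : IsCSurfaceWithData r X Γ x) (hr : 0 < r)
    (hy : IsCSurfaceWithData r X Γ y) (j : Fin 2) {t : ℝ} (ht : t ∈ Icc 0 r) :
    surfaceFields r x j (Pi.single j t) = surfaceFields r y j (Pi.single j t) := by
  have key : ∀ {f g : (Fin 2 → ℝ) → E N}, ContDiffOn ℝ ∞ f (box r) → ContDiffOn ℝ ∞ g (box r) →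
      (∀ t ∈ Icc 0 r, f (Pi.single j t) = g (Pi.single j t)) →
      ∀ t ∈ Icc 0 r, pderiv r j f (Pi.single j t) = pderiv r j g (Pi.single j t) := by
    intro f g hf hg h t ht
    have h0 : (0 : Fin 2 → ℝ) ∈ box r := fun i => ⟨le_rfl, hr.le⟩
    have h1 : HasDerivWithinAt (fun s => f (Pi.single j s)) (pderiv r j f (Pi.single j t))
        (Icc 0 r) t := hasDerivWithinAt_line h0
      (hf.differentiableOn (by simp) _ (single_mem_box j ht))
    have h2 : HasDerivWithinAt (fun s => g (Pi.single j s)) (pderiv r j g (Pi.single j t))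
        (Icc 0 r) t := hasDerivWithinAt_line h0
      (hg.differentiableOn (by simp) _ (single_mem_box j ht))
    exact (uniqueDiffOn_Icc hr t ht).eq_deriv _ h1 (h2.congr h (h t ht))
  have h1 := key hx.1.smooth hy.1.smooth fun t ht => (hx.2.1 j t ht).trans (hy.2.1 j t ht).symm
  have h2 : ∀ t ∈ Icc 0 r, unitVec r x j (Pi.single j t) = unitVec r y j (Pi.single j t) :=
    fun t ht => by rw [unitVec, unitVec, h1 t ht]
  rw [surfaceFields, surfaceFields, h1 t ht, h2 t ht,
    key (hx.1.contDiffOn_unitVec hr j) (hy.1.contDiffOn_unitVec hr j) h2 t ht]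

/-- A C-surface is determined by two coordinate lines and the function `Γ`. -/
theorem IsCSurfaceWithData.eqOn (hx : IsCSurfaceWithData r X Γ x) (hr : 0 < r)
    (hΓ : ContDiff ℝ ∞ Γ) (hy : IsCSurfaceWithData r X Γ y) : EqOn x y (box r) := by
  have hfx := hx.1.contDiffOn_surfaceFields hr
  have hfy := hy.1.contDiffOn_surfaceFields hr
  have hb : ∀ {z : (Fin 2 → ℝ) → E N}, (∀ j, ContDiffOn ℝ ∞ (surfaceFields r z j) (box r)) →
      ∃ C, ∀ i j, ∀ ξ ∈ box r,
        ‖(sgn j * Γ ξ, surfaceFields r z j ξ, surfaceFields r z i ξ)‖ ≤ C := by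
    intro z hz
    have h1 : ∀ p : Fin 2 × Fin 2, ∃ C, ∀ ξ ∈ box r,
        ‖(sgn p.2 * Γ ξ, surfaceFields r z p.2 ξ, surfaceFields r z p.1 ξ)‖ ≤ C := fun p =>
      (isCompact_box r).exists_bound_of_continuousOn
        ((continuous_const.mul hΓ.continuous).continuousOn.prodMk
          ((hz p.2).continuousOn.prodMk (hz p.1).continuousOn))
    choose C hC using h1
    exact ⟨∑ p, |C p|, fun i j ξ hξ => (hC (i, j) ξ hξ).trans ((le_abs_self _).trans
      (Finset.single_le_sum (f := fun p => |C p|) (fun p _ => abs_nonneg _) (Finset.mem_univ _)))⟩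
  obtain ⟨Cx, hCx⟩ := hb hfx
  obtain ⟨Cy, hCy⟩ := hb hfy
  obtain ⟨L, hL, hLip⟩ := exists_lipschitz_closedBall (contDiff_surfaceRhs (N := N)) (max Cx Cy)
  have dx : ∀ j, ∀ ξ ∈ box r, DifferentiableWithinAt ℝ (surfaceFields r x j) (box r) ξ :=
    fun j ξ hξ => (hfx j).differentiableOn (by simp) ξ hξ
  have dy : ∀ j, ∀ ξ ∈ box r, DifferentiableWithinAt ℝ (surfaceFields r y j) (box r) ξ :=
    fun j ξ hξ => (hfy j).differentiableOn (by simp) ξ hξ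
  have hfields : ∀ j, ∀ ξ ∈ box r, surfaceFields r x j ξ = surfaceFields r y j ξ := by
    intro j ξ hξ
    refine sub_eq_zero.1 (eq_zero_of_goursat
      (f := fun j ξ => surfaceFields r x j ξ - surfaceFields r y j ξ) hr hL
      (fun j => (hfx j).sub (hfy j)) (fun i j hij ξ hξ => ?_)
      (fun j t ht => sub_eq_zero.2 (hx.surfaceFields_axis_eq hr hy j ht)) j ξ hξ)
    rw [pderiv_sub hr (dx j ξ hξ) (dy j ξ hξ) hξ, hx.pderiv_surfaceFields hr hij hξ,
      hy.pderiv_surfaceFields hr hij hξ]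
    refine (hLip _ _ ((hCx i j ξ hξ).trans (le_max_left _ _))
      ((hCy i j ξ hξ).trans (le_max_right _ _))).trans ?_
    gcongr
    rw [Prod.mk_sub_mk, Prod.mk_sub_mk, sub_self, Prod.norm_mk, Prod.norm_mk, norm_zero]
    exact max_le (by positivity) (max_le_add_of_nonneg (norm_nonneg _) (norm_nonneg _))
  -- Equal lengths and unit tangents give equal derivatives in the direction `1`; the surfaces
  -- already agree on the first axis.
  have hp : ∀ ξ ∈ box r, pderiv r 1 x ξ = pderiv r 1 y ξ := fun ξ hξ => by
    have h1 := hfields 1 ξ hξ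
    simp only [surfaceFields, Prod.mk.injEq] at h1
    rw [← hx.1.norm_smul_unitVec 1 hξ, ← hy.1.norm_smul_unitVec 1 hξ, h1.1, h1.2.1]
  intro ξ hξ
  rw [← sub_eq_zero, eq_of_pderiv_eq_zero (f := fun ξ => x ξ - y ξ) (i := 1)
    (hx.1.smooth.sub hy.1.smooth) (fun η hη => ?_) hξ, update_zero (j := 0) (by decide)]
  · exact sub_eq_zero.2 ((hx.2.1 0 _ (hξ 0)).trans (hy.2.1 0 _ (hξ 0)).symm)
  · rw [pderiv_sub hr (hx.1.smooth.differentiableOn (by simp) η hη)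
      (hy.1.smooth.differentiableOn (by simp) η hη) hη, hp η hη, sub_self]

end Uniqueness

end CSurf

end

theorem mainTheorem9 (N : ℕ) (hN : 2 ≤ N)
    (X : Fin 2 → ℝ → CSurf.E N) (hX : ∀ i, ContDiff ℝ ∞ (X i))
    (hmeet : X 0 0 = X 1 0) (hreg : ∀ i, deriv (X i) 0 ≠ 0)
    (horth : inner ℝ (deriv (X 0) 0) (deriv (X 1) 0) = 0)
    (Γ : (Fin 2 → ℝ) → ℝ) (hΓ : ContDiff ℝ ∞ Γ) :
    ∃ r : ℝ, 0 < r ∧ ∃ x : (Fin 2 → ℝ) → CSurf.E N,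
      CSurf.IsCSurfaceWithData r X Γ x ∧
      (∀ y, CSurf.IsCSurfaceWithData r X Γ y → Set.EqOn y x (CSurf.box r)) ∧
      ∀ Ψ : CSurf.Cl N, CSurf.IsSuited hN X Ψ →
        (∃ (H : Fin 2 → ℝ → ℝ) (B : Fin N → Fin 2 → ℝ → ℝ),
          ∀ i, CSurf.IsReadOff hN r Ψ i (X i) (H i) (fun k => B k i)) ∧
        ∀ (H : Fin 2 → ℝ → ℝ) (B : Fin N → Fin 2 → ℝ → ℝ),
          (∀ i, CSurf.IsReadOff hN r Ψ i (X i) (H i) (fun k => B k i)) →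
          ∃ ε₁ : ℝ, 0 < ε₁ ∧ ∃ xd : ℝ → CSurf.Lat → CSurf.E N,
            (∀ ε : ℝ, 0 < ε → ε < ε₁ →
              (∃ S : CSurf.Fields N,
                CSurf.IsGoursatSolution hN ε r Ψ H B Γ S ∧
                (∀ T, CSurf.IsGoursatSolution hN ε r Ψ H B Γ T → T.EqOnBox hN ε r S) ∧
                ∀ n ∈ CSurf.latBox ε r, S.ψ n ∈ CSurf.HInf N ∧
                  CSurf.emb (CSurf.lift (xd ε n)) = CSurf.act (S.ψ n) (CSurf.eZero N)) ∧
              CSurf.IsDiscreteCSurface ε r (xd ε) ∧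
              ∀ i, CSurf.IsCanonicalDiscretization hN ε r Ψ i (H i) (fun k => B k i)
                (fun a => xd ε (Pi.single i a))) ∧
            CSurf.SmoothOConverges r ε₁ xd x := by
  obtain ⟨r, hr, W, c, h, b, R, S, F, hW, hx⟩ := CSurf.exists_smoothSol hX hmeet hreg horth hΓ
  refine ⟨r, hr, fun ξ => (c ξ).1, hx, fun y hy => hy.eqOn hr hΓ hx, fun Ψ hΨ => ?_⟩
  obtain ⟨O, hO, hu⟩ := hΨ.exists_isFrame
    fun i => ((hX i).differentiable (by simp)).differentiableAt
  -- The solution `S` was built before `Ψ` from the unit tangents of the curves; these are the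
  -- images under `O` of the first two basis vectors, so `S` and `F` can be read in the coordinates
  -- of `Ψ`.
  rw [← funext hu] at S
  simp only [← hu] at F
  have hOi : ∀ i, CSurf.IsFrame O Ψ (X i 0) (.id ℝ _) := fun i => by
    fin_cases i
    · exact hO
    · exact hmeet ▸ hO
  refine ⟨⟨h, fun k i t => O.symm (b i t) k, fun i => (F i).isReadOff hr (hOi i)⟩, ?_⟩
  -- Any `H`, `B` read off the curves coincide on `[0, r]` with the axis values of the smooth
  -- solution, so the approximation applies to them.
  intro H B hB
  refine S.approximation hr hΓ hΨ.1 hO (fun i t ht => ?_) fun i k hk t ht => ?_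
  · rw [hW i t ht]
    exact ((F i).eq_of_isReadOff hr (hOi i) (hB i)).1 t ht
  · rw [hW i t ht]
    exact ((F i).eq_of_isReadOff hr (hOi i) (hB i)).2 k hk t ht
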